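/- Let $m\ge 1$ be an integer. Identify an $m$-equivariant function $g(r)e^{im\theta}$ on $\mathbb R^2$ with its radial part $g:(0,\infty)\to\mathbb C$, and write $\|g\|_{L^2}^2=2\pi\int_0^\infty|g|^2\,r\,dr$, $\langle x\rangle=(1+x^2)^{1/2}$, $\log_-r=\max\{-\log r,0\}$, $|f|_{-k}(r)=\sup_{0\le\ell\le k}|r^{-\ell}\partial_r^{k-\ell}f(r)|$ and $\partial_+f=\partial_rf-\frac mr f$. Let $\mathcal S_m$ be the set of $m$-equivariant Schwartz functions on $\mathbb R^2$. Put $$Q(r)=\sqrt8\,(m+1)\frac{r^m}{1+r^{2(m+1)}},\qquad A_\theta[Q](r)=-\tfrac12\int_0^rQ^2\,r'dr',\qquad B_Qv(r)=\tfrac1r\int_0^r\mathrm{Re}(\overline Qv)\,r'dr',$$ $$L_Q=\partial_r-\tfrac{m+A_\theta[Q]}{r}+QB_Q,\qquad A_Q=\partial_r-\tfrac{m+1+A_\theta[Q]}{r},\qquad A_Q^*=-\partial_r-\tfrac1r-\tfrac{m+1+A_\theta[Q]}{r},\qquad \Lambda Q=Q+r\partial_rQ,$$ and let $\rho:(0,\infty)\to\mathbb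 R$ be the unique solution of $L_Q\rho=\frac{1}{2(m+1)}rQ$ with $|\rho|\lesssim r^2Q$. Let $\dot{\mathcal H}^3_m$ be the completion of $\mathcal S_m$, realized as a space of functions on $(0,\infty)$, under $$\|f\|_{\dot{\mathcal H}^3_m}=\||\partial_+f|_{-2}\|_{L^2}+\begin{cases}\||f|_{-3}\|_{L^2}&m\ge3,\\ \|\partial_{rrr}f\|_{L^2}+\|r^{-1}\langle\log_-r\rangle^{-1}|f|_{-2}\|_{L^2}&m=2,\\ \||\partial_{rr}f|_{-1}\|_{L^2}+\|r^{-1}\langle r\rangle^{-1}\langle\log_-r\rangle^{-1}|f|_{-1}\|_{L^2}&m=1.\end{cases}$$ Then the following hold. 1. (Boundedness and subcoercivity) For all $v\in\dot{\mathcal H}^3_m$, $$\|A_Q^*A_QL_Qv\|_{L^2}+\|Q|v|_{-2}\|_{L^2}\sim\|v\|_{\dot{\mathcal H}^3_m},$$ with constants depending only on $m$. 2. (Kernel) The kernel of $A_Q^*A_QL_Q:\dot{\mathcal H}^3_m\to L^2$ is $\mathrm{span}_{\mathbb R}\{\Lambda Q,iQ,ir^2Q,\rho\}$. 3. (Coercivity)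 Let $\psi_1,\dots,\psi_4$ be elements of the real dual of $\dot{\mathcal H}^3_m$ (bounded $\mathbb R$-linear real-valued functionals) such that the $4\times4$ matrix with rows $\big(\psi_i(\Lambda Q),\psi_i(iQ),\psi_i(ir^2Q),\psi_i(\rho)\big)$, $i=1,\dots,4$, has nonzero determinant. Then there is a constant $C$, depending only on $m,\psi_1,\dots,\psi_4$, such that $$\|v\|_{\dot{\mathcal H}^3_m}\le C\,\|A_Q^*A_QL_Qv\|_{L^2}$$ for every $v\in\dot{\mathcal H}^3_m$ with $\psi_1(v)=\dots=\psi_4(v)=0$. If moreover $m\ge3$, then 1, 2 and 3 also hold with $A_Q^*A_QL_Q$ replaced by $A_Q^*A_QA_Q^*A_QL_Q$, with $|v|_{-2}$ replaced by $|v|_{-4}$, and with $\dot{\mathcal H}^3_m$ replaced by $\dot{\mathcal H}^5_m$, the completion of $\mathcal S_m$ (realized as functions on $(0,\infty)$) under $$\|f\|_{\dot{\mathcal H}^5_m}=\||\partial_+f|_{-4}\|_{L^2}+\begin{cases}\||f|_{-5}\|_{L^2}&m\ge5,\\ \|\partial_{rrrrr}f\|_{L^2}+\|r^{-1}\langle\log_-r\rangle^{-1}|f|_{-4}\|_{L^2}&m=4,\\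 \||\partial_{rrrr}f|_{-1}\|_{L^2}+\|r^{-1}\langle r\rangle^{-1}\langle\log_-r\rangle^{-1}|f|_{-3}\|_{L^2}&m=3.\end{cases}$$ -/

import Mathlib

noncomputable section

namespace ChernSimons

open MeasureTheory Set Filter Topology
open scoped ENNReal SchwartzMap

/-! Throughout, an `m`-equivariant function `g(r)e^{imθ}` on `ℝ²` is identified with its radial
part `g`, which is a function on `(0,∞)`. It is represented by a function `ℝ → ℂ` of which only the
values on `(0,∞)` are ever used. -/

/-! ### Norms and weights -/

/-- The norm in `L²(ℝ²)` of a radial function with absolute value `g`, that is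
`(2π ∫₀^∞ g(r)² r dr)^{1/2}`. -/
def l2norm (g : ℝ → ℝ≥0∞) : ℝ≥0∞ :=
  (∫⁻ r in Ioi (0 : ℝ), g r ^ 2 * ENNReal.ofReal (2 * Real.pi * r)) ^ (1 / 2 : ℝ)

/-- `⟨x⟩ = (1 + x²)^{1/2}`. -/
def japanese (x : ℝ) : ℝ := Real.sqrt (1 + x ^ 2)

/-- `log₋ r`, the negative part of the logarithm. -/
def logMinus (r : ℝ) : ℝ := max (-Real.log r) 0

/-- `|f|_{-k}(r) = sup_{0 ≤ ℓ ≤ k} |r^{-ℓ} ∂_r^{k-ℓ} f(r)|`. -/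
def homAbs (k : ℕ) (f : ℝ → ℂ) (r : ℝ) : ℝ≥0∞ :=
  ⨆ ℓ : Fin (k + 1), ‖(r ^ (ℓ : ℕ))⁻¹ • iteratedDeriv (k - ℓ) f r‖ₑ

/-- `∂₊ = ∂₁ + i∂₂` on `m`-equivariant functions, in terms of radial parts: `∂_r - m/r`. -/
def dPlus (m : ℕ) (f : ℝ → ℂ) (r : ℝ) : ℂ := deriv f r - ((m : ℝ) / r) • f r

/-- The norm of the adapted space of regularity `k` and equivariance index `m`. It is used for
`k = 3`, `m ≥ 1` and for `k = 5`, `m ≥ 3`, so that the last case means `m = k - 2`. -/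
def adaptedNorm (k m : ℕ) (f : ℝ → ℂ) : ℝ≥0∞ :=
  l2norm (homAbs (k - 1) (dPlus m f)) +
    if k ≤ m then
      l2norm (homAbs k f)
    else if m = k - 1 then
      l2norm (fun r => ‖iteratedDeriv k f r‖ₑ) +
        l2norm (fun r => ENNReal.ofReal (r⁻¹ * (japanese (logMinus r))⁻¹) * homAbs (k - 1) f r)
    else
      l2norm (homAbs 1 (iteratedDeriv (k - 1) f)) +
        l2norm (fun r => ENNReal.ofReal (r⁻¹ * (japanese r)⁻¹ * (japanese (logMinus r))⁻¹) *
          homAbs (k - 2) f r)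

/-! ### The adapted spaces -/

/-- `m`-equivariance of a function on the plane: `f(x) = g(r)e^{imθ}`. -/
def IsEquivariant (m : ℕ) (f : ℂ → ℂ) : Prop :=
  ∀ (θ : ℝ) (z : ℂ), f (Complex.exp (θ * Complex.I) * z) = Complex.exp (m * θ * Complex.I) * f z

/-- The radial part of a function on the plane. -/
def radialPart (f : ℂ → ℂ) (r : ℝ) : ℂ := f r

/-- Membership in the adapted space, the completion of the `m`-equivariant Schwartz functions under
`adaptedNorm k m`, realized as a space of functions on `(0,∞)`. The norm controls `v` in
`H^k_loc(0,∞)`; hence the elements are `C^{k-1}` functions `v` on `(0,∞)` with locally absolutely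
continuous `(k-1)`-st derivative (so that `∂_r^k v` exists almost everywhere and is the weak
derivative), and those among them that are limits of `m`-equivariant Schwartz functions in the
norm. -/
def MemAdapted (k m : ℕ) (v : ℝ → ℂ) : Prop :=
  ContDiffOn ℝ ((k - 1 : ℕ) : WithTop ℕ∞) v (Ioi 0) ∧
  (∀ a b : ℝ, 0 < a → a < b → AbsolutelyContinuousOnInterval (iteratedDeriv (k - 1) v) a b) ∧
  ∃ f : ℕ → 𝓢(ℂ, ℂ), (∀ n, IsEquivariant m (f n)) ∧
    Tendsto (fun n => adaptedNorm k m (fun r => v r - radialPart (f n) r)) atTop (𝓝 0)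

/-- `ψ` is (on the adapted space) a bounded real-linear functional, i.e. an element of the dual. -/
def IsDualElement (k m : ℕ) (ψ : (ℝ → ℂ) → ℝ) : Prop :=
  (∀ v w, MemAdapted k m v → MemAdapted k m w → ψ (fun r => v r + w r) = ψ v + ψ w) ∧
  (∀ (c : ℝ) (v), MemAdapted k m v → ψ (fun r => c • v r) = c * ψ v) ∧
  ∃ C : NNReal, ∀ v, MemAdapted k m v → ‖ψ v‖ₑ ≤ C * adaptedNorm k m v

/-! ### The static solution and the operators -/

/-- The static solution `Q(r) = √8 (m+1) r^m / (1 + r^{2(m+1)})`. -/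
def Q (m : ℕ) (r : ℝ) : ℝ := Real.sqrt 8 * (m + 1) * r ^ m / (1 + r ^ (2 * (m + 1)))

/-- `A_θ[Q](r) = -½ ∫₀^r Q² r' dr'`. -/
def Atheta (m : ℕ) (r : ℝ) : ℝ := -(1 / 2) * ∫ x in (0 : ℝ)..r, Q m x ^ 2 * x

/-- `B_Q v (r) = (1/r) ∫₀^r Re(Q̄ v) r' dr'`. -/
def BQ (m : ℕ) (v : ℝ → ℂ) (r : ℝ) : ℝ := 1 / r * ∫ x in (0 : ℝ)..r, Q m x * (v x).re * x

/-- `L_Q = D₊^{(Q)} + Q B_Q`, where `D₊^{(Q)} = ∂_r - (m + A_θ[Q])/r`. -/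
def LQ (m : ℕ) (v : ℝ → ℂ) (r : ℝ) : ℂ :=
  deriv v r - ((m + Atheta m r) / r) • v r + ((Q m r * BQ m v r : ℝ) : ℂ)

/-- `A_Q = ∂_r - (m + 1 + A_θ[Q])/r`. -/
def AQ (m : ℕ) (v : ℝ → ℂ) (r : ℝ) : ℂ := deriv v r - ((m + 1 + Atheta m r) / r) • v r

/-- `A_Q^*`, the formal adjoint of `A_Q` with respect to the measure `r dr`:
`A_Q^* = -∂_r - 1/r - (m + 1 + A_θ[Q])/r`. -/
def AQstar (m : ℕ) (v : ℝ → ℂ) (r : ℝ) : ℂ :=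
  -deriv v r - (1 / r) • v r - ((m + 1 + Atheta m r) / r) • v r

/-- `A_Q^* A_Q L_Q`. -/
def op3 (m : ℕ) (v : ℝ → ℂ) : ℝ → ℂ := AQstar m (AQ m (LQ m v))

/-- `A_Q^* A_Q A_Q^* A_Q L_Q`. -/
def op5 (m : ℕ) (v : ℝ → ℂ) : ℝ → ℂ := AQstar m (AQ m (AQstar m (AQ m (LQ m v))))

/-! ### The generalized null space -/

/-- `ΛQ = Q + r ∂_r Q`. -/
def LambdaQ (m : ℕ) (r : ℝ) : ℝ := Q m r + r * deriv (Q m) r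

/-- `(r^{2m+2} - 1)/(r^{2m+2} + 1) = tanh((m+1) log r)`. -/
def tanhProfile (m : ℕ) (r : ℝ) : ℝ := (r ^ (2 * (m + 1)) - 1) / (1 + r ^ (2 * (m + 1)))

/-- The generalized null mode `ρ`: the unique real solution on `(0,∞)` of
`L_Q ρ = r Q / (2(m+1))` with `|ρ| ≲ r² Q` (see `LQ_rho` and `abs_rho_le`), written down by
variation of parameters. -/
def rho (m : ℕ) (r : ℝ) : ℝ :=
  Q m r * (1 / (m + 1) ^ 2 * ∫ x in (0 : ℝ)..r,
    ((m + 1) * tanhProfile m r * tanhProfile m x * Real.log (r / x)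
      + tanhProfile m r - tanhProfile m x) * x)

/-- The four functions `ΛQ, iQ, ir²Q, ρ`. -/
def mode (m : ℕ) : Fin 4 → ℝ → ℂ :=
  ![fun r => (LambdaQ m r : ℂ),
    fun r => Complex.I * (Q m r : ℂ),
    fun r => Complex.I * ((r ^ 2 * Q m r : ℝ) : ℂ),
    fun r => (rho m r : ℂ)]

/-! ### The characterizing properties of `ρ` -/

lemma one_add_pow_pos (m : ℕ) (x : ℝ) : 0 < 1 + x ^ (2 * (m + 1)) := by
  have : 0 ≤ x ^ (2 * (m + 1)) := by rw [pow_mul]; positivity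
  linarith

lemma continuous_Q (m : ℕ) : Continuous (Q m) := by
  unfold Q
  exact Continuous.div (by fun_prop) (by fun_prop) (fun x => (one_add_pow_pos m x).ne')

lemma continuous_tanhProfile (m : ℕ) : Continuous (tanhProfile m) := by
  unfold tanhProfile
  exact Continuous.div (by fun_prop) (by fun_prop) (fun x => (one_add_pow_pos m x).ne')

lemma abs_tanhProfile_le (m : ℕ) (x : ℝ) : |tanhProfile m x| ≤ 1 := by
  have h := one_add_pow_pos m x
  have h2 : 0 ≤ x ^ (2 * (m + 1)) := by rw [pow_mul]; positivity
  unfold tanhProfile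
  rw [abs_le]
  constructor
  · rw [le_div_iff₀ h]; linarith
  · rw [div_le_iff₀ h]; linarith

lemma sqrt_eight_sq : Real.sqrt 8 ^ 2 = 8 := Real.sq_sqrt (by norm_num)

lemma Atheta_eq (m : ℕ) (r : ℝ) :
    Atheta m r = -(2 * (m + 1)) * (r ^ (2 * (m + 1)) / (1 + r ^ (2 * (m + 1)))) := by
  have hd : ∀ x : ℝ, HasDerivAt
      (fun x : ℝ => 4 * ((m : ℝ) + 1) * (x ^ (2 * (m + 1)) / (1 + x ^ (2 * (m + 1)))))
      (Q m x ^ 2 * x) x := by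
    intro x
    have hp := hasDerivAt_pow (2 * (m + 1)) x
    have h := ((hp.div (hp.const_add 1) (one_add_pow_pos m x).ne').const_mul (4 * ((m : ℝ) + 1)))
    refine h.congr_deriv ?_
    have h1 := (one_add_pow_pos m x).ne'
    unfold Q
    rw [div_pow, mul_pow, mul_pow, sqrt_eight_sq]
    have e : 2 * (m + 1) - 1 = 2 * m + 1 := by omega
    rw [e]
    field_simp
    push_cast
    ring
  unfold Atheta
  rw [intervalIntegral.integral_eq_sub_of_hasDerivAt (fun x _ => hd x)
    (((continuous_Q m).pow 2).mul continuous_id).continuousOn.intervalIntegrable]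
  simp
  ring

lemma hasDerivAt_Q (m : ℕ) {r : ℝ} (hr : 0 < r) :
    HasDerivAt (Q m) ((m + Atheta m r) / r * Q m r) r := by
  have hp := hasDerivAt_pow (2 * (m + 1)) r
  have h := ((hasDerivAt_pow m r).const_mul (Real.sqrt 8 * ((m : ℝ) + 1))).div
    (hp.const_add 1) (one_add_pow_pos m r).ne'
  refine h.congr_deriv ?_
  have h1 := (one_add_pow_pos m r).ne'
  rw [Atheta_eq]
  unfold Q
  have e : 2 * (m + 1) - 1 = 2 * m + 1 := by omega
  rw [e]
  have e2 : (m : ℝ) * r ^ (m - 1) = m * r ^ m / r := by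
    rcases m with _ | k
    · simp
    · field_simp; simp [pow_succ]
  rw [e2]
  field_simp
  push_cast
  ring

lemma hasDerivAt_tanhProfile (m : ℕ) {r : ℝ} (hr : 0 < r) :
    HasDerivAt (tanhProfile m) ((m + 1) * (1 - tanhProfile m r ^ 2) / r) r := by
  have hp := hasDerivAt_pow (2 * (m + 1)) r
  have h := (hp.sub_const 1).div (hp.const_add 1) (one_add_pow_pos m r).ne'
  refine h.congr_deriv ?_
  have h1 := (one_add_pow_pos m r).ne'
  unfold tanhProfile
  have e : 2 * (m + 1) - 1 = 2 * m + 1 := by omega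
  rw [e]
  field_simp
  push_cast
  ring

/-- The second solution `(m+1) log r tanh((m+1) log r) - 1` of the homogeneous equation, times
`r`. -/
lemma continuous_second (m : ℕ) : Continuous
    (fun x : ℝ => ((m + 1) * Real.log x * tanhProfile m x - 1) * x) := by
  have h : Continuous (fun x : ℝ => (m + 1) * tanhProfile m x * (x * Real.log x) - x) :=
    ((continuous_const.mul (continuous_tanhProfile m)).mul Real.continuous_mul_log).sub
      continuous_id
  refine h.congr fun x => by ring

lemma continuous_first (m : ℕ) : Continuous (fun x : ℝ => tanhProfile m x * x) :=
  (continuous_tanhProfile m).mul continuous_id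

lemma rho_eq (m : ℕ) {r : ℝ} (hr : 0 ≤ r) :
    rho m r = Q m r * (1 / (m + 1) ^ 2 *
      (((m + 1) * Real.log r * tanhProfile m r - 1) * (∫ x in (0 : ℝ)..r, tanhProfile m x * x)
        - tanhProfile m r *
          ∫ x in (0 : ℝ)..r, ((m + 1) * Real.log x * tanhProfile m x - 1) * x)) := by
  unfold rho
  congr 2
  rw [← intervalIntegral.integral_const_mul, ← intervalIntegral.integral_const_mul,
    ← intervalIntegral.integral_sub
      (((continuous_first m).intervalIntegrable _ _).const_mul _)
      (((continuous_second m).intervalIntegrable _ _).const_mul _)]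
  refine intervalIntegral.integral_congr_ae (Eventually.of_forall fun x hx => ?_)
  rw [uIoc_of_le hr] at hx
  rw [Real.log_div (hx.1.trans_le hx.2).ne' hx.1.ne']
  ring

/-- `L_Q ρ = r Q / (2(m+1))`. -/
theorem LQ_rho (m : ℕ) {r : ℝ} (hr : 0 < r) :
    LQ m (fun x => (rho m x : ℂ)) r = ((r * Q m r / (2 * (m + 1)) : ℝ) : ℂ) := by
  set u := tanhProfile m with hu
  set M : ℝ := (m : ℝ) + 1 with hM
  have hMpos : 0 < M := by positivity
  set U : ℝ → ℝ := fun r => ∫ x in (0 : ℝ)..r, u x * x with hU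
  set V : ℝ → ℝ := fun r => ∫ x in (0 : ℝ)..r, (M * Real.log x * u x - 1) * x with hV
  have dU : ∀ x, HasDerivAt U (u x * x) x := fun x =>
    ((continuous_first m).integral_hasStrictDerivAt 0 x).hasDerivAt
  have dV : ∀ x, HasDerivAt V ((M * Real.log x * u x - 1) * x) x := fun x =>
    ((continuous_second m).integral_hasStrictDerivAt 0 x).hasDerivAt
  have cU : Continuous U := continuous_iff_continuousAt.2 fun x => (dU x).continuousAt
  have cV : Continuous V := continuous_iff_continuousAt.2 fun x => (dV x).continuousAt
  have du : ∀ x, 0 < x → HasDerivAt u (M * (1 - u x ^ 2) / x) x := fun x hx =>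
    hasDerivAt_tanhProfile m hx
  -- the quotient `ρ / Q`
  set t : ℝ → ℝ := fun x => 1 / M ^ 2 * ((M * Real.log x * u x - 1) * U x - u x * V x) with ht
  have hrho : ∀ x, 0 ≤ x → rho m x = Q m x * t x := fun x hx => rho_eq m hx
  -- `r` times its derivative
  set G : ℝ → ℝ := fun x => 1 / M ^ 2 *
    ((M * u x + M ^ 2 * (4 * x ^ (2 * m + 1) / (1 + x ^ (2 * (m + 1))) ^ 2 * (x * Real.log x)))
      * U x - M * (1 - u x ^ 2) * V x) with hG
  have hsq : ∀ x, 4 * x ^ (2 * m + 1) / (1 + x ^ (2 * (m + 1))) ^ 2 * (x * Real.log x)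
      = (1 - u x ^ 2) * Real.log x := by
    intro x
    have h1 := (one_add_pow_pos m x).ne'
    rw [hu]; unfold tanhProfile
    field_simp
    ring
  have dt : ∀ x, 0 < x → HasDerivAt t (G x / x) x := by
    intro x hx
    have h := (((((Real.hasDerivAt_log hx.ne').const_mul M).mul (du x hx)).sub_const 1).mul
      (dU x)).sub ((du x hx).mul (dV x)) |>.const_mul (1 / M ^ 2)
    refine h.congr_deriv ?_
    simp only [hG, hsq]
    simp only [Pi.mul_apply]
    field_simp
    ring
  have dG : ∀ x, 0 < x → HasDerivAt G (x / M - Q m x ^ 2 * t x * x) x := by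
    intro x hx
    have hGe : G = fun x => 1 / M ^ 2 *
        ((M * u x + M ^ 2 * ((1 - u x ^ 2) * Real.log x)) * U x - M * (1 - u x ^ 2) * V x) := by
      funext y; simp only [hG, hsq]
    rw [hGe]
    have hlog := Real.hasDerivAt_log hx.ne'
    have hu2 := ((du x hx).pow 2).const_sub 1
    have h := ((((du x hx).const_mul M).add ((hu2.mul hlog).const_mul (M ^ 2))).mul
      (dU x)).sub ((hu2.const_mul M).mul (dV x)) |>.const_mul (1 / M ^ 2)
    refine h.congr_deriv ?_
    have hQ : Q m x ^ 2 = 2 * M ^ 2 * (1 - u x ^ 2) / x ^ 2 := by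
      have h1 := (one_add_pow_pos m x).ne'
      rw [hu]; unfold tanhProfile Q
      rw [div_pow, mul_pow, mul_pow, sqrt_eight_sq]
      field_simp
      ring
    rw [hQ]
    simp only [ht, Pi.mul_apply, Pi.add_apply, Pi.pow_apply]
    field_simp
    ring
  have cG : Continuous G := by
    have c1 : Continuous (fun x : ℝ => 4 * x ^ (2 * m + 1) / (1 + x ^ (2 * (m + 1))) ^ 2) :=
      Continuous.div (by fun_prop) (by fun_prop)
        (fun x => (pow_pos (one_add_pow_pos m x) 2).ne')
    have c2 : Continuous u := continuous_tanhProfile m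
    exact continuous_const.mul ((((continuous_const.mul c2).add
      (continuous_const.mul (c1.mul Real.continuous_mul_log))).mul cU).sub
      ((continuous_const.mul (continuous_const.sub (c2.pow 2))).mul cV))
  have hint : ∫ x in (0 : ℝ)..r, Q m x ^ 2 * t x * x = r ^ 2 / (2 * M) - G r := by
    have hc : Continuous (fun x => Q m x ^ 2 * t x * x) := by
      have h : Continuous (fun x => Q m x ^ 2 * (1 / M ^ 2 *
          (((M * Real.log x * u x - 1) * x) * U x - (u x * x) * V x))) :=
        ((continuous_Q m).pow 2).mul (continuous_const.mul
          (((continuous_second m).mul cU).sub ((continuous_first m).mul cV)))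
      refine h.congr fun x => ?_
      simp only [ht]; ring
    have h := intervalIntegral.integral_eq_sub_of_hasDerivAt_of_le hr.le
      (f := fun x => x ^ 2 / (2 * M) - G x) (f' := fun x => Q m x ^ 2 * t x * x)
      (by fun_prop) (fun x hx => by
        refine (((hasDerivAt_pow 2 x).div_const (2 * M)).sub (dG x hx.1)).congr_deriv ?_
        field_simp
        push_cast
        ring) (hc.intervalIntegrable _ _)
    rw [h]
    have hG0 : G 0 = 0 := by simp [hG, hU, hV]
    simp [hG0]
  have dQ := hasDerivAt_Q m hr
  have drho : HasDerivAt (rho m) ((m + Atheta m r) / r * Q m r * t r + Q m r * (G r / r)) r := by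
    refine (dQ.mul (dt r hr)).congr_of_eventuallyEq ?_
    filter_upwards [lt_mem_nhds hr] with x hx
    exact hrho x hx.le
  have hB : BQ m (fun x => (rho m x : ℂ)) r = 1 / r * (r ^ 2 / (2 * M) - G r) := by
    unfold BQ
    rw [← hint]
    congr 1
    refine intervalIntegral.integral_congr fun x hx => ?_
    rw [uIcc_of_le hr.le] at hx
    simp only [Complex.ofReal_re, hrho x hx.1]
    ring
  unfold LQ
  rw [hB, drho.ofReal_comp.deriv, Complex.real_smul]
  simp only [hrho r hr.le]
  norm_cast
  field_simp
  ring

/-- `|ρ| ≲ r² Q`. -/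
theorem abs_rho_le (m : ℕ) {r : ℝ} (hr : 0 < r) :
    |rho m r| ≤ (m + 3) / (m + 1) ^ 2 * (r ^ 2 * Q m r) := by
  have hQ : 0 ≤ Q m r := by
    unfold Q
    have := one_add_pow_pos m r
    positivity
  have hI : ‖∫ x in (0 : ℝ)..r, (((m : ℝ) + 1) * tanhProfile m r * tanhProfile m x
      * Real.log (r / x) + tanhProfile m r - tanhProfile m x) * x‖
      ≤ ((m + 3) * r) * |r - 0| := by
    refine intervalIntegral.norm_integral_le_of_norm_le_const fun x hx => ?_
    rw [uIoc_of_le hr.le] at hx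
    obtain ⟨hx0, hxr⟩ := hx
    have hl0 : 0 ≤ Real.log (r / x) := Real.log_nonneg ((one_le_div hx0).2 hxr)
    have hl1 : Real.log (r / x) * x ≤ r := by
      have := Real.log_le_self (div_pos hr hx0).le
      calc Real.log (r / x) * x ≤ r / x * x := by gcongr
        _ = r := by field_simp
    have h1 := abs_tanhProfile_le m r
    have h2 := abs_tanhProfile_le m x
    have h3 : |tanhProfile m r * tanhProfile m x| ≤ 1 := by
      rw [abs_mul]; exact mul_le_one₀ h1 (abs_nonneg _) h2
    rw [Real.norm_eq_abs]
    have e : (((m : ℝ) + 1) * tanhProfile m r * tanhProfile m x * Real.log (r / x)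
        + tanhProfile m r - tanhProfile m x) * x
        = (m + 1) * (tanhProfile m r * tanhProfile m x) * (Real.log (r / x) * x)
          + (tanhProfile m r * x - tanhProfile m x * x) := by ring
    rw [e]
    refine (abs_add_le _ _).trans ?_
    have a1 : |((m : ℝ) + 1) * (tanhProfile m r * tanhProfile m x) * (Real.log (r / x) * x)|
        ≤ (m + 1) * 1 * r := by
      rw [abs_mul, abs_mul, abs_of_nonneg (by positivity : (0 : ℝ) ≤ m + 1),
        abs_of_nonneg (mul_nonneg hl0 hx0.le)]
      gcongr
    have a2 : |tanhProfile m r * x - tanhProfile m x * x| ≤ 1 * r + 1 * r := by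
      refine (abs_sub _ _).trans ?_
      rw [abs_mul, abs_mul, abs_of_pos hx0]
      gcongr
    linarith
  unfold rho
  rw [abs_mul, abs_mul, abs_of_nonneg hQ, abs_of_nonneg (by positivity : (0:ℝ) ≤ 1 / (m + 1) ^ 2)]
  rw [Real.norm_eq_abs, sub_zero, abs_of_pos hr] at hI
  calc Q m r * (1 / (m + 1) ^ 2 * |_|) ≤ Q m r * (1 / (m + 1) ^ 2 * ((m + 3) * r * r)) := by
        gcongr
    _ = _ := by ring

end ChernSimons

end

noncomputable section

namespace ChernSimons

open MeasureTheory Set Filter Topology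
open scoped ENNReal SchwartzMap

/-! ### The radial `L²` norm -/

/-! Write M = m + 1, u = tanh(M log r), and use the Euler derivative r∂_r throughout. Since A_θ[Q] =
-M(1 + u), r²Q² = 2M²(1 - u²) and r∂_r u = M(1 - u²), every coefficient is a polynomial in u: r A_Q
= r∂_r + Mu, r A_Q^* = -r∂_r + Mu - 1, and r L_Q v = r∂₊v + M(1 + u)v + Q∫₀^r Q Re(v) r'dr'. The
adapted norm of order k is equivalent to two pieces of information, collected in `AdaptedBound`: k -
1 Euler derivatives of q = r∂₊v in the weight r^{-k}, and v itself in a weight that loses a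
logarithm, or a logarithm and a power, near 0 when m < k. The equivalence is
`exists_adaptedBound_of_adaptedNorm` and `exists_adaptedNorm_le`.

Boundedness. The factor 1 + u vanishes at the origin to an order that pays for the loss of weight,
and the nonlocal term is O(r³Q) times the norm by Cauchy–Schwarz. Together with q these two
potential terms form a closed first order system, so their higher Euler derivatives come for free
(`exists_potential_eulerBound`), which gives `exists_LQ_bound`.

Inversion. The operator is peeled off from the left. Energy identities invert A_Q^*, and the product
A_Q A_Q^* when m ≥ 3, with no kernel (`energy_AQstar`, `energy_AQ_AQstar`); boundary terms vanish
along sequences because the norms are finite. The remaining factors have kernels. A_Q annihilates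
rQ, so dividing by rQ and using the Hardy inequality `hardy_Q` inverts it on functions vanishing at
r = 1. On imaginary parts L_Q annihilates Q and is treated in the same way. On real parts, t = Re v
/ Q satisfies with s = M log r the Pöschl–Teller equation t'' + 2 sech²(s) t = forcing, whose
homogeneous solutions tanh s and s tanh s - 1 are explicit. Variation of parameters expresses v
through two Wronskians: the one with tanh s is integrated from 0, the other vanishes at r = 1 and is
estimated by Hardy (`exists_real_part_bound`).

Conclusion. The normalization L_Q v(1) = 0, Im v(1) = 0, ∫₀^1 Q Re(v) r dr = 0 is four real
conditions. Since L_Q ΛQ = L_Q(iQ) = 0 while L_Q(ir²Q) and L_Q ρ are i and real multiples of rQ,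
subtracting a unique combination of the four modes achieves it (`exists_decomposition`), with
coefficients controlled by ‖Q|v|_{-(k-1)}‖ through values near r = 1. The remainder is bounded by
the operator applied to v. Subcoercivity, the kernel and coercivity are then linear algebra in the
four coefficients (`boundedness_kernel_coercivity`).

It must also be shown that Schwartz functions have finite norm and that the modes are limits of
them. Equivariance kills the Taylor coefficients of the radial part of orders below m and of order m
+ 1, so it equals a r^m + O(r^k); truncation to compact annuli, uniform thanks to scale invariance
of r∂_r, then approximates every smooth function with enough decay in the weight r^{-k}
(`memAdapted_of_eulerBound`). -/

/-- Lebesgue measure on `(0,∞)`. -/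
abbrev halfLine : Measure ℝ := volume.restrict (Ioi 0)

/-- The measure `2πr dr` on `(0,∞)`. -/
def planeMeasure : Measure ℝ := halfLine.withDensity fun r => ENNReal.ofReal (2 * Real.pi * r)

/-- This is the form to which Minkowski's inequality applies. The density is finite everywhere, so
the change of measure needs no measurability of `g`. -/
lemma l2norm_eq (g : ℝ → ℝ≥0∞) :
    l2norm g = (∫⁻ r, g r ^ (2 : ℝ) ∂planeMeasure) ^ (1 / 2 : ℝ) := by
  unfold l2norm planeMeasure
  rw [lintegral_withDensity_eq_lintegral_mul_non_measurable _ (by fun_prop)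
    (Eventually.of_forall fun _ => ENNReal.ofReal_lt_top)]
  simp only [Pi.mul_apply, ENNReal.rpow_ofNat, mul_comm]

lemma ae_halfLine_iff {p : ℝ → Prop} : (∀ᵐ r ∂halfLine, p r) ↔ ∀ᵐ r, 0 < r → p r :=
  ae_restrict_iff' measurableSet_Ioi

lemma ae_halfLine_of_forall {p : ℝ → Prop} (h : ∀ r, 0 < r → p r) : ∀ᵐ r ∂halfLine, p r :=
  ae_halfLine_iff.2 (Eventually.of_forall h)

lemma planeMeasure_ac : planeMeasure ≪ halfLine := withDensity_absolutelyContinuous _ _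

lemma l2norm_mono_ae {g h : ℝ → ℝ≥0∞} (H : ∀ᵐ r ∂halfLine, g r ≤ h r) : l2norm g ≤ l2norm h := by
  rw [l2norm_eq, l2norm_eq]
  refine ENNReal.rpow_le_rpow (lintegral_mono_ae ?_) (by norm_num)
  filter_upwards [planeMeasure_ac.ae_le H] with r hr
  exact ENNReal.rpow_le_rpow hr (by norm_num)

lemma l2norm_mono {g h : ℝ → ℝ≥0∞} (H : ∀ r, 0 < r → g r ≤ h r) : l2norm g ≤ l2norm h :=
  l2norm_mono_ae (ae_halfLine_of_forall H)

lemma l2norm_congr_ae {g h : ℝ → ℝ≥0∞} (H : ∀ᵐ r ∂halfLine, g r = h r) : l2norm g = l2norm h :=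
  le_antisymm (l2norm_mono_ae (H.mono fun _ h => h.le)) (l2norm_mono_ae (H.mono fun _ h => h.ge))

lemma l2norm_add_le {g h : ℝ → ℝ≥0∞} (hg : AEMeasurable g halfLine)
    (hh : AEMeasurable h halfLine) :
    l2norm (fun r => g r + h r) ≤ l2norm g + l2norm h := by
  rw [l2norm_eq, l2norm_eq, l2norm_eq]
  exact ENNReal.lintegral_Lp_add_le (hg.mono_ac planeMeasure_ac) (hh.mono_ac planeMeasure_ac)
    (by norm_num)

lemma l2norm_const_mul {c : ℝ≥0∞} (hc : c ≠ ∞) (g : ℝ → ℝ≥0∞) :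
    l2norm (fun r => c * g r) = c * l2norm g := by
  rw [l2norm_eq, l2norm_eq]
  simp_rw [ENNReal.mul_rpow_of_nonneg _ _ (by norm_num : (0 : ℝ) ≤ 2)]
  rw [lintegral_const_mul' _ _ (by simp [hc]),
    ENNReal.mul_rpow_of_nonneg _ _ (by norm_num), ← ENNReal.rpow_mul]
  norm_num

lemma l2norm_sq (g : ℝ → ℝ≥0∞) :
    l2norm g ^ 2 = ∫⁻ r in Ioi (0 : ℝ), g r ^ 2 * ENNReal.ofReal (2 * Real.pi * r) := by
  unfold l2norm
  rw [← ENNReal.rpow_natCast, ← ENNReal.rpow_mul]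
  norm_num

lemma l2norm_sum_le {ι : Type*} (s : Finset ι) (g : ι → ℝ → ℝ≥0∞)
    (hg : ∀ i ∈ s, AEMeasurable (g i) halfLine) :
    l2norm (fun r => ∑ i ∈ s, g i r) ≤ ∑ i ∈ s, l2norm (g i) := by
  classical
  induction s using Finset.induction_on with
  | empty => simp [l2norm]
  | insert a s ha ih =>
    simp only [Finset.sum_insert ha]
    refine (l2norm_add_le (hg a (by simp))
      (Finset.aemeasurable_fun_sum s fun i hi => hg i (by simp [hi]))).trans ?_
    gcongr
    exact ih fun i hi => hg i (by simp [hi])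

/-! ### Euler derivatives in the sense of absolutely continuous functions -/

section EulerDeriv

variable {E : Type*} [NormedAddCommGroup E]

/-- `f` is locally absolutely continuous on `(0,∞)`. -/
def LocAC (f : ℝ → E) : Prop :=
  ∀ a b : ℝ, 0 < a → a < b → AbsolutelyContinuousOnInterval f a b

lemma absolutelyContinuousOnInterval_congr {f g : ℝ → E} {a b : ℝ}
    (hf : AbsolutelyContinuousOnInterval f a b) (h : ∀ r ∈ uIcc a b, f r = g r) :
    AbsolutelyContinuousOnInterval g a b := by
  rw [absolutelyContinuousOnInterval_iff] at hf ⊢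
  intro ε hε
  obtain ⟨δ, hδ, H⟩ := hf ε hε
  refine ⟨δ, hδ, fun E hE hEδ => ?_⟩
  have := H E hE hEδ
  refine lt_of_eq_of_lt (Finset.sum_congr rfl fun i hi => ?_) this
  rw [h _ (hE.1 i hi).1, h _ (hE.1 i hi).2]

lemma LocAC.continuousOn {f : ℝ → E} (hf : LocAC f) : ContinuousOn f (Ioi 0) := by
  intro r hr
  have hr' : (0 : ℝ) < r := hr
  have h := (hf (r / 2) (2 * r) (by linarith) (by linarith)).continuousOn
  rw [uIcc_of_le (by linarith)] at h
  exact (h.continuousAt (Icc_mem_nhds (by linarith) (by linarith))).continuousWithinAt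

lemma LocAC.congr {f g : ℝ → E} (hf : LocAC f) (h : ∀ r, 0 < r → f r = g r) : LocAC g :=
  fun a b ha hab => absolutelyContinuousOnInterval_congr (hf a b ha hab) fun r hr => by
    rw [uIcc_of_le hab.le] at hr
    exact h r (ha.trans_le hr.1)

variable [NormedSpace ℝ E]

/-- `g` is the (almost everywhere defined) Euler derivative `r ∂_r f` of the locally absolutely
continuous function `f`. -/
def HasEulerDeriv (f g : ℝ → E) : Prop :=
  LocAC f ∧ ∀ᵐ r ∂halfLine, HasDerivAt f (r⁻¹ • g r) r

lemma absolutelyContinuousOnInterval_lipschitz {F : Type*} [NormedAddCommGroup F]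
    [NormedSpace ℝ F] {f : ℝ → E} {a b : ℝ}
    (hf : AbsolutelyContinuousOnInterval f a b) (L : E →L[ℝ] F) :
    AbsolutelyContinuousOnInterval (fun r => L (f r)) a b := by
  unfold AbsolutelyContinuousOnInterval at hf ⊢
  refine squeeze_zero (fun t => Finset.sum_nonneg fun i _ => dist_nonneg) (fun t => ?_)
    (by simpa using hf.const_mul ‖L‖)
  rw [Finset.mul_sum]
  exact Finset.sum_le_sum fun i _ => L.dist_le_opNorm _ _

lemma locAC_of_contDiffOn {f : ℝ → E} (hf : ContDiffOn ℝ 1 f (Ioi 0)) : LocAC f :=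
  fun a b ha hab => (hf.mono fun r hr => by
    rw [uIcc_of_le hab.le] at hr
    exact ha.trans_le hr.1).absolutelyContinuousOnInterval

lemma contDiffOn_one_of_hasDerivAt {f f' : ℝ → E} (h : ∀ r, 0 < r → HasDerivAt f (f' r) r)
    (hc : ContinuousOn f' (Ioi 0)) : ContDiffOn ℝ 1 f (Ioi 0) := by
  have := (contDiffOn_succ_iff_deriv_of_isOpen (𝕜 := ℝ) (n := 0) (f := f) isOpen_Ioi (s := Ioi 0)).2
    ⟨fun r hr => (h r hr).differentiableAt.differentiableWithinAt, by simp, ?_⟩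
  · simpa using this
  · rw [contDiffOn_zero]
    exact hc.congr fun r hr => (h r hr).deriv

lemma continuousOn_inv_smul {g : ℝ → E} (hg : ContinuousOn g (Ioi 0)) :
    ContinuousOn (fun r : ℝ => r⁻¹ • g r) (Ioi 0) := by
  have h : ContinuousOn (fun r : ℝ => r⁻¹) (Ioi 0) :=
    continuousOn_inv₀.mono fun r hr => (ne_of_gt hr : r ≠ 0)
  exact h.smul hg

lemma hasEulerDeriv_of_hasDerivAt {f g : ℝ → E} (h : ∀ r, 0 < r → HasDerivAt f (r⁻¹ • g r) r)
    (hc : ContinuousOn g (Ioi 0)) : HasEulerDeriv f g :=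
  ⟨locAC_of_contDiffOn (contDiffOn_one_of_hasDerivAt h (continuousOn_inv_smul hc)),
    ae_halfLine_of_forall h⟩

namespace HasEulerDeriv

variable {f g f₁ g₁ : ℝ → E}

lemma continuousOn (h : HasEulerDeriv f g) : ContinuousOn f (Ioi 0) := h.1.continuousOn

lemma congr (h : HasEulerDeriv f g) (hf : ∀ r, 0 < r → f r = f₁ r)
    (hg : ∀ᵐ r ∂halfLine, g r = g₁ r) : HasEulerDeriv f₁ g₁ := by
  refine ⟨h.1.congr hf, ?_⟩
  filter_upwards [h.2, hg, ae_restrict_mem measurableSet_Ioi] with r h1 h2 h3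
  rw [← h2]
  refine h1.congr_of_eventuallyEq ?_
  filter_upwards [Ioi_mem_nhds h3] with x hx
  exact (hf x hx).symm

lemma add (h : HasEulerDeriv f g) (h₁ : HasEulerDeriv f₁ g₁) :
    HasEulerDeriv (fun r => f r + f₁ r) (fun r => g r + g₁ r) := by
  refine ⟨fun a b ha hb => (h.1 a b ha hb).fun_add (h₁.1 a b ha hb), ?_⟩
  filter_upwards [h.2, h₁.2] with r h1 h2
  rw [smul_add]
  exact h1.add h2

/-- Product with a continuously differentiable scalar function. -/
lemma smul {s s' : ℝ → ℝ} (hs : HasEulerDeriv s s') (h : HasEulerDeriv f g) :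
    HasEulerDeriv (fun r => s r • f r) (fun r => s' r • f r + s r • g r) := by
  refine ⟨fun a b ha hb => (hs.1 a b ha hb).fun_smul (h.1 a b ha hb), ?_⟩
  filter_upwards [h.2, hs.2] with r h1 h2
  refine (h2.smul h1).congr_deriv ?_
  rw [smul_add, smul_eq_mul, add_comm, smul_smul, smul_smul, smul_smul, mul_comm (s r)]

lemma const (c : E) : HasEulerDeriv (fun _ => c) (fun _ => 0) :=
  hasEulerDeriv_of_hasDerivAt (fun r _ => by simpa using hasDerivAt_const r c) continuousOn_const

lemma const_smul (c : ℝ) (h : HasEulerDeriv f g) :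
    HasEulerDeriv (fun r => c • f r) (fun r => c • g r) :=
  ((const c).smul h).congr (fun _ _ => rfl) (Eventually.of_forall fun r => by simp)

lemma sub (h : HasEulerDeriv f g) (h₁ : HasEulerDeriv f₁ g₁) :
    HasEulerDeriv (fun r => f r - f₁ r) (fun r => g r - g₁ r) :=
  (h.add (h₁.const_smul (-1))).congr (fun r _ => by simp [sub_eq_add_neg])
    (Eventually.of_forall fun r => by simp [sub_eq_add_neg])

lemma clm {F : Type*} [NormedAddCommGroup F] [NormedSpace ℝ F] (L : E →L[ℝ] F)
    (h : HasEulerDeriv f g) : HasEulerDeriv (fun r => L (f r)) (fun r => L (g r)) := by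
  refine ⟨fun a b ha hb => absolutelyContinuousOnInterval_lipschitz (h.1 a b ha hb) L, ?_⟩
  filter_upwards [h.2] with r h1
  have := L.hasFDerivAt.comp_hasDerivAt r h1
  rw [map_smul] at this
  exact this

/-- If the Euler derivative is continuous, it is a classical derivative. -/
lemma hasDerivAt [CompleteSpace E] (h : HasEulerDeriv f g) (hg : ContinuousOn g (Ioi 0)) {r : ℝ}
    (hr : 0 < r) : HasDerivAt f (r⁻¹ • g r) r := by
  -- The primitive of `g t / t` is continuously differentiable, and its difference from `f` is
  -- absolutely continuous with zero derivative almost everywhere, hence constant.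
  set G : ℝ → E := fun x => ∫ t in r..x, t⁻¹ • g t with hG
  have hc : ContinuousOn (fun t => t⁻¹ • g t) (Ioi (0 : ℝ)) :=
    continuousOn_inv_smul hg
  have hd : ∀ x, 0 < x → HasDerivAt G (x⁻¹ • g x) x := by
    intro x hx
    have hsub : uIcc r x ⊆ Ioi 0 := fun y hy => lt_of_lt_of_le (lt_min hr hx) hy.1
    refine intervalIntegral.integral_hasDerivAt_right ((hc.mono hsub).intervalIntegrable) ?_
      (hc.continuousAt (Ioi_mem_nhds hx))
    exact hc.stronglyMeasurableAtFilter isOpen_Ioi _ hx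
  have hGe : HasEulerDeriv G g := hasEulerDeriv_of_hasDerivAt hd hg
  have h0 := h.sub hGe
  have hab : r / 2 < 2 * r := by linarith
  obtain ⟨C, hC⟩ := (h0.1 (r / 2) (2 * r) (by linarith) hab).const_of_ae_hasDerivAt_zero (by
    filter_upwards [ae_halfLine_iff.1 h0.2] with x hx hx2
    rw [uIcc_of_le hab.le] at hx2
    simpa using hx ((by linarith : (0 : ℝ) < r / 2).trans_le hx2.1))
  rw [uIcc_of_le hab.le] at hC
  refine ((hd r hr).add_const C).congr_of_eventuallyEq ?_
  filter_upwards [Icc_mem_nhds (by linarith : r / 2 < r) (by linarith : r < 2 * r)] with x hx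
  rw [← hC x hx]; simp

end HasEulerDeriv

end EulerDeriv

/-! ### Weighted norms of iterated Euler derivatives -/

/-- The `L²` norm with weight `W`. -/
def wnorm {E : Type*} [NormedAddCommGroup E] (W : ℝ → ℝ≥0∞) (f : ℝ → E) : ℝ≥0∞ :=
  l2norm fun r => W r * ‖f r‖ₑ

/-- The weighted norms of `f` and its first `n` Euler derivatives are at most `B`. -/
def EulerBound (W : ℝ → ℝ≥0∞) (B : ℝ≥0∞) : ℕ → (ℝ → ℂ) → Prop
  | 0, f => AEMeasurable f halfLine ∧ wnorm W f ≤ B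
  | n + 1, f => (AEMeasurable f halfLine ∧ wnorm W f ≤ B) ∧
      ∃ g, HasEulerDeriv f g ∧ EulerBound W B n g

/-- The function `s` and its first `n` Euler derivatives are bounded by `C`. -/
def SymbolBound (C : NNReal) : ℕ → (ℝ → ℝ) → Prop
  | 0, s => ContinuousOn s (Ioi 0) ∧ ∀ r, 0 < r → |s r| ≤ C
  | n + 1, s => (∀ r, 0 < r → |s r| ≤ C) ∧
      ∃ s', (∀ r, 0 < r → HasDerivAt s (r⁻¹ • s' r) r) ∧ SymbolBound C n s'

lemma aemeasurable_of_continuousOn {E : Type*} [NormedAddCommGroup E] [MeasurableSpace E]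
    [BorelSpace E] {f : ℝ → E} (hf : ContinuousOn f (Ioi 0)) : AEMeasurable f halfLine :=
  hf.aemeasurable measurableSet_Ioi

section wnorm

variable {E : Type*} [NormedAddCommGroup E] {W W' : ℝ → ℝ≥0∞} {f g : ℝ → E}

lemma wnorm_mono (h : ∀ r, 0 < r → W r * ‖f r‖ₑ ≤ W' r * ‖g r‖ₑ) : wnorm W f ≤ wnorm W' g :=
  l2norm_mono h

lemma wnorm_congr (h : ∀ r, 0 < r → f r = g r) : wnorm W f = wnorm W g :=
  le_antisymm (wnorm_mono fun r hr => by rw [h r hr]) (wnorm_mono fun r hr => by rw [h r hr])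

lemma wnorm_congr_ae (h : ∀ᵐ r ∂halfLine, f r = g r) : wnorm W f = wnorm W g :=
  l2norm_congr_ae (h.mono fun r hr => by rw [hr])

lemma wnorm_le_const_mul (c : NNReal) (h : ∀ r, 0 < r → W r * ‖f r‖ₑ ≤ c * (W' r * ‖g r‖ₑ)) :
    wnorm W f ≤ c * wnorm W' g := by
  unfold wnorm
  rw [← l2norm_const_mul ENNReal.coe_ne_top]
  exact l2norm_mono h

lemma wnorm_add_le [MeasurableSpace E] [BorelSpace E] (hW : Measurable W)
    (hf : AEMeasurable f halfLine) (hg : AEMeasurable g halfLine) :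
    wnorm W (fun r => f r + g r) ≤ wnorm W f + wnorm W g := by
  refine le_trans ?_ (l2norm_add_le (hW.aemeasurable.mul hf.enorm) (hW.aemeasurable.mul hg.enorm))
  refine l2norm_mono fun r _ => ?_
  rw [← mul_add]
  gcongr
  exact enorm_add_le _ _

lemma wnorm_smul_le {s : ℝ → ℝ} [NormedSpace ℝ E] (c : NNReal) (h : ∀ r, 0 < r → |s r| ≤ c) :
    wnorm W (fun r => s r • f r) ≤ c * wnorm W f := by
  refine wnorm_le_const_mul c fun r hr => ?_
  rw [enorm_smul, mul_left_comm]
  gcongr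
  rw [enorm_eq_nnnorm, ENNReal.coe_le_coe, ← NNReal.coe_le_coe]
  simpa using h r hr

end wnorm

namespace EulerBound

variable {W W' : ℝ → ℝ≥0∞} {B B' : ℝ≥0∞} {n : ℕ} {f g : ℝ → ℂ}

lemma zero_level (h : EulerBound W B n f) : EulerBound W B 0 f := by
  cases n with
  | zero => exact h
  | succ n => exact h.1

lemma aemeasurable (h : EulerBound W B n f) : AEMeasurable f halfLine := h.zero_level.1

lemma wnorm_le (h : EulerBound W B n f) : wnorm W f ≤ B := h.zero_level.2

lemma pred (h : EulerBound W B (n + 1) f) : EulerBound W B n f := by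
  induction n generalizing f with
  | zero => exact h.1
  | succ n ih =>
    obtain ⟨h0, g, hg, hB⟩ := h
    exact ⟨h0, g, hg, ih hB⟩

lemma of_le {k : ℕ} (h : EulerBound W B n f) (hk : k ≤ n) : EulerBound W B k f := by
  induction n with
  | zero => obtain rfl : k = 0 := by omega
            exact h
  | succ n ih =>
    rcases Nat.lt_or_ge k (n + 1) with h1 | h1
    · exact ih h.pred (by omega)
    · obtain rfl : k = n + 1 := by omega
      exact h

lemma mono (h : EulerBound W B n f) (hB : B ≤ B') : EulerBound W B' n f := by
  induction n generalizing f with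
  | zero => exact ⟨h.1, h.2.trans hB⟩
  | succ n ih =>
    obtain ⟨h0, g, hg, h1⟩ := h
    exact ⟨⟨h0.1, h0.2.trans hB⟩, g, hg, ih h1⟩

lemma mono_weight (c : NNReal) (hW : ∀ r, 0 < r → W' r ≤ c * W r) (h : EulerBound W B n f) :
    EulerBound W' (c * B) n f := by
  have key : ∀ f : ℝ → ℂ, wnorm W f ≤ B → wnorm W' f ≤ c * B := fun f hf =>
    (wnorm_le_const_mul c fun r hr => by rw [← mul_assoc]; gcongr; exact hW r hr).trans
      (by gcongr)
  induction n generalizing f with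
  | zero => exact ⟨h.1, key f h.2⟩
  | succ n ih =>
    obtain ⟨h0, g, hg, h1⟩ := h
    exact ⟨⟨h0.1, key f h0.2⟩, g, hg, ih h1⟩

lemma congr_ae (h : EulerBound W B 0 f) (hfg : ∀ᵐ r ∂halfLine, f r = g r) :
    EulerBound W B 0 g :=
  ⟨h.1.congr hfg, (wnorm_congr_ae hfg).symm.trans_le h.2⟩

lemma congr (h : EulerBound W B n f) (hfg : ∀ r, 0 < r → f r = g r) : EulerBound W B n g := by
  cases n with
  | zero => exact h.congr_ae (ae_halfLine_of_forall hfg)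
  | succ n =>
    obtain ⟨h0, g', hg', h1⟩ := h
    exact ⟨congr_ae h0 (ae_halfLine_of_forall hfg), g',
      hg'.congr hfg (Eventually.of_forall fun _ => rfl), h1⟩

lemma add (hW : Measurable W) (hf : EulerBound W B n f) (hg : EulerBound W B' n g) :
    EulerBound W (B + B') n (fun r => f r + g r) := by
  induction n generalizing f g with
  | zero => exact ⟨hf.1.add hg.1, (wnorm_add_le hW hf.1 hg.1).trans (add_le_add hf.2 hg.2)⟩
  | succ n ih =>
    obtain ⟨h0, f', hf', h1⟩ := hf
    obtain ⟨k0, g', hg', k1⟩ := hg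
    exact ⟨⟨h0.1.add k0.1, (wnorm_add_le hW h0.1 k0.1).trans (add_le_add h0.2 k0.2)⟩, _,
      hf'.add hg', ih h1 k1⟩

lemma re (h : EulerBound W B n f) : EulerBound W B n (fun r => ((f r).re : ℂ)) := by
  have key : ∀ f : ℝ → ℂ, EulerBound W B 0 f → EulerBound W B 0 (fun r => ((f r).re : ℂ)) := by
    intro f hf
    refine ⟨Complex.measurable_ofReal.comp_aemeasurable
      (Complex.measurable_re.comp_aemeasurable hf.1), (wnorm_mono fun r _ => ?_).trans hf.2⟩
    gcongr
    rw [← ofReal_norm, ← ofReal_norm]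
    refine ENNReal.ofReal_le_ofReal ?_
    rw [Complex.norm_real]
    exact Complex.abs_re_le_norm _
  induction n generalizing f with
  | zero => exact key f h
  | succ n ih =>
    obtain ⟨h0, f', hf', h1⟩ := h
    exact ⟨key f h0, _, hf'.clm (Complex.ofRealCLM.comp Complex.reCLM), ih h1⟩

end EulerBound

namespace SymbolBound

variable {C C' : NNReal} {n : ℕ} {s t : ℝ → ℝ}

lemma continuousOn (h : SymbolBound C n s) : ContinuousOn s (Ioi 0) := by
  cases n with
  | zero => exact h.1
  | succ n =>
    obtain ⟨-, s', hs', -⟩ := h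
    exact fun r hr => (hs' r hr).continuousAt.continuousWithinAt

lemma mono (h : SymbolBound C n s) (hC : C ≤ C') : SymbolBound C' n s := by
  induction n generalizing s with
  | zero => exact ⟨h.1, fun r hr => (h.2 r hr).trans (by exact_mod_cast hC)⟩
  | succ n ih =>
    obtain ⟨h0, s', hs', h1⟩ := h
    exact ⟨fun r hr => (h0 r hr).trans (by exact_mod_cast hC), s', hs', ih h1⟩

lemma pred (h : SymbolBound C (n + 1) s) : SymbolBound C n s := by
  induction n generalizing s with
  | zero => exact ⟨h.continuousOn, h.1⟩
  | succ n ih =>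
    obtain ⟨h0, g, hg, hB⟩ := h
    exact ⟨h0, g, hg, ih hB⟩

lemma congr (h : SymbolBound C n s) (hst : ∀ r, 0 < r → s r = t r) : SymbolBound C n t := by
  cases n with
  | zero => exact ⟨h.1.congr fun r hr => (hst r hr).symm, fun r hr => hst r hr ▸ h.2 r hr⟩
  | succ n =>
    obtain ⟨h0, s', hs', h1⟩ := h
    refine ⟨fun r hr => hst r hr ▸ h0 r hr, s', fun r hr => (hs' r hr).congr_of_eventuallyEq ?_, h1⟩
    filter_upwards [Ioi_mem_nhds hr] with x hx
    exact (hst x hx).symm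

lemma const (c : ℝ) (n : ℕ) : SymbolBound ‖c‖₊ n (fun _ => c) := by
  induction n generalizing c with
  | zero => exact ⟨continuousOn_const, fun r _ => by simp⟩
  | succ n ih =>
    exact ⟨fun r _ => by simp, fun _ => 0, fun r _ => by simpa using hasDerivAt_const r c,
      (ih 0).mono (by simp)⟩

lemma add (hs : SymbolBound C n s) (ht : SymbolBound C' n t) :
    SymbolBound (C + C') n (fun r => s r + t r) := by
  induction n generalizing s t with
  | zero =>
    exact ⟨hs.1.add ht.1, fun r hr => (abs_add_le _ _).trans (add_le_add (hs.2 r hr) (ht.2 r hr))⟩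
  | succ n ih =>
    obtain ⟨h0, s', hs', h1⟩ := hs
    obtain ⟨k0, t', ht', k1⟩ := ht
    exact ⟨fun r hr => (abs_add_le _ _).trans (add_le_add (h0 r hr) (k0 r hr)), _,
      fun r hr => by rw [smul_add]; exact (hs' r hr).add (ht' r hr), ih h1 k1⟩

/-- The factor `2 ^ n` counts the terms of the Leibniz rule: each Euler derivative splits the
product in two. -/
lemma mul (hs : SymbolBound C n s) (ht : SymbolBound C' n t) :
    SymbolBound (2 ^ n * (C * C')) n (fun r => s r * t r) := by
  have key : ∀ s t : ℝ → ℝ, (∀ r, 0 < r → |s r| ≤ C) → (∀ r, 0 < r → |t r| ≤ C') → ∀ n : ℕ,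
      ∀ r, 0 < r → |s r * t r| ≤ (2 ^ n * (C * C') : NNReal) := by
    intro s t hs ht n r hr
    rw [abs_mul]; push_cast
    calc |s r| * |t r| ≤ C * C' := mul_le_mul (hs r hr) (ht r hr) (abs_nonneg _) C.2
      _ ≤ 2 ^ n * (C * C') := le_mul_of_one_le_left (by positivity) (one_le_pow₀ (by norm_num))
  induction n generalizing s t with
  | zero => exact ⟨hs.1.mul ht.1, key s t hs.2 ht.2 0⟩
  | succ n ih =>
    have hs0 := hs.pred
    have ht0 := ht.pred
    obtain ⟨h0, s', hs', h1⟩ := hs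
    obtain ⟨k0, t', ht', k1⟩ := ht
    refine ⟨key s t h0 k0 _, fun r => s' r * t r + s r * t' r, fun r hr => ?_, ?_⟩
    · refine ((hs' r hr).mul (ht' r hr)).congr_deriv ?_
      simp only [smul_eq_mul]; ring
    · refine ((ih h1 ht0).add (ih hs0 k1)).mono (le_of_eq ?_)
      ring

end SymbolBound

/-- Leibniz rule again. No derivative ever falls on `W`, so the weight is arbitrary. -/
lemma SymbolBound.smul {W : ℝ → ℝ≥0∞} (hW : Measurable W) {B : ℝ≥0∞} {C : NNReal} {n : ℕ}
    {s : ℝ → ℝ} {f : ℝ → ℂ} (hs : SymbolBound C n s) (hf : EulerBound W B n f) :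
    EulerBound W ((2 ^ n * C : NNReal) * B) n (fun r => s r • f r) := by
  have key : ∀ (s : ℝ → ℝ) (f : ℝ → ℂ), ContinuousOn s (Ioi 0) → (∀ r, 0 < r → |s r| ≤ C) →
      EulerBound W B 0 f → ∀ n : ℕ,
      EulerBound W ((2 ^ n * C : NNReal) * B) 0 (fun r => s r • f r) := by
    intro s f hc hs hf n
    refine ⟨(aemeasurable_of_continuousOn hc).smul hf.1, (wnorm_smul_le C hs).trans ?_⟩
    gcongr
    · exact le_mul_of_one_le_left (by positivity) (one_le_pow₀ (by norm_num))
    · exact hf.2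
  induction n generalizing s f with
  | zero => exact key s f hs.1 hs.2 hf 0
  | succ n ih =>
    have hs0 := hs.pred
    have hf0 := hf.pred
    have hsc := hs.continuousOn
    obtain ⟨h0, s', hs', h1⟩ := hs
    obtain ⟨k0, f', hf', k1⟩ := hf
    refine ⟨key s f hsc h0 k0 _, _,
      (hasEulerDeriv_of_hasDerivAt hs' h1.continuousOn).smul hf', ?_⟩
    refine ((ih h1 hf0).add hW (ih hs0 k1)).mono (le_of_eq ?_)
    push_cast
    ring

lemma EulerBound.const_smul {W : ℝ → ℝ≥0∞} {B : ℝ≥0∞} {n : ℕ}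
    {f : ℝ → ℂ} (c : ℝ) (hf : EulerBound W B n f) :
    EulerBound W (‖c‖₊ * B) n (fun r => c • f r) := by
  induction n generalizing f with
  | zero => exact ⟨hf.1.const_smul c, (wnorm_smul_le ‖c‖₊ (by simp)).trans (by gcongr; exact hf.2)⟩
  | succ n ih =>
    obtain ⟨k0, f', hf', k1⟩ := hf
    exact ⟨⟨k0.1.const_smul c, (wnorm_smul_le ‖c‖₊ (by simp)).trans (by gcongr; exact k0.2)⟩, _,
      hf'.const_smul c, ih k1⟩

/-- If the Euler derivatives of a family of functions are controlled by the family itself, then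
bounds for the family propagate to its higher Euler derivatives. -/
lemma EulerBound.bootstrap {ι : Type*} {W : ℝ → ℝ≥0∞} {B : ℝ≥0∞} {c : NNReal} {N : ℕ}
    {f g : ι → ℝ → ℂ} (hfg : ∀ i, HasEulerDeriv (f i) (g i)) (base : ∀ i, EulerBound W B 0 (f i))
    (step : ∀ n, n < N → ∀ B', B ≤ B' → (∀ j, EulerBound W B' n (f j)) →
      ∀ i, EulerBound W (c * B') n (g i)) (i : ι) :
    EulerBound W (((1 + c) ^ N : NNReal) * B) N (f i) := by
  have one_le : ∀ n : ℕ, B ≤ ((1 + c) ^ n : NNReal) * B := fun n => by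
    calc B = ((1 : NNReal) : ℝ≥0∞) * B := by simp
      _ ≤ _ := by gcongr; exact one_le_pow₀ (by simp)
  -- Each order costs one factor `1 + c`. Letting `step` act on every bound `B'` above `B` allows it
  -- to absorb data that are bounded only by `B`.
  suffices h : ∀ n, n ≤ N → ∀ i, EulerBound W (((1 + c) ^ n : NNReal) * B) n (f i) from
    h N le_rfl i
  intro n
  induction n with
  | zero => intro _ i; exact (base i).mono (one_le 0)
  | succ n ih =>
    intro hn i
    refine ⟨(base i).mono (one_le _), g i, hfg i, ?_⟩
    refine (step n hn _ (one_le n) (ih (by omega)) i).mono ?_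
    rw [← mul_assoc]
    gcongr
    rw [← ENNReal.coe_mul]
    gcongr
    rw [pow_succ']
    gcongr
    simp

/-! ### The coefficient functions -/

/-- Since r∂_r u = (m+1)(1 - u²), polynomials in u are stable under r∂_r, and they are bounded
because |u| ≤ 1. -/
lemma tanhProfile_polynomial_symbolBound (m n : ℕ) (P : Polynomial ℝ) :
    ∃ C, SymbolBound C n (fun r => P.eval (tanhProfile m r)) := by
  have hb : ∀ P : Polynomial ℝ, ∃ C : NNReal, ∀ r, |P.eval (tanhProfile m r)| ≤ C := by
    intro P
    obtain ⟨C, hC⟩ := (isCompact_Icc (a := (-1 : ℝ)) (b := 1)).exists_bound_of_continuousOn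
      P.continuous.continuousOn
    exact ⟨C.toNNReal, fun r => (hC _ (abs_le.1 (abs_tanhProfile_le m r))).trans
      (Real.le_coe_toNNReal C)⟩
  induction n generalizing P with
  | zero =>
    obtain ⟨C, hC⟩ := hb P
    exact ⟨C, (P.continuous.comp (continuous_tanhProfile m)).continuousOn, fun r _ => hC r⟩
  | succ n ih =>
    obtain ⟨C, hC⟩ := hb P
    obtain ⟨C', hC'⟩ := ih (P.derivative * (Polynomial.C ((m : ℝ) + 1) * (1 - Polynomial.X ^ 2)))
    refine ⟨max C C', fun r _ => (hC r).trans (by simp), _, fun r hr => ?_,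
      hC'.mono (le_max_right _ _)⟩
    refine ((P.hasDerivAt _).comp r (hasDerivAt_tanhProfile m hr)).congr_deriv ?_
    simp
    ring

/-! ### Energy estimates for locally absolutely continuous functions -/

lemma ofReal_integral_le_lintegral {α : Type*} [MeasurableSpace α] {μ : Measure α} {f : α → ℝ}
    (hf : Integrable f μ) : ENNReal.ofReal (∫ x, f x ∂μ) ≤ ∫⁻ x, ENNReal.ofReal (f x) ∂μ := by
  rw [integral_eq_lintegral_pos_part_sub_lintegral_neg_part hf]
  refine (ENNReal.ofReal_le_ofReal (sub_le_self _ ENNReal.toReal_nonneg)).trans ?_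
  exact ENNReal.ofReal_toReal_le

/-- The basic energy inequality: a nonnegative density `P` dominated by `R` plus a total
derivative `Φ'`. -/
lemma lintegral_le_of_le_add_deriv {Φ P R : ℝ → ℝ} {a b : ℝ} (hab : a ≤ b)
    (hΦ : AbsolutelyContinuousOnInterval Φ a b) (hP : ContinuousOn P (Icc a b))
    (hP0 : ∀ r ∈ Ioc a b, 0 ≤ P r)
    (h : ∀ᵐ r, r ∈ Ioc a b → P r ≤ R r + deriv Φ r) :
    ∫⁻ r in Ioc a b, ENNReal.ofReal (P r) ≤
      (∫⁻ r in Ioc a b, ENNReal.ofReal (R r)) + ENNReal.ofReal (Φ b - Φ a) := by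
  have hPi : IntervalIntegrable P volume a b :=
    ContinuousOn.intervalIntegrable (by rwa [uIcc_of_le hab])
  have hΦi := hΦ.intervalIntegrable_deriv
  have e1 : ∫⁻ r in Ioc a b, ENNReal.ofReal (P r) = ENNReal.ofReal (∫ r in a..b, P r) := by
    rw [intervalIntegral.integral_of_le hab, ofReal_integral_eq_lintegral_ofReal
      ((intervalIntegrable_iff_integrableOn_Ioc_of_le hab).1 hPi)]
    exact (ae_restrict_iff' measurableSet_Ioc).2 (Eventually.of_forall hP0)
  -- Only P - Φ' is integrated; `R` enters under `lintegral` and may have infinite integral.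
  have e2 : ∫ r in a..b, P r = (∫ r in a..b, (P r - deriv Φ r)) + (Φ b - Φ a) := by
    rw [intervalIntegral.integral_sub hPi hΦi, hΦ.integral_deriv_eq_sub]
    ring
  rw [e1, e2]
  refine ENNReal.ofReal_add_le.trans ?_
  gcongr
  rw [intervalIntegral.integral_of_le hab]
  refine (ofReal_integral_le_lintegral
    ((intervalIntegrable_iff_integrableOn_Ioc_of_le hab).1 (hPi.sub hΦi))).trans ?_
  refine lintegral_mono_ae ((ae_restrict_iff' measurableSet_Ioc).2 ?_)
  filter_upwards [h] with r hr hr2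
  exact ENNReal.ofReal_le_ofReal (by linarith [hr hr2])

lemma LocAC.absolutelyContinuousOnInterval {E : Type*} [NormedAddCommGroup E] [NormedSpace ℝ E]
    {f : ℝ → E} (hf : LocAC f) {a b : ℝ} (ha : 0 < a) (hab : a ≤ b) :
    AbsolutelyContinuousOnInterval f a b :=
  (hf a (b + 1) ha (by linarith)).mono (by
    rw [uIcc_of_le hab, uIcc_of_le (by linarith)]
    exact Icc_subset_Icc_right (by linarith))

/-- Energy inequality on the half line, with boundary terms vanishing along sequences. -/
lemma lintegral_halfLine_le_of_le_add_deriv {Φ φ P R : ℝ → ℝ} (hΦ : HasEulerDeriv Φ φ)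
    (hP : ContinuousOn P (Ioi 0)) (hP0 : ∀ r, 0 < r → 0 ≤ P r)
    (h : ∀ᵐ r ∂halfLine, P r ≤ R r + r⁻¹ * φ r)
    (hbd : ∀ ε, 0 < ε → ∀ δ, 0 < δ → ∃ a b, 0 < a ∧ a < δ ∧ δ⁻¹ < b ∧ Φ b - Φ a ≤ ε) :
    ∫⁻ r, ENNReal.ofReal (P r) ∂halfLine ≤ ∫⁻ r, ENNReal.ofReal (R r) ∂halfLine := by
  have hU : Ioi (0 : ℝ) = ⋃ n : ℕ, Ioc ((n + 1 : ℝ)⁻¹) (n + 1) := by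
    ext x
    simp only [mem_Ioi, mem_iUnion, mem_Ioc]
    constructor
    · intro hx
      obtain ⟨n, hn⟩ := exists_nat_gt (max x x⁻¹)
      refine ⟨n, inv_lt_of_inv_lt₀ hx ?_, ?_⟩
      · linarith [le_max_right x x⁻¹]
      · linarith [le_max_left x x⁻¹]
    · rintro ⟨n, h1, -⟩
      exact lt_trans (by positivity) h1
  have hmono : Monotone fun n : ℕ => Ioc ((n + 1 : ℝ)⁻¹) (n + 1) := fun n k hnk =>
    Ioc_subset_Ioc (by gcongr) (by gcongr)
  change ∫⁻ r in Ioi (0 : ℝ), ENNReal.ofReal (P r) ≤ _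
  rw [hU, setLIntegral_iUnion_of_directed _ hmono.directed_le]
  -- The left side increases with the interval, so each fixed interval may be enlarged to one whose
  -- boundary contribution is at most ε.
  refine iSup_le fun n => ENNReal.le_of_forall_pos_le_add fun ε hε _ => ?_
  obtain ⟨a, b, ha, haδ, hb, hab⟩ := hbd ε (by exact_mod_cast hε) ((n + 1 : ℝ)⁻¹) (by positivity)
  rw [inv_inv] at hb
  have hn1 : (n + 1 : ℝ)⁻¹ ≤ 1 := inv_le_one_of_one_le₀ (by linarith [n.cast_nonneg (α := ℝ)])
  have hab' : a ≤ b := by linarith [n.cast_nonneg (α := ℝ)]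
  have hsub : Ioc a b ⊆ Ioi 0 := fun x hx => ha.trans hx.1
  calc ∫⁻ r in Ioc ((n + 1 : ℝ)⁻¹) (n + 1), ENNReal.ofReal (P r)
      ≤ ∫⁻ r in Ioc a b, ENNReal.ofReal (P r) :=
        lintegral_mono_set (Ioc_subset_Ioc haδ.le hb.le)
    _ ≤ (∫⁻ r in Ioc a b, ENNReal.ofReal (R r)) + ENNReal.ofReal (Φ b - Φ a) := by
        refine lintegral_le_of_le_add_deriv hab' (hΦ.1.absolutelyContinuousOnInterval ha hab')
          (hP.mono fun x hx => ha.trans_le hx.1) (fun r hr => hP0 r (hsub hr)) ?_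
        filter_upwards [ae_halfLine_iff.1 h, ae_halfLine_iff.1 hΦ.2] with r h1 h2 hr
        rw [(h2 (hsub hr)).deriv]
        exact h1 (hsub hr)
    _ ≤ (∫⁻ r, ENNReal.ofReal (R r) ∂halfLine) + ε :=
        add_le_add (lintegral_mono_set hsub) ((ENNReal.ofReal_le_ofReal hab).trans (by simp))

/-- A nonnegative function which is integrable for `dr/r` gets small near `0` and near `∞`. -/
lemma exists_small_of_lintegral_ne_top {g : ℝ → ℝ}
    (hg : ∫⁻ r, ENNReal.ofReal (r⁻¹ * g r) ∂halfLine ≠ ∞) {ε δ : ℝ} (hε : 0 < ε) (hδ : 0 < δ) :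
    ∃ a b, 0 < a ∧ a < δ ∧ δ⁻¹ < b ∧ g a ≤ ε ∧ g b ≤ ε := by
  -- The measure dr/r has infinite mass near 0 and near ∞, so `g > ε` on all of such a set would
  -- make the integral infinite.
  have key : ∀ s : Set ℝ, MeasurableSet s → s ⊆ Ioi 0 →
      ∫⁻ r in s, ENNReal.ofReal r⁻¹ = ∞ → ∃ a ∈ s, g a ≤ ε := by
    intro s hs hs0 hinf
    by_contra! hcon
    refine hg (top_le_iff.1 ?_)
    calc (∞ : ℝ≥0∞) = ENNReal.ofReal ε * ∫⁻ r in s, ENNReal.ofReal r⁻¹ := by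
          rw [hinf, ENNReal.mul_top (by simpa using hε)]
      _ = ∫⁻ r in s, ENNReal.ofReal ε * ENNReal.ofReal r⁻¹ :=
          (lintegral_const_mul' _ _ ENNReal.ofReal_ne_top).symm
      _ ≤ ∫⁻ r in s, ENNReal.ofReal (r⁻¹ * g r) := by
          refine setLIntegral_mono' hs fun r hr => ?_
          have hr0 : (0 : ℝ) < r := hs0 hr
          rw [← ENNReal.ofReal_mul hε.le, mul_comm]
          refine ENNReal.ofReal_le_ofReal ?_
          gcongr
          exact (hcon r hr).le
      _ ≤ _ := lintegral_mono_set hs0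
  have top_of : ∀ s : Set ℝ, MeasurableSet s → s ⊆ Ioi 0 →
      ¬ IntegrableOn (fun r : ℝ => r⁻¹) s → ∫⁻ r in s, ENNReal.ofReal r⁻¹ = ∞ := by
    intro s hs hs0 hni
    by_contra hne
    refine hni ⟨measurable_inv.aestronglyMeasurable, ?_⟩
    rw [hasFiniteIntegral_iff_ofReal]
    · exact lt_top_iff_ne_top.2 hne
    · exact (ae_restrict_iff' hs).2 (Eventually.of_forall fun r hr =>
        inv_nonneg.2 (le_of_lt (hs0 hr)))
  obtain ⟨a, ha, hga⟩ := key (Ioo 0 δ) measurableSet_Ioo (fun x hx => hx.1)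
    (top_of _ measurableSet_Ioo (fun x hx => hx.1) (by
      intro h
      have := (intervalIntegrable_iff_integrableOn_Ioo_of_le hδ.le).2 h
      rw [intervalIntegrable_inv_iff] at this
      rcases this with h1 | h1
      · exact hδ.ne h1
      · exact h1 left_mem_uIcc))
  obtain ⟨b, hb, hgb⟩ := key (Ioi δ⁻¹) measurableSet_Ioi (fun x hx => (inv_pos.2 hδ).trans hx)
    (top_of _ measurableSet_Ioi (fun x hx => (inv_pos.2 hδ).trans hx)
      (not_integrableOn_Ioi_inv))
  exact ⟨a, b, ha.1, ha.2, hb, hga, hgb⟩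

/-- Weighted Hardy inequality on a compact interval, for an increasing primitive `φ` of the
weight `φ'` such that the boundary terms have the good sign. -/
lemma hardy_interval {φ φ' z : ℝ → ℝ} {a b : ℝ} (hab : a ≤ b)
    (hz : AbsolutelyContinuousOnInterval z a b) (hφ : ∀ r ∈ Icc a b, HasDerivAt φ (φ' r) r)
    (hφc : ContinuousOn φ' (Icc a b)) (hφAC : AbsolutelyContinuousOnInterval φ a b)
    (hpos : ∀ r ∈ Icc a b, 0 < φ' r) (hbd : φ b * z b ^ 2 ≤ φ a * z a ^ 2) :
    ∫⁻ r in Ioc a b, ENNReal.ofReal (φ' r * z r ^ 2) ≤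
      ∫⁻ r in Ioc a b, ENNReal.ofReal (4 * (φ r ^ 2 / φ' r) * deriv z r ^ 2) := by
  have hΦ : AbsolutelyContinuousOnInterval (fun r => 2 * (φ r * (z r * z r))) a b :=
    (hφAC.fun_smul (hz.fun_smul hz)).const_mul 2
  have h := lintegral_le_of_le_add_deriv (Φ := fun r => 2 * (φ r * (z r * z r)))
    (P := fun r => φ' r * z r ^ 2) (R := fun r => 4 * (φ r ^ 2 / φ' r) * deriv z r ^ 2) hab hΦ
    (hφc.mul ((hz.continuousOn.mono (by rw [uIcc_of_le hab])).pow 2))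
    (fun r hr => mul_nonneg (hpos r (Ioc_subset_Icc_self hr)).le (sq_nonneg _)) ?_
  · refine h.trans ?_
    rw [ENNReal.ofReal_of_nonpos (by nlinarith), add_zero]
  · filter_upwards [hz.ae_differentiableAt] with r hr hr2
    have hri : r ∈ Icc a b := Ioc_subset_Icc_self hr2
    have hd := (hr (by rwa [uIcc_of_le hab])).hasDerivAt
    have hd2 := (((hφ r hri).fun_mul (hd.fun_mul hd)).const_mul 2)
    rw [hd2.deriv]
    have hp := hpos r hri
    -- With Φ = 2φz² the asserted density inequality is exactly the nonnegativity of this completed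
    -- square.
    have : 0 ≤ (φ' r * z r + 2 * φ r * deriv z r) ^ 2 / φ' r := by positivity
    have e : (φ' r * z r + 2 * φ r * deriv z r) ^ 2 / φ' r
        = φ' r * z r ^ 2 + 4 * φ r * z r * deriv z r + 4 * (φ r ^ 2 / φ' r) * deriv z r ^ 2 := by
      field_simp
      ring
    rw [e] at this
    nlinarith

lemma absolutelyContinuousOnInterval_of_hasDerivAt {f f' : ℝ → ℝ} {a b : ℝ} (hab : a ≤ b)
    (h : ∀ r ∈ Icc a b, HasDerivAt f (f' r) r) (hc : ContinuousOn f' (Icc a b)) :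
    AbsolutelyContinuousOnInterval f a b := by
  obtain ⟨C, hC⟩ := isCompact_Icc.exists_bound_of_continuousOn hc
  have : LipschitzOnWith C.toNNReal f (uIcc a b) := by
    rw [uIcc_of_le hab]
    refine (convex_Icc a b).lipschitzOnWith_of_nnnorm_hasDerivWithin_le
      (fun r hr => (h r hr).hasDerivWithinAt) fun r hr => ?_
    rw [← NNReal.coe_le_coe, coe_nnnorm]
    exact (hC r hr).trans (Real.le_coe_toNNReal C)
  exact this.absolutelyContinuousOnInterval

/-- `hardy_interval` for the measure dr/r: here ψ = r∂_r φ, and the actual weights only need to be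
comparable with ψ on the left and with 4φ²/ψ on the right. -/
lemma hardy_compact {φ ψ z z' p q : ℝ → ℝ} {c₁ c₂ a b : ℝ} (hz : HasEulerDeriv z z')
    (ha : 0 < a) (hab : a ≤ b) (hφ : ∀ r ∈ Icc a b, HasDerivAt φ (ψ r / r) r)
    (hψc : ContinuousOn ψ (Icc a b)) (hψ : ∀ r ∈ Icc a b, 0 < ψ r)
    (hbd : φ b * z b ^ 2 ≤ φ a * z a ^ 2) (hc : 0 ≤ c₁) (hc' : 0 ≤ c₂)
    (hp : ∀ r ∈ Icc a b, p r ≤ c₁ * ψ r) (hq : ∀ r ∈ Icc a b, 4 * (φ r ^ 2 / ψ r) ≤ c₂ * q r) :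
    ∫⁻ r in Ioc a b, ENNReal.ofReal (p r * z r ^ 2 / r) ≤
      ENNReal.ofReal c₁ * (ENNReal.ofReal c₂ *
        ∫⁻ r in Ioc a b, ENNReal.ofReal (q r * z' r ^ 2 / r)) := by
  have hpos : ∀ r ∈ Icc a b, 0 < r := fun r hr => ha.trans_le hr.1
  have hφc : ContinuousOn (fun r => ψ r / r) (Icc a b) :=
    hψc.div continuousOn_id fun r hr => (hpos r hr).ne'
  have h := hardy_interval hab (hz.1.absolutelyContinuousOnInterval ha hab) hφ hφc
    (absolutelyContinuousOnInterval_of_hasDerivAt hab hφ hφc)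
    (fun r hr => div_pos (hψ r hr) (hpos r hr)) hbd
  calc ∫⁻ r in Ioc a b, ENNReal.ofReal (p r * z r ^ 2 / r)
      ≤ ∫⁻ r in Ioc a b, ENNReal.ofReal c₁ * ENNReal.ofReal (ψ r / r * z r ^ 2) := by
        refine setLIntegral_mono' measurableSet_Ioc fun r hr => ?_
        have hr' := Ioc_subset_Icc_self hr
        have hr0 := hpos r hr'
        rw [← ENNReal.ofReal_mul hc]
        refine ENNReal.ofReal_le_ofReal ?_
        calc p r * z r ^ 2 / r ≤ c₁ * ψ r * z r ^ 2 / r := by gcongr; exact hp r hr'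
          _ = _ := by ring
    _ = ENNReal.ofReal c₁ * ∫⁻ r in Ioc a b, ENNReal.ofReal (ψ r / r * z r ^ 2) :=
        lintegral_const_mul' _ _ ENNReal.ofReal_ne_top
    _ ≤ ENNReal.ofReal c₁ *
        ∫⁻ r in Ioc a b, ENNReal.ofReal c₂ * ENNReal.ofReal (q r * z' r ^ 2 / r) := by
        refine mul_le_mul' le_rfl ?_
        refine h.trans (lintegral_mono_ae ((ae_restrict_iff' measurableSet_Ioc).2 ?_))
        filter_upwards [ae_halfLine_iff.1 hz.2] with r h1 hr
        have hr' := Ioc_subset_Icc_self hr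
        have hr0 := hpos r hr'
        have hψr := hψ r hr'
        rw [(h1 hr0).deriv]
        have hc₂ : 4 * (φ r ^ 2 / (ψ r / r)) * (r⁻¹ • z' r) ^ 2 ≤ c₂ * (q r * z' r ^ 2 / r) := by
          calc 4 * (φ r ^ 2 / (ψ r / r)) * (r⁻¹ • z' r) ^ 2
              = 4 * (φ r ^ 2 / ψ r) * (z' r ^ 2 / r) := by
                rw [smul_eq_mul]; field_simp
            _ ≤ c₂ * q r * (z' r ^ 2 / r) :=
              mul_le_mul_of_nonneg_right (hq r hr') (by positivity)
            _ = _ := by ring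
        rw [← ENNReal.ofReal_mul hc']
        exact ENNReal.ofReal_le_ofReal hc₂
    _ = _ := by rw [lintegral_const_mul' _ _ ENNReal.ofReal_ne_top]

lemma Ioc_zero_one_eq_iUnion : Ioc (0 : ℝ) 1 = ⋃ n : ℕ, Ioc ((n + 1 : ℝ)⁻¹) 1 := by
  ext x
  simp only [mem_iUnion, mem_Ioc, exists_and_right, and_congr_left_iff]
  intro _
  constructor
  · intro hx
    obtain ⟨n, hn⟩ := exists_nat_gt x⁻¹
    exact ⟨n, inv_lt_of_inv_lt₀ hx (by linarith)⟩
  · rintro ⟨n, h1⟩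
    exact lt_trans (by positivity) h1

lemma Ioi_one_eq_iUnion : Ioi (1 : ℝ) = ⋃ n : ℕ, Ioc 1 (n + 1 : ℝ) := by
  ext x
  simp only [mem_iUnion, mem_Ioc, mem_Ioi, exists_and_left, iff_self_and]
  intro _
  obtain ⟨n, hn⟩ := exists_nat_gt x
  exact ⟨n, by linarith⟩

/-- Weighted Hardy inequality on `(0,1]` for functions vanishing at `1`. -/
lemma hardy_left {φ ψ z z' p q : ℝ → ℝ} {c₁ c₂ : ℝ} (hz : HasEulerDeriv z z') (hz1 : z 1 = 0)
    (hφ : ∀ r ∈ Ioc (0 : ℝ) 1, HasDerivAt φ (ψ r / r) r) (hψc : ContinuousOn ψ (Ioc 0 1))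
    (hψ : ∀ r ∈ Ioc (0 : ℝ) 1, 0 < ψ r) (hφ0 : ∀ r ∈ Ioc (0 : ℝ) 1, 0 ≤ φ r) (hc : 0 ≤ c₁)
    (hc' : 0 ≤ c₂) (hp : ∀ r ∈ Ioc (0 : ℝ) 1, p r ≤ c₁ * ψ r)
    (hq : ∀ r ∈ Ioc (0 : ℝ) 1, 4 * (φ r ^ 2 / ψ r) ≤ c₂ * q r) :
    ∫⁻ r in Ioc 0 1, ENNReal.ofReal (p r * z r ^ 2 / r) ≤
      ENNReal.ofReal c₁ * (ENNReal.ofReal c₂ *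
        ∫⁻ r in Ioc 0 1, ENNReal.ofReal (q r * z' r ^ 2 / r)) := by
  have hmono : Monotone fun n : ℕ => Ioc ((n + 1 : ℝ)⁻¹) 1 := fun n k hnk =>
    Ioc_subset_Ioc (by gcongr) le_rfl
  rw [Ioc_zero_one_eq_iUnion, setLIntegral_iUnion_of_directed _ hmono.directed_le,
    ← Ioc_zero_one_eq_iUnion]
  refine iSup_le fun n => ?_
  have hn0 : 0 < (n + 1 : ℝ)⁻¹ := by positivity
  have hn1 : (n + 1 : ℝ)⁻¹ ≤ 1 := inv_le_one_of_one_le₀ (by linarith [n.cast_nonneg (α := ℝ)])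
  have hsub : Icc (n + 1 : ℝ)⁻¹ 1 ⊆ Ioc 0 1 := fun x hx => ⟨hn0.trans_le hx.1, hx.2⟩
  refine (hardy_compact hz hn0 hn1 (fun r hr => hφ r (hsub hr)) (hψc.mono hsub)
    (fun r hr => hψ r (hsub hr)) ?_ hc hc' (fun r hr => hp r (hsub hr))
    (fun r hr => hq r (hsub hr))).trans ?_
  · rw [hz1]
    have := hφ0 _ (hsub ⟨le_rfl, hn1⟩)
    simp only [ne_eq, OfNat.ofNat_ne_zero, not_false_eq_true, zero_pow, mul_zero]
    positivity
  · gcongr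

/-- Weighted Hardy inequality on `(1,∞)` for functions vanishing at `1`. -/
lemma hardy_right {φ ψ z z' p q : ℝ → ℝ} {c₁ c₂ : ℝ} (hz : HasEulerDeriv z z') (hz1 : z 1 = 0)
    (hφ : ∀ r ∈ Ici (1 : ℝ), HasDerivAt φ (ψ r / r) r) (hψc : ContinuousOn ψ (Ici 1))
    (hψ : ∀ r ∈ Ici (1 : ℝ), 0 < ψ r) (hφ0 : ∀ r ∈ Ici (1 : ℝ), φ r ≤ 0) (hc : 0 ≤ c₁)
    (hc' : 0 ≤ c₂) (hp : ∀ r ∈ Ici (1 : ℝ), p r ≤ c₁ * ψ r)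
    (hq : ∀ r ∈ Ici (1 : ℝ), 4 * (φ r ^ 2 / ψ r) ≤ c₂ * q r) :
    ∫⁻ r in Ioi 1, ENNReal.ofReal (p r * z r ^ 2 / r) ≤
      ENNReal.ofReal c₁ * (ENNReal.ofReal c₂ *
        ∫⁻ r in Ioi 1, ENNReal.ofReal (q r * z' r ^ 2 / r)) := by
  have hmono : Monotone fun n : ℕ => Ioc 1 (n + 1 : ℝ) := fun n k hnk =>
    Ioc_subset_Ioc le_rfl (by gcongr)
  rw [Ioi_one_eq_iUnion, setLIntegral_iUnion_of_directed _ hmono.directed_le, ← Ioi_one_eq_iUnion]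
  refine iSup_le fun n => ?_
  have hn1 : 1 ≤ (n + 1 : ℝ) := by linarith [n.cast_nonneg (α := ℝ)]
  have hsub : Icc 1 (n + 1 : ℝ) ⊆ Ici 1 := fun x hx => hx.1
  refine (hardy_compact hz one_pos hn1 (fun r hr => hφ r (hsub hr)) (hψc.mono hsub)
    (fun r hr => hψ r (hsub hr)) ?_ hc hc' (fun r hr => hp r (hsub hr))
    (fun r hr => hq r (hsub hr))).trans ?_
  · rw [hz1]
    have := hφ0 _ (hsub ⟨hn1, le_rfl⟩)
    nlinarith [sq_nonneg (z (n + 1))]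
  · gcongr
    exact fun x hx => hx.1

/-! ### Weights -/

/-- The weight `r^{-k}`. -/
def powWeight (k : ℕ) (r : ℝ) : ℝ≥0∞ := ENNReal.ofReal (r ^ k)⁻¹

/-- The loss of the zeroth order weight of the adapted norm compared with `r^{-k}`. -/
def weightLoss (k m : ℕ) (r : ℝ) : ℝ :=
  if k ≤ m then 1 else if m = k - 1 then (japanese (logMinus r))⁻¹
  else r * (japanese r)⁻¹ * (japanese (logMinus r))⁻¹

/-- The weight of the zeroth order part of the adapted norm. -/
def adaptedWeight (k m : ℕ) (r : ℝ) : ℝ≥0∞ := ENNReal.ofReal (weightLoss k m r * (r ^ k)⁻¹)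

lemma one_le_japanese (x : ℝ) : 1 ≤ japanese x :=
  Real.one_le_sqrt.2 (by nlinarith [sq_nonneg x])

lemma japanese_pos (x : ℝ) : 0 < japanese x := one_pos.trans_le (one_le_japanese x)

lemma le_japanese (x : ℝ) : x ≤ japanese x :=
  Real.le_sqrt_of_sq_le (by linarith)

lemma japanese_sq (x : ℝ) : japanese x ^ 2 = 1 + x ^ 2 := Real.sq_sqrt (by positivity)

lemma japanese_le {x : ℝ} (hx : 0 ≤ x) : japanese x ≤ 1 + x :=
  Real.sqrt_le_iff.2 ⟨by linarith, by nlinarith⟩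

lemma measurable_japanese : Measurable japanese := by unfold japanese; fun_prop

lemma measurable_logMinus : Measurable logMinus := by unfold logMinus; fun_prop

lemma measurable_powWeight (k : ℕ) : Measurable (powWeight k) := by unfold powWeight; fun_prop

lemma measurable_weightLoss (k m : ℕ) : Measurable (weightLoss k m) := by
  have h1 := measurable_japanese
  have h2 := measurable_japanese.comp measurable_logMinus
  unfold weightLoss
  split_ifs
  · fun_prop
  · exact h2.inv
  · exact (measurable_id.mul h1.inv).mul h2.inv

lemma measurable_adaptedWeight (k m : ℕ) : Measurable (adaptedWeight k m) :=
  ENNReal.measurable_ofReal.comp ((measurable_weightLoss k m).mul (by fun_prop))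

lemma weightLoss_nonneg (k m : ℕ) {r : ℝ} (hr : 0 < r) : 0 ≤ weightLoss k m r := by
  have h1 := japanese_pos r
  have h2 := japanese_pos (logMinus r)
  unfold weightLoss
  split_ifs <;> positivity

lemma weightLoss_le_one (k m : ℕ) (r : ℝ) : weightLoss k m r ≤ 1 := by
  have h2 : (japanese (logMinus r))⁻¹ ≤ 1 := inv_le_one_of_one_le₀ (one_le_japanese _)
  have h3 : 0 < (japanese (logMinus r))⁻¹ := inv_pos.2 (japanese_pos _)
  have h4 : r * (japanese r)⁻¹ ≤ 1 := by
    rw [mul_inv_le_iff₀ (japanese_pos r), one_mul]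
    exact le_japanese r
  unfold weightLoss
  split_ifs
  · exact le_rfl
  · exact h2
  · exact mul_le_one₀ h4 h3.le h2

lemma adaptedWeight_le (k m : ℕ) {r : ℝ} (hr : 0 < r) : adaptedWeight k m r ≤ powWeight k r :=
  ENNReal.ofReal_le_ofReal (mul_le_of_le_one_left (by positivity) (weightLoss_le_one k m r))

lemma le_inv_japanese_logMinus {r : ℝ} (hr : 0 < r) (hr1 : r ≤ 1) :
    r ≤ (japanese (logMinus r))⁻¹ := by
  have h0 : 0 ≤ logMinus r := le_max_right _ _
  have h1 : logMinus r ≤ r⁻¹ - 1 := by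
    refine max_le ?_ (by linarith [(one_le_inv₀ hr).2 hr1])
    linarith [Real.one_sub_inv_le_log_of_pos hr]
  have h2 := japanese_le h0
  rw [le_inv_comm₀ hr (japanese_pos _)]
  linarith

lemma inv_japanese_logMinus_of_one_le {r : ℝ} (hr : 1 ≤ r) : (japanese (logMinus r))⁻¹ = 1 := by
  have : logMinus r = 0 := max_eq_right (by linarith [Real.log_nonneg hr])
  simp [this, japanese]

/-- The loss is never worse than r²/(1 + r²). Near 0 the worst case has a factor r and an inverse
logarithm, each at least of size r; for r ≥ 1 nothing is lost up to a constant. -/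
lemma le_weightLoss (k m : ℕ) {r : ℝ} (hr : 0 < r) : r ^ 2 ≤ 2 * weightLoss k m r * (1 + r ^ 2) := by
  have hj := japanese_pos r
  have hj1 := japanese_le hr.le
  rcases le_total r 1 with h1 | h1
  · have h2 := le_inv_japanese_logMinus hr h1
    have h3 : r / 2 ≤ r * (japanese r)⁻¹ := by
      rw [← div_eq_mul_inv]; gcongr; linarith
    have h4 : r ^ 2 ≤ 2 * weightLoss k m r := by
      unfold weightLoss
      split_ifs
      · nlinarith
      · nlinarith
      · have : r / 2 * r ≤ r * (japanese r)⁻¹ * (japanese (logMinus r))⁻¹ :=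
          mul_le_mul h3 h2 hr.le (by positivity)
        linarith
    nlinarith [weightLoss_nonneg k m hr, sq_nonneg r]
  · have h2 := inv_japanese_logMinus_of_one_le h1
    have h3 : 1 / 2 ≤ r * (japanese r)⁻¹ := by
      rw [← div_eq_mul_inv, le_div_iff₀ hj]; linarith
    have h4 : 1 ≤ 2 * weightLoss k m r := by
      unfold weightLoss
      split_ifs
      · norm_num
      · rw [h2]; norm_num
      · rw [h2]; linarith
    nlinarith [sq_nonneg r]

/-! ### Elementary bounds for `Q` -/

lemma pow_le_pow_add_pow {a b c : ℕ} (hab : a ≤ b) (hbc : b ≤ c) {r : ℝ} (hr : 0 ≤ r) :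
    r ^ b ≤ r ^ a + r ^ c := by
  rcases le_total r 1 with h | h
  · exact (pow_le_pow_of_le_one hr h hab).trans (le_add_of_nonneg_right (by positivity))
  · exact (pow_le_pow_right₀ h hbc).trans (le_add_of_nonneg_left (by positivity))

/-- The constant `√8 (m+1)` in the definition of `Q`. -/
def Qconst (m : ℕ) : ℝ := Real.sqrt 8 * (m + 1)

lemma Qconst_pos (m : ℕ) : 0 < Qconst m := by unfold Qconst; positivity

lemma Q_eq (m : ℕ) (r : ℝ) : Q m r = Qconst m * r ^ m / (1 + r ^ (2 * (m + 1))) := rfl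

lemma Q_pos (m : ℕ) {r : ℝ} (hr : 0 < r) : 0 < Q m r := by
  have := Qconst_pos m
  have := one_add_pow_pos m r
  rw [Q_eq]; positivity

/-- Q behaves like r^m at 0 and like r^{-m-2} at ∞, so two comparisons of exponents, one at each
end, decide the inequality. -/
lemma pow_mul_Q_le (m : ℕ) {a b c : ℕ} {r : ℝ} (hr : 0 < r) (h1 : b ≤ m + a)
    (h2 : m + a + c ≤ 2 * (m + 1) + b) : r ^ a * Q m r * (1 + r ^ c) ≤ 2 * Qconst m * r ^ b := by
  have hA := Qconst_pos m
  have hp := one_add_pow_pos m r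
  have e1 := pow_le_pow_add_pow (a := b) (b := m + a) (c := 2 * (m + 1) + b) h1 (by omega) hr.le
  have e2 := pow_le_pow_add_pow (a := b) (b := m + a + c) (c := 2 * (m + 1) + b) (by omega) h2 hr.le
  have e : r ^ a * Q m r * (1 + r ^ c)
      = Qconst m * (r ^ (m + a) + r ^ (m + a + c)) / (1 + r ^ (2 * (m + 1))) := by
    rw [Q_eq]; field_simp; ring
  rw [e, div_le_iff₀ hp]
  have : 2 * Qconst m * r ^ b * (1 + r ^ (2 * (m + 1)))
      = Qconst m * (2 * (r ^ b + r ^ (2 * (m + 1) + b))) := by ring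
  rw [this]
  gcongr
  linarith

lemma mul_Q_le_weightLoss (k m : ℕ) (hm : 1 ≤ m) {r : ℝ} (hr : 0 < r) :
    r * Q m r ≤ 4 * Qconst m * weightLoss k m r := by
  have h := pow_mul_Q_le m (a := 1) (b := 2) (c := 2) hr (by omega) (by omega)
  have h2 := mul_le_mul_of_nonneg_left (le_weightLoss k m hr)
    (by linarith [Qconst_pos m] : 0 ≤ 2 * Qconst m)
  rw [pow_one] at h
  have : r * Q m r * (1 + r ^ 2) ≤ 4 * Qconst m * weightLoss k m r * (1 + r ^ 2) := by linarith
  exact le_of_mul_le_mul_right this (by positivity)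

/-- Of the four powers of r gained from Q, two with a factor (1 + r²)⁻¹ pay for the weight loss
through `le_weightLoss`, and r² remains. This is the gain used in the moment integral. -/
lemma pow_mul_Q_le_weightLoss {k m : ℕ} (hk : 4 ≤ m + k) (hkm : k ≤ m + 2) {r : ℝ} (hr : 0 < r) :
    r ^ k * Q m r ≤ 4 * Qconst m * weightLoss k m r * r ^ 2 := by
  have h := pow_mul_Q_le m (a := k) (b := 4) (c := 2) hr (by omega) (by omega)
  have h2 := mul_le_mul_of_nonneg_left (le_weightLoss k m hr)
    (by have := Qconst_pos m; positivity : 0 ≤ 2 * Qconst m * r ^ 2)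
  have : r ^ k * Q m r * (1 + r ^ 2) ≤ 4 * Qconst m * weightLoss k m r * r ^ 2 * (1 + r ^ 2) := by
    linarith
  exact le_of_mul_le_mul_right this (by positivity)

lemma one_add_tanhProfile (m : ℕ) (r : ℝ) :
    1 + tanhProfile m r = 2 * r ^ (2 * (m + 1)) / (1 + r ^ (2 * (m + 1))) := by
  have := (one_add_pow_pos m r).ne'
  unfold tanhProfile
  field_simp
  ring

/-- 1 + u vanishes like r^{2m+2} at the origin, more than enough to cover the loss of weight there.
This makes (1 + u)v a lower order term. -/
lemma one_add_tanhProfile_le (k m : ℕ) {r : ℝ} (hr : 0 < r) :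
    1 + tanhProfile m r ≤ 8 * weightLoss k m r := by
  have hp := one_add_pow_pos m r
  have h : (1 + tanhProfile m r) * (1 + r ^ 2) ≤ 4 * r ^ 2 := by
    rw [one_add_tanhProfile, div_mul_eq_mul_div, div_le_iff₀ hp]
    have e1 := pow_le_pow_add_pow (a := 2) (b := 2 * (m + 1)) (c := 2 * (m + 1) + 2) (by omega)
      (by omega) hr.le
    have e2 : r ^ (2 * (m + 1) + 2) = r ^ (2 * (m + 1)) * r ^ 2 := pow_add _ _ _
    nlinarith [sq_nonneg r]
  have h2 := le_weightLoss k m hr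
  have : (1 + tanhProfile m r) * (1 + r ^ 2) ≤ 8 * weightLoss k m r * (1 + r ^ 2) := by linarith
  exact le_of_mul_le_mul_right this (by positivity)

lemma mul_Q_near_zero (m : ℕ) {r : ℝ} (hr : 0 < r) (hr1 : r ≤ 1) :
    Qconst m / 2 * r ^ (m + 1) ≤ r * Q m r ∧ r * Q m r ≤ Qconst m * r ^ (m + 1) := by
  have hA := Qconst_pos m
  have hp := one_add_pow_pos m r
  have e : r * Q m r = Qconst m * r ^ (m + 1) / (1 + r ^ (2 * (m + 1))) := by
    rw [Q_eq]; field_simp; ring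
  have h1 : r ^ (2 * (m + 1)) ≤ 1 := pow_le_one₀ hr.le hr1
  have h2 : 0 ≤ r ^ (2 * (m + 1)) := by positivity
  rw [e, le_div_iff₀ hp, div_le_iff₀ hp]
  have h3 : 0 ≤ Qconst m * r ^ (m + 1) := by positivity
  constructor <;> nlinarith

lemma mul_Q_near_top (m : ℕ) {r : ℝ} (hr1 : 1 ≤ r) :
    Qconst m / 2 * (r ^ (m + 1))⁻¹ ≤ r * Q m r ∧ r * Q m r ≤ Qconst m * (r ^ (m + 1))⁻¹ := by
  have hA := Qconst_pos m
  have hr : 0 < r := by linarith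
  have hp := one_add_pow_pos m r
  have hR : 1 ≤ r ^ (m + 1) := one_le_pow₀ hr1
  have e : r * Q m r = Qconst m * r ^ (m + 1) / (1 + (r ^ (m + 1)) ^ 2) := by
    rw [Q_eq, ← pow_mul, mul_comm 2 (m + 1)]; field_simp; ring
  rw [e]
  set R := r ^ (m + 1)
  have hR0 : 0 < R := by linarith
  rw [← div_eq_mul_inv, ← div_eq_mul_inv, div_le_div_iff₀ hR0 (by positivity),
    div_le_div_iff₀ (by positivity) hR0]
  constructor <;> nlinarith [mul_pos hA hR0]

lemma sq_inv_japanese_logMinus_le {r : ℝ} (hr : 0 < r) (hr1 : r ≤ 1) :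
    (japanese (logMinus r))⁻¹ ^ 2 ≤ 2 * (1 - Real.log r)⁻¹ ^ 2 := by
  have hl : Real.log r ≤ 0 := Real.log_nonpos hr.le hr1
  have h : logMinus r = -Real.log r := max_eq_left (by linarith)
  rw [inv_pow, inv_pow, japanese_sq, h, ← div_eq_mul_inv, inv_eq_one_div,
    div_le_div_iff₀ (by positivity) (by nlinarith)]
  nlinarith [sq_nonneg (Real.log r + 1)]

/-- The power of r in the loss is exactly what separates r^{m+1} from r^k in the two cases k = m + 1
and k = m + 2; only the logarithm survives. -/
lemma weightLoss_mul_pow_le {k m : ℕ} (hk : 1 ≤ k) (hkm : k ≤ m + 2) (hmk : m < k) {r : ℝ}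
    (hr : 0 < r) : weightLoss k m r * r ^ (m + 1) ≤ (japanese (logMinus r))⁻¹ * r ^ k := by
  have h0 := japanese_pos (logMinus r)
  have h1 : (japanese r)⁻¹ ≤ 1 := inv_le_one_of_one_le₀ (one_le_japanese _)
  unfold weightLoss
  rw [if_neg (by omega)]
  split_ifs with h
  · rw [show k = m + 1 by omega]
  · rw [show k = m + 2 by omega]
    calc r * (japanese r)⁻¹ * (japanese (logMinus r))⁻¹ * r ^ (m + 1)
        ≤ r * 1 * (japanese (logMinus r))⁻¹ * r ^ (m + 1) := by gcongr
      _ = _ := by ring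

lemma hasDerivAt_inv_one_sub_log {r : ℝ} (hr : 0 < r) (hr1 : r ≤ 1) :
    HasDerivAt (fun r => (1 - Real.log r)⁻¹) ((1 - Real.log r)⁻¹ ^ 2 / r) r := by
  have hl : Real.log r ≤ 0 := Real.log_nonpos hr.le hr1
  refine (((Real.hasDerivAt_log hr.ne').const_sub 1).inv (by linarith)).congr_deriv ?_
  field_simp

/-- Near 0 the weight rQ/r^k has size r^{m+1-k}. If m < k, Hardy for dr/r has no power to work with
and loses a logarithm, which is why the adapted norm contains one. If k ≤ m the exponent is positive
and the inequality is lossless. -/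
lemma hardy_Q_left {k m : ℕ} (hk : 1 ≤ k) (hkm : k ≤ m + 2) : ∃ C : NNReal, ∀ z z' : ℝ → ℝ,
    HasEulerDeriv z z' → z 1 = 0 →
    ∫⁻ r in Ioc 0 1, ENNReal.ofReal ((weightLoss k m r * (r * Q m r / r ^ k)) ^ 2 * z r ^ 2 / r) ≤
      C * ∫⁻ r in Ioc 0 1, ENNReal.ofReal ((r * Q m r / r ^ k) ^ 2 * z' r ^ 2 / r) := by
  have hA := Qconst_pos m
  rcases Nat.lt_or_ge m k with hmk | hmk
  · refine ⟨(Qconst m ^ 2 * 2).toNNReal * (16 / Qconst m ^ 2).toNNReal, fun z z' hz hz1 => ?_⟩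
    rw [ENNReal.coe_mul, mul_assoc]
    have hl : ∀ r ∈ Ioc (0 : ℝ) 1, 0 < 1 - Real.log r := fun r hr => by
      linarith [Real.log_nonpos hr.1.le hr.2]
    -- Critical case: φ = (1 - log r)⁻¹ satisfies r∂_r φ = φ², so 4φ²/ψ is the constant 4, which is
    -- dominated by the weight on the right.
    refine hardy_left (φ := fun r => (1 - Real.log r)⁻¹) (ψ := fun r => (1 - Real.log r)⁻¹ ^ 2)
      hz hz1 (fun r hr => hasDerivAt_inv_one_sub_log hr.1 hr.2) ?_
      (fun r hr => by have := hl r hr; positivity) (fun r hr => (inv_pos.2 (hl r hr)).le)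
      (by positivity) (by positivity) ?_ ?_
    · refine ContinuousOn.pow (ContinuousOn.inv₀ (continuousOn_const.sub
        (Real.continuousOn_log.mono fun r hr => ?_)) fun r hr => (hl r hr).ne') 2
      simpa using hr.1.ne'
    · intro r hr
      have h1 := (mul_Q_near_zero m hr.1 hr.2).2
      have h2 := weightLoss_mul_pow_le hk hkm hmk hr.1
      have h3 := sq_inv_japanese_logMinus_le hr.1 hr.2
      have h4 := weightLoss_nonneg k m hr.1
      have hr0 := hr.1
      have hq := Q_pos m hr.1
      have : weightLoss k m r * (r * Q m r / r ^ k) ≤ Qconst m * (japanese (logMinus r))⁻¹ := by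
        rw [← mul_div_assoc, div_le_iff₀ (by positivity)]
        calc weightLoss k m r * (r * Q m r) ≤ weightLoss k m r * (Qconst m * r ^ (m + 1)) := by
              gcongr
          _ = Qconst m * (weightLoss k m r * r ^ (m + 1)) := by ring
          _ ≤ Qconst m * ((japanese (logMinus r))⁻¹ * r ^ k) := by gcongr
          _ = _ := by ring
      calc (weightLoss k m r * (r * Q m r / r ^ k)) ^ 2
          ≤ (Qconst m * (japanese (logMinus r))⁻¹) ^ 2 := by gcongr
        _ = Qconst m ^ 2 * (japanese (logMinus r))⁻¹ ^ 2 := by ring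
        _ ≤ Qconst m ^ 2 * (2 * (1 - Real.log r)⁻¹ ^ 2) := by gcongr
        _ = _ := by ring
    · intro r hr
      have h1 := (mul_Q_near_zero m hr.1 hr.2).1
      have hr0 := hr.1
      have hlr := hl r hr
      have h2 : r ^ k ≤ r ^ (m + 1) := pow_le_pow_of_le_one hr.1.le hr.2 (by omega)
      have h3 : Qconst m / 2 ≤ r * Q m r / r ^ k := by
        rw [le_div_iff₀ (by positivity)]
        exact le_trans (by gcongr) h1
      have h4 : (Qconst m / 2) ^ 2 ≤ (r * Q m r / r ^ k) ^ 2 := by gcongr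
      rw [div_self (by positivity), div_mul_eq_mul_div, le_div_iff₀ (by positivity)]
      linarith
  · obtain ⟨d, hd⟩ : ∃ d, m + 1 = k + (d + 1) := ⟨m - k, by omega⟩
    refine ⟨(Qconst m ^ 2).toNNReal * (8 / Qconst m ^ 2).toNNReal, fun z z' hz hz1 => ?_⟩
    rw [ENNReal.coe_mul, mul_assoc]
    have hd0 : (0 : ℝ) < d + 1 := by positivity
    refine hardy_left (φ := fun r => r ^ (2 * (d + 1)))
      (ψ := fun r => 2 * (d + 1) * r ^ (2 * (d + 1))) hz hz1 (fun r hr => ?_) (by fun_prop)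
      (fun r hr => by have := hr.1; positivity) (fun r hr => by have := hr.1; positivity)
      (by positivity) (by positivity) ?_ ?_
    · refine (hasDerivAt_pow _ r).congr_deriv ?_
      have := hr.1.ne'
      rw [show 2 * (d + 1) - 1 = 2 * d + 1 by omega]
      field_simp
      push_cast
      ring
    · intro r hr
      have hr0 := hr.1
      have h1 := (mul_Q_near_zero m hr.1 hr.2).2
      have hq := Q_pos m hr.1
      have h2 : r * Q m r / r ^ k ≤ Qconst m * r ^ (d + 1) := by
        rw [div_le_iff₀ (by positivity), mul_assoc, ← pow_add, add_comm, ← hd]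
        exact h1
      have h4 := weightLoss_nonneg k m hr.1
      have h5 := weightLoss_le_one k m r
      calc (weightLoss k m r * (r * Q m r / r ^ k)) ^ 2 ≤ (1 * (Qconst m * r ^ (d + 1))) ^ 2 := by
            gcongr
        _ = Qconst m ^ 2 * (1 * r ^ (2 * (d + 1))) := by ring
        _ ≤ _ := by gcongr; nlinarith
    · intro r hr
      have hr0 := hr.1
      have h1 := (mul_Q_near_zero m hr.1 hr.2).1
      have h2 : Qconst m / 2 * r ^ (d + 1) ≤ r * Q m r / r ^ k := by
        rw [le_div_iff₀ (by positivity), mul_assoc, ← pow_add, add_comm (d + 1), ← hd]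
        exact h1
      have h4 : (Qconst m / 2 * r ^ (d + 1)) ^ 2 ≤ (r * Q m r / r ^ k) ^ 2 := by gcongr
      have e : 4 * ((r ^ (2 * (d + 1))) ^ 2 / (2 * (d + 1) * r ^ (2 * (d + 1))))
          = 2 * r ^ (2 * (d + 1)) / (d + 1) := by field_simp; ring
      rw [e, div_mul_eq_mul_div, div_le_div_iff₀ hd0 (by positivity)]
      have e2 : (Qconst m / 2 * r ^ (d + 1)) ^ 2 = Qconst m ^ 2 / 4 * r ^ (2 * (d + 1)) := by ring
      have h5 : 0 ≤ (r * Q m r / r ^ k) ^ 2 := by positivity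
      rw [e2] at h4
      nlinarith

/-- For r ≥ 1 the weight decays like r^{-(m+1+k)}. Its increasing primitive is negative, so the
boundary term at infinity has the good sign and no condition on z there is needed. -/
lemma hardy_Q_right (k m : ℕ) : ∃ C : NNReal, ∀ z z' : ℝ → ℝ,
    HasEulerDeriv z z' → z 1 = 0 →
    ∫⁻ r in Ioi 1, ENNReal.ofReal ((weightLoss k m r * (r * Q m r / r ^ k)) ^ 2 * z r ^ 2 / r) ≤
      C * ∫⁻ r in Ioi 1, ENNReal.ofReal ((r * Q m r / r ^ k) ^ 2 * z' r ^ 2 / r) := by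
  have hA := Qconst_pos m
  set e := m + 1 + k with he
  have he0 : (1 : ℝ) ≤ e := by exact_mod_cast (by omega)
  have hp0 : ∀ r ∈ Ici (1 : ℝ), 0 < r := fun r hr => one_pos.trans_le hr
  have hinv : ∀ r : ℝ, 0 < r → (r ^ (m + 1))⁻¹ / r ^ k = (r ^ e)⁻¹ := fun r hr => by
    rw [he, pow_add r (m + 1)]; field_simp
  refine ⟨(Qconst m ^ 2).toNNReal * (8 / Qconst m ^ 2).toNNReal, fun z z' hz hz1 => ?_⟩
  rw [ENNReal.coe_mul, mul_assoc]
  refine hardy_right (φ := fun r => -(r ^ (2 * e))⁻¹)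
    (ψ := fun r => 2 * e * (r ^ (2 * e))⁻¹) hz hz1 (fun r hr => ?_) ?_
    (fun r hr => by have := hp0 r hr; positivity)
    (fun r hr => by have := hp0 r hr; simp only [Left.neg_nonpos_iff]; positivity)
    (by positivity) (by positivity) ?_ ?_
  · have hr0 := hp0 r hr
    refine ((hasDerivAt_pow (2 * e) r).inv (by positivity)).neg.congr_deriv ?_
    obtain ⟨j, hj⟩ : ∃ j, 2 * e = j + 1 := ⟨2 * e - 1, by omega⟩
    have hj' : (2 * e : ℝ) = j + 1 := by exact_mod_cast hj
    rw [hj, hj']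
    simp only [Nat.add_sub_cancel]
    push_cast
    field_simp
    ring
  · exact continuousOn_const.mul (ContinuousOn.inv₀ (by fun_prop)
      fun r hr => (pow_pos (hp0 r hr) _).ne')
  · intro r hr
    have hr0 := hp0 r hr
    have h1 := (mul_Q_near_top m hr).2
    have hq := Q_pos m hr0
    have h2 : r * Q m r / r ^ k ≤ Qconst m * (r ^ e)⁻¹ := by
      rw [← hinv r hr0, ← mul_div_assoc]
      gcongr
    have h4 := weightLoss_nonneg k m hr0
    have h5 := weightLoss_le_one k m r
    calc (weightLoss k m r * (r * Q m r / r ^ k)) ^ 2 ≤ (1 * (Qconst m * (r ^ e)⁻¹)) ^ 2 := by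
          gcongr
      _ = Qconst m ^ 2 * (1 * (r ^ (2 * e))⁻¹) := by rw [mul_comm 2 e, pow_mul]; ring
      _ ≤ _ := by gcongr; linarith
  · intro r hr
    have hr0 := hp0 r hr
    have h1 := (mul_Q_near_top m hr).1
    have h2 : Qconst m / 2 * (r ^ e)⁻¹ ≤ r * Q m r / r ^ k := by
      rw [← hinv r hr0, ← mul_div_assoc]
      gcongr
    have h4 : (Qconst m / 2 * (r ^ e)⁻¹) ^ 2 ≤ (r * Q m r / r ^ k) ^ 2 := by gcongr
    have e1 : 4 * ((-(r ^ (2 * e))⁻¹) ^ 2 / (2 * e * (r ^ (2 * e))⁻¹))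
        = 2 * (r ^ (2 * e))⁻¹ / e := by field_simp; ring
    rw [e1, div_mul_eq_mul_div, div_le_div_iff₀ (by positivity) (by positivity)]
    have e2 : (Qconst m / 2 * (r ^ e)⁻¹) ^ 2 = Qconst m ^ 2 / 4 * (r ^ (2 * e))⁻¹ := by
      rw [mul_comm 2 e, pow_mul]; ring
    have h5 : 0 ≤ (r * Q m r / r ^ k) ^ 2 := by positivity
    rw [e2] at h4
    nlinarith

lemma enorm_real_sq (x : ℝ) : ‖x‖ₑ ^ 2 = ENNReal.ofReal (x ^ 2) := by
  rw [Real.enorm_eq_ofReal_abs, ← ENNReal.ofReal_pow (abs_nonneg _), sq_abs]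

/-- In the logarithmic variable, with measure dr/r, the weight picks up one factor r. Hardy and
energy estimates are both carried out in this form. -/
lemma wnorm_real_sq (w f : ℝ → ℝ) (hw : ∀ r, 0 < r → 0 ≤ w r) :
    wnorm (fun r => ENNReal.ofReal (w r)) f ^ 2 =
      ENNReal.ofReal (2 * Real.pi) *
        ∫⁻ r, ENNReal.ofReal ((r * w r * f r) ^ 2 / r) ∂halfLine := by
  unfold wnorm
  rw [l2norm_sq, ← lintegral_const_mul' _ _ ENNReal.ofReal_ne_top]
  refine setLIntegral_congr_fun measurableSet_Ioi fun r hr => ?_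
  have hr0 : (0 : ℝ) < r := hr
  rw [mul_pow, enorm_real_sq, ← ENNReal.ofReal_pow (hw r hr0),
    ← ENNReal.ofReal_mul (by have := hw r hr0; positivity),
    ← ENNReal.ofReal_mul (by have := hw r hr0; positivity), ← ENNReal.ofReal_mul (by positivity)]
  congr 1
  field_simp

lemma le_coe_mul_of_sq_le {a b : ℝ≥0∞} (C : NNReal) (h : a ^ 2 ≤ C * b ^ 2) :
    a ≤ (NNReal.sqrt C : NNReal) * b := by
  rw [← ENNReal.pow_le_pow_left_iff two_ne_zero]
  rw [mul_pow, ← ENNReal.coe_pow, NNReal.sq_sqrt]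
  exact h

/-- Hardy inequality for functions of the form `Q z` with `z(1) = 0`. -/
lemma hardy_Q {k m : ℕ} (hk : 1 ≤ k) (hkm : k ≤ m + 2) : ∃ C : NNReal, ∀ z z' : ℝ → ℝ,
    HasEulerDeriv z z' → z 1 = 0 →
    wnorm (adaptedWeight k m) (fun r => Q m r * z r) ≤
      C * wnorm (powWeight k) (fun r => Q m r * z' r) := by
  obtain ⟨C₁, h₁⟩ := hardy_Q_left hk hkm
  obtain ⟨C₂, h₂⟩ := hardy_Q_right k m
  refine ⟨NNReal.sqrt (C₁ + C₂), fun z z' hz hz1 => le_coe_mul_of_sq_le _ ?_⟩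
  have hw1 := wnorm_real_sq (fun r => weightLoss k m r * (r ^ k)⁻¹) (fun r => Q m r * z r)
    (fun r hr => mul_nonneg (weightLoss_nonneg k m hr) (by positivity))
  have hw2 := wnorm_real_sq (fun r => (r ^ k)⁻¹) (fun r => Q m r * z' r)
    (fun r hr => by positivity)
  unfold adaptedWeight powWeight
  rw [hw1, hw2, ← mul_assoc, mul_comm (((C₁ + C₂ : NNReal)) : ℝ≥0∞), mul_assoc]
  refine mul_le_mul' le_rfl ?_
  have hsplit : Ioi (0 : ℝ) = Ioc 0 1 ∪ Ioi 1 := (Ioc_union_Ioi_eq_Ioi zero_le_one).symm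
  have hd : Disjoint (Ioc (0 : ℝ) 1) (Ioi 1) := Ioc_disjoint_Ioi le_rfl
  have e : ∀ F : ℝ → ℝ≥0∞, ∫⁻ r, F r ∂halfLine
      = (∫⁻ r in Ioc 0 1, F r) + ∫⁻ r in Ioi 1, F r := fun F => by
    change ∫⁻ r in Ioi (0 : ℝ), F r = _
    rw [hsplit, lintegral_union measurableSet_Ioi hd]
  rw [e, e, ENNReal.coe_add]
  have k1 := h₁ z z' hz hz1
  have k2 := h₂ z z' hz hz1
  have r1 : ∀ r : ℝ, (weightLoss k m r * (r * Q m r / r ^ k)) ^ 2 * z r ^ 2 / r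
      = (r * (weightLoss k m r * (r ^ k)⁻¹) * (Q m r * z r)) ^ 2 / r := fun r => by ring
  have r2 : ∀ r : ℝ, (r * Q m r / r ^ k) ^ 2 * z' r ^ 2 / r
      = (r * (r ^ k)⁻¹ * (Q m r * z' r)) ^ 2 / r := fun r => by ring
  simp only [r1, r2] at k1 k2
  rw [add_mul]
  refine add_le_add (k1.trans ?_) (k2.trans ?_)
  · gcongr
    exact le_self_add
  · gcongr
    exact le_add_self

/-! ### The potential terms of `L_Q` -/

/-- This makes the coefficients of all the operators affine functions of u divided by r. -/
lemma Atheta_eq_tanhProfile (m : ℕ) (r : ℝ) : Atheta m r = -((m + 1) * (1 + tanhProfile m r)) := by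
  rw [Atheta_eq, one_add_tanhProfile]
  ring

/-- r²Q² is the Pöschl–Teller potential 2(m+1)² sech²((m+1) log r). This identity makes the equation
for the real part explicitly solvable. -/
lemma sq_mul_Q_sq (m : ℕ) (r : ℝ) :
    r ^ 2 * Q m r ^ 2 = 2 * (m + 1) ^ 2 * (1 - tanhProfile m r ^ 2) := by
  have h1 := (one_add_pow_pos m r).ne'
  unfold tanhProfile Q
  rw [div_pow, mul_pow, mul_pow, sqrt_eight_sq]
  field_simp
  ring

lemma hasDerivAt_Q_euler (m : ℕ) {r : ℝ} (hr : 0 < r) :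
    HasDerivAt (Q m) (r⁻¹ • (-(1 + (m + 1) * tanhProfile m r) * Q m r)) r := by
  refine (hasDerivAt_Q m hr).congr_deriv ?_
  rw [Atheta_eq_tanhProfile, smul_eq_mul]
  ring

lemma continuousOn_Q (m : ℕ) : ContinuousOn (Q m) (Ioi 0) := (continuous_Q m).continuousOn

lemma hasEulerDeriv_Q (m : ℕ) :
    HasEulerDeriv (Q m) (fun r => -(1 + (m + 1) * tanhProfile m r) * Q m r) := by
  have := continuous_tanhProfile m
  have := continuous_Q m
  exact hasEulerDeriv_of_hasDerivAt (fun r hr => hasDerivAt_Q_euler m hr)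
    (Continuous.continuousOn (by fun_prop))

lemma hasEulerDeriv_tanhProfile (m : ℕ) :
    HasEulerDeriv (tanhProfile m) (fun r => (m + 1) * (1 - tanhProfile m r ^ 2)) := by
  have := continuous_tanhProfile m
  refine hasEulerDeriv_of_hasDerivAt (fun r hr => (hasDerivAt_tanhProfile m hr).congr_deriv ?_)
    (Continuous.continuousOn (by fun_prop))
  rw [smul_eq_mul]; ring

lemma hasEulerDeriv_pow (j : ℕ) :
    HasEulerDeriv (fun r : ℝ => r ^ j) (fun r => j * r ^ j) := by
  refine hasEulerDeriv_of_hasDerivAt (fun r hr => (hasDerivAt_pow j r).congr_deriv ?_)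
    (Continuous.continuousOn (by fun_prop))
  rcases j with _ | j
  · simp
  · rw [smul_eq_mul]; field_simp; simp [pow_succ]

/-- Cauchy–Schwarz with respect to 2πx dx: the other factor contributes the square root of ∫₀^r
x⁶/(2πx) dx ≤ r⁶. -/
lemma lintegral_cube_mul_le {H : ℝ → ℝ≥0∞} (hH : AEMeasurable H halfLine) {r : ℝ} (hr : 0 < r) :
    ∫⁻ x in Ioc 0 r, ENNReal.ofReal (x ^ 3) * H x ≤ ENNReal.ofReal (r ^ 3) * l2norm H := by
  have hsub : volume.restrict (Ioc 0 r) ≤ halfLine :=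
    Measure.restrict_mono (fun x hx => hx.1) le_rfl
  have hπ : 0 < 2 * Real.pi := by positivity
  have h := ENNReal.lintegral_mul_le_Lp_mul_Lq (volume.restrict (Ioc 0 r))
    (Real.HolderConjugate.two_two)
    (f := fun x => ENNReal.ofReal (x ^ 3 * (Real.sqrt (2 * Real.pi * x))⁻¹))
    (g := fun x => H x * ENNReal.ofReal (Real.sqrt (2 * Real.pi * x))) (by fun_prop)
    ((hH.mono_measure hsub).mul (by fun_prop))
  have e : ∫⁻ x in Ioc 0 r, ENNReal.ofReal (x ^ 3) * H x = ∫⁻ x in Ioc 0 r,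
      ((fun x => ENNReal.ofReal (x ^ 3 * (Real.sqrt (2 * Real.pi * x))⁻¹)) *
      fun x => H x * ENNReal.ofReal (Real.sqrt (2 * Real.pi * x))) x := by
    refine setLIntegral_congr_fun measurableSet_Ioc fun x hx => ?_
    have hx0 : 0 < Real.sqrt (2 * Real.pi * x) := Real.sqrt_pos.2 (mul_pos hπ hx.1)
    have hx3 : 0 ≤ x ^ 3 := by have := hx.1; positivity
    simp only [Pi.mul_apply]
    rw [ENNReal.ofReal_mul hx3, mul_mul_mul_comm, ← ENNReal.ofReal_mul (inv_nonneg.2 hx0.le),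
      inv_mul_cancel₀ hx0.ne', ENNReal.ofReal_one, mul_one]
  rw [e]
  refine h.trans (mul_le_mul' ?_ ?_)
  · calc (∫⁻ x in Ioc 0 r, ENNReal.ofReal (x ^ 3 * (Real.sqrt (2 * Real.pi * x))⁻¹) ^ (2 : ℝ)) ^
          (1 / 2 : ℝ) ≤ (∫⁻ x in Ioc 0 r, ENNReal.ofReal (r ^ 5)) ^ (1 / 2 : ℝ) := by
          refine ENNReal.rpow_le_rpow (setLIntegral_mono' measurableSet_Ioc fun x hx => ?_)
            (by norm_num)
          have hx0 := hx.1
          rw [ENNReal.rpow_ofNat, ← ENNReal.ofReal_pow (by positivity)]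
          refine ENNReal.ofReal_le_ofReal ?_
          rw [mul_pow, inv_pow, Real.sq_sqrt (by positivity)]
          have : (x ^ 3) ^ 2 * (2 * Real.pi * x)⁻¹ = x ^ 5 / (2 * Real.pi) := by field_simp
          rw [this]
          calc x ^ 5 / (2 * Real.pi) ≤ x ^ 5 :=
                div_le_self (by positivity) (by linarith [Real.pi_gt_three])
            _ ≤ r ^ 5 := by gcongr; exact hx.2
      _ = (ENNReal.ofReal (r ^ 3) ^ (2 : ℝ)) ^ (1 / 2 : ℝ) := by
          rw [setLIntegral_const, Real.volume_Ioc, sub_zero, ← ENNReal.ofReal_mul (by positivity),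
            ENNReal.rpow_ofNat, ← ENNReal.ofReal_pow (by positivity)]
          congr 2; ring
      _ = ENNReal.ofReal (r ^ 3) := by rw [← ENNReal.rpow_mul]; norm_num
      _ ≤ _ := le_rfl
  · unfold l2norm
    refine ENNReal.rpow_le_rpow ?_ (by norm_num)
    calc ∫⁻ x in Ioc 0 r, (H x * ENNReal.ofReal (Real.sqrt (2 * Real.pi * x))) ^ (2 : ℝ)
        = ∫⁻ x in Ioc 0 r, H x ^ 2 * ENNReal.ofReal (2 * Real.pi * x) := by
          refine setLIntegral_congr_fun measurableSet_Ioc fun x hx => ?_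
          have hx0 := hx.1
          rw [ENNReal.rpow_ofNat, mul_pow, ← ENNReal.ofReal_pow (Real.sqrt_nonneg _),
            Real.sq_sqrt (by positivity)]
      _ ≤ _ := lintegral_mono_set fun x hx => hx.1

lemma l2norm_ofReal_ne_top {f : ℝ → ℝ} {C : ℝ} (h0 : ∀ r, 0 < r → 0 ≤ f r)
    (h : ∀ r, 0 < r → f r * (1 + r ^ 2) ≤ C) : l2norm (fun r => ENNReal.ofReal (f r)) ≠ ∞ := by
  have hi : Integrable (fun r : ℝ => (2 * Real.pi * C ^ 2) * (1 + r ^ 2)⁻¹) :=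
    integrable_inv_one_add_sq.const_mul _
  have : l2norm (fun r => ENNReal.ofReal (f r)) ^ 2 ≠ ∞ := by
    rw [l2norm_sq]
    refine ne_top_of_le_ne_top (hi.integrableOn (s := Ioi 0)).2.ne ?_
    refine setLIntegral_mono' measurableSet_Ioi fun r hr => ?_
    have hr0 : (0 : ℝ) < r := hr
    have hf := h0 r hr0
    rw [← ENNReal.ofReal_pow hf, ← ENNReal.ofReal_mul (by positivity), Real.enorm_eq_ofReal_abs]
    refine ENNReal.ofReal_le_ofReal (le_trans ?_ (le_abs_self _))
    change _ ≤ 2 * Real.pi * C ^ 2 * (1 + r ^ 2)⁻¹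
    rw [← div_eq_mul_inv, le_div_iff₀ (by positivity)]
    have h1 : f r ^ 2 * r * (1 + r ^ 2) ≤ C ^ 2 := by
      calc f r ^ 2 * r * (1 + r ^ 2) ≤ f r ^ 2 * (1 + r ^ 2) * (1 + r ^ 2) := by
            gcongr; nlinarith [sq_nonneg (r - 1)]
        _ = (f r * (1 + r ^ 2)) ^ 2 := by ring
        _ ≤ C ^ 2 := by gcongr; exact h r hr0
    nlinarith [Real.pi_pos]
  intro hcon
  rw [hcon] at this
  simp at this

/-- The integral `∫₀^r Re(Q̄ v) r' dr'`, that is `r B_Q v`. -/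
def momentQ (m : ℕ) (v : ℝ → ℂ) (r : ℝ) : ℝ := ∫ x in (0 : ℝ)..r, Q m x * (v x).re * x

section momentQ

variable {k m : ℕ} {v w : ℝ → ℂ}

lemma momentQ_integrand_le (hk : 4 ≤ m + k) (hkm : k ≤ m + 2) {x : ℝ} (hx : 0 < x) :
    ‖Q m x * (v x).re * x‖ₑ ≤ ENNReal.ofReal (4 * Qconst m) *
      (ENNReal.ofReal (x ^ 3) * (adaptedWeight k m x * ‖v x‖ₑ)) := by
  have hA := Qconst_pos m
  have hq := Q_pos m hx
  have hw := weightLoss_nonneg k m hx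
  unfold adaptedWeight
  rw [Real.enorm_eq_ofReal_abs, ← ofReal_norm, ← ENNReal.ofReal_mul (by positivity),
    ← ENNReal.ofReal_mul (by positivity), ← ENNReal.ofReal_mul (by positivity)]
  refine ENNReal.ofReal_le_ofReal ?_
  rw [abs_mul, abs_mul, abs_of_pos hq, abs_of_pos hx]
  have h := pow_mul_Q_le_weightLoss hk hkm hx
  have hre := Complex.abs_re_le_norm (v x)
  calc Q m x * |(v x).re| * x ≤ Q m x * ‖v x‖ * x := by gcongr
    _ = (x ^ k * Q m x) * (x * (x ^ k)⁻¹ * ‖v x‖) := by field_simp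
    _ ≤ (4 * Qconst m * weightLoss k m x * x ^ 2) * (x * (x ^ k)⁻¹ * ‖v x‖) := by gcongr
    _ = _ := by ring

lemma lintegral_momentQ_le (hk : 4 ≤ m + k) (hkm : k ≤ m + 2) (hv : AEMeasurable v halfLine)
    {r : ℝ} (hr : 0 < r) : ∫⁻ x in Ioc 0 r, ‖Q m x * (v x).re * x‖ₑ ≤
      ENNReal.ofReal (4 * Qconst m) *
        (ENNReal.ofReal (r ^ 3) * wnorm (adaptedWeight k m) v) := by
  calc ∫⁻ x in Ioc 0 r, ‖Q m x * (v x).re * x‖ₑ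
      ≤ ∫⁻ x in Ioc 0 r, ENNReal.ofReal (4 * Qconst m) *
          (ENNReal.ofReal (x ^ 3) * (adaptedWeight k m x * ‖v x‖ₑ)) :=
        setLIntegral_mono' measurableSet_Ioc fun x hx => momentQ_integrand_le hk hkm hx.1
    _ = ENNReal.ofReal (4 * Qconst m) *
        ∫⁻ x in Ioc 0 r, ENNReal.ofReal (x ^ 3) * (adaptedWeight k m x * ‖v x‖ₑ) :=
        lintegral_const_mul' _ _ ENNReal.ofReal_ne_top
    _ ≤ _ := by
        refine mul_le_mul' le_rfl (lintegral_cube_mul_le ?_ hr)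
        exact (measurable_adaptedWeight k m).aemeasurable.mul hv.enorm

lemma intervalIntegrable_momentQ (hk : 4 ≤ m + k) (hkm : k ≤ m + 2) (hv : AEMeasurable v halfLine)
    (hfin : wnorm (adaptedWeight k m) v ≠ ∞) {r : ℝ} (hr : 0 < r) :
    IntervalIntegrable (fun x => Q m x * (v x).re * x) volume 0 r := by
  rw [intervalIntegrable_iff_integrableOn_Ioc_of_le hr.le]
  refine ⟨AEMeasurable.aestronglyMeasurable ?_, ?_⟩
  · have : AEMeasurable v (volume.restrict (Ioc 0 r)) :=
      hv.mono_measure (Measure.restrict_mono (fun x hx => hx.1) le_rfl)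
    exact ((continuous_Q m).measurable.aemeasurable.mul
      (Complex.measurable_re.comp_aemeasurable this)).mul aemeasurable_id
  · refine lt_of_le_of_lt (lintegral_momentQ_le hk hkm hv hr) ?_
    exact ENNReal.mul_lt_top ENNReal.ofReal_lt_top
      (ENNReal.mul_lt_top ENNReal.ofReal_lt_top hfin.lt_top)

lemma enorm_momentQ_le (hk : 4 ≤ m + k) (hkm : k ≤ m + 2) (hv : AEMeasurable v halfLine)
    {r : ℝ} (hr : 0 < r) : ‖momentQ m v r‖ₑ ≤ ENNReal.ofReal (4 * Qconst m) *
        (ENNReal.ofReal (r ^ 3) * wnorm (adaptedWeight k m) v) := by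
  unfold momentQ
  rw [intervalIntegral.integral_of_le hr.le]
  exact (enorm_integral_le_lintegral_enorm _).trans (lintegral_momentQ_le hk hkm hv hr)

lemma hasEulerDeriv_momentQ (hk : 4 ≤ m + k) (hkm : k ≤ m + 2) (hv : ContinuousOn v (Ioi 0))
    (hfin : wnorm (adaptedWeight k m) v ≠ ∞) :
    HasEulerDeriv (momentQ m v) (fun r => r ^ 2 * Q m r * (v r).re) := by
  have hvm := aemeasurable_of_continuousOn hv
  have hc : ContinuousOn (fun x => Q m x * (v x).re * x) (Ioi 0) :=
    ((continuousOn_Q m).mul (Complex.continuous_re.comp_continuousOn hv)).mul continuousOn_id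
  refine hasEulerDeriv_of_hasDerivAt (fun r hr => ?_)
    (((by fun_prop : Continuous fun r : ℝ => r ^ 2).continuousOn.mul (continuousOn_Q m)).mul
      (Complex.continuous_re.comp_continuousOn hv))
  refine (intervalIntegral.integral_hasDerivAt_right
    (intervalIntegrable_momentQ hk hkm hvm hfin hr)
    (hc.stronglyMeasurableAtFilter isOpen_Ioi _ hr)
    (hc.continuousAt (Ioi_mem_nhds hr))).congr_deriv ?_
  rw [smul_eq_mul]; field_simp

lemma momentQ_congr (h : ∀ r, 0 < r → v r = w r) {r : ℝ} (hr : 0 < r) :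
    momentQ m v r = momentQ m w r := by
  unfold momentQ
  refine intervalIntegral.integral_congr_ae (Eventually.of_forall fun x hx => ?_)
  rw [uIoc_of_le hr.le] at hx
  rw [h x hx.1]

end momentQ

/-! ### The operators in terms of Euler derivatives -/

lemma AQ_eq (m : ℕ) (f : ℝ → ℂ) (r : ℝ) :
    AQ m f r = (1 : ℝ) • deriv f r + (((m + 1) * tanhProfile m r) / r) • f r := by
  unfold AQ
  rw [Atheta_eq_tanhProfile, sub_eq_add_neg, ← neg_smul, one_smul]
  congr 2
  ring

lemma AQstar_eq (m : ℕ) (f : ℝ → ℂ) (r : ℝ) :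
    AQstar m f r = (-1 : ℝ) • deriv f r + (((m + 1) * tanhProfile m r - 1) / r) • f r := by
  unfold AQstar
  rw [Atheta_eq_tanhProfile, sub_sub, ← add_smul, sub_eq_add_neg, ← neg_smul, neg_one_smul]
  congr 2
  ring

/-- With q = r∂₊v, the singular part of the potential is absorbed into ∂₊. What remains is (m+1)(1 +
u)v, small at the origin, and the nonlocal term. -/
lemma LQ_eq_of_hasDerivAt {m : ℕ} {v q : ℝ → ℂ} {r : ℝ} (hr : 0 < r)
    (hv : HasDerivAt v (r⁻¹ • (q r + (m : ℝ) • v r)) r) :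
    LQ m v r = r⁻¹ • (q r + (((m : ℝ) + 1) • ((1 + tanhProfile m r) • v r)
      + ((Q m r * momentQ m v r : ℝ) : ℂ))) := by
  unfold LQ BQ
  rw [hv.deriv, Atheta_eq_tanhProfile]
  change _ + ((Q m r * (1 / r * momentQ m v r) : ℝ) : ℂ) = _
  have : (r : ℂ) ≠ 0 := by exact_mod_cast hr.ne'
  simp only [Complex.real_smul]
  push_cast
  field_simp
  ring

lemma SymbolBound.of_le {C : NNReal} {n k : ℕ} {s : ℝ → ℝ} (h : SymbolBound C n s) (hk : k ≤ n) :
    SymbolBound C k s := by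
  induction n with
  | zero => obtain rfl : k = 0 := by omega
            exact h
  | succ n ih =>
    rcases Nat.lt_or_ge k (n + 1) with h1 | h1
    · exact ih h.pred (by omega)
    · obtain rfl : k = n + 1 := by omega
      exact h

/-- First order operators `σ ∂_r + s/r` with bounded coefficients. -/
lemma EulerBound.firstOrder {C : NNReal} {n : ℕ} {s : ℝ → ℝ} (hs : SymbolBound C n s) (σ : ℝ)
    (j : ℕ) : ∃ K : NNReal, ∀ (W : ℝ → ℝ≥0∞) (B : ℝ≥0∞) (f T : ℝ → ℂ), Measurable W →
      (∀ r, 0 < r → T r = σ • deriv f r + (s r / r) • f r) →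
      EulerBound W B (n + 1) (fun r => r ^ j • f r) →
      EulerBound W (K * B) n (fun r => r ^ (j + 1) • T r) := by
  refine ⟨‖σ‖₊ + (‖-(σ * j)‖₊ + 2 ^ n * C), fun W B f T hW hT h => ?_⟩
  have hf := h.pred
  obtain ⟨-, g, hg, hgB⟩ := h
  have key : ∀ r, 0 < r → HasDerivAt (fun r => r ^ j • f r) (r⁻¹ • g r) r →
      σ • g r + ((-(σ * j)) • (r ^ j • f r) + s r • (r ^ j • f r)) = r ^ (j + 1) • T r := by
    intro r hr hd
    have hi : HasDerivAt (fun r : ℝ => (r ^ j)⁻¹) (-(j * r ^ j / r) / (r ^ j) ^ 2) r := by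
      refine ((hasDerivAt_pow j r).inv (by positivity)).congr_deriv ?_
      rcases j with _ | j
      · simp
      · field_simp; simp [pow_succ]
    have hd2 : HasDerivAt f ((r ^ j)⁻¹ • (r⁻¹ • g r)
        + (-(j * r ^ j / r) / (r ^ j) ^ 2) • (r ^ j • f r)) r := by
      refine (hi.smul hd).congr_of_eventuallyEq ?_
      filter_upwards [Ioi_mem_nhds hr] with x hx
      have hx0 : (0 : ℝ) < x := hx
      change f x = (x ^ j)⁻¹ • (x ^ j • f x)
      rw [smul_smul, inv_mul_cancel₀ (pow_pos hx0 j).ne', one_smul]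
    rw [hT r hr, hd2.deriv]
    have hr' : (r : ℂ) ≠ 0 := by exact_mod_cast hr.ne'
    simp only [Complex.real_smul]
    push_cast
    field_simp
    ring
  have hsum := (hgB.const_smul σ).add hW ((hf.const_smul (-(σ * j))).add hW (hs.smul hW hf))
  have hsum' := hsum.mono (B' := (‖σ‖₊ + (‖-(σ * j)‖₊ + 2 ^ n * C) : NNReal) * B)
    (le_of_eq (by push_cast; ring))
  -- At order 0 the derivative of `r ^ j • f` is known only almost everywhere, which suffices there.
  -- At higher order it is continuous, hence classical, and the identity holds pointwise.
  rcases n with _ | n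
  · refine hsum'.congr_ae ?_
    filter_upwards [hg.2, ae_restrict_mem measurableSet_Ioi] with r h1 h2
    exact key r h2 h1
  · obtain ⟨-, g', hg', -⟩ := id hgB
    exact hsum'.congr fun r hr => key r hr (hg.hasDerivAt hg'.continuousOn hr)

lemma exists_firstOrder_AQ (m n j : ℕ) : ∃ K : NNReal, ∀ (W : ℝ → ℝ≥0∞) (B : ℝ≥0∞) (f : ℝ → ℂ),
    Measurable W → EulerBound W B (n + 1) (fun r => r ^ j • f r) →
      EulerBound W (K * B) n (fun r => r ^ (j + 1) • AQ m f r) := by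
  obtain ⟨C, hC⟩ := tanhProfile_polynomial_symbolBound m n
    (Polynomial.C ((m : ℝ) + 1) * Polynomial.X)
  obtain ⟨K, hK⟩ := EulerBound.firstOrder hC 1 j
  refine ⟨K, fun W B f hW => hK W B f _ hW fun r _ => ?_⟩
  rw [AQ_eq]; simp

lemma exists_firstOrder_AQstar (m n j : ℕ) : ∃ K : NNReal, ∀ (W : ℝ → ℝ≥0∞) (B : ℝ≥0∞)
    (f : ℝ → ℂ), Measurable W → EulerBound W B (n + 1) (fun r => r ^ j • f r) →
      EulerBound W (K * B) n (fun r => r ^ (j + 1) • AQstar m f r) := by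
  obtain ⟨C, hC⟩ := tanhProfile_polynomial_symbolBound m n
    (Polynomial.C ((m : ℝ) + 1) * Polynomial.X - 1)
  obtain ⟨K, hK⟩ := EulerBound.firstOrder hC (-1) j
  refine ⟨K, fun W B f hW => hK W B f _ hW fun r _ => ?_⟩
  rw [AQstar_eq]; simp

lemma wnorm_pow_smul (k : ℕ) (F : ℝ → ℂ) :
    wnorm (powWeight k) (fun r => r ^ k • F r) = l2norm (fun r => ‖F r‖ₑ) := by
  refine l2norm_congr_ae (ae_halfLine_of_forall fun r hr => ?_)
  unfold powWeight
  rw [enorm_smul, ← mul_assoc, Real.enorm_eq_ofReal_abs, abs_of_pos (by positivity),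
    ← ENNReal.ofReal_mul (by positivity), inv_mul_cancel₀ (by positivity), ENNReal.ofReal_one,
    one_mul]

/-! ### The adapted norm in terms of Euler derivatives -/

/-- `v` belongs to the space defined by the adapted norm, with norm at most `B`: its zeroth order
part is controlled with the adapted weight, and so are the Euler derivatives of `r ∂₊ v`. -/
def AdaptedBound (k m : ℕ) (B : ℝ≥0∞) (v : ℝ → ℂ) : Prop :=
  ∃ q, HasEulerDeriv v (fun r => q r + (m : ℝ) • v r) ∧ EulerBound (powWeight k) B (k - 1) q ∧
    wnorm (adaptedWeight k m) v ≤ B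

/-- The powers r², r³, r⁴ cover both uses: the moment is O(r³), and multiplying r³ by the growing
homogeneous solution produces r² and r⁴ as well. -/
lemma l2norm_Q_ne_top {k m : ℕ} (hk : 3 ≤ k) (hkm : k ≤ m + 2) :
    l2norm (fun r => ENNReal.ofReal (r ^ 2 * (1 + r + r ^ 2) * Q m r * (r ^ k)⁻¹)) ≠ ∞ := by
  refine l2norm_ofReal_ne_top (C := 6 * Qconst m) (fun r hr => ?_) fun r hr => ?_
  · have := Q_pos m hr; positivity
  · have h2 := pow_mul_Q_le m (a := 2) (b := k) (c := 2) hr (by omega) (by omega)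
    have h3 := pow_mul_Q_le m (a := 3) (b := k) (c := 2) hr (by omega) (by omega)
    have h4 := pow_mul_Q_le m (a := 4) (b := k) (c := 2) hr (by omega) (by omega)
    rw [mul_right_comm, ← div_eq_mul_inv, div_le_iff₀ (by positivity)]
    linarith

/-! ### The potential terms of `L_Q` as a closed first order system. -/

section potential

variable {k m : ℕ} {v q : ℝ → ℂ}

/-- The function (1 + u)v reproduces itself because r∂_r(1 + u) = (m+1)(1 - u)(1 + u) keeps the
factor 1 + u. -/
lemma hasEulerDeriv_one_add_tanhProfile_smul
    (hv : HasEulerDeriv v (fun r => q r + (m : ℝ) • v r)) :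
    HasEulerDeriv (fun r => (1 + tanhProfile m r) • v r)
      (fun r => (((m : ℝ) + 1) * (1 - tanhProfile m r) + m) • ((1 + tanhProfile m r) • v r)
        + (1 + tanhProfile m r) • q r) := by
  have h1 := (HasEulerDeriv.const (1 : ℝ)).add (hasEulerDeriv_tanhProfile m)
  refine (h1.smul hv).congr (fun _ _ => rfl) (Eventually.of_forall fun r => ?_)
  simp only [Complex.real_smul]
  push_cast
  ring

/-- Differentiating the moment produces r²Q² Re v, and r²Q² = 2(m+1)²(1 - u)(1 + u) turns this into
a bounded multiple of (1 + u) Re v. This closes the system. -/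
lemma hasEulerDeriv_Q_mul_momentQ (hk : 4 ≤ m + k) (hkm : k ≤ m + 2) (hv : ContinuousOn v (Ioi 0))
    (hfin : wnorm (adaptedWeight k m) v ≠ ∞) :
    HasEulerDeriv (fun r => ((Q m r * momentQ m v r : ℝ) : ℂ))
      (fun r => (-(1 + ((m : ℝ) + 1) * tanhProfile m r)) • ((Q m r * momentQ m v r : ℝ) : ℂ)
        + (2 * ((m : ℝ) + 1) ^ 2 * (1 - tanhProfile m r)) •
          ((((1 + tanhProfile m r) • v r).re : ℝ) : ℂ)) := by
  have h := ((hasEulerDeriv_Q m).smul (hasEulerDeriv_momentQ hk hkm hv hfin)).clm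
    Complex.ofRealCLM
  refine h.congr (fun _ _ => rfl) (Eventually.of_forall fun r => ?_)
  have e : Q m r * (r ^ 2 * Q m r * (v r).re)
      = 2 * ((m : ℝ) + 1) ^ 2 * (1 - tanhProfile m r ^ 2) * (v r).re := by
    rw [← sq_mul_Q_sq]; ring
  simp only [smul_eq_mul, Complex.ofRealCLM_apply, e, Complex.real_smul, Complex.re_ofReal_mul]
  push_cast
  ring

/-- Zeroth order bounds for the two potential terms of `L_Q`. -/
lemma exists_potential_bound (hk : 3 ≤ k) (hkm : k ≤ m + 2) : ∃ C : NNReal, ∀ v : ℝ → ℂ,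
    ContinuousOn v (Ioi 0) → wnorm (adaptedWeight k m) v ≠ ∞ →
    EulerBound (powWeight k) (C * wnorm (adaptedWeight k m) v) 0
      (fun r => (1 + tanhProfile m r) • v r) ∧
    EulerBound (powWeight k) (C * wnorm (adaptedWeight k m) v) 0
      (fun r => ((Q m r * momentQ m v r : ℝ) : ℂ)) := by
  have hA := Qconst_pos m
  set K := l2norm (fun r => ENNReal.ofReal (r ^ 2 * (1 + r + r ^ 2) * Q m r * (r ^ k)⁻¹)) with hK
  have hKfin : K ≠ ∞ := l2norm_Q_ne_top hk hkm
  refine ⟨max 8 ((4 * Qconst m).toNNReal * K.toNNReal), fun v hv hfin => ⟨⟨?_, ?_⟩, ?_, ?_⟩⟩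
  · exact (aemeasurable_of_continuousOn
      ((continuous_const.add (continuous_tanhProfile m)).continuousOn)).smul
      (aemeasurable_of_continuousOn hv)
  · refine (wnorm_le_const_mul 8 fun r hr => ?_).trans
      (mul_le_mul' (ENNReal.coe_le_coe.2 (le_max_left _ _)) le_rfl)
    have h := one_add_tanhProfile_le k m hr
    have h0 : 0 ≤ 1 + tanhProfile m r := by
      linarith [(abs_le.1 (abs_tanhProfile_le m r)).1]
    unfold adaptedWeight powWeight
    rw [enorm_smul, ← mul_assoc, ← mul_assoc]
    refine mul_le_mul' ?_ le_rfl
    rw [Real.enorm_eq_ofReal_abs, abs_of_nonneg h0, ← ENNReal.ofReal_mul (by positivity)]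
    have e : ((8 : NNReal) : ℝ≥0∞) = ENNReal.ofReal 8 := by simp
    rw [e, ← ENNReal.ofReal_mul (by norm_num)]
    refine ENNReal.ofReal_le_ofReal ?_
    calc (r ^ k)⁻¹ * (1 + tanhProfile m r) ≤ (r ^ k)⁻¹ * (8 * weightLoss k m r) := by gcongr
      _ = _ := by ring
  · exact (hasEulerDeriv_Q_mul_momentQ (by omega) hkm hv hfin).continuousOn.aemeasurable
      measurableSet_Ioi
  · refine le_trans ?_ (mul_le_mul' (ENNReal.coe_le_coe.2 (le_max_right _ _)) le_rfl)
    have hvm := aemeasurable_of_continuousOn hv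
    rw [ENNReal.coe_mul, ENNReal.coe_toNNReal hKfin]
    calc wnorm (powWeight k) (fun r => ((Q m r * momentQ m v r : ℝ) : ℂ))
        ≤ l2norm (fun r => (ENNReal.ofReal (4 * Qconst m) * wnorm (adaptedWeight k m) v) *
            ENNReal.ofReal (r ^ 2 * (1 + r + r ^ 2) * Q m r * (r ^ k)⁻¹)) := by
          refine l2norm_mono fun r hr => ?_
          have hq := Q_pos m hr
          have h := enorm_momentQ_le (by omega : 4 ≤ m + k) hkm hvm hr
          unfold powWeight
          have e1 : ‖((Q m r * momentQ m v r : ℝ) : ℂ)‖ₑ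
              = ENNReal.ofReal (Q m r) * ‖momentQ m v r‖ₑ := by
            rw [← ofReal_norm, Complex.norm_real, ofReal_norm, enorm_mul, Real.enorm_eq_ofReal_abs,
              abs_of_pos hq]
          rw [e1]
          calc ENNReal.ofReal (r ^ k)⁻¹ * (ENNReal.ofReal (Q m r) * ‖momentQ m v r‖ₑ)
              ≤ ENNReal.ofReal (r ^ k)⁻¹ * (ENNReal.ofReal (Q m r) *
                (ENNReal.ofReal (4 * Qconst m) *
                  (ENNReal.ofReal (r ^ 3) * wnorm (adaptedWeight k m) v))) := by gcongr
            _ = (ENNReal.ofReal (4 * Qconst m) * wnorm (adaptedWeight k m) v) *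
                ENNReal.ofReal (r ^ 3 * Q m r * (r ^ k)⁻¹) := by
                rw [ENNReal.ofReal_mul (p := r ^ 3 * Q m r) (by positivity),
                  ENNReal.ofReal_mul (p := r ^ 3) (by positivity)]
                ring
            _ ≤ _ := by
                gcongr
                nlinarith [sq_nonneg r, pow_pos hr 2, pow_pos hr 4]
      _ = _ := by
          rw [l2norm_const_mul (ENNReal.mul_ne_top ENNReal.ofReal_ne_top hfin), ← hK]
          simp only [ENNReal.ofReal]
          ring

/-- The potential terms of `L_Q` are controlled to higher order as soon as `q = r ∂₊ v` is
controlled in terms of them. -/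
lemma exists_potential_eulerBound (hk : 3 ≤ k) (hkm : k ≤ m + 2) (N : ℕ) (c : NNReal) :
    ∃ C : NNReal, ∀ (B : ℝ≥0∞) (v q : ℝ → ℂ),
      HasEulerDeriv v (fun r => q r + (m : ℝ) • v r) → wnorm (adaptedWeight k m) v ≤ B →
      wnorm (adaptedWeight k m) v ≠ ∞ →
      (∀ n, n < N → ∀ B', B ≤ B' →
        EulerBound (powWeight k) B' n (fun r => (1 + tanhProfile m r) • v r) →
        EulerBound (powWeight k) B' n (fun r => ((Q m r * momentQ m v r : ℝ) : ℂ)) →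
        EulerBound (powWeight k) (c * B') n q) →
      EulerBound (powWeight k) (C * B) N (fun r => (1 + tanhProfile m r) • v r) ∧
      EulerBound (powWeight k) (C * B) N (fun r => ((Q m r * momentQ m v r : ℝ) : ℂ)) := by
  have hW := measurable_powWeight k
  obtain ⟨C₀, hC₀⟩ := exists_potential_bound hk hkm (k := k) (m := m)
  obtain ⟨s₁, h₁⟩ := tanhProfile_polynomial_symbolBound m N
    (Polynomial.C ((m : ℝ) + 1) * (1 - Polynomial.X) + Polynomial.C (m : ℝ))
  obtain ⟨s₂, h₂⟩ := tanhProfile_polynomial_symbolBound m N (1 + Polynomial.X)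
  obtain ⟨s₃, h₃⟩ := tanhProfile_polynomial_symbolBound m N
    (-(1 + Polynomial.C ((m : ℝ) + 1) * Polynomial.X))
  obtain ⟨s₄, h₄⟩ := tanhProfile_polynomial_symbolBound m N
    (Polynomial.C (2 * ((m : ℝ) + 1) ^ 2) * (1 - Polynomial.X))
  simp only [Polynomial.eval_add, Polynomial.eval_mul, Polynomial.eval_C, Polynomial.eval_sub,
    Polynomial.eval_one, Polynomial.eval_X, Polynomial.eval_neg] at h₁ h₂ h₃ h₄
  set K : NNReal := 2 ^ N * s₁ + 2 ^ N * s₂ * c + (2 ^ N * s₃ + 2 ^ N * s₄) with hKdef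
  have h2 : ∀ n, n < N → ∀ s : NNReal, 2 ^ n * s ≤ 2 ^ N * s := fun n hn s => by
    gcongr
    norm_num
  refine ⟨(1 + K) ^ N * (1 + C₀), fun B v q hv hvB hfin hstep => ?_⟩
  obtain ⟨b₁, b₂⟩ := hC₀ v hv.continuousOn hfin
  have hB₀ : (C₀ : ℝ≥0∞) * wnorm (adaptedWeight k m) v ≤ (1 + C₀ : NNReal) * B := by
    gcongr
    simp
  have hBB : B ≤ (1 + C₀ : NNReal) * B := by
    calc B = ((1 : NNReal) : ℝ≥0∞) * B := by simp
      _ ≤ _ := by gcongr; simp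
  -- The family has two members: `true` stands for (1 + u)v and `false` for Q times the moment.
  have hboot := EulerBound.bootstrap (W := powWeight k) (B := (1 + C₀ : NNReal) * B) (c := K)
    (N := N) (f := fun i : Bool => if i then (fun r => (1 + tanhProfile m r) • v r)
      else (fun r => ((Q m r * momentQ m v r : ℝ) : ℂ)))
    (g := fun i : Bool => if i then
      (fun r => (((m : ℝ) + 1) * (1 - tanhProfile m r) + m) • ((1 + tanhProfile m r) • v r)
        + (1 + tanhProfile m r) • q r)
      else (fun r => (-(1 + ((m : ℝ) + 1) * tanhProfile m r)) • ((Q m r * momentQ m v r : ℝ) : ℂ)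
        + (2 * ((m : ℝ) + 1) ^ 2 * (1 - tanhProfile m r)) •
          ((((1 + tanhProfile m r) • v r).re : ℝ) : ℂ)))
    (fun i => by
      cases i
      · simpa using hasEulerDeriv_Q_mul_momentQ (by omega) hkm hv.continuousOn hfin
      · simpa using hasEulerDeriv_one_add_tanhProfile_smul hv)
    (fun i => by
      cases i
      · simpa using b₂.mono hB₀
      · simpa using b₁.mono hB₀)
    (fun n hn B' hB' hj i => by
      have j₁ := hj true
      have j₂ := hj false
      simp only [if_true] at j₁
      simp only [Bool.false_eq_true, if_false] at j₂
      have hq := hstep n hn B' (hBB.trans hB') j₁ j₂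
      cases i
      · simp only [Bool.false_eq_true, if_false]
        refine (((h₃.of_le hn.le).smul hW j₂).add hW ((h₄.of_le hn.le).smul hW j₁.re)).mono ?_
        rw [← add_mul, ← ENNReal.coe_add]
        gcongr
        exact (add_le_add (h2 n hn _) (h2 n hn _)).trans le_add_self
      · simp only [if_true]
        refine (((h₁.of_le hn.le).smul hW j₁).add hW ((h₂.of_le hn.le).smul hW hq)).mono ?_
        rw [← mul_assoc, ← ENNReal.coe_mul, ← add_mul, ← ENNReal.coe_add]
        gcongr
        exact (add_le_add (h2 n hn _) (mul_le_mul_left (h2 n hn _) _)).trans le_self_add)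
  have e : (((1 + K) ^ N : NNReal) : ℝ≥0∞) * ((1 + C₀ : NNReal) * B)
      = ((1 + K) ^ N * (1 + C₀) : NNReal) * B := by
    rw [ENNReal.coe_mul, mul_assoc]
  rw [e] at hboot
  exact ⟨by simpa using hboot true, by simpa using hboot false⟩

end potential

lemma EulerBound.continuousOn {W : ℝ → ℝ≥0∞} {B : ℝ≥0∞} {n : ℕ} {f : ℝ → ℂ}
    (h : EulerBound W B (n + 1) f) : ContinuousOn f (Ioi 0) := by
  obtain ⟨-, g, hg, -⟩ := h
  exact hg.continuousOn

lemma EulerBound.sub {W : ℝ → ℝ≥0∞} (hW : Measurable W) {B B' : ℝ≥0∞} {n : ℕ} {f g : ℝ → ℂ}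
    (hf : EulerBound W B n f) (hg : EulerBound W B' n g) :
    EulerBound W (B + B') n (fun r => f r - g r) := by
  have := hf.add hW (hg.const_smul (-1))
  simpa [sub_eq_add_neg] using this

/-- A bound for `q = r ∂₊ v` gives a bound for `r L_Q v`. -/
lemma exists_LQ_bound {k m : ℕ} (hk : 3 ≤ k) (hkm : k ≤ m + 2) : ∃ C : NNReal,
    ∀ (B : ℝ≥0∞) (v : ℝ → ℂ), B ≠ ∞ → AdaptedBound k m B v →
      EulerBound (powWeight k) (C * B) (k - 1) (fun r => r ^ 1 • LQ m v r) := by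
  obtain ⟨C, hC⟩ := exists_potential_eulerBound hk hkm (k - 1) 1
  refine ⟨1 + (‖(m : ℝ) + 1‖₊ * C + C), fun B v hB ⟨q, hq, hqB, hv⟩ => ?_⟩
  obtain ⟨h1, h2⟩ := hC B v q hq hv (ne_top_of_le_ne_top hB hv) fun n hn B' hB' _ _ =>
    ((hqB.of_le hn.le).mono hB').mono (by simp)
  have hW := measurable_powWeight k
  have hqc : ContinuousOn q (Ioi 0) := (hqB.of_le (k := 0 + 1) (by omega)).continuousOn
  have h := hqB.add hW ((h1.const_smul ((m : ℝ) + 1)).add hW h2)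
  refine (h.mono (le_of_eq (by push_cast; ring))).congr fun r hr => ?_
  have hmc : ContinuousOn (fun r => (m : ℝ) • v r) (Ioi 0) := hq.continuousOn.const_smul (m : ℝ)
  have hd := hq.hasDerivAt (hqc.add hmc) hr
  rw [LQ_eq_of_hasDerivAt hr hd, pow_one, smul_inv_smul₀ hr.ne', smul_smul]

lemma exists_op3_bound {m : ℕ} (hm : 1 ≤ m) : ∃ C : NNReal, ∀ (B : ℝ≥0∞) (v : ℝ → ℂ),
    B ≠ ∞ → AdaptedBound 3 m B v → l2norm (fun r => ‖op3 m v r‖ₑ) ≤ C * B := by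
  obtain ⟨C₀, h₀⟩ := exists_LQ_bound (k := 3) (m := m) le_rfl (by omega)
  obtain ⟨C₁, h₁⟩ := exists_firstOrder_AQ m 1 1
  obtain ⟨C₂, h₂⟩ := exists_firstOrder_AQstar m 0 2
  have hW := measurable_powWeight 3
  refine ⟨C₂ * (C₁ * C₀), fun B v hB hv => ?_⟩
  simp only [ENNReal.coe_mul, mul_assoc]
  have h := (h₂ _ _ _ hW (h₁ _ _ _ hW (h₀ B v hB hv))).wnorm_le
  rw [wnorm_pow_smul] at h
  exact h

lemma exists_op5_bound {m : ℕ} (hm : 3 ≤ m) : ∃ C : NNReal, ∀ (B : ℝ≥0∞) (v : ℝ → ℂ),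
    B ≠ ∞ → AdaptedBound 5 m B v → l2norm (fun r => ‖op5 m v r‖ₑ) ≤ C * B := by
  obtain ⟨C₀, h₀⟩ := exists_LQ_bound (k := 5) (m := m) (by norm_num) (by omega)
  obtain ⟨C₁, h₁⟩ := exists_firstOrder_AQ m 3 1
  obtain ⟨C₂, h₂⟩ := exists_firstOrder_AQstar m 2 2
  obtain ⟨C₃, h₃⟩ := exists_firstOrder_AQ m 1 3
  obtain ⟨C₄, h₄⟩ := exists_firstOrder_AQstar m 0 4
  have hW := measurable_powWeight 5
  refine ⟨C₄ * (C₃ * (C₂ * (C₁ * C₀))), fun B v hB hv => ?_⟩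
  simp only [ENNReal.coe_mul, mul_assoc]
  have h := (h₄ _ _ _ hW (h₃ _ _ _ hW (h₂ _ _ _ hW (h₁ _ _ _ hW (h₀ B v hB hv))))).wnorm_le
  rw [wnorm_pow_smul] at h
  exact h

/-! ### Regularity and iterated derivatives -/

/-- `f` is of class `C^{n-1}` on `(0,∞)` with locally absolutely continuous derivative of order
`n - 1`. -/
def Regular : ℕ → (ℝ → ℂ) → Prop
  | 0, f => AEMeasurable f halfLine
  | n + 1, f => ContDiffOn ℝ n f (Ioi 0) ∧ LocAC (iteratedDeriv n f)

lemma contDiffOn_deriv {n : ℕ} {f : ℝ → ℂ} (h : ContDiffOn ℝ (n + 1 : ℕ) f (Ioi 0)) :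
    ContDiffOn ℝ n (deriv f) (Ioi 0) :=
  ((contDiffOn_succ_iff_deriv_of_isOpen isOpen_Ioi).1 (by simpa using h)).2.2

lemma contDiffOn_iteratedDeriv {n j : ℕ} {f : ℝ → ℂ} (h : ContDiffOn ℝ (n + j : ℕ) f (Ioi 0)) :
    ContDiffOn ℝ n (iteratedDeriv j f) (Ioi 0) := by
  induction j generalizing f with
  | zero => simpa using h
  | succ j ih =>
    rw [iteratedDeriv_succ']
    exact ih (contDiffOn_deriv h)

lemma differentiableAt_of_contDiffOn {n : ℕ} {f : ℝ → ℂ} (h : ContDiffOn ℝ (n + 1 : ℕ) f (Ioi 0))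
    {r : ℝ} (hr : 0 < r) : DifferentiableAt ℝ f r :=
  (h.differentiableOn (by simp)).differentiableAt (Ioi_mem_nhds hr)

lemma LocAC.ae_differentiableAt {f : ℝ → ℂ} (hf : LocAC f) :
    ∀ᵐ r ∂halfLine, DifferentiableAt ℝ f r := by
  rw [ae_halfLine_iff]
  have h : ∀ n : ℕ, ∀ᵐ r, r ∈ uIcc ((n + 2 : ℝ)⁻¹) (n + 2) → DifferentiableAt ℝ f r := fun n => by
    refine (hf _ _ (by positivity) ?_).boundedVariationOn.ae_differentiableAt_of_mem_uIcc
    have : (n + 2 : ℝ)⁻¹ < 1 := inv_lt_one_of_one_lt₀ (by linarith [n.cast_nonneg (α := ℝ)])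
    linarith [n.cast_nonneg (α := ℝ)]
  filter_upwards [ae_all_iff.2 h] with r hr hr0
  obtain ⟨n, hn⟩ := exists_nat_gt (max r r⁻¹)
  refine hr n (mem_uIcc.2 (Or.inl ⟨(inv_lt_of_inv_lt₀ hr0 ?_).le, ?_⟩))
  · linarith [le_max_right r r⁻¹]
  · linarith [le_max_left r r⁻¹]

namespace Regular

variable {n : ℕ} {f g : ℝ → ℂ}

lemma deriv (h : Regular (n + 1) f) : Regular n (deriv f) := by
  cases n with
  | zero => exact (measurable_deriv f).aemeasurable
  | succ n =>
    refine ⟨contDiffOn_deriv h.1, ?_⟩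
    have := h.2
    rwa [iteratedDeriv_succ'] at this

lemma locAC (h : Regular (n + 1) f) : LocAC f := by
  cases n with
  | zero => simpa using h.2
  | succ n => exact locAC_of_contDiffOn (h.1.of_le (by simp))

lemma aemeasurable (h : Regular n f) : AEMeasurable f halfLine := by
  cases n with
  | zero => exact h
  | succ n => exact aemeasurable_of_continuousOn h.locAC.continuousOn

lemma pred (h : Regular (n + 1) f) : Regular n f := by
  cases n with
  | zero => exact h.aemeasurable
  | succ n =>
    exact ⟨h.1.of_le (by simp), locAC_of_contDiffOn (contDiffOn_iteratedDeriv
      (n := 1) (j := n) (h.1.of_le (by norm_cast; omega)))⟩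

lemma hasEulerDeriv (h : Regular (n + 1) f) :
    HasEulerDeriv f (fun r => r • _root_.deriv f r) := by
  refine ⟨h.locAC, ?_⟩
  filter_upwards [h.locAC.ae_differentiableAt, ae_restrict_mem measurableSet_Ioi] with r h1 h2
  rw [smul_smul, inv_mul_cancel₀ (ne_of_gt h2), one_smul]
  exact h1.hasDerivAt

lemma of_contDiffOn (h : ContDiffOn ℝ n f (Ioi 0)) : Regular n f := by
  cases n with
  | zero => exact aemeasurable_of_continuousOn h.continuousOn
  | succ n =>
    exact ⟨h.of_le (by norm_cast; omega), locAC_of_contDiffOn (contDiffOn_iteratedDeriv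
      (n := 1) (j := n) (h.of_le (by norm_cast; omega)))⟩

lemma add (hf : Regular n f) (hg : Regular n g) : Regular n (fun r => f r + g r) := by
  cases n with
  | zero => exact AEMeasurable.add hf hg
  | succ n =>
    refine ⟨hf.1.add hg.1, LocAC.congr (f := fun r => iteratedDeriv n f r + iteratedDeriv n g r)
      (fun a b ha hb => (hf.2 a b ha hb).fun_add (hg.2 a b ha hb)) fun r hr => ?_⟩
    exact (iteratedDeriv_fun_add (hf.1.contDiffAt (Ioi_mem_nhds hr))
      (hg.1.contDiffAt (Ioi_mem_nhds hr))).symm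

lemma const_smul (c : ℝ) (hf : Regular n f) : Regular n (fun r => c • f r) := by
  cases n with
  | zero => exact AEMeasurable.const_smul hf c
  | succ n =>
    refine ⟨hf.1.const_smul c, LocAC.congr (f := fun r => c • iteratedDeriv n f r)
      (fun a b ha hb => (hf.2 a b ha hb).const_smul c) fun r hr => ?_⟩
    exact (iteratedDeriv_fun_const_smul (hf.1.contDiffAt (Ioi_mem_nhds hr)) c).symm

lemma congr (hf : Regular n f) (h : ∀ r, 0 < r → f r = g r) : Regular n g := by
  cases n with
  | zero => exact AEMeasurable.congr hf (ae_halfLine_of_forall h)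
  | succ n =>
    refine ⟨hf.1.congr fun r hr => (h r hr).symm, hf.2.congr fun r hr => ?_⟩
    refine Filter.EventuallyEq.iteratedDeriv_eq n ?_
    filter_upwards [Ioi_mem_nhds hr] with x hx
    exact h x hx

lemma aemeasurable_iteratedDeriv (hf : Regular n f) (j : ℕ) :
    AEMeasurable (iteratedDeriv j f) halfLine := by
  cases j with
  | zero => simpa using hf.aemeasurable
  | succ j => rw [iteratedDeriv_succ]; exact (measurable_deriv _).aemeasurable

/-- One order of regularity is given up so that the product is of class C^n and no Leibniz formula
for the absolutely continuous top derivative is needed. -/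
lemma smul_of_succ {t : ℝ → ℝ} (ht : ContDiffOn ℝ n t (Ioi 0)) (hf : Regular (n + 1) f) :
    Regular n (fun r => t r • f r) := by
  cases n with
  | zero => exact (aemeasurable_of_continuousOn ht.continuousOn).smul hf.aemeasurable
  | succ n => exact of_contDiffOn (ht.smul hf.1)

end Regular

/-! ### Euler derivatives and iterated derivatives -/

/-- Induction from r∂_r(r^i f) = i r^i f + r^{i+1} f', which lowers the order and raises the
exponent; hence `i` is kept general. -/
lemma exists_eulerBound_of_iteratedDeriv (n i : ℕ) : ∃ C : NNReal,
    ∀ (W : ℝ → ℝ≥0∞) (B : ℝ≥0∞) (f : ℝ → ℂ), Measurable W → Regular n f →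
      (∀ j ≤ n, wnorm W (fun r => r ^ (i + j) • iteratedDeriv j f r) ≤ B) →
      EulerBound W (C * B) n (fun r => r ^ i • f r) := by
  have hm : ∀ i f, AEMeasurable f halfLine → AEMeasurable (fun r : ℝ => r ^ i • f r : ℝ → ℂ) halfLine :=
    fun i f hf => (measurable_id.pow_const i).aemeasurable.smul hf
  induction n generalizing i with
  | zero =>
    exact ⟨1, fun W B f hW hf h => ⟨hm i f hf.aemeasurable, by simpa using h 0 le_rfl⟩⟩
  | succ n ih =>
    obtain ⟨C₁, h₁⟩ := ih i
    obtain ⟨C₂, h₂⟩ := ih (i + 1)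
    refine ⟨1 + (‖(i : ℝ)‖₊ * C₁ + C₂), fun W B f hW hf h =>
      ⟨⟨hm i f hf.aemeasurable, ?_⟩, _, (hasEulerDeriv_pow i).smul hf.hasEulerDeriv, ?_⟩⟩
    · have h0 := h 0 (by omega)
      simp only [add_zero, iteratedDeriv_zero] at h0
      refine h0.trans ?_
      push_cast
      rw [add_mul, one_mul]
      exact le_self_add
    · have e₁ := h₁ W B f hW hf.pred fun j hj => h j (by omega)
      have e₂ := h₂ W B (deriv f) hW hf.deriv fun j hj => by
        have := h (j + 1) (by omega)
        rw [iteratedDeriv_succ'] at this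
        rwa [add_assoc, add_comm 1 j]
      refine (((e₁.const_smul i).add hW e₂).mono ?_).congr fun r hr => ?_
      · push_cast
        rw [add_mul, one_mul, add_mul, ← mul_assoc]
        exact le_add_self
      · rw [smul_smul, smul_smul, pow_succ]

/-- The converse passage: ∂_r is a first order operator with zero potential, so
`EulerBound.firstOrder` trades one Euler derivative for one ordinary derivative and one power of r.
-/
lemma exists_iteratedDeriv_bound (n i : ℕ) : ∃ C : NNReal,
    ∀ (W : ℝ → ℝ≥0∞) (B : ℝ≥0∞) (f : ℝ → ℂ), Measurable W →
      EulerBound W B n (fun r => r ^ i • f r) →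
      ∀ j ≤ n, wnorm W (fun r => r ^ (i + j) • iteratedDeriv j f r) ≤ C * B := by
  induction n generalizing i with
  | zero =>
    refine ⟨1, fun W B f _ h j hj => ?_⟩
    obtain rfl : j = 0 := by omega
    simpa using h.wnorm_le
  | succ n ih =>
    obtain ⟨K, hK⟩ := EulerBound.firstOrder (SymbolBound.const 0 n) 1 i
    obtain ⟨C, hC⟩ := ih (i + 1)
    refine ⟨1 + C * K, fun W B f hW h j hj => ?_⟩
    push_cast
    rw [add_mul, one_mul]
    rcases j with _ | j
    · simpa using h.wnorm_le.trans le_self_add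
    · have := hC W (K * B) (deriv f) hW (hK W B f _ hW (by simp) h) j (by omega)
      rw [iteratedDeriv_succ']
      rw [add_assoc, add_comm 1 j, ← mul_assoc] at this
      exact this.trans le_add_self

/-- Leibniz' rule for `q = r f' - c f`. -/
lemma smul_iteratedDeriv_succ {f : ℝ → ℂ} (c : ℝ) {j : ℕ} (h : ContDiffOn ℝ j f (Ioi 0)) {r : ℝ}
    (hr : 0 < r) (hd : DifferentiableAt ℝ (iteratedDeriv j f) r) :
    r • iteratedDeriv (j + 1) f r = iteratedDeriv j (fun x => x • deriv f x - c • f x) r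
      + (c - j) • iteratedDeriv j f r := by
  induction j generalizing r with
  | zero => simp
  | succ j ih =>
    have hj : ∀ x, 0 < x → DifferentiableAt ℝ (iteratedDeriv j f) x := fun x hx =>
      differentiableAt_of_contDiffOn (n := 0) (contDiffOn_iteratedDeriv (n := 1) (j := j)
        (h.of_le (by norm_cast; omega))) hx
    have he : iteratedDeriv j (fun x => x • deriv f x - c • f x) =ᶠ[𝓝 r]
        fun x => x • iteratedDeriv (j + 1) f x - (c - j) • iteratedDeriv j f x := by
      filter_upwards [Ioi_mem_nhds hr] with x hx
      rw [ih (h.of_le (by norm_cast; omega)) hx (hj x hx)]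
      simp
    have h1 := (hasDerivAt_id r).smul hd.hasDerivAt
    have h2 : HasDerivAt (iteratedDeriv j f) (iteratedDeriv (j + 1) f r) r := by
      rw [iteratedDeriv_succ]
      exact (hj r hr).hasDerivAt
    have h3 := (h1.sub (h2.const_smul (c - (j : ℝ)))).congr_of_eventuallyEq he
    rw [iteratedDeriv_succ (n := j) (f := fun x => x • deriv f x - c • f x), h3.deriv,
      iteratedDeriv_succ (n := j + 1)]
    simp only [Complex.real_smul, id]
    push_cast
    ring

/-! ### Bounds for the adapted norm -/

lemma enorm_le_homAbs {n j : ℕ} (hj : j ≤ n) (f : ℝ → ℂ) (r : ℝ) :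
    ‖(r ^ (n - j))⁻¹ • iteratedDeriv j f r‖ₑ ≤ homAbs n f r := by
  refine le_trans (le_of_eq ?_) (le_iSup
    (fun ℓ : Fin (n + 1) => ‖(r ^ (ℓ : ℕ))⁻¹ • iteratedDeriv (n - ℓ) f r‖ₑ) ⟨n - j, by omega⟩)
  simp only [Nat.sub_sub_self hj]

lemma l2norm_mul_homAbs_le {W : ℝ → ℝ≥0∞} (hW : Measurable W) {n : ℕ} {f : ℝ → ℂ}
    (hf : ∀ j, AEMeasurable (iteratedDeriv j f) halfLine) {B : ℝ≥0∞}
    (hB : ∀ j ≤ n, wnorm W (fun r => (r ^ (n - j))⁻¹ • iteratedDeriv j f r) ≤ B) :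
    l2norm (fun r => W r * homAbs n f r) ≤ (n + 1 : NNReal) * B := by
  calc l2norm (fun r => W r * homAbs n f r)
      ≤ l2norm (fun r => ∑ ℓ : Fin (n + 1),
          W r * ‖(r ^ (ℓ : ℕ))⁻¹ • iteratedDeriv (n - ℓ) f r‖ₑ) := by
        refine l2norm_mono fun r _ => ?_
        rw [← Finset.mul_sum]
        gcongr
        exact iSup_le fun ℓ => Finset.single_le_sum
          (f := fun ℓ : Fin (n + 1) => ‖(r ^ (ℓ : ℕ))⁻¹ • iteratedDeriv (n - ℓ) f r‖ₑ)
          (fun _ _ => zero_le) (Finset.mem_univ ℓ)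
    _ ≤ ∑ ℓ : Fin (n + 1), wnorm W (fun r => (r ^ (ℓ : ℕ))⁻¹ • iteratedDeriv (n - ℓ) f r) :=
        l2norm_sum_le _ _ fun ℓ _ => hW.aemeasurable.mul
          (((measurable_id.pow_const _).inv.aemeasurable.smul (hf _)).enorm)
    _ ≤ ∑ ℓ : Fin (n + 1), B := by
        refine Finset.sum_le_sum fun ℓ _ => ?_
        have := hB (n - ℓ) (Nat.sub_le _ _)
        rwa [Nat.sub_sub_self (Nat.lt_succ_iff.1 ℓ.2)] at this
    _ = _ := by simp

lemma powWeight_mul_enorm {E : Type*} [NormedAddCommGroup E] [NormedSpace ℝ E] {k i : ℕ}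
    (hi : i ≤ k) {r : ℝ} (hr : 0 < r) (x : E) :
    powWeight k r * ‖r ^ i • x‖ₑ = ‖(r ^ (k - i))⁻¹ • x‖ₑ := by
  unfold powWeight
  rw [enorm_smul, enorm_smul, ← mul_assoc, Real.enorm_eq_ofReal_abs, Real.enorm_eq_ofReal_abs,
    abs_of_pos (by positivity), abs_of_pos (by positivity), ← ENNReal.ofReal_mul (by positivity)]
  congr 3
  rw [pow_sub₀ _ hr.ne' hi]
  field_simp

lemma adaptedWeight_mul_enorm {k m i : ℕ} (hi : i ≤ k) {r : ℝ} (hr : 0 < r) (x : ℂ) :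
    adaptedWeight k m r * ‖r ^ i • x‖ₑ =
      ENNReal.ofReal (weightLoss k m r) * ‖(r ^ (k - i))⁻¹ • x‖ₑ := by
  rw [← powWeight_mul_enorm hi hr, adaptedWeight, powWeight,
    ENNReal.ofReal_mul (weightLoss_nonneg k m hr), mul_assoc]

lemma Regular.dPlus {n m : ℕ} {v : ℝ → ℂ} (h : Regular (n + 1) v) : Regular n (dPlus m v) := by
  have h1 : Regular n (fun r => ((m : ℝ) / r) • v r) :=
    Regular.smul_of_succ (contDiffOn_const.div contDiffOn_id fun r hr => (ne_of_gt hr)) h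
  refine (h.deriv.add (h1.const_smul (-1))).congr fun r _ => ?_
  simp [ChernSimons.dPlus, sub_eq_add_neg]

lemma smul_dPlus {m : ℕ} (v : ℝ → ℂ) {r : ℝ} (hr : 0 < r) :
    r • dPlus m v r = r • deriv v r - (m : ℝ) • v r := by
  rw [dPlus, smul_sub, smul_smul, mul_div_cancel₀ _ hr.ne']

lemma measurable_inv_mul_japanese : Measurable
    (fun r : ℝ => ENNReal.ofReal (r⁻¹ * (japanese r)⁻¹ * (japanese (logMinus r))⁻¹)) := by
  have := measurable_japanese
  have := measurable_logMinus
  fun_prop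

lemma measurable_inv_mul_japanese_logMinus : Measurable
    (fun r : ℝ => ENNReal.ofReal (r⁻¹ * (japanese (logMinus r))⁻¹)) := by
  have := measurable_japanese
  have := measurable_logMinus
  fun_prop

/-- The zeroth order part of the adapted norm. -/
lemma wnorm_adaptedWeight_le {k : ℕ} (hk : 2 ≤ k) (m : ℕ) (v : ℝ → ℂ) :
    wnorm (adaptedWeight k m) v ≤ adaptedNorm k m v := by
  have key : ∀ r, 0 < r → adaptedWeight k m r * ‖v r‖ₑ
      = ENNReal.ofReal (weightLoss k m r) * ‖(r ^ k)⁻¹ • v r‖ₑ := fun r hr => by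
    simpa using adaptedWeight_mul_enorm (k := k) (m := m) (i := 0) (by omega) hr (v r)
  have split : ∀ i ≤ k, ∀ r : ℝ, 0 < r → ‖(r ^ k)⁻¹ • v r‖ₑ
      = ENNReal.ofReal (r ^ i)⁻¹ * ‖(r ^ (k - i))⁻¹ • v r‖ₑ := fun i hi r hr => by
    rw [enorm_smul, enorm_smul, ← mul_assoc, Real.enorm_eq_ofReal_abs, Real.enorm_eq_ofReal_abs,
      abs_of_pos (by positivity), abs_of_pos (by positivity), ← ENNReal.ofReal_mul (by positivity)]
    congr 2
    rw [← mul_inv, ← pow_add, Nat.add_sub_cancel' hi]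
  unfold adaptedNorm
  refine le_trans ?_ le_add_self
  split_ifs with h1 h2
  · refine l2norm_mono fun r hr => ?_
    rw [key r hr, weightLoss, if_pos h1, ENNReal.ofReal_one, one_mul]
    simpa using enorm_le_homAbs (Nat.zero_le k) v r
  · refine le_trans (l2norm_mono fun r hr => ?_) le_add_self
    have hJ := japanese_pos (logMinus r)
    rw [key r hr, weightLoss, if_neg h1, if_pos h2, split 1 (by omega) r hr, ← mul_assoc,
      ← ENNReal.ofReal_mul (by positivity), pow_one, mul_comm r⁻¹]
    gcongr
    simpa using enorm_le_homAbs (Nat.zero_le (k - 1)) v r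
  · refine le_trans (l2norm_mono fun r hr => ?_) le_add_self
    have hJ := japanese_pos (logMinus r)
    have hJ' := japanese_pos r
    rw [key r hr, weightLoss, if_neg h1, if_neg h2, split 2 hk r hr, ← mul_assoc,
      ← ENNReal.ofReal_mul (by positivity)]
    refine mul_le_mul' (ENNReal.ofReal_le_ofReal (le_of_eq ?_)) ?_
    · field_simp
    · simpa using enorm_le_homAbs (Nat.zero_le (k - 2)) v r

/-- Only the ∂₊ part of the adapted norm and its zeroth order part are used; the other terms follow
from these. -/
lemma exists_adaptedBound_of_adaptedNorm {k : ℕ} (hk : 2 ≤ k) (m : ℕ) :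
    ∃ C : NNReal, ∀ v, Regular k v → AdaptedBound k m (C * adaptedNorm k m v) v := by
  obtain ⟨C, hC⟩ := exists_eulerBound_of_iteratedDeriv (k - 1) 1
  obtain ⟨n, rfl⟩ : ∃ n, k = n + 1 := ⟨k - 1, by omega⟩
  simp only [Nat.add_sub_cancel] at hC
  refine ⟨1 + C, fun v hv => ⟨fun r => r ^ 1 • dPlus m v r, ?_, ?_, ?_⟩⟩
  · refine hv.hasEulerDeriv.congr (fun _ _ => rfl) (ae_halfLine_of_forall fun r hr => ?_)
    simp [smul_dPlus v hr]
  · refine (hC _ (l2norm (homAbs n (dPlus m v))) _ (measurable_powWeight _) hv.dPlus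
      fun j hj => ?_).mono ?_
    · refine l2norm_mono fun r hr => ?_
      rw [powWeight_mul_enorm (by omega) hr, show n + 1 - (1 + j) = n - j by omega]
      exact enorm_le_homAbs hj _ _
    · push_cast
      rw [add_mul]
      refine le_trans ?_ le_add_self
      gcongr
      exact le_self_add
  · refine (wnorm_adaptedWeight_le hk m v).trans ?_
    push_cast
    rw [add_mul, one_mul]
    exact le_self_add

/-- Control of the Euler derivatives of `v` by those of `q = r ∂₊ v`. -/
lemma EulerBound.of_dPlus {W : ℝ → ℝ≥0∞} (hW : Measurable W) {B : ℝ≥0∞} {n : ℕ} {c : ℝ}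
    {v q : ℝ → ℂ} (hv : HasEulerDeriv v (fun r => q r + c • v r)) (hq : EulerBound W B n q)
    (h0 : wnorm W v ≤ B) :
    EulerBound W (((1 + (1 + ‖c‖₊)) ^ (n + 1) : NNReal) * B) (n + 1) v := by
  refine EulerBound.bootstrap (ι := Unit) (f := fun _ => v) (g := fun _ r => q r + c • v r)
    (fun _ => hv) (fun _ => ⟨aemeasurable_of_continuousOn hv.continuousOn, h0⟩)
    (fun j hj B' hB hjv _ => ?_) ()
  refine ((((hq.of_le (by omega)).mono hB).add hW ((hjv ()).const_smul c))).mono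
    (le_of_eq ?_)
  push_cast
  ring

/-- The equation r∂_r v = q + mv recovers k Euler derivatives of v in the adapted weight. The
unweighted top derivatives occurring for m = k - 1 and m = k - 2 come from the Leibniz identity
r∂^{j+1}v = ∂^j q + (m - j)∂^j v, whose last term drops out at j = m. -/
lemma exists_adaptedNorm_le {k m : ℕ} (hk : 2 ≤ k) (hkm : k ≤ m + 2) :
    ∃ C : NNReal, ∀ (v : ℝ → ℂ) (B : ℝ≥0∞), Regular k v → AdaptedBound k m B v →
      adaptedNorm k m v ≤ C * B := by
  obtain ⟨n, rfl⟩ : ∃ n, k = n + 2 := ⟨k - 2, by omega⟩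
  obtain ⟨C₁, h₁⟩ := exists_iteratedDeriv_bound (n + 1) 1
  obtain ⟨C₂, h₂⟩ := exists_iteratedDeriv_bound (n + 2) 0
  obtain ⟨C₃, h₃⟩ := exists_iteratedDeriv_bound (n + 1) 0
  set K : NNReal := C₂ * (1 + (1 + ‖(m : ℝ)‖₊)) ^ (n + 2) with hK
  refine ⟨(n + 2) * C₁ + ((n + 3) * K + 4 * C₃), fun v B hv ⟨q, hq, hqB, hvB⟩ => ?_⟩
  simp only [show n + 2 - 1 = n + 1 by omega] at hqB
  have hW := measurable_powWeight (n + 2)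
  have hW' := measurable_adaptedWeight (n + 2) m
  have hqe : ∀ r, 0 < r → q r = r • deriv v r - (m : ℝ) • v r := fun r hr => by
    have hmc : ContinuousOn (fun r => (m : ℝ) • v r) (Ioi 0) := hq.continuousOn.const_smul (m : ℝ)
    have hd := hq.hasDerivAt (hqB.continuousOn.add hmc) hr
    rw [hd.deriv, smul_inv_smul₀ hr.ne']
    simp
  have hp := h₁ _ B (dPlus m v) hW (hqB.congr fun r hr => by
    rw [pow_one, smul_dPlus v hr, hqe r hr])
  have hq' := h₃ _ B (fun x => x • deriv v x - (m : ℝ) • v x) hW (hqB.congr fun r hr => by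
    rw [pow_zero, one_smul, hqe r hr])
  have hlow := h₂ _ _ v hW' ((EulerBound.of_dPlus hW' hq ((hqB.mono_weight 1 fun r hr => by
    simpa using adaptedWeight_le (n + 2) m hr).mono (by simp)) hvB).congr fun r hr => by simp)
  have hlow' : ∀ j ≤ n + 2, wnorm (adaptedWeight (n + 2) m)
      (fun r => r ^ j • iteratedDeriv j v r) ≤ K * B := fun j hj => by
    have := hlow j hj
    rw [zero_add, ← mul_assoc, ← ENNReal.coe_mul] at this
    exact this
  have hvm : ∀ j, AEMeasurable (iteratedDeriv j v) halfLine := hv.aemeasurable_iteratedDeriv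
  have first : l2norm (homAbs (n + 1) (dPlus m v)) ≤ ((n + 2) * C₁ : NNReal) * B := by
    have := l2norm_mul_homAbs_le (W := fun _ => 1) measurable_const (n := n + 1) (f := dPlus m v)
      (hv.dPlus.aemeasurable_iteratedDeriv) (B := C₁ * B) (fun j hj => by
        refine le_trans (wnorm_mono fun r hr => ?_) (hp j hj)
        rw [powWeight_mul_enorm (by omega) hr, one_mul, show n + 2 - (1 + j) = n + 1 - j by omega])
    simp only [one_mul] at this
    refine this.trans (le_of_eq ?_)
    push_cast
    ring
  have hident : ∀ j ≤ n + 1, ∀ᵐ r ∂halfLine, r • iteratedDeriv (j + 1) v r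
      = iteratedDeriv j (fun x => x • deriv v x - (m : ℝ) • v x) r
        + ((m : ℝ) - j) • iteratedDeriv j v r := fun j hj => by
    have hc : ContDiffOn ℝ j v (Ioi 0) := hv.1.of_le (by norm_cast)
    have hd : ∀ᵐ r ∂halfLine, DifferentiableAt ℝ (iteratedDeriv j v) r := by
      rcases Nat.lt_or_ge j (n + 1) with h | h
      · exact ae_halfLine_of_forall fun r hr => differentiableAt_of_contDiffOn (n := 0)
          (contDiffOn_iteratedDeriv (n := 1) (j := j) (hv.1.of_le (by norm_cast; omega))) hr
      · obtain rfl : j = n + 1 := by omega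
        exact hv.2.ae_differentiableAt
    filter_upwards [hd, ae_restrict_mem measurableSet_Ioi] with r h1 h2
    exact smul_iteratedDeriv_succ m hc h2 h1
  have second : ∀ W : ℝ → ℝ≥0∞, Measurable W → ∀ i ≤ n + 2, 
      (∀ r, 0 < r → W r ≤ ENNReal.ofReal (weightLoss (n + 2) m r * (r ^ i)⁻¹)) →
      l2norm (fun r => W r * homAbs (n + 2 - i) v r) ≤ ((n + 3) * K : NNReal) * B := by
    intro W hWm i hi hWle
    refine (l2norm_mul_homAbs_le hWm hvm (B := K * B) fun j hj => ?_).trans ?_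
    · refine le_trans (wnorm_mono fun r hr => ?_) (hlow' j (by omega))
      rw [adaptedWeight_mul_enorm (by omega) hr]
      refine (mul_le_mul' (hWle r hr) le_rfl).trans (le_of_eq ?_)
      rw [ENNReal.ofReal_mul (weightLoss_nonneg _ _ hr), mul_assoc, enorm_smul, enorm_smul,
        ← mul_assoc (ENNReal.ofReal (r ^ i)⁻¹), Real.enorm_eq_ofReal_abs, Real.enorm_eq_ofReal_abs,
        abs_of_pos (by positivity), abs_of_pos (by positivity),
        ← ENNReal.ofReal_mul (by positivity), ← mul_inv, ← pow_add,
        show i + (n + 2 - i - j) = n + 2 - j by omega]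
    · rw [← mul_assoc, ← ENNReal.coe_mul]
      refine mul_le_mul' (ENNReal.coe_le_coe.2 (mul_le_mul' ?_ le_rfl)) le_rfl
      exact_mod_cast (by omega : n + 2 - i + 1 ≤ n + 3)
  -- Here m = k - 1 and the identity is used at j = m: the top derivative is r⁻¹ times a derivative
  -- of q, so no weighted bound for v is lost.
  have top : m = n + 1 → l2norm (fun r => ‖iteratedDeriv (n + 2) v r‖ₑ) ≤ C₃ * B := by
    intro hm
    refine le_trans (l2norm_mono_ae ?_) (hq' (n + 1) le_rfl)
    filter_upwards [hident (n + 1) le_rfl, ae_restrict_mem measurableSet_Ioi] with r h1 (h2 : 0 < r)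
    rw [powWeight_mul_enorm (by omega) h2, show n + 2 - (0 + (n + 1)) = 1 by omega]
    rw [hm] at h1 ⊢
    rw [sub_self, zero_smul, add_zero] at h1
    rw [← h1, pow_one, inv_smul_smul₀ h2.ne']
  -- Here m = k - 2: the identity at j = m controls ∂^{k-1}v with weight r⁻¹.
  have top' : m = n → l2norm (homAbs 1 (iteratedDeriv (n + 1) v)) ≤ (4 * C₃ : NNReal) * B := by
    intro hm
    have t1 : l2norm (fun r => ‖(r ^ 1)⁻¹ • iteratedDeriv (n + 1) v r‖ₑ) ≤ C₃ * B := by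
      refine le_trans (l2norm_mono_ae ?_) (hq' n (by omega))
      filter_upwards [hident n (by omega), ae_restrict_mem measurableSet_Ioi] with r h1 (h2 : 0 < r)
      rw [powWeight_mul_enorm (by omega) h2, show n + 2 - (0 + n) = 2 by omega]
      rw [hm] at h1 ⊢
      rw [sub_self, zero_smul, add_zero] at h1
      rw [← h1, smul_smul, pow_one]
      refine le_of_eq ?_
      congr 2
      field_simp
    -- At j = m + 1 the coefficient m - j equals -1, and the extra term is the quantity just bounded
    -- in `t1`.
    have t2 : l2norm (fun r => ‖iteratedDeriv (n + 2) v r‖ₑ) ≤ C₃ * B + C₃ * B := by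
      refine le_trans (l2norm_mono_ae ?_) ((l2norm_add_le ?_ ?_).trans
        (add_le_add (hq' (n + 1) le_rfl) t1))
      · filter_upwards [hident (n + 1) le_rfl, ae_restrict_mem measurableSet_Ioi]
          with r h1 (h2 : 0 < r)
        rw [powWeight_mul_enorm (by omega) h2, show n + 2 - (0 + (n + 1)) = 1 by omega]
        have e : iteratedDeriv (n + 2) v r = (r ^ 1)⁻¹ • (r • iteratedDeriv (n + 1 + 1) v r) := by
          rw [pow_one, inv_smul_smul₀ h2.ne']
        rw [e, h1, smul_add]
        refine (enorm_add_le _ _).trans ?_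
        gcongr 1
        subst hm
        rw [smul_smul, mul_comm, ← smul_smul, enorm_smul]
        push_cast
        simp
      · refine hW.aemeasurable.mul (AEMeasurable.enorm ?_)
        refine (measurable_id.pow_const _).aemeasurable.smul (AEMeasurable.congr
          (f := fun r => r • iteratedDeriv (n + 2) v r - ((m : ℝ) - (n + 1 : ℕ)) •
            iteratedDeriv (n + 1) v r) ?_ ?_)
        · exact (aemeasurable_id.smul (hvm _)).sub
            ((hvm (n + 1)).const_smul ((m : ℝ) - (n + 1 : ℕ)))
        · filter_upwards [hident (n + 1) le_rfl] with r h1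
          rw [h1]; simp
      · exact ((measurable_id.pow_const 1).inv.aemeasurable.smul (hvm _)).enorm
    have := l2norm_mul_homAbs_le (W := fun _ => 1) measurable_const (n := 1)
      (f := iteratedDeriv (n + 1) v) (B := C₃ * B + C₃ * B) (fun j => by
        rcases j with _ | j
        · simpa using hvm _
        · rw [iteratedDeriv_succ]; exact (measurable_deriv _).aemeasurable) (fun j hj => by
        unfold wnorm
        simp only [one_mul]
        interval_cases j
        · simpa using t1.trans le_self_add
        · simpa [iteratedDeriv_one, ← iteratedDeriv_succ] using t2)
    simp only [one_mul] at this
    refine this.trans (le_of_eq ?_)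
    push_cast
    ring
  unfold adaptedNorm
  have hsum : (((n + 2) * C₁ + ((n + 3) * K + 4 * C₃) : NNReal) : ℝ≥0∞) * B
      = ((n + 2) * C₁ : NNReal) * B + (((4 * C₃ : NNReal) * B) + ((n + 3) * K : NNReal) * B) := by
    push_cast; ring
  rw [hsum]
  refine add_le_add first ?_
  split_ifs with c1 c2
  · refine le_trans ?_ le_add_self
    have := second (fun _ => 1) measurable_const 0 (by omega) fun r hr => by
      simp [weightLoss, c1]
    simpa using this
  · refine add_le_add ((top (by omega)).trans ?_) ?_
    · gcongr
      exact le_mul_of_one_le_left zero_le (by norm_num)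
    · refine second _ measurable_inv_mul_japanese_logMinus 1 (by omega) fun r hr => ?_
      rw [weightLoss, if_neg c1, if_pos c2, pow_one, mul_comm]
  · refine add_le_add (top' (by omega)) ?_
    refine second _ measurable_inv_mul_japanese 2 (by omega) fun r hr => ?_
    rw [weightLoss, if_neg c1, if_neg c2]
    refine ENNReal.ofReal_le_ofReal (le_of_eq ?_)
    field_simp

/-! ### Energy estimates for the first order factors -/

lemma wnorm_re_le (W : ℝ → ℝ≥0∞) (f : ℝ → ℂ) : wnorm W (fun r => (f r).re) ≤ wnorm W f := by
  refine l2norm_mono fun r _ => ?_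
  gcongr
  rw [← ofReal_norm (f _).re, ← ofReal_norm (f _)]
  exact ENNReal.ofReal_le_ofReal (Complex.abs_re_le_norm _)

lemma wnorm_im_le (W : ℝ → ℝ≥0∞) (f : ℝ → ℂ) : wnorm W (fun r => (f r).im) ≤ wnorm W f := by
  refine l2norm_mono fun r _ => ?_
  gcongr
  rw [← ofReal_norm (f _).im, ← ofReal_norm (f _)]
  exact ENNReal.ofReal_le_ofReal (Complex.abs_im_le_norm _)

lemma wnorm_le_re_add_im {W : ℝ → ℝ≥0∞} (hW : Measurable W) {f : ℝ → ℂ}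
    (hf : AEMeasurable f halfLine) :
    wnorm W f ≤ wnorm W (fun r => (f r).re) + wnorm W (fun r => (f r).im) := by
  refine le_trans (l2norm_mono fun r _ => ?_) (l2norm_add_le
    (hW.aemeasurable.mul (Complex.measurable_re.comp_aemeasurable hf).enorm)
    (hW.aemeasurable.mul (Complex.measurable_im.comp_aemeasurable hf).enorm))
  rw [← mul_add]
  gcongr
  rw [← ofReal_norm, ← ofReal_norm, ← ofReal_norm, ← ENNReal.ofReal_add (norm_nonneg _)
    (norm_nonneg _)]
  exact ENNReal.ofReal_le_ofReal (Complex.norm_le_abs_re_add_abs_im _)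

lemma wnorm_powWeight_sq (n : ℕ) (f : ℝ → ℝ) :
    wnorm (powWeight n) f ^ 2 = ENNReal.ofReal (2 * Real.pi) *
      ∫⁻ r, ENNReal.ofReal (r⁻¹ * (r * (r ^ n)⁻¹ * f r) ^ 2) ∂halfLine := by
  simp only [inv_mul_eq_div]
  exact wnorm_real_sq (fun r => (r ^ n)⁻¹) f fun r hr => by positivity

lemma lintegral_ne_top_of_wnorm {n : ℕ} {f : ℝ → ℝ} (h : wnorm (powWeight n) f ≠ ∞) :
    ∫⁻ r, ENNReal.ofReal (r⁻¹ * (r * (r ^ n)⁻¹ * f r) ^ 2) ∂halfLine ≠ ∞ := by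
  intro hcon
  have := wnorm_powWeight_sq n f
  rw [hcon, ENNReal.mul_top (by simp [Real.pi_pos])] at this
  exact h (by simpa using this)

lemma abs_mul_tanhProfile_le (m : ℕ) (r : ℝ) : |((m : ℝ) + 1) * tanhProfile m r| ≤ m + 1 := by
  rw [abs_mul, abs_of_nonneg (by positivity)]
  exact mul_le_of_le_one_right (by positivity) (abs_tanhProfile_le m r)

/-- With M = m + 1, expanding g² plus the Euler derivative of (Mu - 1)y² gives a square plus (M² -
2Mu + 1)y². The last coefficient is at least (M - 1)² = m² ≥ 1. Finiteness of the norm of y serves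
only to discard the boundary terms. -/
lemma energy_AQstar_real {m : ℕ} (hm : 1 ≤ m) {y g : ℝ → ℝ}
    (hy : HasEulerDeriv y (fun r => ((m + 1) * tanhProfile m r - 1) * y r - g r))
    (hfin : wnorm (powWeight 1) y ≠ ∞) : wnorm (powWeight 1) y ≤ wnorm (powWeight 1) g := by
  have hm' : (1 : ℝ) ≤ m := by exact_mod_cast hm
  rw [← ENNReal.pow_le_pow_left_iff two_ne_zero, wnorm_powWeight_sq, wnorm_powWeight_sq]
  refine mul_le_mul' le_rfl ?_
  have hu := hasEulerDeriv_tanhProfile m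
  -- The total derivative comes from Φ = (Mu - 1)y², the cross term produced by squaring the
  -- equation.
  have hΦ := (((hu.const_smul ((m : ℝ) + 1)).sub (HasEulerDeriv.const 1)).smul (hy.smul hy))
  have hyc := hy.continuousOn
  have key : ∀ r : ℝ, 0 < r → ∀ a : ℝ, r * (r ^ 1)⁻¹ * a = a := fun r hr a => by field_simp
  refine lintegral_halfLine_le_of_le_add_deriv hΦ ?_ (fun r hr => by positivity)
    (ae_halfLine_of_forall fun r hr => ?_) fun ε hε δ hδ => ?_
  · exact ((continuousOn_id.inv₀ fun r hr => ne_of_gt hr).mul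
      (((continuousOn_id.mul ((continuousOn_id.pow 1).inv₀ fun r hr => by
        simpa using ne_of_gt hr)).mul hyc).pow 2))
  · rw [key r hr, key r hr, ← mul_add]
    gcongr
    have h1 := (abs_le.1 (abs_tanhProfile_le m r)).2
    simp only [smul_eq_mul, sub_zero]
    set u := tanhProfile m r
    set a := y r
    have h2 : 0 ≤ (((m : ℝ) + 1) ^ 2 + 1 - 2 * (m + 1) * u - 1) * a ^ 2 := by
      refine mul_nonneg ?_ (sq_nonneg _)
      nlinarith
    nlinarith [sq_nonneg (((m : ℝ) + 1) * u * a - a - g r)]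
  · have hb := abs_mul_tanhProfile_le m
    -- Since |Mu - 1| ≤ m + 2, this choice makes each of the two boundary terms at most ε/2.
    obtain ⟨a, b, ha, haδ, hb', h1, h2⟩ := exists_small_of_lintegral_ne_top
      (lintegral_ne_top_of_wnorm hfin) (ε := ε / (2 * (m + 2))) (by positivity) hδ
    refine ⟨a, b, ha, haδ, hb', ?_⟩
    have hb0 : 0 < b := (inv_pos.2 hδ).trans hb'
    rw [key a ha] at h1
    rw [key b hb0] at h2
    have e : ∀ x, |(((m : ℝ) + 1) * tanhProfile m x - 1) * (y x * y x)| ≤ (m + 2) * y x ^ 2 := by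
      intro x
      rw [abs_mul, abs_mul_self, ← sq]
      gcongr
      have := abs_le.1 (hb x)
      rw [abs_le]; constructor <;> linarith
    have ea := (abs_le.1 (e a)).1
    have eb := (abs_le.1 (e b)).2
    simp only [smul_eq_mul]
    have h3 : (m + 2 : ℝ) * y a ^ 2 ≤ ε / 2 := by
      calc (m + 2 : ℝ) * y a ^ 2 ≤ (m + 2) * (ε / (2 * (m + 2))) := by gcongr
        _ = ε / 2 := by field_simp
    have h4 : (m + 2 : ℝ) * y b ^ 2 ≤ ε / 2 := by
      calc (m + 2 : ℝ) * y b ^ 2 ≤ (m + 2) * (ε / (2 * (m + 2))) := by gcongr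
        _ = ε / 2 := by field_simp
    linarith

/-- Energy estimate for `A_Q^* y = g / r`. -/
lemma energy_AQstar {m : ℕ} (hm : 1 ≤ m) {y g : ℝ → ℂ}
    (hy : HasEulerDeriv y (fun r => (((m : ℝ) + 1) * tanhProfile m r - 1) • y r - g r))
    (hfin : wnorm (powWeight 1) y ≠ ∞) :
    wnorm (powWeight 1) y ≤ (2 : NNReal) * wnorm (powWeight 1) g := by
  have hre := energy_AQstar_real hm (y := fun r => (y r).re) (g := fun r => (g r).re)
    ((hy.clm Complex.reCLM).congr (fun _ _ => rfl) (Eventually.of_forall fun r => by simp))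
    (ne_top_of_le_ne_top hfin (wnorm_re_le _ _))
  have him := energy_AQstar_real hm (y := fun r => (y r).im) (g := fun r => (g r).im)
    ((hy.clm Complex.imCLM).congr (fun _ _ => rfl) (Eventually.of_forall fun r => by simp))
    (ne_top_of_le_ne_top hfin (wnorm_im_le _ _))
  calc wnorm (powWeight 1) y ≤ _ :=
        wnorm_le_re_add_im (measurable_powWeight 1) (aemeasurable_of_continuousOn hy.continuousOn)
    _ ≤ wnorm (powWeight 1) g + wnorm (powWeight 1) g :=
        add_le_add (hre.trans (wnorm_re_le _ _)) (him.trans (wnorm_im_le _ _))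
    _ = _ := by push_cast; ring

/-- Pair the second order equation with r⁻⁴y. Integration by parts leaves the square of r∂_r y = (Mu
- 1)y - z and a zeroth order term with coefficient M² - 2Mu - 8, where -8 is the price of the
weight; it is nonnegative for M ≥ 4. The function z is then recovered from y and r∂_r y. -/
lemma energy_AQ_AQstar_real {m : ℕ} (hm : 3 ≤ m) {y z g : ℝ → ℝ}
    (hy : HasEulerDeriv y (fun r => ((m + 1) * tanhProfile m r - 1) * y r - z r))
    (hz : HasEulerDeriv z (fun r => (1 - (m + 1) * tanhProfile m r) * z r + g r))
    (hyfin : wnorm (powWeight 3) y ≠ ∞) (hzfin : wnorm (powWeight 3) z ≠ ∞) :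
    ENNReal.ofReal (2 * Real.pi) * ∫⁻ r, ENNReal.ofReal
        (r⁻¹ * ((r * (r ^ 3)⁻¹ * y r) ^ 2 + (r * (r ^ 3)⁻¹ * z r) ^ 2)) ∂halfLine
      ≤ (NNReal.sqrt (3 * (m + 2) ^ 2) * wnorm (powWeight 3) g) ^ 2 := by
  have hm' : (3 : ℝ) ≤ m := by exact_mod_cast hm
  set K : ℝ := 3 * (m + 2) ^ 2 with hK
  have hK0 : 0 < K := by positivity
  have e0 : ((NNReal.sqrt (3 * (m + 2) ^ 2) : NNReal) : ℝ≥0∞) ^ 2 = ENNReal.ofReal K := by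
    rw [← ENNReal.coe_pow, NNReal.sq_sqrt, ENNReal.ofReal, ENNReal.coe_inj]
    ext
    rw [Real.coe_toNNReal _ hK0.le]
    simp [hK]
  rw [mul_pow, e0, wnorm_powWeight_sq, ← mul_assoc, mul_comm (ENNReal.ofReal K), mul_assoc]
  refine mul_le_mul' le_rfl ?_
  rw [← lintegral_const_mul' _ _ ENNReal.ofReal_ne_top]
  simp only [← ENNReal.ofReal_mul hK0.le]
  have hu := hasEulerDeriv_tanhProfile m
  have hpow : HasEulerDeriv (fun r : ℝ => (r ^ 4)⁻¹) (fun r => -4 * (r ^ 4)⁻¹) :=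
    hasEulerDeriv_of_hasDerivAt (fun r hr => by
      refine ((hasDerivAt_pow 4 r).inv (pow_pos hr 4).ne').congr_deriv ?_
      rw [smul_eq_mul]; push_cast; field_simp)
      (continuousOn_const.mul ((continuous_pow 4).continuousOn.inv₀ fun r hr =>
        (pow_pos (show (0 : ℝ) < r from hr) 4).ne'))
  -- Φ = -2K r⁻⁴(yz - (Mu + 1)y²). The correction (Mu + 1)y² removes the cross terms between y and z
  -- that the weight and the equation create.
  have hΦ := (hpow.smul ((hy.smul hz).sub
    (((hu.const_smul ((m : ℝ) + 1)).add (HasEulerDeriv.const 1)).smul (hy.smul hy)))).const_smul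
      (-2 * K)
  have hyc := hy.continuousOn
  have hzc := hz.continuousOn
  have key : ∀ r : ℝ, 0 < r → ∀ a : ℝ, (r * (r ^ 3)⁻¹ * a) ^ 2 = (r ^ 4)⁻¹ * a ^ 2 :=
    fun r hr a => by field_simp
  have hinv : ContinuousOn (fun r : ℝ => r * (r ^ 3)⁻¹) (Ioi 0) :=
    continuousOn_id.mul ((continuous_pow 3).continuousOn.inv₀ fun r hr =>
      (pow_pos (show (0 : ℝ) < r from hr) 3).ne')
  have hb := abs_mul_tanhProfile_le m
  refine lintegral_halfLine_le_of_le_add_deriv hΦ ?_ (fun r hr => by positivity)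
    (ae_halfLine_of_forall fun r hr => ?_) fun ε hε δ hδ => ?_
  · exact ((continuousOn_id.inv₀ fun r hr => ne_of_gt hr).mul
      (((hinv.mul hyc).pow 2).add ((hinv.mul hzc).pow 2)))
  · rw [key r hr, key r hr, key r hr]
    have h1 := (abs_le.1 (abs_tanhProfile_le m r)).2
    have h0 := (abs_le.1 (abs_tanhProfile_le m r)).1
    simp only [smul_eq_mul, add_zero]
    set u := tanhProfile m r
    set a := y r
    set b := z r
    set c := g r
    set M : ℝ := (m : ℝ) + 1 with hM
    have hM4 : 4 ≤ M := by linarith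
    have main : a ^ 2 + b ^ 2 ≤ K * (c ^ 2 - 2 * (a * c - b ^ 2 - 4 * (a * b)
        - (M ^ 2 * (1 - u ^ 2) * a ^ 2 + (M * u + 1) * (2 * (a * ((M * u - 1) * a - b)))
          - 4 * ((M * u + 1) * a ^ 2)))) := by
      have d1 : c ^ 2 - 2 * (a * c - b ^ 2 - 4 * (a * b)
        - (M ^ 2 * (1 - u ^ 2) * a ^ 2 + (M * u + 1) * (2 * (a * ((M * u - 1) * a - b)))
          - 4 * ((M * u + 1) * a ^ 2)))
          = (c - a) ^ 2 + a ^ 2 + 2 * ((M * u - 1) * a - b) ^ 2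
            + 2 * (M ^ 2 - 2 * M * u - 8) * a ^ 2 := by ring
      -- Since u ≤ 1, the coefficient is at least (M - 4)(M + 2). This is where m ≥ 3 is needed.
      have d2 : 0 ≤ (M ^ 2 - 2 * M * u - 8) * a ^ 2 := by
        refine mul_nonneg ?_ (sq_nonneg _)
        nlinarith
      -- z = (Mu - 1)y - r∂_r y and |Mu - 1| ≤ m + 2; this is the origin of the constant 3(m + 2)².
      have d3 : b ^ 2 ≤ 2 * (m + 2) ^ 2 * a ^ 2 + 2 * ((M * u - 1) * a - b) ^ 2 := by
        have d4 : (M * u - 1) ^ 2 * a ^ 2 ≤ (m + 2) ^ 2 * a ^ 2 :=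
          mul_le_mul_of_nonneg_right (sq_le_sq' (by nlinarith) (by nlinarith)) (sq_nonneg a)
        nlinarith [sq_nonneg ((M * u - 1) * a - b + (M * u - 1) * a)]
      rw [d1]
      have d5 : (1 : ℝ) ≤ (m + 2) ^ 2 := by nlinarith
      have d6 := sq_nonneg ((M * u - 1) * a - b)
      have d7 := sq_nonneg (c - a)
      have d8 := sq_nonneg a
      rw [hK]
      nlinarith [mul_le_mul_of_nonneg_right d5 d6, mul_le_mul_of_nonneg_right d5 d8,
        mul_nonneg (sq_nonneg ((m : ℝ) + 2)) d7, mul_nonneg (sq_nonneg ((m : ℝ) + 2)) d2]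
    have hfin := mul_le_mul_of_nonneg_left main (by positivity : 0 ≤ r⁻¹ * (r ^ 4)⁻¹)
    refine le_trans (le_of_eq (by ring)) (hfin.trans (le_of_eq ?_))
    ring
  · have hsum : ∫⁻ r, ENNReal.ofReal (r⁻¹ * ((r * (r ^ 3)⁻¹ * y r) ^ 2 +
        (r * (r ^ 3)⁻¹ * z r) ^ 2)) ∂halfLine ≠ ∞ := by
      refine ne_top_of_le_ne_top (ENNReal.add_ne_top.2
        ⟨lintegral_ne_top_of_wnorm hyfin, lintegral_ne_top_of_wnorm hzfin⟩) ?_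
      rw [← lintegral_add_left']
      · refine setLIntegral_mono' measurableSet_Ioi fun r (hr : 0 < r) => ?_
        rw [mul_add, ENNReal.ofReal_add (by positivity) (by positivity)]
      · exact (aemeasurable_of_continuousOn ((continuousOn_id.inv₀ fun r hr => ne_of_gt hr).mul
          ((hinv.mul hyc).pow 2))).ennreal_ofReal
    obtain ⟨a, b, ha, haδ, hb', h1, h2⟩ := exists_small_of_lintegral_ne_top hsum
      (ε := ε / (4 * K * (m + 3))) (by positivity) hδ
    refine ⟨a, b, ha, haδ, hb', ?_⟩
    have hb0 : 0 < b := (inv_pos.2 hδ).trans hb'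
    have e : ∀ x : ℝ, 0 < x → (x * (x ^ 3)⁻¹ * y x) ^ 2 + (x * (x ^ 3)⁻¹ * z x) ^ 2
        ≤ ε / (4 * K * (m + 3)) → |(-2 * K) * ((x ^ 4)⁻¹ * (y x * z x -
          (((m : ℝ) + 1) * tanhProfile m x + 1) * (y x * y x)))| ≤ ε / 2 := by
      intro x hx hs
      rw [key x hx, key x hx] at hs
      have hi : 0 < (x ^ 4)⁻¹ := by positivity
      have f1 : |y x * z x - (((m : ℝ) + 1) * tanhProfile m x + 1) * (y x * y x)|
          ≤ (m + 3) * (y x ^ 2 + z x ^ 2) := by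
        have f2 := abs_le.1 (hb x)
        have f3 : |y x * z x| ≤ y x ^ 2 + z x ^ 2 := by
          rw [abs_le]
          constructor <;> nlinarith [sq_nonneg (y x + z x), sq_nonneg (y x - z x)]
        have f4 : |(((m : ℝ) + 1) * tanhProfile m x + 1) * (y x * y x)| ≤ (m + 2) * y x ^ 2 := by
          rw [abs_mul, abs_mul_self, ← sq]
          gcongr
          rw [abs_le]; constructor <;> linarith
        refine (abs_sub _ _).trans ?_
        nlinarith [sq_nonneg (z x)]
      rw [abs_mul (-2 * K), abs_mul (x ^ 4)⁻¹, abs_of_pos hi, abs_of_nonpos (by linarith : -2 * K ≤ 0)]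
      calc -(-2 * K) * ((x ^ 4)⁻¹ * |_|)
          ≤ 2 * K * ((x ^ 4)⁻¹ * ((m + 3) * (y x ^ 2 + z x ^ 2))) := by
            rw [show -(-2 * K) = 2 * K by ring]; gcongr
        _ = 2 * K * (m + 3) * ((x ^ 4)⁻¹ * y x ^ 2 + (x ^ 4)⁻¹ * z x ^ 2) := by ring
        _ ≤ 2 * K * (m + 3) * (ε / (4 * K * (m + 3))) := by gcongr
        _ = ε / 2 := by field_simp; ring
    have ea := (abs_le.1 (e a ha h1)).1
    have eb := (abs_le.1 (e b hb0 h2)).2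
    simp only [smul_eq_mul]
    linarith

/-- Energy estimate for `A_Q A_Q^* y = g / r²`, where `z = r A_Q^* y`. -/
lemma energy_AQ_AQstar {m : ℕ} (hm : 3 ≤ m) : ∃ C : NNReal, ∀ y z g : ℝ → ℂ,
    HasEulerDeriv y (fun r => (((m : ℝ) + 1) * tanhProfile m r - 1) • y r - z r) →
    HasEulerDeriv z (fun r => (1 - ((m : ℝ) + 1) * tanhProfile m r) • z r + g r) →
    wnorm (powWeight 3) y ≠ ∞ → wnorm (powWeight 3) z ≠ ∞ →
    wnorm (powWeight 3) y ≤ C * wnorm (powWeight 3) g ∧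
    wnorm (powWeight 3) z ≤ C * wnorm (powWeight 3) g := by
  set K : NNReal := NNReal.sqrt (3 * (m + 2) ^ 2) with hK
  have real : ∀ y z g : ℝ → ℝ,
      HasEulerDeriv y (fun r => (((m : ℝ) + 1) * tanhProfile m r - 1) * y r - z r) →
      HasEulerDeriv z (fun r => (1 - ((m : ℝ) + 1) * tanhProfile m r) * z r + g r) →
      wnorm (powWeight 3) y ≠ ∞ → wnorm (powWeight 3) z ≠ ∞ →
      wnorm (powWeight 3) y ≤ K * wnorm (powWeight 3) g ∧
      wnorm (powWeight 3) z ≤ K * wnorm (powWeight 3) g := by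
    intro y z g hy hz hyf hzf
    have h := energy_AQ_AQstar_real hm hy hz hyf hzf
    constructor
    · rw [← ENNReal.pow_le_pow_left_iff two_ne_zero, wnorm_powWeight_sq]
      refine le_trans (mul_le_mul' le_rfl ?_) h
      refine setLIntegral_mono' measurableSet_Ioi fun r (hr : 0 < r) => ENNReal.ofReal_le_ofReal ?_
      gcongr
      exact le_add_of_nonneg_right (sq_nonneg _)
    · rw [← ENNReal.pow_le_pow_left_iff two_ne_zero, wnorm_powWeight_sq]
      refine le_trans (mul_le_mul' le_rfl ?_) h
      refine setLIntegral_mono' measurableSet_Ioi fun r (hr : 0 < r) => ENNReal.ofReal_le_ofReal ?_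
      gcongr
      exact le_add_of_nonneg_left (sq_nonneg _)
  refine ⟨2 * K, fun y z g hy hz hyf hzf => ?_⟩
  have hre := real (fun r => (y r).re) (fun r => (z r).re) (fun r => (g r).re)
    ((hy.clm Complex.reCLM).congr (fun _ _ => rfl) (Eventually.of_forall fun r => by simp))
    ((hz.clm Complex.reCLM).congr (fun _ _ => rfl) (Eventually.of_forall fun r => by simp))
    (ne_top_of_le_ne_top hyf (wnorm_re_le _ _)) (ne_top_of_le_ne_top hzf (wnorm_re_le _ _))
  have him := real (fun r => (y r).im) (fun r => (z r).im) (fun r => (g r).im)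
    ((hy.clm Complex.imCLM).congr (fun _ _ => rfl) (Eventually.of_forall fun r => by simp))
    ((hz.clm Complex.imCLM).congr (fun _ _ => rfl) (Eventually.of_forall fun r => by simp))
    (ne_top_of_le_ne_top hyf (wnorm_im_le _ _)) (ne_top_of_le_ne_top hzf (wnorm_im_le _ _))
  have hg : ((2 * K : NNReal) : ℝ≥0∞) * wnorm (powWeight 3) g
      = K * wnorm (powWeight 3) g + K * wnorm (powWeight 3) g := by push_cast; ring
  have hW := measurable_powWeight 3
  rw [hg]
  exact ⟨(wnorm_le_re_add_im hW (aemeasurable_of_continuousOn hy.continuousOn)).trans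
      (add_le_add (hre.1.trans (mul_le_mul' le_rfl (wnorm_re_le _ _)))
        (him.1.trans (mul_le_mul' le_rfl (wnorm_im_le _ _)))),
    (wnorm_le_re_add_im hW (aemeasurable_of_continuousOn hz.continuousOn)).trans
      (add_le_add (hre.2.trans (mul_le_mul' le_rfl (wnorm_re_le _ _)))
        (him.2.trans (mul_le_mul' le_rfl (wnorm_im_le _ _))))⟩

/-! ### Inverting the first order factors -/

/-- An equation r∂_r f = sf + g expresses each further derivative through lower ones, so a zeroth
order bound on f and bounds on g yield one derivative more than g has. -/
lemma EulerBound.of_linear {C : NNReal} {n : ℕ} {s : ℝ → ℝ} (hs : SymbolBound C n s) :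
    ∃ K : NNReal, ∀ (W : ℝ → ℝ≥0∞) (B : ℝ≥0∞) (f g : ℝ → ℂ), Measurable W →
      HasEulerDeriv f (fun r => s r • f r + g r) → EulerBound W B n g → wnorm W f ≤ B →
      EulerBound W (K * B) (n + 1) f := by
  refine ⟨(1 + (2 ^ n * C + 1)) ^ (n + 1), fun W B f g hW hf hg h0 => ?_⟩
  refine EulerBound.bootstrap (ι := Unit) (f := fun _ => f) (g := fun _ r => s r • f r + g r)
    (fun _ => hf) (fun _ => ⟨aemeasurable_of_continuousOn hf.continuousOn, h0⟩)
    (fun j hj B' hB hjf _ => ?_) ()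
  refine (((hs.of_le (by omega : j ≤ n)).smul hW (hjf ())).add hW
    ((hg.of_le (by omega)).mono hB)).mono ?_
  have h2 : (2 : NNReal) ^ j * C ≤ 2 ^ n * C := by
    gcongr
    · norm_num
    · omega
  calc ((2 ^ j * C : NNReal) : ℝ≥0∞) * B' + B' ≤ ((2 ^ n * C : NNReal) : ℝ≥0∞) * B' + B' := by
        gcongr
    _ = _ := by rw [ENNReal.coe_add, add_mul, ENNReal.coe_one, one_mul]

lemma HasEulerDeriv.smul_deriv {f g : ℝ → ℂ} (h : HasEulerDeriv f g) :
    HasEulerDeriv f (fun r => r • deriv f r) := by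
  refine h.congr (fun _ _ => rfl) ?_
  filter_upwards [h.2, ae_restrict_mem measurableSet_Ioi] with r h1 (h2 : 0 < r)
  rw [h1.deriv, smul_inv_smul₀ h2.ne']

lemma hasEulerDeriv_inv_pow (j : ℕ) :
    HasEulerDeriv (fun r : ℝ => (r ^ j)⁻¹) (fun r => -j * (r ^ j)⁻¹) := by
  refine hasEulerDeriv_of_hasDerivAt (fun r hr => ?_) (continuousOn_const.mul
    ((continuous_pow j).continuousOn.inv₀ fun r hr => (pow_pos (show (0 : ℝ) < r from hr) j).ne'))
  refine ((hasDerivAt_pow j r).inv (pow_pos hr j).ne').congr_deriv ?_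
  rcases j with _ | j
  · simp
  · rw [smul_eq_mul, Nat.add_sub_cancel]
    field_simp
    rw [pow_succ]

lemma hasEulerDeriv_inv_Q (m : ℕ) :
    HasEulerDeriv (fun r => (Q m r)⁻¹) (fun r => (1 + (m + 1) * tanhProfile m r) * (Q m r)⁻¹) := by
  have hQc : ContinuousOn (fun r => (Q m r)⁻¹) (Ioi 0) :=
    (continuousOn_Q m).inv₀ fun r hr => (Q_pos m hr).ne'
  refine hasEulerDeriv_of_hasDerivAt (fun r hr => ?_) ((continuousOn_const.add
    (continuousOn_const.mul (continuous_tanhProfile m).continuousOn)).mul hQc)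
  have hq := Q_pos m hr
  refine ((hasDerivAt_Q_euler m hr).inv hq.ne').congr_deriv ?_
  simp only [smul_eq_mul]
  field_simp

lemma EulerBound.hasEulerDeriv_of_pow_smul {W : ℝ → ℝ≥0∞} {B : ℝ≥0∞} {n j : ℕ} {f : ℝ → ℂ}
    (h : EulerBound W B (n + 1) (fun r => r ^ j • f r)) :
    HasEulerDeriv f (fun r => r • deriv f r) := by
  obtain ⟨-, g, hg, -⟩ := h
  refine (((hasEulerDeriv_inv_pow j).smul hg).congr (fun r hr => ?_)
    (Eventually.of_forall fun _ => rfl)).smul_deriv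
  rw [inv_smul_smul₀ (pow_pos hr j).ne']

lemma hasEulerDeriv_AQ (m : ℕ) {f g : ℝ → ℂ} (h : HasEulerDeriv f g) :
    HasEulerDeriv f (fun r => (-(((m : ℝ) + 1) * tanhProfile m r)) • f r + r • AQ m f r) := by
  refine h.smul_deriv.congr (fun _ _ => rfl) (ae_halfLine_of_forall fun r hr => ?_)
  have : (r : ℂ) ≠ 0 := by exact_mod_cast hr.ne'
  rw [AQ_eq]
  simp only [Complex.real_smul]
  push_cast
  field_simp
  ring

lemma hasEulerDeriv_AQstar (m : ℕ) {f g : ℝ → ℂ} (h : HasEulerDeriv f g) :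
    HasEulerDeriv f
      (fun r => (((m : ℝ) + 1) * tanhProfile m r - 1) • f r - r • AQstar m f r) := by
  refine h.smul_deriv.congr (fun _ _ => rfl) (ae_halfLine_of_forall fun r hr => ?_)
  have : (r : ℂ) ≠ 0 := by exact_mod_cast hr.ne'
  rw [AQstar_eq]
  simp only [Complex.real_smul]
  push_cast
  field_simp
  ring

lemma EulerBound.of_AQ (m n j : ℕ) : ∃ K : NNReal, ∀ (W : ℝ → ℝ≥0∞) (B : ℝ≥0∞) (f g : ℝ → ℂ),
    Measurable W → HasEulerDeriv f g → EulerBound W B n (fun r => r ^ (j + 1) • AQ m f r) →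
      wnorm W (fun r => r ^ j • f r) ≤ B → EulerBound W (K * B) (n + 1) (fun r => r ^ j • f r) := by
  obtain ⟨C, hC⟩ := tanhProfile_polynomial_symbolBound m n
    (Polynomial.C (j : ℝ) - Polynomial.C ((m : ℝ) + 1) * Polynomial.X)
  obtain ⟨K, hK⟩ := EulerBound.of_linear hC
  refine ⟨K, fun W B f g hW hf => hK W B _ _ hW ?_⟩
  refine ((hasEulerDeriv_pow j).smul (hasEulerDeriv_AQ m hf)).congr (fun _ _ => rfl)
    (Eventually.of_forall fun r => ?_)
  simp only [Complex.real_smul, Polynomial.eval_sub, Polynomial.eval_mul, Polynomial.eval_C,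
    Polynomial.eval_X]
  push_cast
  ring

lemma EulerBound.of_AQstar (m n j : ℕ) : ∃ K : NNReal, ∀ (W : ℝ → ℝ≥0∞) (B : ℝ≥0∞)
    (f g : ℝ → ℂ), Measurable W → HasEulerDeriv f g →
      EulerBound W B n (fun r => r ^ (j + 1) • AQstar m f r) →
      wnorm W (fun r => r ^ j • f r) ≤ B → EulerBound W (K * B) (n + 1) (fun r => r ^ j • f r) := by
  obtain ⟨C, hC⟩ := tanhProfile_polynomial_symbolBound m n
    (Polynomial.C ((m : ℝ) + 1) * Polynomial.X + Polynomial.C ((j : ℝ) - 1))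
  obtain ⟨K, hK⟩ := EulerBound.of_linear hC
  refine ⟨K, fun W B f g hW hf hA => hK W B _ (fun r => -1 * (r ^ (j + 1) • AQstar m f r)) hW ?_ ?_⟩
  · refine ((hasEulerDeriv_pow j).smul (hasEulerDeriv_AQstar m hf)).congr (fun _ _ => rfl)
      (Eventually.of_forall fun r => ?_)
    simp only [Complex.real_smul, Polynomial.eval_add, Polynomial.eval_mul, Polynomial.eval_C,
      Polynomial.eval_X]
    push_cast
    ring
  · refine ((hA.const_smul (-1)).mono (by simp)).congr fun r _ => by simp

lemma wnorm_powWeight_smul (i n : ℕ) (f : ℝ → ℂ) :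
    wnorm (powWeight (i + n)) (fun r => r ^ i • f r) = wnorm (powWeight n) f := by
  refine l2norm_congr_ae (ae_halfLine_of_forall fun r hr => ?_)
  have := powWeight_mul_enorm (k := n) (i := 0) (Nat.zero_le n) hr (f r)
  rw [powWeight_mul_enorm (by omega) hr, Nat.add_sub_cancel_left]
  simpa using this.symm

/-- The a priori bound `B` makes the norm finite, as the energy estimate requires, but does not
enter the constant. Derivatives follow from the equation for A_Q^*. -/
lemma exists_factor_bound_three {m : ℕ} (hm : 1 ≤ m) : ∃ C : NNReal, ∀ (B : ℝ≥0∞) (v : ℝ → ℂ),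
    B ≠ ∞ → AdaptedBound 3 m B v →
    EulerBound (powWeight 3) (C * l2norm (fun r => ‖op3 m v r‖ₑ)) 1
      (fun r => r ^ 2 • AQ m (LQ m v) r) := by
  obtain ⟨C₀, h₀⟩ := exists_LQ_bound (k := 3) (m := m) le_rfl (by omega)
  obtain ⟨C₁, h₁⟩ := exists_firstOrder_AQ m 1 1
  obtain ⟨C₂, h₂⟩ := exists_firstOrder_AQstar m 0 2
  obtain ⟨K, hK⟩ := EulerBound.of_AQstar m 0 2
  have hW := measurable_powWeight 3
  refine ⟨K * 2, fun B v hB hv => ?_⟩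
  have e₁ := h₁ _ _ _ hW (h₀ B v hB hv)
  have e₂ := h₂ _ _ _ hW e₁
  set F := op3 m v with hF
  have hF3 : wnorm (powWeight 3) (fun r => r ^ 3 • F r) = l2norm (fun r => ‖F r‖ₑ) :=
    wnorm_pow_smul 3 F
  have hy := e₁.hasEulerDeriv_of_pow_smul
  have hen := energy_AQstar hm (hasEulerDeriv_AQstar m hy) (by
    rw [← wnorm_powWeight_smul 2 1]
    exact ne_top_of_le_ne_top (by finiteness) e₁.wnorm_le)
  have eF : wnorm (powWeight 1) (fun r => r • AQstar m (AQ m (LQ m v)) r)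
      = l2norm (fun r => ‖F r‖ₑ) := by
    have := wnorm_pow_smul 1 F
    simp only [pow_one] at this
    exact this
  rw [eF, ← wnorm_powWeight_smul 2 1] at hen
  rw [ENNReal.coe_mul, mul_assoc]
  refine hK _ _ _ _ hW hy ⟨e₂.aemeasurable, ?_⟩ hen
  refine hF3.le.trans ?_
  exact le_mul_of_one_le_left zero_le (by norm_num)

/-- The outermost A_Q^* is inverted by the energy estimate with weight r⁻¹. The next two factors are
inverted together with weight r⁻³: A_Q alone has the kernel rQ, whereas A_Q A_Q^* is coercive there.
The equations then supply the derivatives, from the outside in. -/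
lemma exists_factor_bound_five {m : ℕ} (hm : 3 ≤ m) : ∃ C : NNReal, ∀ (B : ℝ≥0∞) (v : ℝ → ℂ),
    B ≠ ∞ → AdaptedBound 5 m B v →
    EulerBound (powWeight 5) (C * l2norm (fun r => ‖op5 m v r‖ₑ)) 3
      (fun r => r ^ 2 • AQ m (LQ m v) r) := by
  obtain ⟨C₀, h₀⟩ := exists_LQ_bound (k := 5) (m := m) (by norm_num) (by omega)
  obtain ⟨C₁, h₁⟩ := exists_firstOrder_AQ m 3 1
  obtain ⟨C₂, h₂⟩ := exists_firstOrder_AQstar m 2 2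
  obtain ⟨C₃, h₃⟩ := exists_firstOrder_AQ m 1 3
  obtain ⟨C₄, h₄⟩ := exists_firstOrder_AQstar m 0 4
  obtain ⟨K₁, k₁⟩ := EulerBound.of_AQstar m 0 4
  obtain ⟨K₂, k₂⟩ := EulerBound.of_AQ m 1 3
  obtain ⟨K₃, k₃⟩ := EulerBound.of_AQstar m 2 2
  obtain ⟨K₄, k₄⟩ := energy_AQ_AQstar hm
  have hW := measurable_powWeight 5
  refine ⟨K₃ * ((1 + K₂) * ((1 + K₄) * (K₁ * 2))), fun B v hB hv => ?_⟩
  set w := LQ m v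
  have e₁ := h₁ _ _ _ hW (h₀ B v hB hv)
  have e₂ := h₂ _ _ _ hW e₁
  have e₃ := h₃ _ _ _ hW e₂
  have e₄ := h₄ _ _ _ hW e₃
  set F := op5 m v with hF
  have hF5 : wnorm (powWeight 5) (fun r => r ^ 5 • F r) = l2norm (fun r => ‖F r‖ₑ) :=
    wnorm_pow_smul 5 F
  have hy₁ := e₁.hasEulerDeriv_of_pow_smul
  have hy₂ := e₂.hasEulerDeriv_of_pow_smul
  have hy₃ := e₃.hasEulerDeriv_of_pow_smul
  have hen := energy_AQstar (by omega) (hasEulerDeriv_AQstar m hy₃) (by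
    rw [← wnorm_powWeight_smul 4 1]
    exact ne_top_of_le_ne_top (by finiteness) e₃.wnorm_le)
  have eF : wnorm (powWeight 1) (fun r => r • AQstar m (AQ m (AQstar m (AQ m w))) r)
      = l2norm (fun r => ‖F r‖ₑ) := by
    have := wnorm_pow_smul 1 F
    simp only [pow_one] at this
    exact this
  rw [eF, ← wnorm_powWeight_smul 4 1] at hen
  have b₃ := k₁ _ _ _ _ hW hy₃ ⟨e₄.aemeasurable, hF5.le.trans
    (le_mul_of_one_le_left zero_le (by norm_num))⟩ hen
  set B₃ := (K₁ : ℝ≥0∞) * ((2 : NNReal) * l2norm (fun r => ‖F r‖ₑ)) with hB₃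
  have hz : HasEulerDeriv (fun r => r ^ 1 • AQstar m (AQ m w) r)
      (fun r => (1 - ((m : ℝ) + 1) * tanhProfile m r) • (r ^ 1 • AQstar m (AQ m w) r)
        + r ^ 2 • AQ m (AQstar m (AQ m w)) r) := by
    refine ((hasEulerDeriv_pow 1).smul (hasEulerDeriv_AQ m hy₂)).congr (fun _ _ => rfl)
      (Eventually.of_forall fun r => ?_)
    simp only [Complex.real_smul]
    push_cast
    ring
  have hy : HasEulerDeriv (AQ m w) (fun r => (((m : ℝ) + 1) * tanhProfile m r - 1) • AQ m w r
      - r ^ 1 • AQstar m (AQ m w) r) := by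
    simpa using hasEulerDeriv_AQstar m hy₁
  have z₁ : wnorm (powWeight 3) (fun r => r ^ 1 • AQstar m (AQ m w) r)
      = wnorm (powWeight 5) (fun r => r ^ 3 • AQstar m (AQ m w) r) := by
    rw [wnorm_powWeight_smul 1 2, wnorm_powWeight_smul 3 2]
  have z₂ : wnorm (powWeight 3) (fun r => r ^ 2 • AQ m (AQstar m (AQ m w)) r)
      = wnorm (powWeight 5) (fun r => r ^ 4 • AQ m (AQstar m (AQ m w)) r) := by
    rw [wnorm_powWeight_smul 2 1, wnorm_powWeight_smul 4 1]
  obtain ⟨b₁, b₂⟩ := k₄ _ _ _ hy hz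
    (by
      rw [← wnorm_powWeight_smul 2 3]
      exact ne_top_of_le_ne_top (by finiteness) e₁.wnorm_le)
    (by
      rw [z₁]
      exact ne_top_of_le_ne_top (by finiteness) e₂.wnorm_le)
  rw [z₂, ← wnorm_powWeight_smul 2 3] at b₁
  rw [z₂, z₁] at b₂
  have l₁ : B₃ ≤ (1 + K₄ : NNReal) * B₃ := le_mul_of_one_le_left zero_le (by simp)
  have l₂ : ∀ {x}, x ≤ K₄ * wnorm (powWeight 5)
      (fun r => r ^ 4 • AQ m (AQstar m (AQ m w)) r) → x ≤ (1 + K₄ : NNReal) * B₃ := fun hx =>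
    hx.trans (mul_le_mul' (ENNReal.coe_le_coe.2 le_add_self) b₃.wnorm_le)
  have c₂ := k₂ _ _ _ _ hW hy₂ (b₃.mono l₁) (l₂ b₂)
  have c₁ := k₃ _ ((1 + K₂ : NNReal) * ((1 + K₄ : NNReal) * B₃)) _ _ hW hy₁
    (c₂.mono (mul_le_mul' (ENNReal.coe_le_coe.2 le_add_self) le_rfl))
    ((l₂ b₁).trans (le_mul_of_one_le_left zero_le (by simp)))
  refine c₁.mono (le_of_eq ?_)
  rw [hB₃]
  push_cast
  ring

/-- Hardy inequality inverting `A_Q`. -/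
lemma exists_hardy_AQ {k m : ℕ} (hk : 3 ≤ k) (hkm : k ≤ m + 2) : ∃ C : NNReal,
    ∀ w g : ℝ → ℂ, HasEulerDeriv w g → w 1 = 0 →
    wnorm (powWeight k) (fun r => r ^ 1 • w r) ≤
      C * wnorm (powWeight k) (fun r => r ^ 2 • AQ m w r) := by
  obtain ⟨n, rfl⟩ : ∃ n, k = n + 2 := ⟨k - 2, by omega⟩
  obtain ⟨C, hC⟩ := hardy_Q (k := n) (m := m) (by omega) (by omega)
  -- The order used in Hardy is k - 2 ≤ m, in the range where the weight has no loss.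
  have haw : ∀ f : ℝ → ℝ, wnorm (adaptedWeight n m) f = wnorm (powWeight n) f := fun f => by
    unfold adaptedWeight powWeight weightLoss
    simp only [if_pos (show n ≤ m by omega), one_mul]
  refine ⟨2 * C, fun w g hw hw1 => ?_⟩
  -- Dividing w by rQ, which A_Q annihilates, turns the equation into r∂_r(w/(rQ)) = A_Q w / Q.
  have hQi := (hasEulerDeriv_inv_pow 1).smul (hasEulerDeriv_inv_Q m)
  simp only [smul_eq_mul] at hQi
  have hz := hQi.smul (hasEulerDeriv_AQ m hw)
  have key : ∀ L : ℂ →L[ℝ] ℝ, (∀ x : ℂ, ‖L x‖ₑ ≤ ‖x‖ₑ) →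
      wnorm (powWeight (n + 2)) (fun r => L (r ^ 1 • w r)) ≤
      C * wnorm (powWeight (n + 2)) (fun r => r ^ 2 • AQ m w r) := by
    intro L hL
    have h := hC (fun r => L (((r ^ 1)⁻¹ * (Q m r)⁻¹) • w r)) (fun r => (Q m r)⁻¹ * L (AQ m w r))
      ((hz.clm L).congr (fun _ _ => rfl) (ae_halfLine_of_forall fun r hr => by
        rw [← smul_eq_mul (Q m r)⁻¹, ← map_smul]
        congr 1
        have : (r : ℂ) ≠ 0 := by exact_mod_cast hr.ne'
        simp only [Complex.real_smul]
        push_cast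
        field_simp
        ring)) (by simp [hw1])
    rw [haw] at h
    refine le_trans (le_of_eq ?_) (h.trans (mul_le_mul' le_rfl (l2norm_mono fun r hr => ?_)))
    · refine l2norm_congr_ae (ae_halfLine_of_forall fun r hr => ?_)
      have hq := Q_pos m hr
      have e : Q m r * L (((r ^ 1)⁻¹ * (Q m r)⁻¹) • w r) = (r ^ 1)⁻¹ • L (w r) := by
        rw [map_smul, smul_eq_mul, smul_eq_mul]
        field_simp
      have h0 := powWeight_mul_enorm (k := n) (i := 0) (Nat.zero_le n) hr ((r ^ 1)⁻¹ • L (w r))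
      rw [pow_zero, one_smul, Nat.sub_zero] at h0
      beta_reduce
      rw [e, map_smul, powWeight_mul_enorm (by omega) hr, h0, smul_smul, ← mul_inv, ← pow_add]
      rfl
    · have hq := Q_pos m hr
      beta_reduce
      rw [← mul_assoc (Q m r), mul_inv_cancel₀ hq.ne', one_mul, powWeight_mul_enorm (by omega) hr,
        Nat.add_sub_cancel]
      refine (mul_le_mul' le_rfl (hL _)).trans (le_of_eq ?_)
      simpa using powWeight_mul_enorm (k := n) (i := 0) (Nat.zero_le n) hr (AQ m w r)
  calc _ ≤ _ := wnorm_le_re_add_im (measurable_powWeight _) (aemeasurable_of_continuousOn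
        ((continuous_pow 1).continuousOn.smul hw.continuousOn))
    _ ≤ C * wnorm (powWeight (n + 2)) (fun r => r ^ 2 • AQ m w r) +
        C * wnorm (powWeight (n + 2)) (fun r => r ^ 2 • AQ m w r) :=
        add_le_add (key Complex.reCLM fun x => ?_) (key Complex.imCLM fun x => ?_)
    _ = _ := by push_cast; ring
  · rw [← ofReal_norm x, ← ofReal_norm (Complex.reCLM x)]
    exact ENNReal.ofReal_le_ofReal (Complex.abs_re_le_norm _)
  · rw [← ofReal_norm x, ← ofReal_norm (Complex.imCLM x)]
    exact ENNReal.ofReal_le_ofReal (Complex.abs_im_le_norm _)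

/-! ### Inverting `L_Q` -/

lemma abs_log_le {r : ℝ} (hr : 0 < r) : |Real.log r| ≤ r + r⁻¹ := by
  have h1 := Real.log_le_sub_one_of_pos hr
  have h2 := Real.log_le_sub_one_of_pos (inv_pos.2 hr)
  rw [Real.log_inv] at h2
  have h3 := inv_pos.2 hr
  rw [abs_le]
  constructor <;> linarith

/-- With R = r^{2m+2}, 1 - u² = 4R/(1 + R)² decays at both ends and beats the logarithm. -/
lemma abs_log_mul_le (m : ℕ) {r : ℝ} (hr : 0 < r) :
    |Real.log r| * (1 - tanhProfile m r ^ 2) ≤ 8 := by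
  have hp := one_add_pow_pos m r
  have e : 1 - tanhProfile m r ^ 2
      = 4 * r ^ (2 * (m + 1)) / (1 + r ^ (2 * (m + 1))) ^ 2 := by
    unfold tanhProfile
    field_simp
    ring
  have h1 := pow_le_pow_add_pow (a := 0) (b := 2 * m + 3) (c := 4 * (m + 1)) (by omega) (by omega)
    hr.le
  have h2 := pow_le_pow_add_pow (a := 0) (b := 2 * m + 1) (c := 4 * (m + 1)) (by omega) (by omega)
    hr.le
  have e1 : (r + r⁻¹) * (4 * r ^ (2 * (m + 1))) = 4 * (r ^ (2 * m + 3) + r ^ (2 * m + 1)) := by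
    field_simp
    ring
  have e2 : r ^ (4 * (m + 1)) = (r ^ (2 * (m + 1))) ^ 2 := by rw [← pow_mul]; congr 1; ring
  rw [e, mul_div_assoc', div_le_iff₀ (by positivity)]
  calc |Real.log r| * (4 * r ^ (2 * (m + 1))) ≤ (r + r⁻¹) * (4 * r ^ (2 * (m + 1))) := by
        gcongr; exact abs_log_le hr
    _ ≤ _ := by
        rw [e1]
        rw [e2, pow_zero] at h1 h2
        have : 0 < r ^ (2 * (m + 1)) := by positivity
        nlinarith

/-- The growing solution of the homogeneous equation for `Re v / Q`. -/
def growing (m : ℕ) (r : ℝ) : ℝ := (m + 1) * Real.log r * tanhProfile m r - 1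

/-- Minus the Euler derivative of `growing`. -/
def growing' (m : ℕ) (r : ℝ) : ℝ :=
  -((m + 1) * tanhProfile m r) - (m + 1) ^ 2 * (Real.log r * (1 - tanhProfile m r ^ 2))

lemma abs_growing_le (m : ℕ) {r : ℝ} (hr : 0 < r) : |growing m r| ≤ (m + 1) * (r + r⁻¹) + 1 := by
  unfold growing
  refine (abs_sub _ _).trans ?_
  rw [abs_one, abs_mul, abs_mul, abs_of_nonneg (by positivity : (0 : ℝ) ≤ m + 1)]
  refine add_le_add ?_ le_rfl
  calc (m + 1) * |Real.log r| * |tanhProfile m r| ≤ (m + 1) * (r + r⁻¹) * 1 := by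
        refine mul_le_mul ?_ (abs_tanhProfile_le m r) (abs_nonneg _) (by positivity)
        gcongr
        exact abs_log_le hr
    _ = _ := mul_one _

lemma abs_growing'_le (m : ℕ) {r : ℝ} (hr : 0 < r) :
    |growing' m r| ≤ (m + 1) + (m + 1) ^ 2 * 8 := by
  have h1 := abs_le.1 (abs_tanhProfile_le m r)
  unfold growing'
  refine (abs_sub _ _).trans ?_
  rw [abs_neg]
  refine add_le_add (abs_mul_tanhProfile_le m r) ?_
  rw [abs_mul, abs_of_nonneg (by positivity : (0 : ℝ) ≤ (m + 1) ^ 2), abs_mul,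
    abs_of_nonneg (by nlinarith : 0 ≤ 1 - tanhProfile m r ^ 2)]
  gcongr
  exact abs_log_mul_le m hr

lemma hasEulerDeriv_log : HasEulerDeriv Real.log (fun _ => 1) :=
  hasEulerDeriv_of_hasDerivAt (fun r hr => (Real.hasDerivAt_log hr.ne').congr_deriv (by simp))
    continuousOn_const

lemma hasEulerDeriv_growing (m : ℕ) :
    HasEulerDeriv (growing m) (fun r => -growing' m r) := by
  refine (((hasEulerDeriv_log.const_smul ((m : ℝ) + 1)).smul (hasEulerDeriv_tanhProfile m)).sub
    (HasEulerDeriv.const 1)).congr (fun r _ => by simp [growing]) (Eventually.of_forall fun r => ?_)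
  simp only [growing', smul_eq_mul]
  ring

/-- Together with `hasEulerDeriv_growing` this says that s tanh s - 1, s = (m+1) log r, solves the
Pöschl–Teller equation (r∂_r)²t + 2(m+1)²(1 - u²)t = 0. -/
lemma hasEulerDeriv_growing' (m : ℕ) : HasEulerDeriv (growing' m)
    (fun r => 2 * (m + 1) ^ 2 * (1 - tanhProfile m r ^ 2) * growing m r) := by
  have hu := hasEulerDeriv_tanhProfile m
  refine ((hu.const_smul (-((m : ℝ) + 1))).sub ((hasEulerDeriv_log.smul
    ((HasEulerDeriv.const 1).sub (hu.smul hu))).const_smul (((m : ℝ) + 1) ^ 2))).congr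
    (fun r _ => by simp only [growing', smul_eq_mul]; ring) (Eventually.of_forall fun r => ?_)
  simp only [growing, smul_eq_mul]
  ring

section inverse

variable {k m : ℕ}

/-- The quantity bounded is the Wronskian of (x/Q, I) with the bounded homogeneous solution u, that
is with the mode ΛQ. The homogeneous part cancels in its derivative, leaving r²Qg/(2(m+1)), which is
integrated from 0 by Cauchy–Schwarz. -/
lemma enorm_bounded_solution_le (hk : 3 ≤ k) (hkm : k ≤ m + 2) {x I g : ℝ → ℝ}
    (hx : HasEulerDeriv x (fun r => -(1 + (m + 1) * tanhProfile m r) * x r + (g r - Q m r * I r)))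
    (hI : HasEulerDeriv I (fun r => r ^ 2 * Q m r * x r)) (hg : ContinuousOn g (Ioi 0))
    (hfin : wnorm (adaptedWeight k m) x ≠ ∞) {K : ℝ} (hIK : ∀ r, 0 < r → |I r| ≤ K * r ^ 3)
    {r : ℝ} (hr : 0 < r) :
    ‖r ^ 2 * Q m r * x r / (2 * (m + 1)) + tanhProfile m r * I r‖ₑ ≤
      ENNReal.ofReal (Qconst m) * (ENNReal.ofReal (r ^ 3) * wnorm (powWeight k) g) := by
  have hA := Qconst_pos m
  have hMpos : (0 : ℝ) < m + 1 := by positivity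
  set E : ℝ → ℝ := fun r => r ^ 2 * Q m r * x r / (2 * (m + 1)) + tanhProfile m r * I r with hE
  have hEd : HasEulerDeriv E (fun r => r ^ 2 * Q m r * g r / (2 * (m + 1))) := by
    refine (((((hasEulerDeriv_pow 2).smul (hasEulerDeriv_Q m)).smul hx).const_smul
      (2 * ((m : ℝ) + 1))⁻¹).add ((hasEulerDeriv_tanhProfile m).smul hI)).congr
      (fun r _ => by simp only [hE, smul_eq_mul]; ring) (Eventually.of_forall fun r => ?_)
    have e := sq_mul_Q_sq m r
    simp only [smul_eq_mul]
    have e2 : r ^ 2 * (Q m r * (Q m r * I r)) = 2 * (m + 1) ^ 2 * (1 - tanhProfile m r ^ 2) * I r := by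
      rw [← e]; ring
    field_simp
    push_cast
    linear_combination (-1 : ℝ) * e2
  have hcont : ContinuousOn (fun r => r ^ 2 * Q m r * g r / (2 * (m + 1))) (Ioi 0) :=
    (((continuous_pow 2).continuousOn.mul (continuousOn_Q m)).mul hg).div_const _
  -- The integration cannot start at 0, where x has no value. Finiteness of the weighted norm gives
  -- points a → 0 at which the Wronskian is O(a³).
  have hsmall : ∀ δ, 0 < δ → ∃ a, 0 < a ∧ a < δ ∧ |E a| ≤ (4 * Qconst m + K) * a ^ 3 := by
    intro δ hδ
    have hw := wnorm_real_sq (fun r => weightLoss k m r * (r ^ k)⁻¹) x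
      (fun r hr => mul_nonneg (weightLoss_nonneg k m hr) (by positivity))
    have hne : ∫⁻ r, ENNReal.ofReal (r⁻¹ * (r * (weightLoss k m r * (r ^ k)⁻¹) * x r) ^ 2)
        ∂halfLine ≠ ∞ := by
      intro hcon
      simp only [div_eq_inv_mul] at hw
      rw [hcon, ENNReal.mul_top (by simp [Real.pi_pos])] at hw
      exact hfin ((ENNReal.pow_eq_top_iff (n := 2)).1 hw).1
    obtain ⟨a, -, ha, haδ, -, h1, -⟩ := exists_small_of_lintegral_ne_top hne one_pos hδ
    refine ⟨a, ha, haδ, ?_⟩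
    have hκ := weightLoss_nonneg k m ha
    have hq := Q_pos m ha
    have h2 : a * (weightLoss k m a * (a ^ k)⁻¹) * |x a| ≤ 1 := by
      rw [← abs_of_nonneg (by positivity : 0 ≤ a * (weightLoss k m a * (a ^ k)⁻¹)), ← abs_mul]
      exact (sq_le_one_iff_abs_le_one _).1 h1
    have h3 := pow_mul_Q_le_weightLoss (k := k) (m := m) (by omega) hkm ha
    have h4 : a ^ 2 * Q m a * |x a| ≤ 4 * Qconst m * a ^ 3 := by
      calc a ^ 2 * Q m a * |x a| = (a ^ k * Q m a) * (a ^ 2 * (a ^ k)⁻¹ * |x a|) := by field_simp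
        _ ≤ (4 * Qconst m * weightLoss k m a * a ^ 2) * (a ^ 2 * (a ^ k)⁻¹ * |x a|) := by gcongr
        _ = 4 * Qconst m * a ^ 3 * (a * (weightLoss k m a * (a ^ k)⁻¹) * |x a|) := by ring
        _ ≤ 4 * Qconst m * a ^ 3 * 1 := by gcongr
        _ = _ := mul_one _
    have h5 := hIK a ha
    refine (abs_add_le _ _).trans ?_
    rw [abs_div, abs_mul, abs_of_nonneg (by positivity : 0 ≤ a ^ 2 * Q m a),
      abs_mul (tanhProfile m a), abs_of_pos (by positivity : (0 : ℝ) < 2 * (m + 1)), add_mul]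
    refine add_le_add ((div_le_self (by positivity) ?_).trans h4) ?_
    · linarith [m.cast_nonneg (α := ℝ)]
    · exact (mul_le_of_le_one_left (abs_nonneg _) (abs_tanhProfile_le m a)).trans h5
  have hbound : ∀ a, 0 < a → a ≤ r → ‖E r - E a‖ₑ ≤
      ENNReal.ofReal (Qconst m) * (ENNReal.ofReal (r ^ 3) * wnorm (powWeight k) g) := by
    intro a ha har
    have hci : ContinuousOn (fun r => r⁻¹ • (r ^ 2 * Q m r * g r / (2 * ((m : ℝ) + 1)))) (Ioi 0) :=
      continuousOn_inv_smul hcont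
    have hsub : Icc a r ⊆ Ioi 0 := fun y hy => ha.trans_le hy.1
    have hint := intervalIntegral.integral_eq_sub_of_hasDerivAt
      (f := E) (a := a) (b := r) (fun y hy => hEd.hasDerivAt hcont (hsub (by
        rwa [uIcc_of_le har] at hy)))
      ((hci.mono (by rwa [uIcc_of_le har])).intervalIntegrable)
    rw [← hint, intervalIntegral.integral_of_le har]
    refine (enorm_integral_le_lintegral_enorm _).trans ?_
    calc ∫⁻ y in Ioc a r, ‖y⁻¹ • (y ^ 2 * Q m y * g y / (2 * ((m : ℝ) + 1)))‖ₑ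
        ≤ ∫⁻ y in Ioc 0 r, ‖y⁻¹ • (y ^ 2 * Q m y * g y / (2 * ((m : ℝ) + 1)))‖ₑ :=
          lintegral_mono_set (Ioc_subset_Ioc_left ha.le)
      _ ≤ ∫⁻ y in Ioc 0 r, ENNReal.ofReal (Qconst m) *
            (ENNReal.ofReal (y ^ 3) * (powWeight k y * ‖g y‖ₑ)) := by
          refine setLIntegral_mono' measurableSet_Ioc fun y hy => ?_
          have hy0 := hy.1
          have hq := Q_pos m hy0
          have h := pow_mul_Q_le m (a := k - 2) (b := 0) (c := 0) hy0 (by omega) (by omega)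
          have hkk : y ^ k = y ^ (k - 2) * y ^ 2 := by rw [← pow_add]; congr 1; omega
          unfold powWeight
          rw [Real.enorm_eq_ofReal_abs, Real.enorm_eq_ofReal_abs,
            ← ENNReal.ofReal_mul (by positivity), ← ENNReal.ofReal_mul (by positivity),
            ← ENNReal.ofReal_mul hA.le]
          refine ENNReal.ofReal_le_ofReal ?_
          rw [smul_eq_mul, abs_mul, abs_div, abs_mul, abs_of_pos (inv_pos.2 hy0),
            abs_of_pos (by positivity : 0 < y ^ 2 * Q m y),
            abs_of_pos (by positivity : (0 : ℝ) < 2 * (m + 1))]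
          calc y⁻¹ * (y ^ 2 * Q m y * |g y| / (2 * (m + 1)))
              ≤ y⁻¹ * (y ^ 2 * Q m y * |g y|) := by
                gcongr
                exact div_le_self (by positivity) (by linarith [m.cast_nonneg (α := ℝ)])
            _ = (y ^ (k - 2) * Q m y) * (y ^ 3 * ((y ^ k)⁻¹ * |g y|)) := by
                rw [hkk]; field_simp
            _ ≤ Qconst m * (y ^ 3 * ((y ^ k)⁻¹ * |g y|)) := by
                gcongr
                simp only [pow_zero] at h
                linarith
      _ = ENNReal.ofReal (Qconst m) *
            ∫⁻ y in Ioc 0 r, ENNReal.ofReal (y ^ 3) * (powWeight k y * ‖g y‖ₑ) :=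
          lintegral_const_mul' _ _ ENNReal.ofReal_ne_top
      _ ≤ _ := mul_le_mul' le_rfl (lintegral_cube_mul_le
          ((measurable_powWeight k).aemeasurable.mul (aemeasurable_of_continuousOn hg).enorm) hr)
  refine ENNReal.le_of_forall_pos_le_add fun ε hε _ => ?_
  have hε' : (0 : ℝ) < ε := hε
  have hK0 : 0 ≤ K := by
    have := (abs_nonneg _).trans (hIK 1 one_pos)
    simpa using this
  obtain ⟨a, ha, haδ, h1⟩ := hsmall (min r (min 1 (ε / (4 * Qconst m + K))))
    (lt_min hr (lt_min one_pos (by positivity)))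
  have ha1 : a ≤ 1 := (haδ.trans_le ((min_le_right _ _).trans (min_le_left _ _))).le
  have h2 : |E a| ≤ ε := by
    calc |E a| ≤ (4 * Qconst m + K) * a ^ 3 := h1
      _ ≤ (4 * Qconst m + K) * a := by
          gcongr
          exact pow_le_of_le_one ha.le ha1 (by norm_num)
      _ ≤ (4 * Qconst m + K) * (ε / (4 * Qconst m + K)) := by
          gcongr
          exact (haδ.trans_le ((min_le_right _ _).trans (min_le_right _ _))).le
      _ = ε := by field_simp
  calc ‖E r‖ₑ = ‖(E r - E a) + E a‖ₑ := by rw [sub_add_cancel]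
    _ ≤ ‖E r - E a‖ₑ + ‖E a‖ₑ := enorm_add_le _ _
    _ ≤ _ := by
        refine add_le_add (hbound a ha (haδ.trans_le (min_le_left _ _)).le) ?_
        rw [Real.enorm_eq_ofReal_abs]
        exact (ENNReal.ofReal_le_ofReal h2).trans (by simp)

/-- Variation of parameters. `E` and `V` are the Wronskians of (x/Q, I) with the bounded and the
growing homogeneous solution. `E` is O(r³) and compensates the growth of its partner; `V` vanishes
at r = 1 and multiplies the bounded solution u, so `hardy_Q` controls it with the adapted weight. -/
lemma exists_real_part_bound (hk : 3 ≤ k) (hkm : k ≤ m + 2) : ∃ C : NNReal, ∀ x I g : ℝ → ℝ,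
    HasEulerDeriv x (fun r => -(1 + (m + 1) * tanhProfile m r) * x r + (g r - Q m r * I r)) →
    HasEulerDeriv I (fun r => r ^ 2 * Q m r * x r) → ContinuousOn g (Ioi 0) →
    wnorm (adaptedWeight k m) x ≠ ∞ → wnorm (powWeight k) g ≠ ∞ →
    (∃ K : ℝ, ∀ r, 0 < r → |I r| ≤ K * r ^ 3) → I 1 = 0 →
    wnorm (adaptedWeight k m) x ≤ C * wnorm (powWeight k) g := by
  obtain ⟨C₁, h₁⟩ := hardy_Q (k := k) (m := m) (by omega) hkm
  have hA := Qconst_pos m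
  have hMpos : (1 : ℝ) ≤ m + 1 := by linarith [m.cast_nonneg (α := ℝ)]
  set K := l2norm (fun r => ENNReal.ofReal (r ^ 2 * (1 + r + r ^ 2) * Q m r * (r ^ k)⁻¹)) with hK
  have hKfin : K ≠ ∞ := l2norm_Q_ne_top hk hkm
  set c : NNReal := ⟨((m : ℝ) + 1) + (m + 1) ^ 2 * 8, by positivity⟩ with hc
  refine ⟨(((m : ℝ) + 1) * Qconst m).toNNReal * K.toNNReal + C₁ * c,
    fun x I g hx hI hg hfin hgfin ⟨K', hIK⟩ hI1 => ?_⟩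
  set G := wnorm (powWeight k) g with hG
  set E : ℝ → ℝ := fun r => r ^ 2 * Q m r * x r / (2 * (m + 1)) + tanhProfile m r * I r with hE
  have hEle : ∀ r, 0 < r → ‖E r‖ₑ ≤ ENNReal.ofReal (Qconst m) * (ENNReal.ofReal (r ^ 3) * G) :=
    fun r hr => enorm_bounded_solution_le hk hkm hx hI hg hfin hIK hr
  set V : ℝ → ℝ := fun r => (Q m r)⁻¹ * growing' m r * x r - growing m r * I r with hV
  have hVd : HasEulerDeriv V (fun r => (Q m r)⁻¹ * growing' m r * g r) := by
    refine ((((hasEulerDeriv_inv_Q m).smul (hasEulerDeriv_growing' m)).smul hx).sub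
      ((hasEulerDeriv_growing m).smul hI)).congr (fun r _ => by simp only [hV, smul_eq_mul])
      (ae_halfLine_of_forall fun r hr => ?_)
    have e := sq_mul_Q_sq m r
    have hq := (Q_pos m hr).ne'
    simp only [smul_eq_mul]
    field_simp
    linear_combination (-growing m r * x r) * e
  -- At r = 1 both log r and u vanish, hence so does `growing'`; the other term vanishes by the
  -- normalization I(1) = 0.
  have hV1 : V 1 = 0 := by
    simp [hV, hI1, growing', tanhProfile]
  have hVle := h₁ V _ hVd hV1
  have hVle' : wnorm (powWeight k) (fun r => Q m r * ((Q m r)⁻¹ * growing' m r * g r)) ≤ c * G := by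
    refine wnorm_le_const_mul c fun r hr => ?_
    have hq := (Q_pos m hr).ne'
    rw [← mul_assoc (Q m r), ← mul_assoc (Q m r), mul_inv_cancel₀ hq, one_mul, enorm_mul,
      mul_left_comm]
    gcongr
    rw [enorm_eq_nnnorm, ENNReal.coe_le_coe, ← NNReal.coe_le_coe]
    exact (abs_growing'_le m hr)
  -- The Wronskian of the two homogeneous solutions is the constant -(m + 1), which explains the
  -- factor in front of both terms.
  have hsol : ∀ r, 0 < r → x r = (-(m + 1 : ℝ)⁻¹) * (Q m r * growing m r * E r) +
      (-((m + 1 : ℝ)⁻¹ * tanhProfile m r)) * (Q m r * V r) := by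
    intro r hr
    have e := sq_mul_Q_sq m r
    have hq := (Q_pos m hr).ne'
    have hM0 : (m + 1 : ℝ) ≠ 0 := by linarith
    simp only [hE, hV, growing', growing] at *
    field_simp
    linear_combination (((m + 1) * Real.log r * tanhProfile m r - 1) * x r) * e
  have hE1 : wnorm (powWeight k) (fun r => Q m r * growing m r * E r) ≤
      ((((m : ℝ) + 1) * Qconst m).toNNReal * K.toNNReal : NNReal) * G := by
    calc wnorm (powWeight k) (fun r => Q m r * growing m r * E r)
        ≤ l2norm (fun r => (ENNReal.ofReal ((m + 1) * Qconst m) * G) *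
            ENNReal.ofReal (r ^ 2 * (1 + r + r ^ 2) * Q m r * (r ^ k)⁻¹)) := by
          refine l2norm_mono fun r hr => ?_
          have hq := Q_pos m hr
          unfold powWeight
          rw [enorm_mul]
          calc ENNReal.ofReal (r ^ k)⁻¹ * (‖Q m r * growing m r‖ₑ * ‖E r‖ₑ)
              ≤ ENNReal.ofReal (r ^ k)⁻¹ * (ENNReal.ofReal (Q m r * ((m + 1) * (r + r⁻¹) + 1)) *
                (ENNReal.ofReal (Qconst m) * (ENNReal.ofReal (r ^ 3) * G))) := by
                refine mul_le_mul' le_rfl (mul_le_mul' ?_ (hEle r hr))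
                rw [Real.enorm_eq_ofReal_abs, abs_mul, abs_of_pos hq]
                refine ENNReal.ofReal_le_ofReal ?_
                gcongr
                exact abs_growing_le m hr
            _ = ENNReal.ofReal (Qconst m) * G * ENNReal.ofReal
                (((m + 1) * (r + r⁻¹) + 1) * r ^ 3 * Q m r * (r ^ k)⁻¹) := by
                rw [show ((m + 1) * (r + r⁻¹) + 1) * r ^ 3 * Q m r * (r ^ k)⁻¹
                  = (r ^ k)⁻¹ * (Q m r * ((m + 1) * (r + r⁻¹) + 1) * r ^ 3) by ring,
                  ENNReal.ofReal_mul (p := (r ^ k)⁻¹) (by positivity),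
                  ENNReal.ofReal_mul (q := r ^ 3) (by positivity)]
                ring
            _ ≤ ENNReal.ofReal (Qconst m) * G * ENNReal.ofReal
                ((m + 1) * (r ^ 2 * (1 + r + r ^ 2) * Q m r * (r ^ k)⁻¹)) := by
                refine mul_le_mul' le_rfl (ENNReal.ofReal_le_ofReal ?_)
                have : ((m + 1) * (r + r⁻¹) + 1) * r ^ 3 ≤ (m + 1) * (r ^ 2 * (1 + r + r ^ 2)) := by
                  have e : ((m + 1) * (r + r⁻¹) + 1) * r ^ 3
                      = (m + 1) * (r ^ 4 + r ^ 2) + r ^ 3 := by field_simp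
                  rw [e]
                  nlinarith [pow_pos hr 3]
                calc _ ≤ (m + 1) * (r ^ 2 * (1 + r + r ^ 2)) * Q m r * (r ^ k)⁻¹ := by gcongr
                  _ = _ := by ring
            _ = _ := by
                rw [ENNReal.ofReal_mul (p := (m : ℝ) + 1) (by positivity),
                  ENNReal.ofReal_mul (p := (m : ℝ) + 1) (by positivity)]
                ring
      _ = _ := by
          rw [l2norm_const_mul (ENNReal.mul_ne_top ENNReal.ofReal_ne_top hgfin), ← hK,
            ENNReal.coe_mul, ENNReal.coe_toNNReal hKfin]
          simp only [ENNReal.ofReal]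
          ring
  have hEc : ContinuousOn E (Ioi 0) :=
    ((((continuous_pow 2).continuousOn.mul (continuousOn_Q m)).mul hx.continuousOn).div_const _).add
      ((continuous_tanhProfile m).continuousOn.mul hI.continuousOn)
  have hgr : ContinuousOn (growing m) (Ioi 0) := (hasEulerDeriv_growing m).continuousOn
  have hu : ContinuousOn (tanhProfile m) (Ioi 0) := (continuous_tanhProfile m).continuousOn
  have hinv1 : (m + 1 : ℝ)⁻¹ ≤ 1 := inv_le_one_of_one_le₀ hMpos
  rw [wnorm_congr hsol, ENNReal.coe_add, add_mul]
  refine (wnorm_add_le (measurable_adaptedWeight k m) (aemeasurable_of_continuousOn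
    (continuousOn_const.mul (((continuousOn_Q m).mul hgr).mul hEc)))
    (aemeasurable_of_continuousOn ((continuousOn_const.mul hu).neg.mul
      ((continuousOn_Q m).mul hVd.continuousOn)))).trans (add_le_add ?_ ?_)
  · refine le_trans ?_ hE1
    refine (wnorm_smul_le (s := fun _ => -(m + 1 : ℝ)⁻¹) 1 fun r hr => ?_).trans ?_
    · rw [abs_neg, abs_of_nonneg (by positivity)]
      exact_mod_cast hinv1
    · rw [ENNReal.coe_one, one_mul]
      exact wnorm_mono fun r hr => mul_le_mul' (adaptedWeight_le k m hr) le_rfl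
  · refine (wnorm_smul_le (s := fun r => -((m + 1 : ℝ)⁻¹ * tanhProfile m r)) 1
      fun r hr => ?_).trans ?_
    · rw [abs_neg, abs_mul, abs_of_nonneg (by positivity : (0 : ℝ) ≤ (m + 1 : ℝ)⁻¹)]
      exact_mod_cast mul_le_one₀ hinv1 (abs_nonneg _) (abs_tanhProfile_le m r)
    · rw [ENNReal.coe_one, one_mul]
      refine hVle.trans ?_
      rw [ENNReal.coe_mul, mul_assoc]
      exact mul_le_mul' le_rfl hVle'

end inverse

/-! ### Estimates for `L_Q` and `A_Q L_Q` on functions normalized at r = 1. -/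

section inverse

variable {k m : ℕ}

lemma AdaptedBound.q_eq {v q : ℝ → ℂ} (hv : HasEulerDeriv v (fun r => q r + (m : ℝ) • v r))
    (hq : ContinuousOn q (Ioi 0)) {r : ℝ} (hr : 0 < r) :
    r ^ 1 • LQ m v r = q r + (((m : ℝ) + 1) • ((1 + tanhProfile m r) • v r)
      + ((Q m r * momentQ m v r : ℝ) : ℂ)) := by
  have hmc : ContinuousOn (fun r => (m : ℝ) • v r) (Ioi 0) := hv.continuousOn.const_smul (m : ℝ)
  have hd := hv.hasDerivAt (hq.add hmc) hr
  rw [LQ_eq_of_hasDerivAt hr hd, pow_one, smul_inv_smul₀ hr.ne']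

/-- The moment only sees Re v, so real and imaginary parts decouple. The condition at 1 on Im v
removes iQ, the condition on the moment removes ΛQ. -/
lemma exists_zeroth_bound (hk : 3 ≤ k) (hkm : k ≤ m + 2) : ∃ C : NNReal, ∀ v q : ℝ → ℂ,
    HasEulerDeriv v (fun r => q r + (m : ℝ) • v r) → ContinuousOn q (Ioi 0) →
    wnorm (adaptedWeight k m) v ≠ ∞ →
    wnorm (powWeight k) (fun r => r ^ 1 • LQ m v r) ≠ ∞ → (v 1).im = 0 → momentQ m v 1 = 0 →
    wnorm (adaptedWeight k m) v ≤ C * wnorm (powWeight k) (fun r => r ^ 1 • LQ m v r) := by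
  obtain ⟨C₁, h₁⟩ := exists_real_part_bound hk hkm
  obtain ⟨C₂, h₂⟩ := hardy_Q (k := k) (m := m) (by omega) hkm
  refine ⟨C₁ + C₂, fun v q hv hq hvfin hwfin him hmom => ?_⟩
  have hvc := hv.continuousOn
  have hI := hasEulerDeriv_momentQ (k := k) (m := m) (by omega) hkm hvc hvfin
  set R : ℝ → ℂ := fun r => r ^ 1 • LQ m v r with hR
  have hRc : ContinuousOn R (Ioi 0) := by
    have h1 : ContinuousOn (fun r => (1 + tanhProfile m r) • v r) (Ioi 0) :=
      (continuous_const.add (continuous_tanhProfile m)).continuousOn.smul hvc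
    have h2 : ContinuousOn (fun r => ((m : ℝ) + 1) • ((1 + tanhProfile m r) • v r)) (Ioi 0) :=
      h1.const_smul ((m : ℝ) + 1)
    exact (hq.add (h2.add (Complex.continuous_ofReal.comp_continuousOn
      ((continuousOn_Q m).mul hI.continuousOn)))).congr fun r hr => AdaptedBound.q_eq hv hq hr
  have hv' : HasEulerDeriv v (fun r => (-(1 + ((m : ℝ) + 1) * tanhProfile m r)) • v r
      + (R r - ((Q m r * momentQ m v r : ℝ) : ℂ))) := by
    refine hv.congr (fun _ _ => rfl) (ae_halfLine_of_forall fun r hr => ?_)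
    simp only [hR]
    rw [AdaptedBound.q_eq hv hq hr]
    simp only [Complex.real_smul]
    push_cast
    ring
  have hre := h₁ (fun r => (v r).re) (momentQ m v) (fun r => (R r).re)
    ((hv'.clm Complex.reCLM).congr (fun _ _ => rfl) (Eventually.of_forall fun r => by
      simp only [Complex.reCLM_apply, Complex.add_re, Complex.sub_re, Complex.real_smul,
        Complex.re_ofReal_mul, Complex.ofReal_re])) hI
    (Complex.continuous_re.comp_continuousOn hRc)
    (ne_top_of_le_ne_top hvfin (wnorm_re_le _ _)) (ne_top_of_le_ne_top hwfin (wnorm_re_le _ _))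
    (by
      refine ⟨4 * Qconst m * (wnorm (adaptedWeight k m) v).toReal, fun r hr => ?_⟩
      have h := enorm_momentQ_le (k := k) (m := m) (by omega) hkm
        (aemeasurable_of_continuousOn hvc) hr
      rw [← ENNReal.ofReal_toReal hvfin, Real.enorm_eq_ofReal_abs,
        ← ENNReal.ofReal_mul (by positivity),
        ← ENNReal.ofReal_mul (by have := Qconst_pos m; positivity),
        ENNReal.ofReal_le_ofReal_iff (by have := Qconst_pos m; positivity)] at h
      linarith) hmom
  have him' := h₂ (fun r => (Q m r)⁻¹ * (v r).im) (fun r => (Q m r)⁻¹ * (R r).im)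
    (((hasEulerDeriv_inv_Q m).smul (hv'.clm Complex.imCLM)).congr (fun _ _ => rfl)
      (Eventually.of_forall fun r => by
        simp only [Complex.imCLM_apply, Complex.add_im, Complex.sub_im, Complex.real_smul,
          Complex.im_ofReal_mul, Complex.ofReal_im, smul_eq_mul]
        ring)) (by simp [him])
  have e : ∀ f : ℝ → ℝ, ∀ r, 0 < r → Q m r * ((Q m r)⁻¹ * f r) = f r := fun f r hr => by
    rw [← mul_assoc, mul_inv_cancel₀ (Q_pos m hr).ne', one_mul]
  rw [wnorm_congr (e fun r => (v r).im), wnorm_congr (e fun r => (R r).im)] at him'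
  rw [ENNReal.coe_add, add_mul]
  exact (wnorm_le_re_add_im (measurable_adaptedWeight k m) (aemeasurable_of_continuousOn hvc)).trans
    (add_le_add (hre.trans (mul_le_mul' le_rfl (wnorm_re_le _ _)))
      (him'.trans (mul_le_mul' le_rfl (wnorm_im_le _ _))))

/-- `L_Q` can be inverted on functions satisfying the normalization at `r = 1`. -/
lemma exists_adaptedBound_of_LQ (hk : 3 ≤ k) (hkm : k ≤ m + 2) : ∃ C : NNReal,
    ∀ (B B' : ℝ≥0∞) (v : ℝ → ℂ), B' ≠ ∞ → B ≠ ∞ → AdaptedBound k m B' v →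
    EulerBound (powWeight k) B (k - 1) (fun r => r ^ 1 • LQ m v r) →
    (v 1).im = 0 → momentQ m v 1 = 0 → AdaptedBound k m (C * B) v := by
  obtain ⟨C₁, h₁⟩ := exists_zeroth_bound hk hkm
  obtain ⟨C₂, h₂⟩ := exists_potential_eulerBound hk hkm (k - 1) (1 + (‖(m : ℝ) + 1‖₊ + 1))
  refine ⟨(1 + (‖(m : ℝ) + 1‖₊ + 1)) * ((1 + C₂) * (1 + C₁)),
    fun B B' v hB' hB ⟨q, hq, hqB, hvB⟩ hw him hmom => ?_⟩
  have hW := measurable_powWeight k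
  have hqc : ContinuousOn q (Ioi 0) := (hqB.of_le (k := 0 + 1) (by omega)).continuousOn
  have hvfin := ne_top_of_le_ne_top hB' hvB
  have h0 : wnorm (adaptedWeight k m) v ≤ (1 + C₁ : NNReal) * B :=
    (h₁ v q hq hqc hvfin (ne_top_of_le_ne_top hB hw.wnorm_le) him hmom).trans
      (mul_le_mul' (ENNReal.coe_le_coe.2 le_add_self) hw.wnorm_le)
  -- q equals r L_Q v minus the potential terms. The same identity runs the bootstrap for the
  -- potentials and, at the end, bounds q.
  have step : ∀ n ≤ k - 1, ∀ B₁, B ≤ B₁ →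
      EulerBound (powWeight k) B₁ n (fun r => (1 + tanhProfile m r) • v r) →
      EulerBound (powWeight k) B₁ n (fun r => ((Q m r * momentQ m v r : ℝ) : ℂ)) →
      EulerBound (powWeight k) ((1 + (‖(m : ℝ) + 1‖₊ + 1) : NNReal) * B₁) n q := by
    intro n hn B₁ hB₁ j₁ j₂
    refine ((((hw.of_le hn).mono hB₁).sub hW ((j₁.const_smul ((m : ℝ) + 1)).add hW j₂)).mono
      (le_of_eq (by push_cast; ring))).congr fun r hr => ?_
    rw [AdaptedBound.q_eq hq hqc hr, add_sub_cancel_right]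
  have le1 : ∀ (c : NNReal) (x : ℝ≥0∞), x ≤ (1 + c : NNReal) * x := fun c x =>
    le_mul_of_one_le_left zero_le (by simp)
  obtain ⟨p₁, p₂⟩ := h₂ ((1 + C₁ : NNReal) * B) v q hq h0 hvfin fun n hn B₁ hB₁ j₁ j₂ =>
    step n hn.le B₁ ((le1 C₁ B).trans hB₁) j₁ j₂
  have hc : (C₂ : ℝ≥0∞) * ((1 + C₁ : NNReal) * B) ≤ ((1 + C₂) * (1 + C₁) : NNReal) * B := by
    rw [← mul_assoc, ← ENNReal.coe_mul]
    gcongr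
    exact le_add_self
  have hB1 : B ≤ ((1 + C₂) * (1 + C₁) : NNReal) * B := by
    rw [ENNReal.coe_mul, mul_assoc]
    exact (le1 C₁ B).trans (le1 C₂ _)
  refine ⟨q, hq, (step (k - 1) le_rfl _ hB1 (p₁.mono hc) (p₂.mono hc)).mono
    (le_of_eq (by push_cast; ring)), h0.trans ?_⟩
  gcongr
  calc 1 + C₁ = 1 * (1 * (1 + C₁)) := by ring
    _ ≤ _ := by gcongr <;> simp

/-- The inverse estimate for the normalized functions, given the bound for `A_Q L_Q v`. -/
lemma exists_adaptedBound_of_factor (hk : 3 ≤ k) (hkm : k ≤ m + 2) : ∃ C : NNReal,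
    ∀ (B B' : ℝ≥0∞) (v : ℝ → ℂ), B' ≠ ∞ → B ≠ ∞ → AdaptedBound k m B' v →
    EulerBound (powWeight k) B (k - 2) (fun r => r ^ 2 • AQ m (LQ m v) r) →
    LQ m v 1 = 0 → (v 1).im = 0 → momentQ m v 1 = 0 → AdaptedBound k m (C * B) v := by
  obtain ⟨C₁, h₁⟩ := exists_adaptedBound_of_LQ hk hkm
  obtain ⟨C₂, h₂⟩ := exists_hardy_AQ hk hkm
  obtain ⟨C₃, h₃⟩ := EulerBound.of_AQ m (k - 2) 1
  obtain ⟨C₄, h₄⟩ := exists_LQ_bound hk hkm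
  refine ⟨C₁ * (C₃ * (1 + C₂)), fun B B' v hB' hB hv hy hw him hmom => ?_⟩
  have hR := h₄ B' v hB' hv
  obtain ⟨n, rfl⟩ : ∃ n, k = n + 2 := ⟨k - 2, by omega⟩
  have hwd := EulerBound.hasEulerDeriv_of_pow_smul (n := n) hR
  have h0 := h₂ _ _ hwd hw
  have h1 := h₃ _ ((1 + C₂ : NNReal) * B) _ _ (measurable_powWeight _) hwd
    (hy.mono (le_mul_of_one_le_left zero_le (by simp)))
    (h0.trans (mul_le_mul' (ENNReal.coe_le_coe.2 le_add_self) hy.wnorm_le))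
  have := h₁ _ B' v hB' (by finiteness) hv h1 him hmom
  simpa only [ENNReal.coe_mul, mul_assoc] using this

end inverse

/-! ### Inverse estimates for the full operators on normalized functions. -/

lemma exists_inverse_three {m : ℕ} (hm : 1 ≤ m) : ∃ C : NNReal, ∀ (B : ℝ≥0∞) (v : ℝ → ℂ),
    B ≠ ∞ → AdaptedBound 3 m B v → LQ m v 1 = 0 → (v 1).im = 0 → momentQ m v 1 = 0 →
    AdaptedBound 3 m (C * l2norm (fun r => ‖op3 m v r‖ₑ)) v := by
  obtain ⟨C₁, h₁⟩ := exists_adaptedBound_of_factor (k := 3) (m := m) le_rfl (by omega)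
  obtain ⟨C₂, h₂⟩ := exists_factor_bound_three hm
  obtain ⟨C₃, h₃⟩ := exists_op3_bound hm
  refine ⟨C₁ * C₂, fun B v hB hv hw him hmom => ?_⟩
  have hfin : l2norm (fun r => ‖op3 m v r‖ₑ) ≠ ∞ :=
    ne_top_of_le_ne_top (by finiteness) (h₃ B v hB hv)
  have := h₁ _ B v hB (by finiteness) hv (h₂ B v hB hv) hw him hmom
  simpa only [ENNReal.coe_mul, mul_assoc] using this

lemma exists_inverse_five {m : ℕ} (hm : 3 ≤ m) : ∃ C : NNReal, ∀ (B : ℝ≥0∞) (v : ℝ → ℂ),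
    B ≠ ∞ → AdaptedBound 5 m B v → LQ m v 1 = 0 → (v 1).im = 0 → momentQ m v 1 = 0 →
    AdaptedBound 5 m (C * l2norm (fun r => ‖op5 m v r‖ₑ)) v := by
  obtain ⟨C₁, h₁⟩ := exists_adaptedBound_of_factor (k := 5) (m := m) (by norm_num) (by omega)
  obtain ⟨C₂, h₂⟩ := exists_factor_bound_five hm
  obtain ⟨C₃, h₃⟩ := exists_op5_bound hm
  refine ⟨C₁ * C₂, fun B v hB hv hw him hmom => ?_⟩
  have hfin : l2norm (fun r => ‖op5 m v r‖ₑ) ≠ ∞ :=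
    ne_top_of_le_ne_top (by finiteness) (h₃ B v hB hv)
  have := h₁ _ B v hB (by finiteness) hv (h₂ B v hB hv) hw him hmom
  simpa only [ENNReal.coe_mul, mul_assoc] using this

/-! ### Equivariant smooth functions near the origin -/

/-- `ℓ`-equivariance for an integer index `ℓ`. -/
def EquivariantWith (ℓ : ℤ) (f : ℂ → ℂ) : Prop :=
  ∀ (θ : ℝ) (z : ℂ), f (Complex.exp (θ * Complex.I) * z) = Complex.exp (ℓ * θ * Complex.I) * f z

/-- Rotation by π/ℓ fixes the origin and changes the sign of f. -/
lemma EquivariantWith.apply_zero {ℓ : ℤ} {f : ℂ → ℂ} (hf : EquivariantWith ℓ f) (hℓ : ℓ ≠ 0) :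
    f 0 = 0 := by
  have h := hf (Real.pi / ℓ) 0
  have hℓ' : (ℓ : ℂ) ≠ 0 := by exact_mod_cast hℓ
  rw [mul_zero] at h
  push_cast at h
  rw [mul_div_cancel₀ _ hℓ', Complex.exp_pi_mul_I] at h
  have h2 : 2 * f 0 = 0 := by linear_combination h
  simpa using h2

lemma EquivariantWith.fderiv_apply {ℓ : ℤ} {f : ℂ → ℂ} (hf : EquivariantWith ℓ f)
    (hd : Differentiable ℝ f) (θ : ℝ) (z v : ℂ) :
    fderiv ℝ f (Complex.exp (θ * Complex.I) * z) (Complex.exp (θ * Complex.I) * v)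
      = Complex.exp (ℓ * θ * Complex.I) * fderiv ℝ f z v := by
  set e := Complex.exp (θ * Complex.I)
  set e' := Complex.exp (ℓ * θ * Complex.I)
  have hl : HasFDerivAt (fun z : ℂ => e * z) ((ContinuousLinearMap.mul ℝ ℂ) e) z :=
    ((ContinuousLinearMap.mul ℝ ℂ) e).hasFDerivAt
  have h1 := (hd (e * z)).hasFDerivAt.comp z hl
  have h2 : HasFDerivAt (fun z => e' * f z) (((ContinuousLinearMap.mul ℝ ℂ) e').comp
      (fderiv ℝ f z)) z :=
    ((ContinuousLinearMap.mul ℝ ℂ) e').hasFDerivAt.comp z (hd z).hasFDerivAt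
  have he : (f ∘ fun z => e * z) = fun z => e' * f z := funext fun z => hf θ z
  rw [he] at h1
  have := congrArg (fun L : ℂ →L[ℝ] ℂ => L v) (h1.unique h2)
  simpa using this

/-- The Wirtinger derivatives `½ (∂₁ + σ i ∂₂)`. -/
def wirtinger (σ : ℝ) (f : ℂ → ℂ) (z : ℂ) : ℂ :=
  1 / 2 * (fderiv ℝ f z 1 + σ * Complex.I * fderiv ℝ f z Complex.I)

lemma contDiff_wirtinger (σ : ℝ) {f : ℂ → ℂ} (hf : ContDiff ℝ ((⊤ : ℕ∞) : WithTop ℕ∞) f) :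
    ContDiff ℝ ((⊤ : ℕ∞) : WithTop ℕ∞) (wirtinger σ f) := by
  have h := hf.fderiv_right (m := ((⊤ : ℕ∞) : WithTop ℕ∞)) (by simp)
  have h1 := h.clm_apply (contDiff_const (c := (1 : ℂ)))
  have h2 := h.clm_apply (contDiff_const (c := Complex.I))
  exact contDiff_const.mul (h1.add (contDiff_const.mul h2))

/-- The derivatives in z̄ and in z shift the equivariance index by +1 and -1 respectively. -/
lemma EquivariantWith.wirtinger {ℓ : ℤ} {f : ℂ → ℂ} (hf : EquivariantWith ℓ f)
    (hd : Differentiable ℝ f) {ε : ℤ} (hε : ε = 1 ∨ ε = -1) :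
    EquivariantWith (ℓ + ε) (wirtinger ε f) := by
  intro θ z
  set c : ℝ := Real.cos θ with hc
  set s : ℝ := Real.sin θ with hs
  have hcs : (c : ℂ) ^ 2 + (s : ℂ) ^ 2 = 1 := by
    have := Real.cos_sq_add_sin_sq θ
    exact_mod_cast this
  have he : Complex.exp (θ * Complex.I) = c + s * Complex.I := by
    rw [Complex.exp_mul_I, ← Complex.ofReal_cos, ← Complex.ofReal_sin]
  have hI := Complex.I_mul_I
  set L := fderiv ℝ f z with hL
  have key : ∀ a b : ℝ, fderiv ℝ f (Complex.exp (θ * Complex.I) * z)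
      (Complex.exp (θ * Complex.I) * (a + b * Complex.I))
      = Complex.exp (ℓ * θ * Complex.I) * (a * L 1 + b * L Complex.I) := by
    intro a b
    rw [hf.fderiv_apply hd]
    congr 1
    have e : (a : ℂ) + b * Complex.I = a • (1 : ℂ) + b • Complex.I := by simp
    rw [e, map_add, map_smul, map_smul]
    simp [hL]
  -- The directions are e^{-iθ} and ie^{-iθ}, which the rotation carries to 1 and i.
  have k1 := key c (-s)
  have k2 := key s c
  have e1 : Complex.exp (θ * Complex.I) * ((c : ℂ) + ((-s : ℝ) : ℂ) * Complex.I) = 1 := by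
    rw [he]; push_cast; linear_combination hcs - (s : ℂ) ^ 2 * hI
  have e2 : Complex.exp (θ * Complex.I) * ((s : ℂ) + c * Complex.I) = Complex.I := by
    rw [he]; linear_combination Complex.I * hcs + (c * s : ℂ) * hI
  rw [e1] at k1
  rw [e2] at k2
  have hexp : Complex.exp (((ℓ + ε : ℤ) : ℂ) * θ * Complex.I)
      = Complex.exp (ℓ * θ * Complex.I) * (c + ε * s * Complex.I) := by
    push_cast
    rw [add_mul, add_mul, Complex.exp_add]
    congr 1
    rcases hε with rfl | rfl
    · simpa using he
    · push_cast
      rw [show (-1 : ℂ) * θ * Complex.I = ((-θ : ℝ) : ℂ) * Complex.I by push_cast; ring,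
        Complex.exp_mul_I, ← Complex.ofReal_cos, ← Complex.ofReal_sin, Real.cos_neg, Real.sin_neg,
        ← hc, ← hs]
      push_cast
      ring
  unfold ChernSimons.wirtinger
  rw [k1, k2, hexp]
  push_cast
  have hε2 : (ε : ℂ) ^ 2 = 1 := by rcases hε with rfl | rfl <;> simp
  linear_combination (-(1 / 2) * Complex.exp (ℓ * θ * Complex.I) * s * L Complex.I) * (ε ^ 2 * hI - hε2)

lemma hasDerivAt_comp_ofReal {f : ℂ → ℂ} (hd : Differentiable ℝ f) (r : ℝ) :
    HasDerivAt (fun r : ℝ => f r) (fderiv ℝ f r 1) r := by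
  have h := (hd (r : ℂ)).hasFDerivAt.comp_hasDerivAt r (Complex.ofRealCLM.hasDerivAt (x := r))
  exact h.congr_deriv (by simp)

lemma contDiff_comp_ofReal {n : WithTop ℕ∞} {f : ℂ → ℂ} (hf : ContDiff ℝ n f) :
    ContDiff ℝ n (fun r : ℝ => f r) :=
  hf.comp Complex.ofRealCLM.contDiff

/-- Vanishing of the Taylor coefficients of the radial part of an equivariant function. -/
lemma EquivariantWith.iteratedDeriv_eq_zero (j : ℕ) : ∀ {ℓ : ℤ} {f : ℂ → ℂ},
    EquivariantWith ℓ f → ContDiff ℝ ((⊤ : ℕ∞) : WithTop ℕ∞) f → ((j : ℤ) < |ℓ| ∨ ¬ Even (ℓ - j)) →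
    iteratedDeriv j (fun r : ℝ => f r) 0 = 0 := by
  induction j with
  | zero =>
    intro ℓ f hf _ h
    have hℓ : ℓ ≠ 0 := by
      rintro rfl
      simp at h
    simpa using hf.apply_zero hℓ
  | succ j ih =>
    intro ℓ f hf hs h
    have hd : Differentiable ℝ f := hs.differentiable (by simp)
    -- ∂₁ is the sum of the two Wirtinger derivatives, of indices ℓ - 1 and ℓ + 1. Both keep the
    -- hypothesis on order or parity when j decreases by one.
    have he : deriv (fun r : ℝ => f r)
        = fun r : ℝ => ChernSimons.wirtinger ((-1 : ℤ) : ℝ) f r +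
          ChernSimons.wirtinger ((1 : ℤ) : ℝ) f r := by
      funext r
      rw [(hasDerivAt_comp_ofReal hd r).deriv]
      unfold ChernSimons.wirtinger
      push_cast
      ring
    have hc : ∀ σ : ℝ, ContDiff ℝ j (fun r : ℝ => ChernSimons.wirtinger σ f r) := fun σ =>
      (contDiff_comp_ofReal (contDiff_wirtinger σ hs)).of_le (by exact_mod_cast le_top)
    have hp : ∀ ε : ℤ, ε = 1 ∨ ε = -1 → iteratedDeriv j
        (fun r : ℝ => ChernSimons.wirtinger (ε : ℝ) f r) 0 = 0 := by
      intro ε hε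
      refine ih (hf.wirtinger hd hε) (contDiff_wirtinger _ hs) ?_
      rcases h with h | h
      · left
        push_cast at h
        have : |ℓ| ≤ |ℓ + ε| + 1 := by
          calc |ℓ| = |(ℓ + ε) + -ε| := by ring_nf
            _ ≤ |ℓ + ε| + |-ε| := abs_add_le _ _
            _ = _ := by rcases hε with rfl | rfl <;> simp
        omega
      · right
        push_cast at h
        rw [Int.not_even_iff_odd] at h ⊢
        have hε' : Even (ε + 1) := by rcases hε with rfl | rfl <;> decide
        have : ℓ + ε - j = (ℓ - (j + 1)) + (ε + 1) := by ring
        rw [this]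
        exact h.add_even hε'
    rw [iteratedDeriv_succ', he, iteratedDeriv_fun_add (hc _).contDiffAt (hc _).contDiffAt,
      hp _ (Or.inr rfl), hp _ (Or.inl rfl), add_zero]

/-- A smooth function vanishing to order `k` at the origin. -/
lemma exists_iteratedDeriv_le_pow {h : ℝ → ℂ} {k : ℕ} (hs : ContDiff ℝ ((⊤ : ℕ∞) : WithTop ℕ∞) h)
    (h0 : ∀ j < k, iteratedDeriv j h 0 = 0) :
    ∃ C : ℝ, 0 ≤ C ∧ ∀ i ≤ k, ∀ r, 0 ≤ r → r ≤ 1 → ‖iteratedDeriv (k - i) h r‖ ≤ C * r ^ i := by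
  have hc : ∀ j, ContDiff ℝ 1 (iteratedDeriv j h) := fun j => by
    rw [iteratedDeriv_eq_iterate]
    exact (hs.iterate_deriv j).of_le (by norm_cast)
  obtain ⟨C, hC⟩ := (isCompact_Icc (a := (0 : ℝ)) (b := 1)).exists_bound_of_continuousOn
    (hc k).continuous.continuousOn
  refine ⟨max C 0, le_max_right _ _, fun i => ?_⟩
  -- The bound descends from the top derivative: `i` counts the integrations from 0, each of which
  -- gains one power of r.
  induction i with
  | zero =>
    intro _ r hr hr1
    simpa using Or.inl (hC r ⟨hr, hr1⟩)
  | succ i ih =>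
    intro hi r hr hr1
    have hd : ∀ x, DifferentiableAt ℝ (iteratedDeriv (k - (i + 1)) h) x := fun x =>
      ((hc _).differentiable (by simp)) x
    have e : k - i = k - (i + 1) + 1 := by omega
    have := (convex_Icc (0 : ℝ) r).norm_image_sub_le_of_norm_deriv_le
      (f := iteratedDeriv (k - (i + 1)) h) (C := max C 0 * r ^ i) (fun x _ => hd x)
      (fun x hx => by
        rw [← iteratedDeriv_succ, ← e]
        refine (ih (by omega) x hx.1 (hx.2.trans hr1)).trans ?_
        have := hx.1
        have := hx.2
        gcongr) (left_mem_Icc.2 hr) (right_mem_Icc.2 hr)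
    rw [h0 _ (by omega), sub_zero, sub_zero, Real.norm_of_nonneg hr] at this
    rwa [pow_succ, ← mul_assoc]

lemma iteratedDeriv_pow_smul (m j : ℕ) (a : ℂ) (r : ℝ) :
    iteratedDeriv j (fun r : ℝ => r ^ m • a) r = iteratedDeriv j (fun r : ℝ => r ^ m) r • a := by
  induction j generalizing r with
  | zero => simp
  | succ j ih =>
    rw [iteratedDeriv_succ, iteratedDeriv_succ, funext ih, deriv_smul_const]
    have : ContDiff ℝ 1 (iteratedDeriv j fun r : ℝ => r ^ m) := by
      rw [iteratedDeriv_eq_iterate]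
      exact ((contDiff_id.pow m : ContDiff ℝ ((⊤ : ℕ∞) : WithTop ℕ∞) _).iterate_deriv j).of_le
        (by norm_cast)
    exact this.differentiable (by simp) r

/-- Taylor expansion of the radial part of an equivariant function. -/
lemma exists_radial_taylor {k m : ℕ} (hkm : k ≤ m + 2) {f : ℂ → ℂ} (hf : IsEquivariant m f)
    (hs : ContDiff ℝ ((⊤ : ℕ∞) : WithTop ℕ∞) f) : ∃ (a : ℂ) (C : ℝ), 0 ≤ C ∧
      ∀ j ≤ k, ∀ r, 0 ≤ r → r ≤ 1 →
        ‖iteratedDeriv j (fun r : ℝ => f r - r ^ m • a) r‖ ≤ C * r ^ (k - j) := by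
  have hf' : EquivariantWith m f := fun θ z => by simpa using hf θ z
  set a : ℂ := ((m.factorial : ℝ)⁻¹) • iteratedDeriv m (fun r : ℝ => f r) 0 with ha
  have hp : ContDiff ℝ ((⊤ : ℕ∞) : WithTop ℕ∞) (fun r : ℝ => r ^ m • a) :=
    (contDiff_id.pow m).smul contDiff_const
  have hF := contDiff_comp_ofReal hs
  obtain ⟨C, hC, h⟩ := exists_iteratedDeriv_le_pow (k := k) (hF.sub hp) fun j hj => by
    have e : iteratedDeriv j (fun r : ℝ => f r - r ^ m • a) 0
        = iteratedDeriv j (fun r : ℝ => f r) 0 - iteratedDeriv j (fun r : ℝ => r ^ m • a) 0 :=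
      iteratedDeriv_fun_sub ((hF.of_le (by exact_mod_cast le_top)).contDiffAt)
        ((hp.of_le (by exact_mod_cast le_top)).contDiffAt)
    rw [e, iteratedDeriv_pow_smul, iteratedDeriv_fun_pow_zero]
    split_ifs with hjm
    · subst hjm
      have : ((j.factorial : ℝ) : ℂ) ≠ 0 := by exact_mod_cast j.factorial_ne_zero
      rw [ha, smul_smul, mul_inv_cancel₀ (by exact_mod_cast j.factorial_ne_zero), one_smul,
        sub_self]
    · rw [Nat.cast_zero, zero_smul, sub_zero]
      refine hf'.iteratedDeriv_eq_zero j hs ?_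
      -- As k ≤ m + 2, an order j < k other than m is either below m or equal to m + 1, and the
      -- latter has the wrong parity.
      rcases Nat.lt_or_ge j m with h1 | h1
      · left; rw [abs_of_nonneg (by positivity)]; exact_mod_cast h1
      · right
        have : j = m + 1 := by omega
        subst this
        rw [Int.not_even_iff_odd]
        refine ⟨-1, ?_⟩
        push_cast
        ring
  refine ⟨a, C, hC, fun j hj r hr hr1 => ?_⟩
  have := h (k - j) (by omega) r hr hr1
  rwa [Nat.sub_sub_self hj] at this

/-! ### Schwartz functions have finite norm -/

/-- A pointwise bound with enough decay at both ends gives a finite weighted norm. -/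
lemma wnorm_powWeight_ne_top {k : ℕ} {f : ℝ → ℂ} {C : ℝ}
    (h : ∀ r, 0 < r → ‖f r‖ * (1 + r ^ 2) ≤ C * r ^ k) : wnorm (powWeight k) f ≠ ∞ := by
  have := l2norm_ofReal_ne_top (f := fun r => (r ^ k)⁻¹ * ‖f r‖) (C := C)
    (fun r hr => by positivity) (fun r hr => by
      have hk : 0 < r ^ k := by positivity
      rw [mul_assoc, inv_mul_le_iff₀ hk, mul_comm (r ^ k)]
      exact h r hr)
  refine ne_top_of_le_ne_top this (l2norm_mono fun r hr => ?_)
  rw [ENNReal.ofReal_mul (by positivity), ofReal_norm]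
  rfl

lemma one_add_tanhProfile_le_sq (m : ℕ) {r : ℝ} (hr : 0 < r) :
    0 ≤ 1 + tanhProfile m r ∧ 1 + tanhProfile m r ≤ 2 * r ^ 2 := by
  have h1 := one_add_pow_pos m r
  rw [one_add_tanhProfile]
  refine ⟨by positivity, ?_⟩
  rw [div_le_iff₀ h1]
  have := pow_le_pow_add_pow (a := 2) (b := 2 * (m + 1)) (c := 2 + 2 * (m + 1)) (by omega)
    (by omega) hr.le
  rw [pow_add] at this
  nlinarith

lemma sq_mul_Q_mul_le {k m : ℕ} (hk : 2 ≤ k) (hkm : k ≤ m + 2) {r : ℝ} (hr : 0 < r) :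
    r ^ 2 * Q m r * (1 + r ^ 2) ≤ 2 * Qconst m * r ^ k :=
  pow_mul_Q_le m hr (by omega) (by omega)

/-- Q is not in L² with the weight r^{-k} near 0 when m < k. Hardy applied to Q·u, with u(1) = 0,
replaces u by r∂_r u, which is O(r²) at the origin and hence harmless. -/
lemma wnorm_adaptedWeight_Q_ne_top {k m : ℕ} (hk : 2 ≤ k) (hkm : k ≤ m + 2) :
    wnorm (adaptedWeight k m) (Q m) ≠ ∞ := by
  obtain ⟨C, hC⟩ := hardy_Q (k := k) (m := m) (by omega) hkm
  have hbd : ∀ {g : ℝ → ℝ} {D : ℝ}, 0 ≤ D → (∀ r, 0 < r → |g r| ≤ D * r ^ 2) →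
      wnorm (powWeight k) (fun r => Q m r * g r) ≠ ∞ := by
    intro g D hD hg
    have := wnorm_powWeight_ne_top (k := k) (f := fun r => ((Q m r * g r : ℝ) : ℂ))
      (C := D * (2 * Qconst m)) fun r hr => by
        have hQ := Q_pos m hr
        rw [Complex.norm_real, Real.norm_eq_abs, abs_mul, abs_of_pos hQ]
        calc Q m r * |g r| * (1 + r ^ 2) ≤ Q m r * (D * r ^ 2) * (1 + r ^ 2) := by
              gcongr; exact hg r hr
          _ = D * (r ^ 2 * Q m r * (1 + r ^ 2)) := by ring
          _ ≤ D * (2 * Qconst m * r ^ k) :=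
            mul_le_mul_of_nonneg_left (sq_mul_Q_mul_le hk hkm hr) hD
          _ = _ := by ring
    refine ne_top_of_le_ne_top this (l2norm_mono fun r _ => ?_)
    rw [← ofReal_norm, ← ofReal_norm, Complex.norm_real]
  have hu := hC _ _ (hasEulerDeriv_tanhProfile m) (by simp [tanhProfile])
  have h1 : wnorm (powWeight k) (fun r => Q m r * ((m + 1) * (1 - tanhProfile m r ^ 2))) ≠ ∞ := by
    refine hbd (D := (m + 1) * (2 * 2)) (by positivity) fun r hr => ?_
    have h2 := one_add_tanhProfile_le_sq m hr
    have h3 := abs_le.1 (abs_tanhProfile_le m r)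
    have : 1 - tanhProfile m r ^ 2 = (1 - tanhProfile m r) * (1 + tanhProfile m r) := by ring
    rw [this, abs_of_nonneg (mul_nonneg (by positivity) (mul_nonneg (by linarith) h2.1)), mul_assoc]
    have : (1 - tanhProfile m r) * (1 + tanhProfile m r) ≤ 2 * (2 * r ^ 2) :=
      mul_le_mul (by linarith) h2.2 h2.1 (by norm_num)
    have hm : (0 : ℝ) ≤ m + 1 := by positivity
    nlinarith [mul_le_mul_of_nonneg_left this hm]
  have h2 : wnorm (powWeight k) (fun r => Q m r * (1 + tanhProfile m r)) ≠ ∞ :=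
    hbd (D := 2) (by norm_num) fun r hr => by
      have h2 := one_add_tanhProfile_le_sq m hr
      rw [abs_of_nonneg h2.1]; exact h2.2
  have hA : ∀ g : ℝ → ℝ, ContinuousOn g (Ioi 0) → AEMeasurable (fun r => Q m r * g r) halfLine :=
    fun g hg => aemeasurable_of_continuousOn ((continuousOn_Q m).mul hg)
  -- This is 1 ≤ |u| + (1 + u); the second summand is O(r²), so Q(1 + u) is finite even in the
  -- weight r^{-k}.
  have key : wnorm (adaptedWeight k m) (Q m) ≤
      wnorm (adaptedWeight k m) (fun r => Q m r * tanhProfile m r)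
        + wnorm (adaptedWeight k m) (fun r => Q m r * (1 + tanhProfile m r)) := by
    have hW := measurable_adaptedWeight k m
    refine le_trans ?_ (l2norm_add_le
      (hW.aemeasurable.mul (hA _ (continuous_tanhProfile m).continuousOn).enorm)
      (hW.aemeasurable.mul (hA _ (continuous_const.add
        (continuous_tanhProfile m)).continuousOn).enorm))
    refine l2norm_mono fun r hr => ?_
    rw [← mul_add]
    gcongr
    rw [← ofReal_norm, ← ofReal_norm, ← ofReal_norm, ← ENNReal.ofReal_add (by positivity)
      (by positivity)]
    refine ENNReal.ofReal_le_ofReal ?_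
    rw [norm_mul, norm_mul, ← mul_add]
    refine le_mul_of_one_le_right (norm_nonneg _) ?_
    rw [Real.norm_eq_abs, Real.norm_eq_abs, abs_of_nonneg (one_add_tanhProfile_le_sq m hr).1]
    linarith [neg_abs_le (tanhProfile m r)]
  refine ne_top_of_le_ne_top (ENNReal.add_ne_top.2 ⟨?_, ?_⟩) key
  · exact ne_top_of_le_ne_top (ENNReal.mul_ne_top ENNReal.coe_ne_top h1) hu
  · refine ne_top_of_le_ne_top h2 (wnorm_mono fun r hr => ?_)
    gcongr
    exact adaptedWeight_le k m hr

lemma mul_one_add_sq_le_of_split {k : ℕ} (hk : 2 ≤ k) {C D r x c : ℝ} (hC : 0 ≤ C) (hD : 0 ≤ D)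
    (hr : 0 < r) (hc : 0 ≤ c) (hx0 : r ≤ 1 → x ≤ c * (C * r ^ k))
    (hx1 : 1 < r → x ≤ c * D) : x * (1 + r ^ 2) ≤ 2 * c * (C + D) * r ^ k := by
  rcases le_or_gt r 1 with h2 | h2
  · have : r ^ 2 ≤ 1 := pow_le_one₀ hr.le h2
    calc x * (1 + r ^ 2) ≤ (c * (C * r ^ k)) * 2 := by
          have := hx0 h2
          gcongr; linarith
      _ ≤ (c * ((C + D) * r ^ k)) * 2 := by gcongr; linarith
      _ = _ := by ring
  · have h3 : r ^ 2 ≤ r ^ k := pow_le_pow_right₀ h2.le hk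
    have h4 : 1 ≤ r ^ 2 := one_le_pow₀ h2.le
    calc x * (1 + r ^ 2) ≤ (c * D) * (2 * r ^ k) := by
          have := hx1 h2
          gcongr; linarith
      _ ≤ (c * (C + D)) * (2 * r ^ k) := by gcongr; linarith
      _ = _ := by ring

/-- The function is dominated by r^k/(1 + r²), finite in the weight r^{-k}, plus a multiple of Q,
which dominates r^m on (0,1]. -/
lemma wnorm_adaptedWeight_ne_top_of_taylor {k m : ℕ} (hk : 2 ≤ k) (hkm : k ≤ m + 2) {F : ℝ → ℂ}
    {a : ℂ} {C D : ℝ} (hC : 0 ≤ C) (hD : 0 ≤ D)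
    (h0 : ∀ r : ℝ, 0 < r → r ≤ 1 → ‖F r - r ^ m • a‖ ≤ C * r ^ k)
    (h1 : ∀ r : ℝ, 0 < r → ‖F r‖ ≤ D) : wnorm (adaptedWeight k m) F ≠ ∞ := by
  set g : ℝ → ℝ := fun r => (r ^ k) * (1 + r ^ 2)⁻¹ with hg
  have hgc : Continuous g := by
    refine (continuous_pow k).mul (Continuous.inv₀ (by fun_prop) fun x => by positivity)
  have hgfin : wnorm (powWeight k) (fun r => ((g r : ℝ) : ℂ)) ≠ ∞ :=
    wnorm_powWeight_ne_top (C := 1) fun r hr => by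
      rw [Complex.norm_real, Real.norm_of_nonneg (by positivity), hg]
      field_simp; exact le_rfl
  have hpt : ∀ r, 0 < r → ‖F r‖ ≤ 2 * (C + D) * ‖g r‖ + 2 * (Qconst m)⁻¹ * ‖a‖ * ‖Q m r‖ := by
    intro r hr
    have hQ := Q_pos m hr
    have hc := Qconst_pos m
    rw [Real.norm_of_nonneg hQ.le, Real.norm_of_nonneg (by positivity)]
    set y : ℝ := if r ≤ 1 then ‖F r - r ^ m • a‖ else ‖F r‖ with hy
    have h3 := mul_one_add_sq_le_of_split (r := r) (x := y) (c := 1) hk hC hD hr zero_le_one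
      (fun hr1 => by
        rw [hy, if_pos hr1, one_mul]
        exact h0 r hr hr1)
      (fun hr1 => by
        rw [hy, if_neg (not_le.2 hr1), one_mul]
        exact h1 r hr)
    have h4 : y ≤ 2 * (C + D) * g r := by
      rw [hg]
      simp only
      rw [← mul_assoc, ← div_eq_mul_inv, le_div_iff₀ (by positivity)]
      linarith
    have h5 : ‖F r‖ ≤ y + 2 * (Qconst m)⁻¹ * ‖a‖ * Q m r := by
      rw [hy]
      split_ifs with hr1
      · have h6 : F r = (F r - r ^ m • a) + r ^ m • a := by simp
        have h7 : r ^ m ≤ 2 * (Qconst m)⁻¹ * Q m r := by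
          rw [Q_eq]
          have h8 : r ^ (2 * (m + 1)) ≤ 1 := pow_le_one₀ hr.le hr1
          have h9 := one_add_pow_pos m r
          rw [show 2 * (Qconst m)⁻¹ * (Qconst m * r ^ m / (1 + r ^ (2 * (m + 1))))
            = r ^ m * (2 / (1 + r ^ (2 * (m + 1)))) by field_simp]
          refine le_mul_of_one_le_right (by positivity) ?_
          rw [one_le_div h9]
          linarith
        have h10 := norm_add_le (F r - r ^ m • a) (r ^ m • a)
        rw [← h6] at h10
        refine h10.trans ?_
        rw [norm_smul, Real.norm_of_nonneg (by positivity)]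
        have := mul_le_mul_of_nonneg_right h7 (norm_nonneg a)
        linarith
      · exact le_add_of_nonneg_right (by positivity)
    linarith
  have hle : wnorm (adaptedWeight k m) F ≤ wnorm (adaptedWeight k m) (fun r =>
      (2 * (C + D)) • g r + (2 * (Qconst m)⁻¹ * ‖a‖) • Q m r) := l2norm_mono fun r hr => by
    gcongr
    rw [← ofReal_norm, ← ofReal_norm]
    refine ENNReal.ofReal_le_ofReal ((hpt r hr).trans ?_)
    have hQ := Q_pos m hr
    have hc := Qconst_pos m
    have hg0 : 0 ≤ g r := by
      rw [hg]; positivity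
    simp only [smul_eq_mul]
    rw [Real.norm_of_nonneg hQ.le, Real.norm_of_nonneg hg0, Real.norm_of_nonneg (by positivity)]
  have hgfin' : wnorm (adaptedWeight k m) g ≠ ∞ :=
    ne_top_of_le_ne_top hgfin (l2norm_mono fun r hr => by
      refine mul_le_mul' (adaptedWeight_le k m hr) ?_
      rw [← ofReal_norm, ← ofReal_norm, Complex.norm_real])
  have hW := measurable_adaptedWeight k m
  have hA := wnorm_add_le hW (f := fun r => (2 * (C + D)) • g r)
    (g := fun r => (2 * (Qconst m)⁻¹ * ‖a‖) • Q m r) (hgc.const_smul (2 * (C + D))).measurable.aemeasurable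
    (((continuous_Q m).const_smul (2 * (Qconst m)⁻¹ * ‖a‖)).measurable).aemeasurable
  have h3 := wnorm_smul_le (W := adaptedWeight k m) (f := g) (s := fun _ => 2 * (C + D))
    ‖2 * (C + D)‖₊ fun r _ => by simp
  have h4 := wnorm_smul_le (W := adaptedWeight k m) (f := Q m)
    (s := fun _ => 2 * (Qconst m)⁻¹ * ‖a‖) ‖2 * (Qconst m)⁻¹ * ‖a‖‖₊ fun r _ => by simp
  exact ne_top_of_le_ne_top (ENNReal.add_ne_top.2
    ⟨ne_top_of_le_ne_top (ENNReal.mul_ne_top ENNReal.coe_ne_top hgfin') h3,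
      ne_top_of_le_ne_top (ENNReal.mul_ne_top ENNReal.coe_ne_top
        (wnorm_adaptedWeight_Q_ne_top hk hkm)) h4⟩) (hle.trans hA)

/-- Decay of the derivatives of the radial part of a Schwartz function. -/
lemma exists_iteratedDeriv_radialPart_le (f : 𝓢(ℂ, ℂ)) (k : ℕ) : ∃ C : ℝ, 0 ≤ C ∧
    ∀ j ≤ k, ∀ r : ℝ, 0 < r → r ^ j * ‖iteratedDeriv j (radialPart f) r‖ ≤ C := by
  have hg : Function.HasTemperateGrowth Complex.ofRealCLM := by fun_prop
  have ha : AntilipschitzWith 1 Complex.ofRealCLM := Complex.isometry_ofReal.antilipschitz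
  set g := SchwartzMap.compCLMOfAntilipschitz ℝ hg ha f
  have he : (g : ℝ → ℂ) = radialPart f := rfl
  choose C hC h using fun j => g.decay j j
  refine ⟨∑ j ∈ Finset.range (k + 1), C j, Finset.sum_nonneg fun j _ => (hC j).le,
    fun j hj r hr => ?_⟩
  have h1 := h j r
  rw [norm_iteratedFDeriv_eq_norm_iteratedDeriv, he, Real.norm_of_nonneg hr.le] at h1
  exact h1.trans (Finset.single_le_sum (fun j _ => (hC j).le) (by simpa using Nat.lt_succ_of_le hj))

lemma contDiff_radialPart (f : 𝓢(ℂ, ℂ)) : ContDiff ℝ ((⊤ : ℕ∞) : WithTop ℕ∞) (radialPart f) :=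
  contDiff_comp_ofReal (f.smooth ⊤)

lemma regular_of_contDiff (n : ℕ) {f : ℝ → ℂ}
    (hf : ContDiffOn ℝ ((⊤ : ℕ∞) : WithTop ℕ∞) f (Ioi 0)) : Regular n f :=
  Regular.of_contDiffOn (hf.of_le (by exact_mod_cast le_top))

/-- r∂_r - m annihilates the leading term a r^m, so near 0 q only sees the Taylor remainder O(r^k);
the function itself needs just the adapted weight. -/
lemma exists_adaptedBound_radialPart {k m : ℕ} (hk : 2 ≤ k) (hkm : k ≤ m + 2) (f : 𝓢(ℂ, ℂ))
    (hf : IsEquivariant m f) : ∃ B : ℝ≥0∞, B ≠ ∞ ∧ AdaptedBound k m B (radialPart f) := by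
  obtain ⟨a, C, hC, h0⟩ := exists_radial_taylor hkm hf (f.smooth ⊤)
  obtain ⟨D, hD, h1⟩ := exists_iteratedDeriv_radialPart_le f k
  set F := radialPart f with hF
  have hs : ContDiff ℝ ((⊤ : ℕ∞) : WithTop ℕ∞) F := contDiff_radialPart f
  set h : ℝ → ℂ := fun r => F r - r ^ m • a with hh
  have hsh : ContDiff ℝ ((⊤ : ℕ∞) : WithTop ℕ∞) h :=
    hs.sub ((contDiff_id.pow m).smul contDiff_const)
  set q : ℝ → ℂ := fun r => r • deriv F r - (m : ℝ) • F r with hq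
  -- q is the same whether computed from F or from the remainder: the latter is used for r ≤ 1, the
  -- former for r > 1, where the remainder need not decay.
  have hqh : q = fun r => r • deriv h r - (m : ℝ) • h r := by
    funext r
    have hd : deriv h r = deriv F r - (m * r ^ (m - 1)) • a := by
      have h2 := ((hs.differentiable (by simp)) r).hasDerivAt.sub
        ((hasDerivAt_pow m r).smul_const a)
      exact h2.deriv
    simp only [hq, hd]
    simp only [hh, smul_sub, smul_smul]
    have : r * (m * r ^ (m - 1)) = m * r ^ m := by
      rcases m with _ | m
      · simp
      · simp [pow_succ]; ring
    rw [this]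
    abel
  have hderiv : ∀ {g : ℝ → ℂ}, ContDiff ℝ ((⊤ : ℕ∞) : WithTop ℕ∞) g → ∀ j r, 0 < r →
      iteratedDeriv j (fun r => r • deriv g r - (m : ℝ) • g r) r
        = r • iteratedDeriv (j + 1) g r - ((m : ℝ) - j) • iteratedDeriv j g r := by
    intro g hg j r hr
    have hc : ContDiff ℝ 1 (iteratedDeriv j g) := by
      rw [iteratedDeriv_eq_iterate]
      exact (hg.iterate_deriv j).of_le (by norm_cast)
    have := smul_iteratedDeriv_succ (f := g) (m : ℝ) (j := j)
      ((hg.of_le (by exact_mod_cast le_top)).contDiffOn) hr (hc.differentiable (by simp) r)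
    rw [this]; abel
  have hqd : ∀ {g : ℝ → ℂ}, ContDiff ℝ ((⊤ : ℕ∞) : WithTop ℕ∞) g →
      q = (fun r => r • deriv g r - (m : ℝ) • g r) → ∀ {E : ℝ} {r : ℝ}, 0 < r →
      (∀ j ≤ k, r ^ j * ‖iteratedDeriv j g r‖ ≤ E) → ∀ j ≤ k - 1,
      ‖r ^ (0 + j) • iteratedDeriv j q r‖ ≤ (1 + m + k) * E := by
    intro g hg hqg E r hr hE j hj
    rw [hqg, hderiv hg j r hr, zero_add, smul_sub, smul_smul, ← pow_succ, smul_smul]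
    refine (norm_sub_le _ _).trans ?_
    rw [norm_smul, norm_smul, norm_mul, Real.norm_of_nonneg (by positivity),
      Real.norm_of_nonneg (by positivity)]
    have e1 := hE (j + 1) (by omega)
    have e2 := hE j (by omega)
    have hE0 : 0 ≤ E := le_trans (by positivity) e2
    have e3 : ‖(m : ℝ) - j‖ ≤ m + k := by
      refine (norm_sub_le _ _).trans ?_
      simp only [Real.norm_natCast]
      gcongr
      omega
    calc _ ≤ E + ‖(m : ℝ) - j‖ * E := by
          refine add_le_add e1 ?_
          rw [mul_comm (r ^ j), mul_assoc]; gcongr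
      _ ≤ E + (m + k) * E := by gcongr
      _ = _ := by ring
  have hqb : ∀ j ≤ k - 1, wnorm (powWeight k) (fun r => r ^ (0 + j) • iteratedDeriv j q r) ≠ ∞ := by
    intro j hj
    refine wnorm_powWeight_ne_top (C := 2 * (1 + m + k) * (C + D)) fun r hr => ?_
    refine mul_one_add_sq_le_of_split hk hC hD hr (by positivity) (fun hr1 => ?_) (fun _ => ?_)
    · refine hqd hsh hqh hr (fun i hi => ?_) j hj
      calc r ^ i * ‖iteratedDeriv i h r‖ ≤ r ^ i * (C * r ^ (k - i)) := by
            gcongr; exact h0 i hi r hr.le hr1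
        _ = C * r ^ k := by rw [mul_left_comm, ← pow_add, Nat.add_sub_cancel' hi]
    · exact hqd hs hq hr (fun i hi => h1 i hi r hr) j hj
  have hFb : wnorm (adaptedWeight k m) F ≠ ∞ :=
    wnorm_adaptedWeight_ne_top_of_taylor hk hkm hC hD (fun r hr hr1 => h0 0 (by omega) r hr.le hr1)
      (fun r hr => by simpa using h1 0 (by omega) r hr)
  obtain ⟨K, hK⟩ := exists_eulerBound_of_iteratedDeriv (k - 1) 0
  set B₀ : ℝ≥0∞ := ∑ j ∈ Finset.range k, wnorm (powWeight k)
    (fun r => r ^ (0 + j) • iteratedDeriv j q r) with hB₀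
  have hB₀fin : B₀ ≠ ∞ :=
    ENNReal.sum_ne_top.2 fun j hj => hqb j (by have := Finset.mem_range.1 hj; omega)
  have hqs : ContDiff ℝ ((⊤ : ℕ∞) : WithTop ℕ∞) q :=
    (contDiff_id.smul (contDiff_infty_iff_deriv.1 hs).2).sub (hs.const_smul (m : ℝ))
  have hqB := hK (powWeight k) B₀ q (measurable_powWeight k) (regular_of_contDiff _ hqs.contDiffOn)
    fun j hj => Finset.single_le_sum (f := fun j => wnorm (powWeight k)
      (fun r => r ^ (0 + j) • iteratedDeriv j q r)) (fun _ _ => zero_le)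
      (Finset.mem_range.2 (by omega))
  refine ⟨K * B₀ + wnorm (adaptedWeight k m) F,
    ENNReal.add_ne_top.2 ⟨ENNReal.mul_ne_top ENNReal.coe_ne_top hB₀fin, hFb⟩, q, ?_,
    (hqB.congr fun r _ => by simp).mono le_self_add, le_add_self⟩
  exact (regular_of_contDiff 1 hs.contDiffOn).hasEulerDeriv.congr (fun _ _ => rfl)
    (Eventually.of_forall fun r => by simp [hq])

/-! ### Linear structure of the adapted spaces -/

section

variable {k m : ℕ} {B B' : ℝ≥0∞} {v w : ℝ → ℂ}

lemma AdaptedBound.mono (hv : AdaptedBound k m B v) (h : B ≤ B') : AdaptedBound k m B' v := by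
  obtain ⟨q, hq, hqB, h0⟩ := hv
  exact ⟨q, hq, hqB.mono h, h0.trans h⟩

lemma AdaptedBound.congr (hv : AdaptedBound k m B v) (h : ∀ r, 0 < r → v r = w r) :
    AdaptedBound k m B w := by
  obtain ⟨q, hq, hqB, h0⟩ := hv
  refine ⟨q, hq.congr h (ae_halfLine_of_forall fun r hr => by rw [h r hr]), hqB, ?_⟩
  rwa [← wnorm_congr h]

lemma AdaptedBound.add (hv : AdaptedBound k m B v) (hw : AdaptedBound k m B' w) :
    AdaptedBound k m (B + B') (fun r => v r + w r) := by
  obtain ⟨q, hq, hqB, h0⟩ := hv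
  obtain ⟨p, hp, hpB, k0⟩ := hw
  refine ⟨fun r => q r + p r, (hq.add hp).congr (fun _ _ => rfl)
    (Eventually.of_forall fun r => ?_), hqB.add (measurable_powWeight k) hpB,
    (wnorm_add_le (measurable_adaptedWeight k m) (aemeasurable_of_continuousOn hq.continuousOn)
      (aemeasurable_of_continuousOn hp.continuousOn)).trans (add_le_add h0 k0)⟩
  simp only [smul_add]
  abel

lemma AdaptedBound.const_smul (c : ℝ) (hv : AdaptedBound k m B v) :
    AdaptedBound k m (‖c‖₊ * B) (fun r => c • v r) := by
  obtain ⟨q, hq, hqB, h0⟩ := hv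
  refine ⟨fun r => c • q r, (hq.const_smul c).congr (fun _ _ => rfl)
    (Eventually.of_forall fun r => ?_), hqB.const_smul c, ?_⟩
  · simp only [smul_add, smul_comm c (m : ℝ)]
  · exact (wnorm_smul_le (s := fun _ => c) ‖c‖₊ fun r _ => by simp).trans (by gcongr)

lemma AdaptedBound.of_eulerBound (hm : EulerBound (powWeight (k + 1)) B (k + 1) v) :
    AdaptedBound (k + 1) m ((1 + ‖(m : ℝ)‖₊ : NNReal) * B) v := by
  have h1 : B ≤ (1 + ‖(m : ℝ)‖₊ : NNReal) * B := by
    rw [ENNReal.coe_add, add_mul]; simp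
  obtain ⟨⟨_, h0⟩, g, hg, hgB⟩ := id hm
  refine ⟨fun r => g r - (m : ℝ) • v r, hg.congr (fun _ _ => rfl)
    (Eventually.of_forall fun r => by simp), ?_, le_trans ?_ (h0.trans h1)⟩
  · refine (hgB.sub (measurable_powWeight _) (hm.pred.const_smul (m : ℝ))).mono (le_of_eq ?_)
    rw [ENNReal.coe_add, add_mul]; simp
  · exact wnorm_mono fun r hr => by gcongr; exact adaptedWeight_le _ m hr

/-- A triangle inequality up to a constant, obtained through `AdaptedBound`, which is visibly
subadditive and depends only on values on (0,∞). -/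
lemma exists_adaptedNorm_congr_add_le (hk : 2 ≤ k) (hkm : k ≤ m + 2) : ∃ C : NNReal,
    ∀ v w x : ℝ → ℂ, Regular k v → Regular k w → (∀ r, 0 < r → x r = v r + w r) →
      adaptedNorm k m x ≤ C * (adaptedNorm k m v + adaptedNorm k m w) := by
  obtain ⟨C, hC⟩ := exists_adaptedBound_of_adaptedNorm hk m
  obtain ⟨D, hD⟩ := exists_adaptedNorm_le hk hkm
  refine ⟨D * C, fun v w x hv hw hx => ?_⟩
  refine (hD x _ ((hv.add hw).congr fun r hr => (hx r hr).symm)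
    (((hC v hv).add (hC w hw)).congr fun r hr => (hx r hr).symm)).trans (le_of_eq ?_)
  push_cast
  ring

lemma exists_adaptedNorm_smul_le (hk : 2 ≤ k) (hkm : k ≤ m + 2) : ∃ C : NNReal,
    ∀ (c : ℝ) (v : ℝ → ℂ), Regular k v →
      adaptedNorm k m (fun r => c • v r) ≤ C * (‖c‖₊ * adaptedNorm k m v) := by
  obtain ⟨C, hC⟩ := exists_adaptedBound_of_adaptedNorm hk m
  obtain ⟨D, hD⟩ := exists_adaptedNorm_le hk hkm
  refine ⟨D * C, fun c v hv => (hD _ _ (hv.const_smul c) ((hC v hv).const_smul c)).trans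
    (le_of_eq ?_)⟩
  push_cast
  ring

lemma memAdapted_iff (hk : 1 ≤ k) : MemAdapted k m v ↔ Regular k v ∧
    ∃ f : ℕ → 𝓢(ℂ, ℂ), (∀ n, IsEquivariant m (f n)) ∧
      Tendsto (fun n => adaptedNorm k m (fun r => v r - radialPart (f n) r)) atTop (𝓝 0) := by
  obtain ⟨n, rfl⟩ : ∃ n, k = n + 1 := ⟨k - 1, by omega⟩
  exact and_assoc.symm

lemma MemAdapted.regular (hk : 1 ≤ k) (hv : MemAdapted k m v) : Regular k v :=
  ((memAdapted_iff hk).1 hv).1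

lemma regular_radialPart (k : ℕ) (f : 𝓢(ℂ, ℂ)) : Regular k (radialPart f) :=
  regular_of_contDiff k (contDiff_radialPart f).contDiffOn

lemma Regular.sub (hv : Regular k v) (hw : Regular k w) : Regular k (fun r => v r - w r) :=
  (hv.add (hw.const_smul (-1))).congr fun r _ => by simp [sub_eq_add_neg]

lemma MemAdapted.exists_adaptedBound (hk : 2 ≤ k) (hkm : k ≤ m + 2) (hv : MemAdapted k m v) :
    ∃ B : ℝ≥0∞, B ≠ ∞ ∧ AdaptedBound k m B v := by
  obtain ⟨hr, f, hf, hlim⟩ := (memAdapted_iff (by omega)).1 hv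
  -- One approximant at finite distance suffices to transfer finiteness from Schwartz functions.
  obtain ⟨n, hn⟩ := (hlim.eventually (gt_mem_nhds one_pos)).exists
  obtain ⟨C, hC⟩ := exists_adaptedBound_of_adaptedNorm hk m
  obtain ⟨B, hB, hfB⟩ := exists_adaptedBound_radialPart hk hkm (f n) (hf n)
  refine ⟨_, ?_, ((hC _ (hr.sub (regular_radialPart k (f n)))).add hfB).congr
    fun r _ => by simp⟩
  exact ENNReal.add_ne_top.2 ⟨ENNReal.mul_ne_top ENNReal.coe_ne_top hn.ne_top, hB⟩

lemma MemAdapted.adaptedNorm_ne_top (hk : 2 ≤ k) (hkm : k ≤ m + 2) (hv : MemAdapted k m v) :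
    adaptedNorm k m v ≠ ∞ := by
  obtain ⟨B, hB, h⟩ := hv.exists_adaptedBound hk hkm
  obtain ⟨D, hD⟩ := exists_adaptedNorm_le hk hkm
  exact ne_top_of_le_ne_top (ENNReal.mul_ne_top ENNReal.coe_ne_top hB)
    (hD v B (hv.regular (by omega)) h)

lemma MemAdapted.congr (hk : 2 ≤ k) (hkm : k ≤ m + 2) (hv : MemAdapted k m v)
    (h : ∀ r, 0 < r → v r = w r) : MemAdapted k m w := by
  obtain ⟨hr, f, hf, hlim⟩ := (memAdapted_iff (by omega)).1 hv
  obtain ⟨C, hC⟩ := exists_adaptedBound_of_adaptedNorm hk m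
  obtain ⟨D, hD⟩ := exists_adaptedNorm_le hk hkm
  refine (memAdapted_iff (by omega)).2 ⟨hr.congr h, f, hf, ?_⟩
  have hd := fun n => hr.sub (regular_radialPart k (f n))
  have he : ∀ n r, 0 < r → v r - radialPart (f n) r = w r - radialPart (f n) r :=
    fun n r hr => by rw [h r hr]
  refine tendsto_of_tendsto_of_tendsto_of_le_of_le tendsto_const_nhds (h := fun n =>
    D * (C * adaptedNorm k m (fun r => v r - radialPart (f n) r))) ?_ (fun _ => zero_le)
    fun n => hD _ _ ((hd n).congr (he n)) ((hC _ (hd n)).congr (he n))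
  have := ENNReal.Tendsto.const_mul (a := (D * C : ℝ≥0∞)) hlim
    (Or.inr (ENNReal.mul_ne_top ENNReal.coe_ne_top ENNReal.coe_ne_top))
  simpa [mul_assoc] using this

lemma IsEquivariant.add {f g : ℂ → ℂ} (hf : IsEquivariant m f) (hg : IsEquivariant m g) :
    IsEquivariant m (fun z => f z + g z) := fun θ z => by
  simp only [hf θ z, hg θ z, mul_add]

lemma MemAdapted.add (hk : 2 ≤ k) (hkm : k ≤ m + 2) (hv : MemAdapted k m v)
    (hw : MemAdapted k m w) : MemAdapted k m (fun r => v r + w r) := by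
  obtain ⟨hr, f, hf, hlim⟩ := (memAdapted_iff (by omega)).1 hv
  obtain ⟨hs, g, hg, hlim'⟩ := (memAdapted_iff (by omega)).1 hw
  obtain ⟨C, hC⟩ := exists_adaptedNorm_congr_add_le hk hkm
  refine (memAdapted_iff (by omega)).2 ⟨hr.add hs, fun n => f n + g n,
    fun n => (hf n).add (hg n), ?_⟩
  refine tendsto_of_tendsto_of_tendsto_of_le_of_le tendsto_const_nhds (h := fun n =>
    C * (adaptedNorm k m (fun r => v r - radialPart (f n) r)
      + adaptedNorm k m (fun r => w r - radialPart (g n) r))) ?_ (fun _ => zero_le)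
    fun n => hC _ _ _ (hr.sub (regular_radialPart k (f n))) (hs.sub (regular_radialPart k (g n)))
      fun r _ => by simp [radialPart]; ring
  have := ENNReal.Tendsto.const_mul (a := (C : ℝ≥0∞)) (hlim.add hlim')
    (Or.inr ENNReal.coe_ne_top)
  simpa using this

lemma MemAdapted.const_smul (hk : 2 ≤ k) (hkm : k ≤ m + 2) (c : ℝ) (hv : MemAdapted k m v) :
    MemAdapted k m (fun r => c • v r) := by
  obtain ⟨hr, f, hf, hlim⟩ := (memAdapted_iff (by omega)).1 hv
  obtain ⟨C, hC⟩ := exists_adaptedNorm_smul_le hk hkm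
  refine (memAdapted_iff (by omega)).2 ⟨hr.const_smul c, fun n => c • f n,
    fun n θ z => ?_, ?_⟩
  · have := hf n θ z
    simp only [smul_apply, this, Complex.real_smul]
    ring
  refine tendsto_of_tendsto_of_tendsto_of_le_of_le tendsto_const_nhds (h := fun n =>
    C * (‖c‖₊ * adaptedNorm k m (fun r => v r - radialPart (f n) r))) ?_ (fun _ => zero_le)
    fun n => ?_
  · have := ENNReal.Tendsto.const_mul (a := (C * ‖c‖₊ : ℝ≥0∞)) hlim
      (Or.inr (ENNReal.mul_ne_top ENNReal.coe_ne_top ENNReal.coe_ne_top))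
    simpa [mul_assoc] using this
  · have := hC c _ (hr.sub (regular_radialPart k (f n)))
    simpa [radialPart, mul_sub] using this

/-- Schwartz functions belong to the adapted spaces. -/
lemma memAdapted_radialPart (hk : 2 ≤ k) (hkm : k ≤ m + 2) (f : 𝓢(ℂ, ℂ))
    (hf : IsEquivariant m f) : MemAdapted k m (radialPart f) := by
  refine (memAdapted_iff (by omega)).2 ⟨regular_radialPart k f, fun _ => f, fun _ => hf, ?_⟩
  obtain ⟨C, hC⟩ := exists_adaptedNorm_smul_le hk hkm
  have := hC 0 _ (regular_radialPart k f)
  have h0 : adaptedNorm k m (fun r => radialPart f r - radialPart f r) = 0 := by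
    have e : (fun r => radialPart f r - radialPart f r) = fun r => (0 : ℝ) • radialPart f r := by
      funext r; simp
    rw [e]
    simpa using this
  simp only [h0]
  exact tendsto_const_nhds

end

/-! ### Cutoffs -/

/-- A smooth cutoff which is `1` for `r ≤ 1` and `0` for `2 ≤ r`. -/
def cutoff (r : ℝ) : ℝ := 1 - Real.smoothTransition (r - 1)

lemma contDiff_cutoff : ContDiff ℝ ((⊤ : ℕ∞) : WithTop ℕ∞) cutoff :=
  contDiff_const.sub (Real.smoothTransition.contDiff.comp (contDiff_id.sub contDiff_const))

lemma cutoff_of_le_one {r : ℝ} (h : r ≤ 1) : cutoff r = 1 := by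
  rw [cutoff, Real.smoothTransition.zero_of_nonpos (by linarith), sub_zero]

lemma cutoff_of_two_le {r : ℝ} (h : 2 ≤ r) : cutoff r = 0 := by
  rw [cutoff, Real.smoothTransition.one_of_one_le (by linarith), sub_self]

/-- Applying r∂_r to a smooth function that is constant near 0 and near ∞ gives another one, with
both constants equal to 0. -/
lemma exists_symbolBound_of_eq_const (n : ℕ) : ∀ {s : ℝ → ℝ} {c₁ c₂ : ℝ},
    ContDiff ℝ ((⊤ : ℕ∞) : WithTop ℕ∞) s → (∀ r, 0 < r → r < 1 → s r = c₁) →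
    (∀ r, 2 < r → s r = c₂) → ∃ C, SymbolBound C n s := by
  have hb : ∀ {s : ℝ → ℝ} {c₁ c₂ : ℝ}, Continuous s → (∀ r, 0 < r → r < 1 → s r = c₁) →
      (∀ r, 2 < r → s r = c₂) → ∃ C : NNReal, ∀ r, 0 < r → |s r| ≤ C := by
    intro s c₁ c₂ hs h1 h2
    obtain ⟨C, hC⟩ := (isCompact_Icc (a := (1 : ℝ)) (b := 2)).exists_bound_of_continuousOn
      hs.continuousOn
    refine ⟨C.toNNReal + (‖c₁‖₊ + ‖c₂‖₊), fun r hr => ?_⟩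
    push_cast
    have a1 := norm_nonneg c₁
    have a2 := norm_nonneg c₂
    have a3 : 0 ≤ max C 0 := le_max_right _ _
    rw [Real.coe_toNNReal']
    rcases lt_or_ge r 1 with hr1 | hr1
    · rw [h1 r hr hr1, ← Real.norm_eq_abs]; linarith
    · rcases lt_or_ge 2 r with hr2 | hr2
      · rw [h2 r hr2, ← Real.norm_eq_abs]; linarith
      · have := (hC r ⟨hr1, hr2⟩).trans (le_max_left C 0)
        rw [Real.norm_eq_abs] at this
        linarith
  induction n with
  | zero =>
    intro s c₁ c₂ hs h1 h2
    obtain ⟨C, hC⟩ := hb hs.continuous h1 h2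
    exact ⟨C, hs.continuous.continuousOn, hC⟩
  | succ n ih =>
    intro s c₁ c₂ hs h1 h2
    obtain ⟨C, hC⟩ := hb hs.continuous h1 h2
    obtain ⟨D, hD⟩ := ih (s := fun r => r * deriv s r) (c₁ := 0) (c₂ := 0)
      (contDiff_id.mul (contDiff_infty_iff_deriv.1 hs).2)
      (fun r hr hr1 => by
        have : s =ᶠ[𝓝 r] fun _ => c₁ := by
          filter_upwards [Ioo_mem_nhds hr hr1] with x hx using h1 x hx.1 hx.2
        rw [this.deriv_eq]; simp)
      (fun r hr => by
        have : s =ᶠ[𝓝 r] fun _ => c₂ := by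
          filter_upwards [Ioi_mem_nhds hr] with x hx using h2 x hx
        rw [this.deriv_eq]; simp)
    refine ⟨max C D, fun r hr => (hC r hr).trans (by simp), _, fun r hr => ?_,
      hD.mono (le_max_right _ _)⟩
    rw [smul_eq_mul, inv_mul_cancel_left₀ hr.ne']
    exact (hs.differentiable (by simp) r).hasDerivAt

/-- Euler derivatives commute with dilations. The bounds on the cutoffs are therefore uniform in the
scale. -/
lemma SymbolBound.comp_mul {C : NNReal} {n : ℕ} {s : ℝ → ℝ} (h : SymbolBound C n s) {c : ℝ}
    (hc : 0 < c) : SymbolBound C n (fun r => s (c * r)) := by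
  induction n generalizing s with
  | zero =>
    exact ⟨h.1.comp (by fun_prop) fun r hr => mul_pos hc hr, fun r hr => h.2 _ (mul_pos hc hr)⟩
  | succ n ih =>
    obtain ⟨h0, s', hs', h1⟩ := h
    refine ⟨fun r hr => h0 _ (mul_pos hc hr), _, fun r hr => ?_, ih h1⟩
    have hd : HasDerivAt (fun r : ℝ => c * r) c r := by
      simpa using (hasDerivAt_id r).const_mul c
    refine ((hs' _ (mul_pos hc hr)).comp r hd).congr_deriv ?_
    simp only [smul_eq_mul]
    field_simp

/-- The region where the `n`-th cutoff in `cutoffBand` equals `1`. -/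
def band (n : ℕ) : Set ℝ := {r | 2 < (n + 1) * r ∧ (n + 1 : ℝ)⁻¹ * r < 1}

lemma isOpen_band (n : ℕ) : IsOpen (band n) :=
  (isOpen_lt (f := fun _ => (2 : ℝ)) (g := fun r : ℝ => (n + 1) * r) (by fun_prop)
    (by fun_prop)).inter (isOpen_lt (f := fun r : ℝ => (n + 1 : ℝ)⁻¹ * r) (g := fun _ => 1)
    (by fun_prop) (by fun_prop))

/-- A cutoff to `[1/(n+1), 2(n+1)]`. -/
def cutoffBand (n : ℕ) (r : ℝ) : ℝ := (1 - cutoff ((n + 1) * r)) * cutoff ((n + 1 : ℝ)⁻¹ * r)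

lemma contDiff_cutoffBand (n : ℕ) : ContDiff ℝ ((⊤ : ℕ∞) : WithTop ℕ∞) (cutoffBand n) :=
  (contDiff_const.sub (contDiff_cutoff.comp (contDiff_const.mul contDiff_id))).mul
    (contDiff_cutoff.comp (contDiff_const.mul contDiff_id))

lemma cutoffBand_of_mem {n : ℕ} {r : ℝ} (h : r ∈ band n) : cutoffBand n r = 1 := by
  rw [cutoffBand, cutoff_of_two_le h.1.le, cutoff_of_le_one h.2.le]; simp

lemma cutoffBand_of_lt {n : ℕ} {r : ℝ} (h : r < (n + 1 : ℝ)⁻¹) : cutoffBand n r = 0 := by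
  have : (n + 1) * r ≤ 1 := by
    have h1 : (0 : ℝ) < n + 1 := by positivity
    calc (n + 1) * r ≤ (n + 1) * (n + 1 : ℝ)⁻¹ := by gcongr
      _ = 1 := mul_inv_cancel₀ h1.ne'
  rw [cutoffBand, cutoff_of_le_one this]; simp

lemma cutoffBand_of_gt {n : ℕ} {r : ℝ} (h : 2 * (n + 1 : ℝ) < r) : cutoffBand n r = 0 := by
  have h1 : (0 : ℝ) < n + 1 := by positivity
  have : 2 ≤ (n + 1 : ℝ)⁻¹ * r := by
    rw [le_inv_mul_iff₀ h1]; linarith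
  rw [cutoffBand, cutoff_of_two_le this]; simp

lemma SymbolBound.one_sub {C : NNReal} {n : ℕ} {s : ℝ → ℝ} (h : SymbolBound C n s) :
    SymbolBound (1 + 2 ^ n * C) n (fun r => 1 - s r) := by
  refine (((SymbolBound.const 1 n).add ((SymbolBound.const (-1) n).mul h)).congr
    fun r _ => by ring).mono (le_of_eq ?_)
  simp

lemma exists_symbolBound_cutoffBand (N : ℕ) : ∃ C : NNReal, ∀ n : ℕ,
    SymbolBound C N (fun r => 1 - cutoffBand n r) := by
  obtain ⟨C, hC⟩ := exists_symbolBound_of_eq_const N contDiff_cutoff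
    (fun r _ h => cutoff_of_le_one h.le) (fun r h => cutoff_of_two_le h.le)
  refine ⟨1 + 2 ^ N * (2 ^ N * ((1 + 2 ^ N * C) * C)), fun n => ?_⟩
  have h1 : (0 : ℝ) < n + 1 := by positivity
  exact (((hC.comp_mul h1).one_sub).mul (hC.comp_mul (inv_pos.2 h1))).one_sub

/-! ### Localized bounds -/

lemma tendsto_wnorm_indicator_band {W : ℝ → ℝ≥0∞} (hW : Measurable W) {f : ℝ → ℂ}
    (hf : AEMeasurable f halfLine) (hfin : wnorm W f ≠ ∞) :
    Tendsto (fun n => wnorm ((band n)ᶜ.indicator W) f) atTop (𝓝 0) := by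
  have hpt : ∀ r : ℝ, 0 < r → ∀ᶠ n : ℕ in atTop, r ∈ band n := by
    intro r hr
    have t1 : Tendsto (fun n : ℕ => ((n : ℝ) + 1)) atTop atTop :=
      tendsto_natCast_atTop_atTop.atTop_add tendsto_const_nhds
    have t2 : Tendsto (fun n : ℕ => ((n : ℝ) + 1) * r) atTop atTop := t1.atTop_mul_const hr
    have t3 : Tendsto (fun n : ℕ => ((n : ℝ) + 1)⁻¹ * r) atTop (𝓝 0) := by
      simpa using t1.inv_tendsto_atTop.mul_const r
    filter_upwards [t2.eventually_gt_atTop 2, t3.eventually (gt_mem_nhds one_pos)] with n h1 h2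
      using ⟨h1, h2⟩
  have hmeas : ∀ n, Measurable ((band n)ᶜ.indicator W) := fun n =>
    hW.indicator (isOpen_band n).measurableSet.compl
  have h := tendsto_lintegral_of_dominated_convergence' (μ := halfLine)
    (F := fun n r => ((band n)ᶜ.indicator W r * ‖f r‖ₑ) ^ 2 * ENNReal.ofReal (2 * Real.pi * r))
    (f := fun _ => 0) (fun r => (W r * ‖f r‖ₑ) ^ 2 * ENNReal.ofReal (2 * Real.pi * r))
    (fun n => (((hmeas n).aemeasurable.mul hf.enorm).pow_const 2).mul (by fun_prop))
    (fun n => Eventually.of_forall fun r => by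
      dsimp only
      gcongr
      exact indicator_le_self _ _ r)
    (by
      have := l2norm_sq (fun r => W r * ‖f r‖ₑ)
      rw [← this]
      exact ENNReal.pow_ne_top hfin)
    (ae_halfLine_of_forall fun r hr => by
      refine tendsto_const_nhds.congr' ?_
      filter_upwards [hpt r hr] with n hn
      rw [indicator_of_notMem (by simpa using hn)]
      simp)
  have h2 := (ENNReal.continuous_rpow_const (y := (1 / 2 : ℝ))).continuousAt.tendsto.comp h
  simpa [Function.comp_def, wnorm, l2norm] using h2

lemma EulerBound.eventually_indicator_band {W : ℝ → ℝ≥0∞} (hW : Measurable W) {B : ℝ≥0∞}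
    (hB : B ≠ ∞) {N : ℕ} : ∀ {f : ℝ → ℂ}, EulerBound W B N f → ∀ ε : ℝ≥0∞, 0 < ε →
    ∀ᶠ n in atTop, EulerBound ((band n)ᶜ.indicator W) ε N f := by
  have key : ∀ {f : ℝ → ℂ}, EulerBound W B 0 f → ∀ ε : ℝ≥0∞, 0 < ε →
      ∀ᶠ n in atTop, EulerBound ((band n)ᶜ.indicator W) ε 0 f := by
    intro f hf ε hε
    filter_upwards [(tendsto_wnorm_indicator_band hW hf.1
      (ne_top_of_le_ne_top hB hf.2)).eventually (gt_mem_nhds hε)] with n hn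
    exact ⟨hf.1, hn.le⟩
  induction N with
  | zero => exact key
  | succ N ih =>
    intro f hf ε hε
    obtain ⟨h0, g, hg, hgB⟩ := hf
    filter_upwards [key h0 ε hε, ih hgB ε hε] with n h1 h2
    exact ⟨h1, g, hg, h2⟩

/-- On an open set where f vanishes all its derivatives vanish, so the weight can be restored there.
The argument passes through iterated derivatives because Euler derivatives are determined only
almost everywhere. -/
lemma exists_eulerBound_of_support (N : ℕ) : ∃ C : NNReal, ∀ (W : ℝ → ℝ≥0∞) (B : ℝ≥0∞)
    (f : ℝ → ℂ) (U : Set ℝ), Measurable W → IsOpen U → (∀ r ∈ U, 0 < r → f r = 0) → Regular N f →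
      EulerBound (Uᶜ.indicator W) B N f → EulerBound W (C * B) N f := by
  obtain ⟨C, hC⟩ := exists_iteratedDeriv_bound N 0
  obtain ⟨D, hD⟩ := exists_eulerBound_of_iteratedDeriv N 0
  refine ⟨D * C, fun W B f U hW hU h0 hf hfB => ?_⟩
  have h1 := hC _ B f (hW.indicator hU.measurableSet.compl) (hfB.congr fun r _ => by simp)
  refine ((hD W (C * B) f hW hf fun j hj => le_trans (l2norm_mono fun r hr => ?_)
    (h1 j hj)).congr fun r _ => by simp).mono (by push_cast; rw [mul_assoc])
  by_cases hrU : r ∈ U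
  · have : f =ᶠ[𝓝 r] fun _ => 0 := by
      filter_upwards [hU.mem_nhds hrU, Ioi_mem_nhds hr] with x hx hx0 using h0 x hx hx0
    have h2 : iteratedDeriv j f r = 0 := by
      rw [this.iteratedDeriv_eq]
      simp
    simp [h2]
  · rw [indicator_of_mem (by simpa using hrU)]

/-! ### Membership in the adapted spaces -/

/-- The equivariant function with a given radial part which vanishes near `0` and `∞`. -/
lemma exists_schwartz_of_vanishing {m : ℕ} {V : ℝ → ℂ} {a b : ℝ} (ha : 0 < a)
    (hV : ContDiffOn ℝ ((⊤ : ℕ∞) : WithTop ℕ∞) V (Ioi 0)) (h0 : ∀ r < a, V r = 0)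
    (h1 : ∀ r, b < r → V r = 0) : ∃ f : 𝓢(ℂ, ℂ), IsEquivariant m f ∧
      ∀ r, 0 < r → radialPart f r = V r := by
  set f : ℂ → ℂ := fun z => (z / (‖z‖ : ℂ)) ^ m * V ‖z‖ with hf
  have hs : ContDiff ℝ ((⊤ : ℕ∞) : WithTop ℕ∞) f := by
    rw [contDiff_iff_contDiffAt]
    intro z
    by_cases hz : z = 0
    · have : f =ᶠ[𝓝 z] fun _ => 0 := by
        filter_upwards [Metric.ball_mem_nhds z ha] with w hw
        rw [hz, mem_ball_zero_iff] at hw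
        simp [hf, h0 _ hw]
      exact contDiffAt_const.congr_of_eventuallyEq this
    · have hn : ContDiffAt ℝ ((⊤ : ℕ∞) : WithTop ℕ∞) (fun z : ℂ => ‖z‖) z := contDiffAt_norm ℝ hz
      have hn' : ContDiffAt ℝ ((⊤ : ℕ∞) : WithTop ℕ∞) (fun z : ℂ => (‖z‖ : ℂ)) z :=
        Complex.ofRealCLM.contDiff.contDiffAt.comp z hn
      have hz' : (‖z‖ : ℂ) ≠ 0 := by simpa using hz
      have hq : ContDiffAt ℝ ((⊤ : ℕ∞) : WithTop ℕ∞) (fun z : ℂ => z / (‖z‖ : ℂ)) z := by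
        simp only [div_eq_mul_inv]
        exact contDiffAt_id.mul (hn'.inv hz')
      refine (hq.pow m).mul ?_
      exact (hV.contDiffAt (Ioi_mem_nhds (norm_pos_iff.2 hz))).comp z hn
  have hc : HasCompactSupport f := by
    refine HasCompactSupport.intro (isCompact_closedBall (0 : ℂ) b) fun z hz => ?_
    rw [mem_closedBall_zero_iff, not_le] at hz
    simp [hf, h1 _ hz]
  refine ⟨hc.toSchwartzMap hs, fun θ z => ?_, fun r hr => ?_⟩
  · change f _ = _ * f z
    simp only [hf, norm_mul, Complex.norm_exp_ofReal_mul_I, one_mul]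
    rw [mul_div_assoc, mul_pow, ← Complex.exp_nat_mul, mul_assoc, mul_assoc]
  · change f r = V r
    simp only [hf, Complex.norm_real, Real.norm_of_nonneg hr.le]
    rw [div_self (by exact_mod_cast hr.ne')]
    simp

/-- A truncation to an annulus is the radial part of a Schwartz function. The error is v times a
symbol supported off the band where the cutoff is 1, bounded uniformly in n by the tail of a finite
norm. -/
lemma memAdapted_of_eulerBound {k m : ℕ} (hk : 2 ≤ k) (hkm : k ≤ m + 2)
    {v : ℝ → ℂ} (hs : ContDiffOn ℝ ((⊤ : ℕ∞) : WithTop ℕ∞) v (Ioi 0)) {B : ℝ≥0∞} (hB : B ≠ ∞)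
    (hv : EulerBound (powWeight k) B k v) : MemAdapted k m v := by
  have hreg := regular_of_contDiff k hs
  obtain ⟨C₁, hC₁⟩ := exists_symbolBound_cutoffBand k
  obtain ⟨C₂, hC₂⟩ := exists_eulerBound_of_support k
  obtain ⟨C₃, hC₃⟩ := exists_adaptedNorm_le hk hkm
  have hcs : ∀ n, ContDiffOn ℝ ((⊤ : ℕ∞) : WithTop ℕ∞) (fun r => cutoffBand n r • v r) (Ioi 0) :=
    fun n => (contDiff_cutoffBand n).contDiffOn.smul hs
  have hf : ∀ n : ℕ, ∃ f : 𝓢(ℂ, ℂ), IsEquivariant m f ∧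
      ∀ r, 0 < r → radialPart f r = cutoffBand n r • v r := fun n =>
    exists_schwartz_of_vanishing (m := m) (a := (n + 1 : ℝ)⁻¹) (b := 2 * (n + 1)) (by positivity) (hcs n)
      (fun r hr => by rw [cutoffBand_of_lt hr, zero_smul])
      (fun r hr => by rw [cutoffBand_of_gt hr, zero_smul])
  choose f hfe hfr using hf
  refine (memAdapted_iff (by omega)).2 ⟨hreg, f, hfe, ?_⟩
  obtain ⟨l, rfl⟩ : ∃ l, k = l + 1 := ⟨k - 1, by omega⟩
  set K : NNReal := C₃ * ((1 + ‖(m : ℝ)‖₊) * (C₂ * (2 ^ (l + 1) * C₁))) with hK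
  have key : ∀ ε : ℝ≥0∞, 0 < ε → ∀ᶠ n in atTop,
      adaptedNorm (l + 1) m (fun r => v r - radialPart (f n) r) ≤ K * ε := by
    intro ε hε
    filter_upwards [hv.eventually_indicator_band (measurable_powWeight _) hB ε hε] with n hn
    have h1 := (hC₁ n).smul ((measurable_powWeight _).indicator
      (isOpen_band n).measurableSet.compl) hn
    have hd : Regular (l + 1) (fun r => (1 - cutoffBand n r) • v r) :=
      regular_of_contDiff _ ((contDiff_const.sub (contDiff_cutoffBand n)).contDiffOn.smul hs)
    have h2 := hC₂ _ _ _ _ (measurable_powWeight (l + 1)) (isOpen_band n)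
      (fun r hr _ => by rw [cutoffBand_of_mem hr]; simp) hd h1
    have he : ∀ r, 0 < r → (1 - cutoffBand n r) • v r = v r - radialPart (f n) r :=
      fun r hr => by rw [hfr n r hr, sub_smul, one_smul]
    refine (hC₃ _ _ (hd.congr he) ((AdaptedBound.of_eulerBound h2).congr he)).trans (le_of_eq ?_)
    rw [hK]
    push_cast
    ring
  rw [ENNReal.tendsto_nhds_zero]
  intro ε hε
  rcases eq_or_ne ε ∞ with rfl | hε'
  · exact Eventually.of_forall fun _ => le_top
  -- K + 1 rather than K, since K may be 0.
  refine (key (ε / (K + 1)) (ENNReal.div_pos hε.ne' (by simp))).mono fun n hn => hn.trans ?_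
  rw [← mul_div_assoc]
  refine ENNReal.div_le_of_le_mul ?_
  rw [mul_comm]
  gcongr
  exact le_self_add

/-- For functions that behave like r^m at 0 the weight r^{-k} need not be finite there. The part
near the origin is itself a Schwartz function; only the outer part is approximated by truncation.
The cutoff is taken in r², which is smooth on the plane. -/
lemma memAdapted_of_contDiff {k m : ℕ} (hk : 2 ≤ k) (hkm : k ≤ m + 2)
    {f : ℂ → ℂ} (hs : ContDiff ℝ ((⊤ : ℕ∞) : WithTop ℕ∞) f) (hf : IsEquivariant m f) {B : ℝ≥0∞}
    (hB : B ≠ ∞) (hfB : EulerBound ((Iio 1)ᶜ.indicator (powWeight k)) B k (radialPart f)) :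
    MemAdapted k m (radialPart f) := by
  have hψ : ContDiff ℝ ((⊤ : ℕ∞) : WithTop ℕ∞) (fun r : ℝ => cutoff (r ^ 2)) :=
    contDiff_cutoff.comp (contDiff_id.pow 2)
  obtain ⟨C, hC⟩ := exists_symbolBound_of_eq_const (s := fun r => cutoff (r ^ 2)) k hψ
    (fun r h0 h => cutoff_of_le_one (by nlinarith)) (fun r h => cutoff_of_two_le (by nlinarith))
  obtain ⟨D, hD⟩ := exists_eulerBound_of_support k
  have hF : ContDiffOn ℝ ((⊤ : ℕ∞) : WithTop ℕ∞) (radialPart f) (Ioi 0) :=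
    (contDiff_comp_ofReal hs).contDiffOn
  have hout : ContDiffOn ℝ ((⊤ : ℕ∞) : WithTop ℕ∞)
      (fun r => (1 - cutoff (r ^ 2)) • radialPart f r) (Ioi 0) :=
    (contDiff_const.sub hψ).contDiffOn.smul hF
  have h1 := hD _ _ _ _ (measurable_powWeight k) isOpen_Iio
    (fun r hr hr0 => by
      rw [cutoff_of_le_one (by have : r < 1 := hr; nlinarith)]; simp) (regular_of_contDiff k hout)
    (hC.one_sub.smul ((measurable_powWeight k).indicator measurableSet_Iio.compl) hfB)
  have h2 := memAdapted_of_eulerBound hk hkm hout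
    (ENNReal.mul_ne_top ENNReal.coe_ne_top (ENNReal.mul_ne_top ENNReal.coe_ne_top hB)) h1
  have hgs : ContDiff ℝ ((⊤ : ℕ∞) : WithTop ℕ∞) (fun z : ℂ => cutoff (‖z‖ ^ 2) • f z) :=
    (contDiff_cutoff.comp (contDiff_norm_sq ℝ)).smul hs
  have hgc : HasCompactSupport (fun z : ℂ => cutoff (‖z‖ ^ 2) • f z) := by
    refine HasCompactSupport.intro (isCompact_closedBall (0 : ℂ) 2) fun z hz => ?_
    rw [mem_closedBall_zero_iff, not_le] at hz
    rw [cutoff_of_two_le (by nlinarith), zero_smul]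
  have h3 := memAdapted_radialPart hk hkm (hgc.toSchwartzMap hgs) (m := m) fun θ z => by
    change cutoff (‖_‖ ^ 2) • f _ = _ * (cutoff (‖z‖ ^ 2) • f z)
    rw [hf θ z, norm_mul, Complex.norm_exp_ofReal_mul_I, one_mul, mul_smul_comm]
  refine (h3.add hk hkm h2).congr hk hkm fun r hr => ?_
  change cutoff (‖(r : ℂ)‖ ^ 2) • f r + (1 - cutoff (r ^ 2)) • f r = f r
  rw [Complex.norm_real, Real.norm_of_nonneg hr.le, ← add_smul]
  simp

/-! ### The null modes belong to the adapted spaces -/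

lemma eulerBound_zero (W : ℝ → ℝ≥0∞) (n : ℕ) : EulerBound W 0 n (fun _ => 0) := by
  have h0 : wnorm W (fun _ : ℝ => (0 : ℂ)) ≤ 0 := by simp [wnorm, l2norm]
  induction n with
  | zero => exact ⟨aemeasurable_const, h0⟩
  | succ n ih => exact ⟨⟨aemeasurable_const, h0⟩, _, HasEulerDeriv.const 0, ih⟩

lemma exists_symbolBound_affine (m n : ℕ) (a b : ℝ) :
    ∃ C, SymbolBound C n (fun r => a + b * tanhProfile m r) := by
  obtain ⟨C, hC⟩ := tanhProfile_polynomial_symbolBound m n (Polynomial.C a + Polynomial.C b * Polynomial.X)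
  exact ⟨C, hC.congr fun r _ => by simp⟩

lemma wnorm_sq_mul_Q_ne_top {k m : ℕ} (hk : 2 ≤ k) (hkm : k ≤ m + 2) (c : ℂ) :
    wnorm (powWeight k) (fun r => ((r ^ 2 * Q m r) • c)) ≠ ∞ :=
  wnorm_powWeight_ne_top (C := 2 * Qconst m * ‖c‖) fun r hr => by
    have := Q_pos m hr
    rw [norm_smul, Real.norm_of_nonneg (by positivity)]
    calc r ^ 2 * Q m r * ‖c‖ * (1 + r ^ 2) = (r ^ 2 * Q m r * (1 + r ^ 2)) * ‖c‖ := by ring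
      _ ≤ (2 * Qconst m * r ^ k) * ‖c‖ :=
          mul_le_mul_of_nonneg_right (sq_mul_Q_mul_le hk hkm hr) (norm_nonneg c)
      _ = _ := by ring

lemma exists_eulerBound_Q {k m : ℕ} (hk : 2 ≤ k) (hkm : k ≤ m + 2) (c : ℂ) : ∃ B : ℝ≥0∞, B ≠ ∞ ∧
    EulerBound ((Iio 1)ᶜ.indicator (powWeight k)) B k (fun r => Q m r • c) := by
  obtain ⟨C, hC⟩ := exists_symbolBound_affine m (k - 1) (-1) (-(m + 1))
  obtain ⟨K, hK⟩ := EulerBound.of_linear hC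
  have hd : HasEulerDeriv (fun r => Q m r • c)
      (fun r => (-1 + -(m + 1) * tanhProfile m r) • (Q m r • c) + 0) :=
    ((hasEulerDeriv_Q m).smul (HasEulerDeriv.const c)).congr (fun _ _ => rfl)
      (Eventually.of_forall fun r => by
        simp only [smul_zero, add_zero, smul_smul]
        congr 1; ring)
  have hfin := wnorm_sq_mul_Q_ne_top hk hkm c
  have hle : wnorm ((Iio 1)ᶜ.indicator (powWeight k)) (fun r => Q m r • c)
      ≤ wnorm (powWeight k) (fun r => ((r ^ 2 * Q m r) • c)) := wnorm_mono fun r hr => by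
    by_cases h1 : r < 1
    · rw [indicator_of_notMem (by simpa using h1)]; simp
    · rw [indicator_of_mem (by simpa using h1)]
      gcongr
      rw [enorm_smul, enorm_smul]
      gcongr
      have := Q_pos m hr
      rw [← ofReal_norm, ← ofReal_norm, Real.norm_of_nonneg this.le,
        Real.norm_of_nonneg (by positivity)]
      refine ENNReal.ofReal_le_ofReal (le_mul_of_one_le_left this.le (one_le_pow₀ (not_lt.1 h1)))
  have := hK _ (wnorm (powWeight k) (fun r => ((r ^ 2 * Q m r) • c))) _ (fun _ => 0)
    ((measurable_powWeight k).indicator measurableSet_Iio.compl) hd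
    ((eulerBound_zero _ _).mono zero_le) hle
  rw [Nat.sub_add_cancel (by omega)] at this
  exact ⟨_, ENNReal.mul_ne_top ENNReal.coe_ne_top hfin, this⟩

/-- u and Q r^{-m} are smooth functions of |z|², so the product extends to a smooth equivariant
function on the plane. This covers ΛQ and iQ. -/
lemma memAdapted_Q_mul {k m : ℕ} (hk : 2 ≤ k) (hkm : k ≤ m + 2) (c : ℂ) (P : Polynomial ℝ) :
    MemAdapted k m (fun r => (P.eval (tanhProfile m r) * Q m r) • c) := by
  set f : ℂ → ℂ := fun z => (P.eval (((‖z‖ ^ 2) ^ (m + 1) - 1) / (1 + (‖z‖ ^ 2) ^ (m + 1))) *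
    (Qconst m / (1 + (‖z‖ ^ 2) ^ (m + 1)))) • (z ^ m * c) with hf
  have hpos : ∀ z : ℂ, 1 + (‖z‖ ^ 2) ^ (m + 1) ≠ 0 := fun z => by positivity
  have hn : ContDiff ℝ ((⊤ : ℕ∞) : WithTop ℕ∞) (fun z : ℂ => (‖z‖ ^ 2) ^ (m + 1)) :=
    ContDiff.pow (contDiff_norm_sq ℝ) _
  have hs : ContDiff ℝ ((⊤ : ℕ∞) : WithTop ℕ∞) f := by
    have hz : ContDiff ℝ ((⊤ : ℕ∞) : WithTop ℕ∞) (fun z : ℂ => z ^ m * c) :=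
      (contDiff_id.pow m).mul contDiff_const
    have hP : ContDiff ℝ ((⊤ : ℕ∞) : WithTop ℕ∞) (fun x => P.eval x) := by
      simpa using P.contDiff_aeval (𝕜 := ℝ) ((⊤ : ℕ∞) : WithTop ℕ∞)
    have hu : ContDiff ℝ ((⊤ : ℕ∞) : WithTop ℕ∞) (fun z : ℂ =>
        P.eval (((‖z‖ ^ 2) ^ (m + 1) - 1) / (1 + (‖z‖ ^ 2) ^ (m + 1)))) :=
      hP.comp ((hn.sub contDiff_const).div (contDiff_const.add hn) hpos)
    have hq : ContDiff ℝ ((⊤ : ℕ∞) : WithTop ℕ∞) (fun z : ℂ =>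
        Qconst m / (1 + (‖z‖ ^ 2) ^ (m + 1))) :=
      contDiff_const.div (contDiff_const.add hn) hpos
    exact (hu.mul hq).smul hz
  have hfr : ∀ r, 0 < r → radialPart f r = (P.eval (tanhProfile m r) * Q m r) • c := by
    intro r hr
    simp only [radialPart, hf, Complex.norm_real, Real.norm_of_nonneg hr.le, ← pow_mul]
    rw [show (r : ℂ) ^ m * c = (r ^ m : ℝ) • c by simp, smul_smul]
    congr 1
    rw [Q_eq, tanhProfile]
    ring
  have hfe : IsEquivariant m f := fun θ z => by
    simp only [hf, norm_mul, Complex.norm_exp_ofReal_mul_I, one_mul, mul_pow,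
      ← Complex.exp_nat_mul, mul_smul_comm, ← mul_assoc]
  obtain ⟨C, hC⟩ := tanhProfile_polynomial_symbolBound m k P
  obtain ⟨B, hB, hQ⟩ := exists_eulerBound_Q hk hkm c
  have h1 := hC.smul ((measurable_powWeight k).indicator measurableSet_Iio.compl) hQ
  exact (memAdapted_of_contDiff hk hkm hs hfe (ENNReal.mul_ne_top ENNReal.coe_ne_top hB)
    (h1.congr fun r hr => by rw [hfr r hr, smul_smul])).congr hk hkm hfr

/-- The extra r² makes the weight r^{-k} finite at 0, and r²Q solves a homogeneous Euler equation
with bounded coefficient, so all derivatives follow. -/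
lemma exists_eulerBound_sq_mul_Q {k m : ℕ} (hk : 2 ≤ k) (hkm : k ≤ m + 2) (c : ℂ) (n : ℕ) :
    ∃ B : ℝ≥0∞, B ≠ ∞ ∧ EulerBound (powWeight k) B (n + 1) (fun r => (r ^ 2 * Q m r) • c) := by
  obtain ⟨C, hC⟩ := exists_symbolBound_affine m n 1 (-(m + 1))
  obtain ⟨K, hK⟩ := EulerBound.of_linear hC
  have hd : HasEulerDeriv (fun r => (r ^ 2 * Q m r) • c)
      (fun r => (1 + -(m + 1) * tanhProfile m r) • ((r ^ 2 * Q m r) • c) + 0) :=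
    (((hasEulerDeriv_pow 2).smul (hasEulerDeriv_Q m)).smul (HasEulerDeriv.const c)).congr
      (fun _ _ => rfl)
      (Eventually.of_forall fun r => by
        simp only [smul_zero, add_zero, smul_smul, smul_eq_mul]
        congr 1
        push_cast; ring)
  have hfin := wnorm_sq_mul_Q_ne_top hk hkm c
  have := hK _ _ _ (fun _ => 0) (measurable_powWeight k) hd ((eulerBound_zero _ _).mono zero_le)
    le_rfl
  exact ⟨_, ENNReal.mul_ne_top ENNReal.coe_ne_top hfin, this⟩

lemma contDiff_Q (m : ℕ) : ContDiff ℝ ((⊤ : ℕ∞) : WithTop ℕ∞) (Q m) := by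
  unfold Q
  exact ContDiff.div (by fun_prop) (by fun_prop) (fun x => (one_add_pow_pos m x).ne')

lemma contDiff_tanhProfile (m : ℕ) : ContDiff ℝ ((⊤ : ℕ∞) : WithTop ℕ∞) (tanhProfile m) := by
  unfold tanhProfile
  exact ContDiff.div (by fun_prop) (by fun_prop) (fun x => (one_add_pow_pos m x).ne')

lemma memAdapted_sq_mul_Q {k m : ℕ} (hk : 2 ≤ k) (hkm : k ≤ m + 2) (c : ℂ) :
    MemAdapted k m (fun r => (r ^ 2 * Q m r) • c) := by
  obtain ⟨B, hB, h⟩ := exists_eulerBound_sq_mul_Q hk hkm c (k - 1)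
  rw [Nat.sub_add_cancel (by omega)] at h
  exact memAdapted_of_eulerBound hk hkm
    ((((contDiff_id.pow 2).mul (contDiff_Q m)).smul contDiff_const).contDiffOn) hB h

lemma contDiffOn_integral {f : ℝ → ℝ} (hc : Continuous f)
    (hs : ContDiffOn ℝ ((⊤ : ℕ∞) : WithTop ℕ∞) f (Ioi 0)) :
    ContDiffOn ℝ ((⊤ : ℕ∞) : WithTop ℕ∞) (fun r => ∫ x in (0 : ℝ)..r, f x) (Ioi 0) := by
  have hd : ∀ r, HasDerivAt (fun r => ∫ x in (0 : ℝ)..r, f x) (f r) r := fun r =>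
    (hc.integral_hasStrictDerivAt 0 r).hasDerivAt
  refine (contDiffOn_infty_iff_deriv_of_isOpen isOpen_Ioi).2
    ⟨fun r _ => (hd r).differentiableAt.differentiableWithinAt, ?_⟩
  rwa [show deriv (fun r => ∫ x in (0 : ℝ)..r, f x) = f from funext fun r => (hd r).deriv]

lemma contDiffOn_rho (m : ℕ) :
    ContDiffOn ℝ ((⊤ : ℕ∞) : WithTop ℕ∞) (rho m) (Ioi 0) := by
  have hl : ContDiffOn ℝ ((⊤ : ℕ∞) : WithTop ℕ∞) Real.log (Ioi 0) :=
    Real.contDiffOn_log.mono fun r hr => (ne_of_gt hr : r ≠ 0)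
  have hu := (contDiff_tanhProfile m).contDiffOn (s := Ioi 0)
  have hg : ContDiffOn ℝ ((⊤ : ℕ∞) : WithTop ℕ∞)
      (fun r => (m + 1) * Real.log r * tanhProfile m r - 1) (Ioi 0) :=
    ((contDiffOn_const.mul hl).mul hu).sub contDiffOn_const
  refine ContDiffOn.congr ((contDiff_Q m).contDiffOn.mul (contDiffOn_const.mul
    ((hg.mul (contDiffOn_integral (continuous_first m) (hu.mul contDiffOn_id))).sub
      (hu.mul (contDiffOn_integral (continuous_second m) (hg.mul contDiffOn_id))))))
    fun r hr => rho_eq m (le_of_lt hr)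

/-- The bound |ρ| ≲ r²Q gives the weight r^{-k} at both ends, so no smoothness at the origin is
required. The equation for L_Q ρ expresses q through r²Q and the potential terms, and the bootstrap
gives the derivatives. -/
lemma memAdapted_rho {k m : ℕ} (hk : 3 ≤ k) (hkm : k ≤ m + 2) :
    MemAdapted k m (fun r => (rho m r : ℂ)) := by
  set v : ℝ → ℂ := fun r => (rho m r : ℂ) with hv
  have hs : ContDiffOn ℝ ((⊤ : ℕ∞) : WithTop ℕ∞) v (Ioi 0) :=
    Complex.ofRealCLM.contDiff.comp_contDiffOn (contDiffOn_rho m)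
  set C₀ : ℝ := (m + 3) / (m + 1) ^ 2 with hC₀
  have hfin : wnorm (powWeight k) v ≠ ∞ :=
    wnorm_powWeight_ne_top (C := C₀ * (2 * Qconst m)) fun r hr => by
      rw [Complex.norm_real, Real.norm_eq_abs]
      calc |rho m r| * (1 + r ^ 2) ≤ C₀ * (r ^ 2 * Q m r) * (1 + r ^ 2) := by
            gcongr; exact abs_rho_le m hr
        _ = C₀ * (r ^ 2 * Q m r * (1 + r ^ 2)) := by ring
        _ ≤ C₀ * (2 * Qconst m * r ^ k) :=
            mul_le_mul_of_nonneg_left (sq_mul_Q_mul_le (by omega) hkm hr) (by positivity)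
        _ = _ := by ring
  have hfin' : wnorm (adaptedWeight k m) v ≤ wnorm (powWeight k) v :=
    wnorm_mono fun r hr => by gcongr; exact adaptedWeight_le k m hr
  have hreg := regular_of_contDiff 1 hs
  set q : ℝ → ℂ := fun r => r • deriv v r - (m : ℝ) • v r with hq
  have hvq : HasEulerDeriv v (fun r => q r + (m : ℝ) • v r) :=
    hreg.hasEulerDeriv.congr (fun _ _ => rfl) (Eventually.of_forall fun r => by simp [hq])
  have hqc : ContinuousOn q (Ioi 0) :=
    (continuousOn_id.smul (((contDiffOn_infty_iff_deriv_of_isOpen isOpen_Ioi).1 hs).2.continuousOn)).sub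
      (hs.continuousOn.const_smul (m : ℝ))
  have hqe : ∀ r, 0 < r → (r ^ 2 * Q m r) • ((1 / (2 * (m + 1)) : ℝ) : ℂ)
      - (((m : ℝ) + 1) • ((1 + tanhProfile m r) • v r)
      + ((Q m r * momentQ m v r : ℝ) : ℂ)) = q r := by
    intro r hr
    have := AdaptedBound.q_eq hvq hqc hr
    rw [hv, LQ_rho m hr, ← hv] at this
    rw [sub_eq_iff_eq_add, ← this]
    simp only [Complex.real_smul, pow_one]
    push_cast
    field_simp
  obtain ⟨B, hB, hBQ⟩ := exists_eulerBound_sq_mul_Q (by omega) hkm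
    ((1 / (2 * (m + 1)) : ℝ) : ℂ) (k - 1)
  have hqn : ∀ n ≤ k - 1, ∀ B', B ≤ B' →
      EulerBound (powWeight k) B' n (fun r => (1 + tanhProfile m r) • v r) →
      EulerBound (powWeight k) B' n (fun r => ((Q m r * momentQ m v r : ℝ) : ℂ)) →
      EulerBound (powWeight k) ((1 + (‖(m : ℝ) + 1‖₊ + 1) : NNReal) * B') n q := by
    intro n hn B' hBB h1 h2
    refine ((((hBQ.of_le (by omega)).mono hBB).sub (measurable_powWeight k)
      ((h1.const_smul ((m : ℝ) + 1)).add (measurable_powWeight k) h2)).congr hqe).mono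
      (le_of_eq ?_)
    push_cast
    ring
  obtain ⟨C, hC⟩ := exists_potential_eulerBound hk hkm (k - 1) (1 + (‖(m : ℝ) + 1‖₊ + 1))
  obtain ⟨h1, h2⟩ := hC (B + wnorm (powWeight k) v) v q hvq (hfin'.trans le_add_self)
    (ne_top_of_le_ne_top hfin hfin')
    fun n hn B' hBB => hqn n hn.le B' (le_self_add.trans hBB)
  have h3 := hqn (k - 1) le_rfl ((C + 1 : NNReal) * (B + wnorm (powWeight k) v))
    (by
      calc B ≤ ((1 : NNReal) : ℝ≥0∞) * (B + wnorm (powWeight k) v) := by simp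
        _ ≤ _ := by gcongr; simp)
    (h1.mono (by gcongr; simp)) (h2.mono (by gcongr; simp))
  have h4 := EulerBound.of_dPlus (measurable_powWeight k) hvq
    (h3.mono (le_self_add (b := wnorm (powWeight k) v))) le_add_self
  rw [Nat.sub_add_cancel (by omega)] at h4
  refine memAdapted_of_eulerBound (by omega) hkm hs ?_ h4
  finiteness

lemma LambdaQ_eq (m : ℕ) {r : ℝ} (hr : 0 < r) :
    LambdaQ m r = -(m + 1) * tanhProfile m r * Q m r := by
  rw [LambdaQ, (hasDerivAt_Q_euler m hr).deriv, smul_eq_mul, mul_inv_cancel_left₀ hr.ne']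
  ring

lemma memAdapted_mode {k m : ℕ} (hk : 3 ≤ k) (hkm : k ≤ m + 2) (j : Fin 4) :
    MemAdapted k m (mode m j) := by
  have hk2 : 2 ≤ k := by omega
  fin_cases j
  · refine (memAdapted_Q_mul hk2 hkm 1 (Polynomial.C (-((m : ℝ) + 1)) * Polynomial.X)).congr hk2 hkm
      fun r hr => ?_
    have := LambdaQ_eq m hr
    simp [mode, this]
  · refine (memAdapted_Q_mul hk2 hkm Complex.I 1).congr hk2 hkm fun r hr => ?_
    simp [mode, mul_comm]
  · refine (memAdapted_sq_mul_Q hk2 hkm Complex.I).congr hk2 hkm fun r hr => ?_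
    simp [mode, mul_comm]
  · exact memAdapted_rho hk hkm

/-! ### The operators on the null modes -/

section

variable {k m : ℕ} {B B' : ℝ≥0∞} {v w : ℝ → ℂ}

lemma AdaptedBound.continuousOn_q (hk : 3 ≤ k) {q : ℝ → ℂ}
    (hq : EulerBound (powWeight k) B (k - 1) q) : ContinuousOn q (Ioi 0) :=
  (hq.of_le (by omega : 0 + 1 ≤ k - 1)).continuousOn

lemma AdaptedBound.differentiableAt (hk : 3 ≤ k) (hv : AdaptedBound k m B v) {r : ℝ}
    (hr : 0 < r) : DifferentiableAt ℝ v r := by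
  obtain ⟨q, hq, hqB, -⟩ := hv
  have hc := AdaptedBound.continuousOn_q hk hqB
  exact (hq.hasDerivAt (hc.add (hq.continuousOn.const_smul (m : ℝ))) hr).differentiableAt

lemma AdaptedBound.continuousOn (hk : 3 ≤ k) (hv : AdaptedBound k m B v) :
    ContinuousOn v (Ioi 0) :=
  fun _ hr => (hv.differentiableAt hk hr).continuousAt.continuousWithinAt

lemma AdaptedBound.intervalIntegrable (hm : 1 ≤ m) (hk : 3 ≤ k) (hkm : k ≤ m + 2)
    (hB : B ≠ ∞) (hv : AdaptedBound k m B v) {r : ℝ} (hr : 0 < r) :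
    IntervalIntegrable (fun x => Q m x * (v x).re * x) volume 0 r := by
  have hc := aemeasurable_of_continuousOn (hv.continuousOn hk)
  obtain ⟨q, -, -, h0⟩ := hv
  exact intervalIntegrable_momentQ (by omega) hkm hc (ne_top_of_le_ne_top hB h0) hr

lemma momentQ_sub {r : ℝ} (hv : IntervalIntegrable (fun x => Q m x * (v x).re * x) volume 0 r)
    (hw : IntervalIntegrable (fun x => Q m x * (w x).re * x) volume 0 r) :
    momentQ m (fun r => v r - w r) r = momentQ m v r - momentQ m w r := by
  unfold momentQ
  rw [← intervalIntegral.integral_sub hv hw]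
  refine intervalIntegral.integral_congr fun x _ => ?_
  simp only [Complex.sub_re]
  ring

lemma momentQ_add {r : ℝ} (hv : IntervalIntegrable (fun x => Q m x * (v x).re * x) volume 0 r)
    (hw : IntervalIntegrable (fun x => Q m x * (w x).re * x) volume 0 r) :
    momentQ m (fun r => v r + w r) r = momentQ m v r + momentQ m w r := by
  unfold momentQ
  rw [← intervalIntegral.integral_add hv hw]
  refine intervalIntegral.integral_congr fun x _ => ?_
  simp only [Complex.add_re]
  ring

lemma momentQ_const_smul (c r : ℝ) (v : ℝ → ℂ) :
    momentQ m (fun r => c • v r) r = c * momentQ m v r := by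
  unfold momentQ
  rw [← intervalIntegral.integral_const_mul]
  refine intervalIntegral.integral_congr fun x _ => ?_
  simp
  ring

lemma LQ_eq_momentQ (v : ℝ → ℂ) (r : ℝ) : LQ m v r =
    deriv v r - ((m + Atheta m r) / r) • v r + ((Q m r * (1 / r * momentQ m v r) : ℝ) : ℂ) := rfl

lemma LQ_congr (h : ∀ r, 0 < r → v r = w r) {r : ℝ} (hr : 0 < r) : LQ m v r = LQ m w r := by
  have he : v =ᶠ[𝓝 r] w := by
    filter_upwards [Ioi_mem_nhds hr] with x hx using h x hx
  rw [LQ_eq_momentQ, LQ_eq_momentQ, he.deriv_eq, h r hr, momentQ_congr h hr]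

lemma AQ_congr (h : ∀ r, 0 < r → v r = w r) {r : ℝ} (hr : 0 < r) : AQ m v r = AQ m w r := by
  have he : v =ᶠ[𝓝 r] w := by
    filter_upwards [Ioi_mem_nhds hr] with x hx using h x hx
  rw [AQ, AQ, he.deriv_eq, h r hr]

lemma AQstar_congr (h : ∀ r, 0 < r → v r = w r) {r : ℝ} (hr : 0 < r) :
    AQstar m v r = AQstar m w r := by
  have he : v =ᶠ[𝓝 r] w := by
    filter_upwards [Ioi_mem_nhds hr] with x hx using h x hx
  rw [AQstar, AQstar, he.deriv_eq, h r hr]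

lemma LQ_sub {r : ℝ} (hv : IntervalIntegrable (fun x => Q m x * (v x).re * x) volume 0 r)
    (hw : IntervalIntegrable (fun x => Q m x * (w x).re * x) volume 0 r)
    (hvd : DifferentiableAt ℝ v r) (hwd : DifferentiableAt ℝ w r) :
    LQ m (fun r => v r - w r) r = LQ m v r - LQ m w r := by
  rw [LQ_eq_momentQ, LQ_eq_momentQ, LQ_eq_momentQ, momentQ_sub hv hw, deriv_fun_sub hvd hwd]
  push_cast
  rw [smul_sub]
  ring

lemma LQ_add {r : ℝ} (hv : IntervalIntegrable (fun x => Q m x * (v x).re * x) volume 0 r)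
    (hw : IntervalIntegrable (fun x => Q m x * (w x).re * x) volume 0 r)
    (hvd : DifferentiableAt ℝ v r) (hwd : DifferentiableAt ℝ w r) :
    LQ m (fun r => v r + w r) r = LQ m v r + LQ m w r := by
  rw [LQ_eq_momentQ, LQ_eq_momentQ, LQ_eq_momentQ, momentQ_add hv hw, deriv_fun_add hvd hwd]
  push_cast
  rw [smul_add]
  ring

lemma LQ_const_smul (c r : ℝ) (v : ℝ → ℂ) : LQ m (fun r => c • v r) r = c • LQ m v r := by
  rw [LQ_eq_momentQ, LQ_eq_momentQ, momentQ_const_smul, deriv_fun_const_smul_field]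
  simp only [Complex.real_smul]
  push_cast
  ring

/-- The integrand is a total derivative: Q(Q + rQ')r = ½(r²Q²)'. -/
lemma momentQ_LambdaQ (m : ℕ) {r : ℝ} (hr : 0 < r) :
    momentQ m (fun x => (LambdaQ m x : ℂ)) r = (m + 1) ^ 2 * (1 - tanhProfile m r ^ 2) := by
  have h1 : momentQ m (fun x => (LambdaQ m x : ℂ)) r
      = momentQ m (fun x => ((-(m + 1) * tanhProfile m x * Q m x : ℝ) : ℂ)) r :=
    momentQ_congr (fun x hx => by rw [LambdaQ_eq m hx]) hr
  have hc := continuous_Q m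
  have hu := continuous_tanhProfile m
  rw [h1, momentQ, intervalIntegral.integral_eq_sub_of_hasDerivAt_of_le
    (f := fun x => 1 / 2 * (x ^ 2 * Q m x ^ 2)) hr.le (by fun_prop)]
  · rw [sq_mul_Q_sq]; ring
  · intro x hx
    have hQ := hasDerivAt_Q_euler m hx.1
    refine ((((hasDerivAt_pow 2 x).mul (hQ.pow 2))).const_mul (1 / 2)).congr_deriv ?_
    have := hx.1.ne'
    simp only [smul_eq_mul, Complex.ofReal_re, Pi.pow_apply]
    field_simp
    push_cast
    ring
  · refine Continuous.intervalIntegrable ?_ _ _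
    simp only [Complex.ofReal_re]
    fun_prop

lemma LQ_LambdaQ (m : ℕ) {r : ℝ} (hr : 0 < r) : LQ m (fun x => (LambdaQ m x : ℂ)) r = 0 := by
  have hd : HasDerivAt (fun x => (LambdaQ m x : ℂ)) ((-(m + 1) *
      (((m + 1) * (1 - tanhProfile m r ^ 2) / r) * Q m r +
        tanhProfile m r * (r⁻¹ • (-(1 + (m + 1) * tanhProfile m r) * Q m r))) : ℝ) : ℂ) r := by
    have h := ((hasDerivAt_tanhProfile m hr).mul (hasDerivAt_Q_euler m hr)).const_mul
      (-((m : ℝ) + 1))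
    refine (h.ofReal_comp).congr_of_eventuallyEq ?_
    filter_upwards [Ioi_mem_nhds hr] with x hx
    rw [LambdaQ_eq m hx]
    simp [mul_assoc]
  rw [LQ_eq_momentQ, hd.deriv, momentQ_LambdaQ m hr, LambdaQ_eq m hr, Atheta_eq_tanhProfile,
    Complex.real_smul, ← Complex.ofReal_mul, ← Complex.ofReal_sub, ← Complex.ofReal_add,
    ← Complex.ofReal_zero]
  congr 1
  have := hr.ne'
  rw [smul_eq_mul]
  field_simp
  ring

lemma momentQ_I_mul (f : ℝ → ℝ) (r : ℝ) : momentQ m (fun x => Complex.I * (f x : ℂ)) r = 0 := by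
  simp [momentQ]

lemma LQ_I_mul {f : ℝ → ℝ} {f' r : ℝ} (hf : HasDerivAt f f' r) :
    LQ m (fun x => Complex.I * (f x : ℂ)) r
      = Complex.I * ((f' - (m + Atheta m r) / r * f r : ℝ) : ℂ) := by
  have hd : HasDerivAt (fun x => Complex.I * (f x : ℂ)) (Complex.I * (f' : ℂ)) r :=
    hf.ofReal_comp.const_mul Complex.I
  rw [LQ_eq_momentQ, momentQ_I_mul, hd.deriv, Complex.real_smul]
  push_cast
  ring

lemma LQ_I_mul_Q (m : ℕ) {r : ℝ} (hr : 0 < r) : LQ m (fun x => Complex.I * (Q m x : ℂ)) r = 0 := by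
  rw [LQ_I_mul (hasDerivAt_Q m hr)]
  simp

lemma LQ_I_mul_sq_mul_Q (m : ℕ) {r : ℝ} (hr : 0 < r) :
    LQ m (fun x => Complex.I * ((x ^ 2 * Q m x : ℝ) : ℂ)) r
      = Complex.I * ((2 * (r * Q m r) : ℝ) : ℂ) := by
  have h := (hasDerivAt_pow 2 r).mul (hasDerivAt_Q m hr)
  rw [LQ_I_mul (f := fun x => x ^ 2 * Q m x) h]
  congr 2
  push_cast
  ring

lemma AQ_mul_Q (m : ℕ) (z : ℂ) {r : ℝ} (hr : 0 < r) : AQ m (fun x => (x * Q m x) • z) r = 0 := by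
  have h := (((hasDerivAt_id r).mul (hasDerivAt_Q m hr))).smul_const z
  have h' : HasDerivAt (fun x => (x * Q m x) • z) _ r := h
  rw [AQ, h'.deriv, smul_smul, ← sub_smul]
  have : 1 * Q m r + id r * ((m + Atheta m r) / r * Q m r)
      - (m + 1 + Atheta m r) / r * (r * Q m r) = 0 := by
    have := hr.ne'
    simp only [id]
    field_simp
    ring
  rw [this, zero_smul]

/-- A real linear combination of the four null modes. -/
def modeSum (m : ℕ) (c : Fin 4 → ℝ) (r : ℝ) : ℂ := ∑ j, c j • mode m j r

/-- The nested form matches the lemmas on sums of two functions. -/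
lemma modeSum_eq (m : ℕ) (c : Fin 4 → ℝ) : modeSum m c = fun r => (fun r => (fun r =>
    (fun r => c 0 • mode m 0 r) r + (fun r => c 1 • mode m 1 r) r) r
      + (fun r => c 2 • mode m 2 r) r) r + (fun r => c 3 • mode m 3 r) r := by
  funext r
  rw [modeSum, Fin.sum_univ_four]

lemma memAdapted_modeSum (hk : 3 ≤ k) (hkm : k ≤ m + 2) (c : Fin 4 → ℝ) :
    MemAdapted k m (modeSum m c) := by
  have hk2 : 2 ≤ k := by omega
  have h := fun j => (memAdapted_mode hk hkm j).const_smul hk2 hkm (c j)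
  rw [modeSum_eq]
  exact (((h 0).add hk2 hkm (h 1)).add hk2 hkm (h 2)).add hk2 hkm (h 3)

lemma exists_adaptedBound_modeSum (hk : 3 ≤ k) (hkm : k ≤ m + 2) : ∃ K : NNReal,
    ∀ (c : Fin 4 → ℝ) (D : ℝ≥0∞), (∀ j, ‖c j‖ₑ ≤ D) → AdaptedBound k m (K * D) (modeSum m c) := by
  choose B hB h using fun j => (memAdapted_mode hk hkm j).exists_adaptedBound (by omega) hkm
  refine ⟨(B 0).toNNReal + (B 1).toNNReal + (B 2).toNNReal + (B 3).toNNReal, fun c D hc => ?_⟩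
  have h' := fun j => ((h j).const_smul (c j)).mono
    (B' := (B j).toNNReal * D) (by
      rw [ENNReal.coe_toNNReal (hB j), mul_comm]
      gcongr
      exact hc j)
  rw [modeSum_eq]
  refine ((((h' 0).add (h' 1)).add (h' 2)).add (h' 3)).mono (le_of_eq ?_)
  push_cast
  ring

/-- The normalization functionals are triangular on the modes: L_Q sees only ir²Q and ρ, through
multiples of rQ, and the moment sees only ΛQ and ρ. -/
lemma momentQ_modeSum_and_LQ_modeSum (hm : 1 ≤ m) (c : Fin 4 → ℝ) {r : ℝ} (hr : 0 < r) :
    momentQ m (modeSum m c) r = c 0 * ((m + 1) ^ 2 * (1 - tanhProfile m r ^ 2))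
        + c 3 * momentQ m (fun r => (rho m r : ℂ)) r ∧
      LQ m (modeSum m c) r = (r * Q m r) •
        (((c 3 / (2 * (m + 1)) : ℝ) : ℂ) + ((2 * c 2 : ℝ) : ℂ) * Complex.I) := by
  have hb : ∀ j, ∃ B : ℝ≥0∞, B ≠ ∞ ∧ AdaptedBound 3 m B (fun r => c j • mode m j r) := fun j =>
    ((memAdapted_mode le_rfl (by omega) j).const_smul (by norm_num) (by omega)
      (c j)).exists_adaptedBound (by norm_num) (by omega)
  choose B hB h using hb
  have hi := fun j => (h j).intervalIntegrable hm le_rfl (by omega) (hB j) hr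
  have hd := fun j => (h j).differentiableAt le_rfl hr
  have h01 := (h 0).add (h 1)
  have h012 := h01.add (h 2)
  have i01 := h01.intervalIntegrable hm le_rfl (by omega) (ENNReal.add_ne_top.2 ⟨hB 0, hB 1⟩) hr
  have i012 := h012.intervalIntegrable hm le_rfl (by omega)
    (ENNReal.add_ne_top.2 ⟨ENNReal.add_ne_top.2 ⟨hB 0, hB 1⟩, hB 2⟩) hr
  have d01 := h01.differentiableAt le_rfl hr
  have d012 := h012.differentiableAt le_rfl hr
  have e0 : momentQ m (mode m 0) r = _ := momentQ_LambdaQ m hr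
  have e1 : momentQ m (mode m 1) r = 0 := momentQ_I_mul _ _
  have e2 : momentQ m (mode m 2) r = 0 := momentQ_I_mul _ _
  have e3 : momentQ m (mode m 3) r = momentQ m (fun r => (rho m r : ℂ)) r := rfl
  have l0 : LQ m (mode m 0) r = 0 := LQ_LambdaQ m hr
  have l1 : LQ m (mode m 1) r = 0 := LQ_I_mul_Q m hr
  have l2 : LQ m (mode m 2) r = _ := LQ_I_mul_sq_mul_Q m hr
  have l3 : LQ m (mode m 3) r = _ := LQ_rho m hr
  rw [modeSum_eq]
  constructor
  · rw [momentQ_add i012 (hi 3), momentQ_add i01 (hi 2), momentQ_add (hi 0) (hi 1)]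
    simp only [momentQ_const_smul, e0, e1, e2, e3]
    ring
  · rw [LQ_add i012 (hi 3) d012 (hd 3), LQ_add i01 (hi 2) d01 (hd 2),
      LQ_add (hi 0) (hi 1) (hd 0) (hd 1)]
    simp only [LQ_const_smul, l0, l1, l2, l3]
    simp only [Complex.real_smul]
    push_cast
    field_simp
    ring

end

/-! ### Control of finitely many functionals by the subcoercivity term -/

section

variable {k m : ℕ} {B : ℝ≥0∞} {v w : ℝ → ℂ}

/-- Fundamental theorem of calculus from 1 to x, averaged over the interval (1,2] of length one. -/
lemma enorm_apply_one_le {f : ℝ → ℂ} (hf : ContDiffOn ℝ 1 f (Ioi 0)) :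
    ‖f 1‖ₑ ≤ ∫⁻ x in Ioc (1 : ℝ) 2, (‖f x‖ₑ + ‖deriv f x‖ₑ) := by
  have hd : ∀ x, 0 < x → HasDerivAt f (deriv f x) x := fun x hx =>
    ((hf.contDiffAt (Ioi_mem_nhds hx)).differentiableAt (by simp)).hasDerivAt
  have hc : ContinuousOn (deriv f) (Ioi 0) :=
    hf.continuousOn_deriv_of_isOpen isOpen_Ioi le_rfl
  have hpt : ∀ x ∈ Ioc (1 : ℝ) 2, ‖f 1‖ₑ ≤ ‖f x‖ₑ + ∫⁻ y in Ioc (1 : ℝ) 2, ‖deriv f y‖ₑ := by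
    intro x hx
    have hsub : uIcc 1 x ⊆ Ioi 0 := by
      rw [uIcc_of_le hx.1.le]
      exact fun y hy => one_pos.trans_le hy.1
    have h := intervalIntegral.integral_eq_sub_of_hasDerivAt (fun y hy => hd y (hsub hy))
      (hc.mono hsub).intervalIntegrable
    have e : f 1 = f x - ∫ y in (1 : ℝ)..x, deriv f y := by rw [h]; abel
    rw [e]
    refine enorm_sub_le.trans (add_le_add_right ?_ _)
    rw [intervalIntegral.integral_of_le hx.1.le]
    exact (enorm_integral_le_lintegral_enorm _).trans
      (lintegral_mono_set (Ioc_subset_Ioc_right hx.2))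
  have hm : AEMeasurable (fun x => ‖f x‖ₑ) (volume.restrict (Ioc (1 : ℝ) 2)) :=
    ((hf.continuousOn.mono fun x hx => one_pos.trans hx.1).aemeasurable measurableSet_Ioc).enorm
  calc ‖f 1‖ₑ = ∫⁻ x in Ioc (1 : ℝ) 2, ‖f 1‖ₑ := by
        rw [setLIntegral_const, Real.volume_Ioc]; norm_num
    _ ≤ ∫⁻ x in Ioc (1 : ℝ) 2, (‖f x‖ₑ + ∫⁻ y in Ioc (1 : ℝ) 2, ‖deriv f y‖ₑ) :=
        setLIntegral_mono' measurableSet_Ioc hpt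
    _ = _ := by
        rw [lintegral_add_left' hm, lintegral_add_left' hm, setLIntegral_const, Real.volume_Ioc]
        norm_num

lemma measurable_ofReal_Q (m : ℕ) : Measurable (fun r => ENNReal.ofReal (Q m r)) :=
  (continuous_Q m).measurable.ennreal_ofReal

lemma aemeasurable_homAbs {n : ℕ} (hv : ∀ j, AEMeasurable (iteratedDeriv j v) halfLine) :
    AEMeasurable (homAbs n v) halfLine := by
  unfold homAbs
  exact AEMeasurable.iSup fun ℓ =>
    (((measurable_id.pow_const _).inv.aemeasurable).smul (hv _)).enorm

/-- On [1,2] Q is bounded below and powers of r are bounded above and below. The factor x³ ≥ 1 is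
inserted so that `lintegral_cube_mul_le` serves as Cauchy–Schwarz. -/
lemma exists_lintegral_iteratedDeriv_le (m n : ℕ) : ∃ K : NNReal, ∀ v : ℝ → ℂ,
    (∀ j, AEMeasurable (iteratedDeriv j v) halfLine) → ∀ j ≤ n,
    ∫⁻ x in Ioc (1 : ℝ) 2, ‖iteratedDeriv j v x‖ₑ ≤
      K * l2norm (fun r => ENNReal.ofReal (Q m r) * homAbs n v r) := by
  obtain ⟨x₀, hx₀, hmin⟩ := (isCompact_Icc (a := (1 : ℝ)) (b := 2)).exists_isMinOn
    (nonempty_Icc.2 one_le_two) (continuous_Q m).continuousOn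
  have hc : 0 < Q m x₀ := Q_pos m (one_pos.trans_le hx₀.1)
  refine ⟨(2 ^ n * (Q m x₀)⁻¹).toNNReal * (2 ^ 3 : ℝ).toNNReal, fun v hv j hj => ?_⟩
  set H : ℝ → ℝ≥0∞ := fun r => ENNReal.ofReal (Q m r) * homAbs n v r with hH
  have hHm : AEMeasurable H halfLine :=
    (measurable_ofReal_Q m).aemeasurable.mul (aemeasurable_homAbs hv)
  have hpt : ∀ x ∈ Ioc (1 : ℝ) 2, ‖iteratedDeriv j v x‖ₑ ≤
      ENNReal.ofReal (2 ^ n * (Q m x₀)⁻¹) * (ENNReal.ofReal (x ^ 3) * H x) := by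
    intro x hx
    have hx0 : 0 < x := one_pos.trans hx.1
    have h1 : iteratedDeriv j v x = x ^ (n - j) • ((x ^ (n - j))⁻¹ • iteratedDeriv j v x) := by
      rw [smul_smul, mul_inv_cancel₀ (by positivity), one_smul]
    have h2 : x ^ (n - j) ≤ 2 ^ n :=
      (pow_le_pow_right₀ hx.1.le (Nat.sub_le n j)).trans (pow_le_pow_left₀ hx0.le hx.2 n)
    have h3 : x ^ (n - j) ≤ 2 ^ n * (Q m x₀)⁻¹ * (x ^ 3 * Q m x) := by
      have h4 : Q m x₀ ≤ Q m x := hmin ⟨hx.1.le, hx.2⟩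
      have h5 : 1 ≤ x ^ 3 := one_le_pow₀ hx.1.le
      calc x ^ (n - j) ≤ 2 ^ n * (1 * 1) := by simpa using h2
        _ ≤ 2 ^ n * (x ^ 3 * ((Q m x₀)⁻¹ * Q m x)) := by
            gcongr
            rw [inv_mul_eq_div, one_le_div hc]
            exact h4
        _ = _ := by ring
    rw [h1, enorm_smul, Real.enorm_eq_ofReal (by positivity), hH]
    calc _ ≤ ENNReal.ofReal (2 ^ n * (Q m x₀)⁻¹ * (x ^ 3 * Q m x)) * homAbs n v x := by
          gcongr
          exact enorm_le_homAbs hj v x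
      _ = _ := by
          rw [ENNReal.ofReal_mul (by positivity), ENNReal.ofReal_mul (by positivity : 0 ≤ x ^ 3)]
          ring
  calc _ ≤ ∫⁻ x in Ioc (1 : ℝ) 2, ENNReal.ofReal (2 ^ n * (Q m x₀)⁻¹) *
        (ENNReal.ofReal (x ^ 3) * H x) := setLIntegral_mono' measurableSet_Ioc hpt
    _ = ENNReal.ofReal (2 ^ n * (Q m x₀)⁻¹) *
        ∫⁻ x in Ioc (1 : ℝ) 2, ENNReal.ofReal (x ^ 3) * H x :=
      lintegral_const_mul' _ _ ENNReal.ofReal_ne_top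
    _ ≤ ENNReal.ofReal (2 ^ n * (Q m x₀)⁻¹) *
        ∫⁻ x in Ioc (0 : ℝ) 2, ENNReal.ofReal (x ^ 3) * H x := by
      gcongr
      exact zero_le_one
    _ ≤ ENNReal.ofReal (2 ^ n * (Q m x₀)⁻¹) * (ENNReal.ofReal (2 ^ 3) * l2norm H) := by
      gcongr
      exact lintegral_cube_mul_le hHm two_pos
    _ = _ := by
      rw [← mul_assoc, ENNReal.coe_mul]
      rfl

/-- On (0,1] one has |v| ≤ x^n |v|_{-n}; with the area factor x this gives x^{n+1} ≤ x³, the weight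
in the Cauchy–Schwarz estimate. -/
lemma enorm_momentQ_one_le {n : ℕ} (hn : 2 ≤ n)
    (hv : ∀ j, AEMeasurable (iteratedDeriv j v) halfLine) :
    ‖momentQ m v 1‖ₑ ≤ l2norm (fun r => ENNReal.ofReal (Q m r) * homAbs n v r) := by
  set H : ℝ → ℝ≥0∞ := fun r => ENNReal.ofReal (Q m r) * homAbs n v r with hH
  have hHm : AEMeasurable H halfLine :=
    (measurable_ofReal_Q m).aemeasurable.mul (aemeasurable_homAbs hv)
  have h := lintegral_cube_mul_le hHm one_pos
  rw [one_pow, ENNReal.ofReal_one, one_mul] at h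
  refine le_trans ?_ h
  rw [momentQ, intervalIntegral.integral_of_le zero_le_one]
  refine (enorm_integral_le_lintegral_enorm _).trans (setLIntegral_mono' measurableSet_Ioc ?_)
  intro x hx
  have hx0 := hx.1
  have hQ := Q_pos m hx0
  have h1 : ‖v x‖ₑ ≤ ENNReal.ofReal (x ^ n) * homAbs n v x := by
    have := enorm_le_homAbs (zero_le : 0 ≤ n) v x
    rw [Nat.sub_zero, iteratedDeriv_zero] at this
    calc ‖v x‖ₑ = ‖x ^ n • ((x ^ n)⁻¹ • v x)‖ₑ := by
          rw [smul_smul, mul_inv_cancel₀ (by positivity), one_smul]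
      _ = ENNReal.ofReal (x ^ n) * ‖(x ^ n)⁻¹ • v x‖ₑ := by
          rw [enorm_smul, Real.enorm_eq_ofReal (by positivity)]
      _ ≤ _ := by gcongr
  have h2 : ‖(v x).re‖ₑ ≤ ‖v x‖ₑ := by
    rw [← ofReal_norm, ← ofReal_norm]
    exact ENNReal.ofReal_le_ofReal (Complex.abs_re_le_norm _)
  rw [enorm_mul, enorm_mul, Real.enorm_eq_ofReal hQ.le, Real.enorm_eq_ofReal hx0.le, hH]
  calc ENNReal.ofReal (Q m x) * ‖(v x).re‖ₑ * ENNReal.ofReal x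
      ≤ ENNReal.ofReal (Q m x) * (ENNReal.ofReal (x ^ n) * homAbs n v x) * ENNReal.ofReal x := by
        gcongr
        exact h2.trans h1
    _ = ENNReal.ofReal (x ^ n * x) * (ENNReal.ofReal (Q m x) * homAbs n v x) := by
        rw [ENNReal.ofReal_mul (by positivity)]
        ring
    _ ≤ _ := by
        gcongr
        rw [← pow_succ]
        exact pow_le_pow_of_le_one hx0.le hx.2 (by omega)

lemma exists_apply_one_le (hk : 3 ≤ k) (m : ℕ) : ∃ K : NNReal, ∀ v : ℝ → ℂ, Regular k v →
    ‖v 1‖ₑ ≤ K * l2norm (fun r => ENNReal.ofReal (Q m r) * homAbs (k - 1) v r) ∧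
    ‖momentQ m v 1‖ₑ ≤ K * l2norm (fun r => ENNReal.ofReal (Q m r) * homAbs (k - 1) v r) ∧
    ‖LQ m v 1‖ₑ ≤ K * l2norm (fun r => ENNReal.ofReal (Q m r) * homAbs (k - 1) v r) := by
  obtain ⟨K, hK⟩ := exists_lintegral_iteratedDeriv_le m (k - 1)
  set A : ℝ := (m + Atheta m 1) / 1 with hA
  refine ⟨2 * K + 1 + (2 * K + ‖A‖₊ * (2 * K) + ‖Q m 1‖₊), fun v hv => ?_⟩
  have hmeas := hv.aemeasurable_iteratedDeriv
  set N := l2norm (fun r => ENNReal.ofReal (Q m r) * homAbs (k - 1) v r) with hN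
  have hcd : ContDiffOn ℝ 2 v (Ioi 0) := by
    obtain ⟨n, rfl⟩ : ∃ n, k = n + 1 := ⟨k - 1, by omega⟩
    exact hv.1.of_le (by exact_mod_cast (by omega : 2 ≤ n))
  have hcd' : ContDiffOn ℝ 1 (deriv v) (Ioi 0) := by
    have := contDiffOn_deriv (n := 1) hcd
    exact_mod_cast this
  have key : ∀ j, j + 1 ≤ k - 1 → ContDiffOn ℝ 1 (iteratedDeriv j v) (Ioi 0) →
      ‖iteratedDeriv j v 1‖ₑ ≤ 2 * K * N := by
    intro j hj hc
    refine (enorm_apply_one_le hc).trans ?_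
    have hm : AEMeasurable (fun x => ‖iteratedDeriv j v x‖ₑ) (volume.restrict (Ioc (1 : ℝ) 2)) :=
      ((hc.continuousOn.mono fun x hx => one_pos.trans hx.1).aemeasurable measurableSet_Ioc).enorm
    rw [lintegral_add_left' hm, ← iteratedDeriv_succ, two_mul, add_mul]
    exact add_le_add (hK v hmeas j (by omega)) (hK v hmeas (j + 1) hj)
  have h0 : ‖v 1‖ₑ ≤ 2 * K * N := by
    have := key 0 (by omega) (by simpa using hcd.of_le (by norm_num))
    simpa using this
  have h1 : ‖deriv v 1‖ₑ ≤ 2 * K * N := by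
    have := key 1 (by omega) (by simpa using hcd')
    simpa using this
  have h2 : ‖momentQ m v 1‖ₑ ≤ N := enorm_momentQ_one_le (by omega) hmeas
  refine ⟨h0.trans ?_, h2.trans ?_, ?_⟩
  · gcongr
    push_cast
    rw [add_assoc]
    exact le_self_add
  · calc N = ((1 : NNReal) : ℝ≥0∞) * N := by simp
      _ ≤ _ := by
        gcongr
        rw [add_right_comm]
        exact le_add_self
  · have h3 : ‖((Q m 1 * (1 / 1 * momentQ m v 1) : ℝ) : ℂ)‖ₑ ≤ ‖Q m 1‖₊ * N := by
      rw [one_div_one, one_mul, enorm_eq_nnnorm, Complex.nnnorm_real, nnnorm_mul, ENNReal.coe_mul]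
      gcongr
      exact h2
    rw [LQ_eq_momentQ]
    calc _ ≤ ‖deriv v 1‖ₑ + ‖A • v 1‖ₑ + ‖((Q m 1 * (1 / 1 * momentQ m v 1) : ℝ) : ℂ)‖ₑ :=
          (enorm_add_le _ _).trans (add_le_add_left enorm_sub_le _)
      _ ≤ 2 * K * N + ‖A‖₊ * (2 * K * N) + ‖Q m 1‖₊ * N := by
          refine add_le_add (add_le_add h1 ?_) h3
          rw [enorm_smul]
          exact mul_le_mul' le_rfl h0
      _ = ((2 * K + ‖A‖₊ * (2 * K) + ‖Q m 1‖₊ : NNReal) : ℝ≥0∞) * N := by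
          push_cast; ring
      _ ≤ _ := mul_le_mul' (ENNReal.coe_le_coe.2 le_add_self) le_rfl

/-- The subcoercivity term has one power of r less than r^{-k}, and rQ is bounded by the weight
loss. -/
lemma exists_l2norm_Q_mul_homAbs_le (hm : 1 ≤ m) (hk : 3 ≤ k) : ∃ K : NNReal, ∀ v : ℝ → ℂ,
    Regular k v → l2norm (fun r => ENNReal.ofReal (Q m r) * homAbs (k - 1) v r)
      ≤ K * adaptedNorm k m v := by
  obtain ⟨C, hC⟩ := exists_adaptedBound_of_adaptedNorm (k := k) (by omega) m
  obtain ⟨D, hD⟩ := exists_iteratedDeriv_bound (k - 1) 0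
  set W : ℝ → ℝ≥0∞ := fun r => ENNReal.ofReal (Q m r * (r ^ (k - 1))⁻¹) with hW
  have hWm : Measurable W :=
    ((continuous_Q m).measurable.mul ((measurable_id.pow_const _).inv)).ennreal_ofReal
  set c : NNReal := (4 * Qconst m).toNNReal with hc
  have hWa : ∀ r, 0 < r → W r ≤ c * adaptedWeight k m r := by
    intro r hr
    have hQ := Qconst_pos m
    change _ ≤ ENNReal.ofReal (4 * Qconst m) * _
    rw [adaptedWeight, ← ENNReal.ofReal_mul (by positivity)]
    refine ENNReal.ofReal_le_ofReal ?_
    have e : (r ^ (k - 1))⁻¹ = r * (r ^ k)⁻¹ := by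
      obtain ⟨n, rfl⟩ : ∃ n, k = n + 1 := ⟨k - 1, by omega⟩
      rw [Nat.add_sub_cancel, pow_succ]
      field_simp
    have h1 := mul_le_mul_of_nonneg_right (mul_Q_le_weightLoss k m hm hr)
      (by positivity : 0 ≤ (r ^ k)⁻¹)
    rw [e]
    linarith
  refine ⟨((k - 1 : ℕ) + 1) * (D * ((1 + (1 + ‖(m : ℝ)‖₊)) ^ (k - 1 + 1) * (c * C))),
    fun v hv => ?_⟩
  obtain ⟨q, hq, hqB, h0⟩ := hC v hv
  have hqW := hqB.mono_weight (W' := W) c fun r hr =>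
    (hWa r hr).trans (by gcongr; exact adaptedWeight_le k m hr)
  have hvW : wnorm W v ≤ c * (C * adaptedNorm k m v) :=
    (wnorm_le_const_mul (W' := adaptedWeight k m) (g := v) c fun r hr => by
      rw [← mul_assoc]; gcongr; exact hWa r hr).trans (by gcongr)
  have hvE := (EulerBound.of_dPlus hWm hq hqW hvW).pred
  have hj := hD W _ v hWm (hvE.congr fun r _ => by simp)
  refine (l2norm_mul_homAbs_le (measurable_ofReal_Q m) hv.aemeasurable_iteratedDeriv
    fun j hjk => le_trans (le_of_eq ?_) (hj j hjk)).trans (le_of_eq ?_)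
  · refine le_antisymm (wnorm_mono fun r hr => ?_) (wnorm_mono fun r hr => ?_) <;>
    · have hQ := Q_pos m hr
      have e : (r ^ (k - 1 - j))⁻¹ = (r ^ (k - 1))⁻¹ * r ^ (0 + j) := by
        rw [zero_add, ← Nat.sub_add_cancel hjk, pow_add, Nat.sub_add_cancel hjk]
        field_simp
      simp only [hW]
      rw [e, mul_smul, enorm_smul (_⁻¹), Real.enorm_eq_ofReal (by positivity),
        ENNReal.ofReal_mul hQ.le, mul_assoc]
  · push_cast
    ring

end

/-! ### Removing the null modes -/

section

variable {k m : ℕ} {v w : ℝ → ℂ}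

/-- Subtraction of null modes achieves the normalization under which the operators are inverted. -/
lemma exists_decomposition (hm : 1 ≤ m) (hk : 3 ≤ k) (hkm : k ≤ m + 2) : ∃ C : NNReal,
    ∀ v, MemAdapted k m v → ∃ c : Fin 4 → ℝ,
      (∀ j, ‖c j‖ₑ ≤ C * l2norm (fun r => ENNReal.ofReal (Q m r) * homAbs (k - 1) v r)) ∧
      LQ m (fun r => v r - modeSum m c r) 1 = 0 ∧ (v 1 - modeSum m c 1).im = 0 ∧
      momentQ m (fun r => v r - modeSum m c r) 1 = 0 := by
  obtain ⟨K, hK⟩ := exists_apply_one_le hk m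
  obtain ⟨L, hL⟩ := exists_l2norm_Q_mul_homAbs_le hm hk
  set A := Q m 1 with hA
  have hA0 : 0 < A := Q_pos m one_pos
  set μ := momentQ m (fun r => (rho m r : ℂ)) 1 with hμ
  set M : ℝ := m + 1 with hM
  have hM1 : 1 ≤ M := by rw [hM]; linarith [(Nat.cast_nonneg m : (0 : ℝ) ≤ m)]
  -- The sum of the bounds for the four coefficients below, per unit of X.
  set R : ℝ := 1 + 2 * M / A + 2 / A + 2 * M / A * |μ| with hR
  refine ⟨K * R.toNNReal, fun v hv => ?_⟩
  have hreg := hv.regular (by omega)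
  have hv1 := hK v hreg
  set N := l2norm (fun r => ENNReal.ofReal (Q m r) * homAbs (k - 1) v r) with hN
  have hNfin : N ≠ ∞ := ne_top_of_le_ne_top (ENNReal.mul_ne_top ENNReal.coe_ne_top
    (hv.adaptedNorm_ne_top (by omega) hkm)) (hL v hreg)
  set X : ℝ := K * N.toReal with hX
  have hX0 : 0 ≤ X := by positivity
  have toX : ∀ {E : Type} [SeminormedAddCommGroup E] (x : E), ‖x‖ₑ ≤ K * N → ‖x‖ ≤ X := by
    intro E _ x hx
    have := ENNReal.toReal_mono (ENNReal.mul_ne_top ENNReal.coe_ne_top hNfin) hx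
    simpa [hX] using this
  have x1 := toX _ hv1.1
  have x2 := toX _ hv1.2.1
  have x3 := toX _ hv1.2.2
  set z := LQ m v 1 with hz
  have y1 : |(v 1).im| ≤ X := (Complex.abs_im_le_norm _).trans x1
  have y2 : |z.re| ≤ X := (Complex.abs_re_le_norm _).trans x3
  have y3 : |z.im| ≤ X := (Complex.abs_im_le_norm _).trans x3
  rw [Real.norm_eq_abs] at x2
  -- Back substitution: L_Q v(1) determines c₂ and c₃. Then Im v(1) gives c₁, corrected by c₂ since
  -- r²Q = Q at r = 1, and the moment gives c₀, corrected by c₃, with factor M² because u(1) = 0.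
  set c₂ : ℝ := z.im / (2 * A) with hc₂
  set c₃ : ℝ := 2 * M * z.re / A with hc₃
  set c₁ : ℝ := (v 1).im / A - c₂ with hc₁
  set c₀ : ℝ := (momentQ m v 1 - c₃ * μ) / M ^ 2 with hc₀
  have b₂ : |c₂| ≤ X / A := by
    rw [hc₂, abs_div, abs_of_pos (by positivity : 0 < 2 * A), div_le_div_iff₀ (by positivity) hA0]
    nlinarith [abs_nonneg z.im]
  have b₃ : |c₃| ≤ 2 * M * X / A := by
    rw [hc₃, abs_div, abs_mul, abs_of_pos hA0, abs_of_pos (by positivity : 0 < 2 * M)]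
    gcongr
  have b₁ : |c₁| ≤ 2 * X / A := by
    have h1 : |(v 1).im / A| ≤ X / A := by
      rw [abs_div, abs_of_pos hA0]
      gcongr
    calc |c₁| ≤ |(v 1).im / A| + |c₂| := abs_sub _ _
      _ ≤ X / A + X / A := add_le_add h1 b₂
      _ = _ := by ring
  have b₀ : |c₀| ≤ X + 2 * M * X / A * |μ| := by
    rw [hc₀, abs_div, abs_of_pos (by positivity : 0 < M ^ 2)]
    refine (div_le_self (abs_nonneg _) (one_le_pow₀ hM1)).trans ((abs_sub _ _).trans ?_)
    rw [abs_mul]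
    gcongr
  have hR' : X * R = X + 2 * M * X / A + 2 * X / A + 2 * M * X / A * |μ| := by
    rw [hR]; field_simp
  have p1 : 0 ≤ 2 * M * X / A := by positivity
  have p2 : 0 ≤ 2 * X / A := by positivity
  have p3 : 0 ≤ 2 * M * X / A * |μ| := by positivity
  have p4 : X / A ≤ 2 * X / A := by gcongr; linarith
  set c : Fin 4 → ℝ := ![c₀, c₁, c₂, c₃] with hc
  have hcb : ∀ j, |c j| ≤ X * R := by
    intro j
    rw [hR']
    fin_cases j
    · change |c₀| ≤ _; linarith
    · change |c₁| ≤ _; linarith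
    · change |c₂| ≤ _; linarith
    · change |c₃| ≤ _; linarith
  have hR0 : 0 ≤ R := by positivity
  obtain ⟨e1, e2⟩ := momentQ_modeSum_and_LQ_modeSum hm c one_pos
  obtain ⟨B₁, hB₁, hvB⟩ := hv.exists_adaptedBound (by omega) hkm
  obtain ⟨B₂, hB₂, hwB⟩ := (memAdapted_modeSum hk hkm c).exists_adaptedBound (by omega) hkm
  have i1 := hvB.intervalIntegrable hm hk hkm hB₁ one_pos
  have i2 := hwB.intervalIntegrable hm hk hkm hB₂ one_pos
  have hu1 : tanhProfile m 1 = 0 := by simp [tanhProfile]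
  have g0 : c 0 = c₀ := rfl
  have g1 : c 1 = c₁ := rfl
  have g2 : c 2 = c₂ := rfl
  have g3 : c 3 = c₃ := rfl
  have hA' := hA0.ne'
  have hM' : M ≠ 0 := by positivity
  refine ⟨c, fun j => ?_, ?_, ?_, ?_⟩
  · rw [← ofReal_norm, Real.norm_eq_abs]
    refine (ENNReal.ofReal_le_ofReal (hcb j)).trans (le_of_eq ?_)
    rw [hX, ENNReal.ofReal_mul (by positivity), ENNReal.ofReal_mul (by positivity),
      ENNReal.ofReal_coe_nnreal, ENNReal.ofReal_toReal hNfin, ENNReal.coe_mul]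
    simp only [ENNReal.ofReal]
    ring
  · rw [LQ_sub i1 i2 (hvB.differentiableAt hk one_pos) (hwB.differentiableAt hk one_pos), e2,
      ← hz, ← hA, g2, g3, Complex.real_smul, sub_eq_zero]
    have r1 : 1 * A * (c₃ / (2 * M)) = z.re := by
      rw [hc₃]; field_simp
    have r2 : 1 * A * (2 * c₂) = z.im := by
      rw [hc₂]; field_simp
    rw [mul_add, ← mul_assoc, ← Complex.ofReal_mul, ← Complex.ofReal_mul, r1, r2]
    exact (Complex.re_add_im z).symm
  · have : (modeSum m c 1).im = c₁ * A + c₂ * A := by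
      rw [modeSum, Fin.sum_univ_four, g0, g1, g2, g3]
      simp [mode, ← hA]
    rw [Complex.sub_im, this, hc₁]
    field_simp
    ring
  · rw [momentQ_sub i1 i2, e1, hu1, g0, g3, ← hμ, hc₀]
    field_simp
    ring

/-- The adapted weight is positive on (0,∞), so v vanishes almost everywhere, and everywhere by
continuity. -/
lemma eq_zero_of_adaptedBound_zero (hk : 3 ≤ k) (hw : AdaptedBound k m 0 w) {r : ℝ} (hr : 0 < r) :
    w r = 0 := by
  have hc := hw.continuousOn hk
  obtain ⟨q, -, -, h0⟩ := hw
  have h1 : l2norm (fun r => adaptedWeight k m r * ‖w r‖ₑ) ^ 2 = 0 := by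
    rw [le_zero_iff.1 (show l2norm (fun r => adaptedWeight k m r * ‖w r‖ₑ) ≤ 0 from h0)]
    simp
  have hm : AEMeasurable (fun r => (adaptedWeight k m r * ‖w r‖ₑ) ^ 2 *
      ENNReal.ofReal (2 * Real.pi * r)) (volume.restrict (Ioi 0)) :=
    (((measurable_adaptedWeight k m).aemeasurable.mul
      (aemeasurable_of_continuousOn hc).enorm).pow_const 2).mul (by fun_prop)
  rw [l2norm_sq] at h1
  replace h1 := (lintegral_eq_zero_iff' hm).1 h1
  have h2 : w =ᵐ[volume.restrict (Ioi 0)] fun _ => 0 := by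
    filter_upwards [h1, ae_restrict_mem measurableSet_Ioi] with x hx hx0
    have hx0 : 0 < x := hx0
    have hκ : 0 < weightLoss k m x := by
      have := le_weightLoss k m hx0
      by_contra h
      have : x ^ 2 ≤ 0 := this.trans
        (mul_nonpos_of_nonpos_of_nonneg (by linarith) (by positivity))
      have : 0 < x ^ 2 := by positivity
      linarith
    have hW : adaptedWeight k m x ≠ 0 := by
      rw [adaptedWeight, Ne, ENNReal.ofReal_eq_zero, not_le]
      positivity
    have hP : ENNReal.ofReal (2 * Real.pi * x) ≠ 0 := by
      rw [Ne, ENNReal.ofReal_eq_zero, not_le]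
      positivity
    have hx' : (adaptedWeight k m x * ‖w x‖ₑ) ^ 2 * ENNReal.ofReal (2 * Real.pi * x) = 0 := hx
    simpa [hW, hP] using hx'
  exact Measure.eqOn_open_of_ae_eq h2 isOpen_Ioi hc continuousOn_const hr

/-- The three conclusions for an operator which factors through `A_Q L_Q`, given its boundedness
and its inversion under the normalization of `exists_decomposition`. -/
theorem boundedness_kernel_coercivity (hm : 1 ≤ m) (hk : 3 ≤ k) (hkm : k ≤ m + 2)
    {op : (ℝ → ℂ) → ℝ → ℂ}
    (hop : ∀ v w, (∀ r, 0 < r → AQ m (LQ m v) r = AQ m (LQ m w) r) →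
      ∀ r, 0 < r → op v r = op w r)
    (hop0 : ∀ r, op (fun _ => 0) r = 0)
    (hbd : ∃ C : NNReal, ∀ (B : ℝ≥0∞) (v : ℝ → ℂ), B ≠ ∞ → AdaptedBound k m B v →
      l2norm (fun r => ‖op v r‖ₑ) ≤ C * B)
    (hinv : ∃ C : NNReal, ∀ (B : ℝ≥0∞) (v : ℝ → ℂ), B ≠ ∞ → AdaptedBound k m B v →
      LQ m v 1 = 0 → (v 1).im = 0 → momentQ m v 1 = 0 →
      AdaptedBound k m (C * l2norm (fun r => ‖op v r‖ₑ)) v) :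
    (∃ C : NNReal, ∀ v : ℝ → ℂ, MemAdapted k m v →
        l2norm (fun r => ‖op v r‖ₑ) +
            l2norm (fun r => ENNReal.ofReal (Q m r) * homAbs (k - 1) v r)
          ≤ C * adaptedNorm k m v ∧
        adaptedNorm k m v ≤ C * (l2norm (fun r => ‖op v r‖ₑ) +
            l2norm (fun r => ENNReal.ofReal (Q m r) * homAbs (k - 1) v r))) ∧
      (∀ v : ℝ → ℂ, (MemAdapted k m v ∧ ∀ᵐ r ∂(volume.restrict (Ioi (0 : ℝ))), op v r = 0) ↔
        ∃ c : Fin 4 → ℝ, ∀ r : ℝ, 0 < r → v r = ∑ j, c j • mode m j r) ∧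
      (∀ ψ : Fin 4 → (ℝ → ℂ) → ℝ, (∀ i, IsDualElement k m (ψ i)) →
        (Matrix.of fun i j => ψ i (mode m j)).det ≠ 0 →
        ∃ C : NNReal, ∀ v : ℝ → ℂ, MemAdapted k m v → (∀ i, ψ i v = 0) →
          adaptedNorm k m v ≤ C * l2norm (fun r => ‖op v r‖ₑ)) := by
  have hk2 : 2 ≤ k := by omega
  have hk1 : 1 ≤ k := by omega
  obtain ⟨C₁, hC₁⟩ := hbd
  obtain ⟨C₂, hC₂⟩ := hinv
  obtain ⟨C₃, hC₃⟩ := exists_decomposition hm hk hkm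
  obtain ⟨C₄, hC₄⟩ := exists_adaptedBound_modeSum hk hkm
  obtain ⟨C₅, hC₅⟩ := exists_adaptedBound_of_adaptedNorm hk2 m
  obtain ⟨C₆, hC₆⟩ := exists_adaptedNorm_le hk2 hkm
  obtain ⟨C₇, hC₇⟩ := exists_l2norm_Q_mul_homAbs_le hm hk
  have hLQd : ∀ {v r}, MemAdapted k m v → 0 < r → DifferentiableAt ℝ (LQ m v) r := by
    intro v r hv hr
    obtain ⟨B, hB, hvB⟩ := hv.exists_adaptedBound hk2 hkm
    obtain ⟨C, hC⟩ := exists_LQ_bound hk hkm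
    have h := (hC B v hB hvB).of_le (by omega : 1 + 1 ≤ k - 1)
    obtain ⟨-, g, hg, hgB⟩ := id h
    have hd := (hg.hasDerivAt hgB.continuousOn hr).differentiableAt
    have hd2 := ((hasDerivAt_inv hr.ne').differentiableAt).smul hd
    refine hd2.congr_of_eventuallyEq ?_
    filter_upwards [Ioi_mem_nhds hr] with x hx
    have hx : x ≠ 0 := ne_of_gt hx
    simp [hx]
  have hLQ : ∀ {v} (c : Fin 4 → ℝ), MemAdapted k m v → ∀ r, 0 < r →
      LQ m (fun r => v r - modeSum m c r) r = LQ m v r - LQ m (modeSum m c) r := by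
    intro v c hv r hr
    obtain ⟨B₁, hB₁, hvB⟩ := hv.exists_adaptedBound hk2 hkm
    obtain ⟨B₂, hB₂, hwB⟩ := (memAdapted_modeSum hk hkm c).exists_adaptedBound hk2 hkm
    exact LQ_sub (hvB.intervalIntegrable hm hk hkm hB₁ hr)
      (hwB.intervalIntegrable hm hk hkm hB₂ hr) (hvB.differentiableAt hk hr)
      (hwB.differentiableAt hk hr)
  have hAQ : ∀ (c : Fin 4 → ℝ) (r : ℝ), 0 < r → AQ m (LQ m (modeSum m c)) r = 0 := by
    intro c r hr
    rw [AQ_congr (fun x hx => (momentQ_modeSum_and_LQ_modeSum hm c hx).2) hr]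
    exact AQ_mul_Q m _ hr
  -- The modes are annihilated already by A_Q L_Q, so subtracting them does not change A_Q L_Q v, on
  -- which alone `op` depends. Linearity of `op` is not required.
  have hopeq : ∀ {v} (c : Fin 4 → ℝ), MemAdapted k m v → ∀ r, 0 < r →
      op (fun r => v r - modeSum m c r) r = op v r := by
    intro v c hv
    refine hop _ _ fun r hr => ?_
    rw [AQ_congr (hLQ c hv) hr]
    have h1 := hAQ c r hr
    have h2 := hLQd hv hr
    have h3 := hLQd (memAdapted_modeSum hk hkm c) hr
    unfold AQ at h1 ⊢
    rw [deriv_fun_sub h2 h3, smul_sub]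
    linear_combination -h1
  have hsub : ∀ {v} (c : Fin 4 → ℝ), MemAdapted k m v →
      MemAdapted k m (fun r => v r - modeSum m c r) := fun {v} c hv =>
    (hv.add hk2 hkm ((memAdapted_modeSum hk hkm c).const_smul hk2 hkm (-1))).congr hk2 hkm
      fun r _ => by simp [sub_eq_add_neg]
  -- the remainder after subtraction of the modes
  have hrem : ∀ v, MemAdapted k m v → ∃ c : Fin 4 → ℝ,
      (∀ j, ‖c j‖ₑ ≤ C₃ * l2norm (fun r => ENNReal.ofReal (Q m r) * homAbs (k - 1) v r)) ∧
      AdaptedBound k m (C₂ * l2norm (fun r => ‖op v r‖ₑ)) (fun r => v r - modeSum m c r) := by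
    intro v hv
    obtain ⟨c, hc, h1, h2, h3⟩ := hC₃ v hv
    obtain ⟨B, hB, hwB⟩ := (hsub c hv).exists_adaptedBound hk2 hkm
    refine ⟨c, hc, (hC₂ B _ hB hwB h1 h2 h3).mono (le_of_eq ?_)⟩
    congr 1
    exact l2norm_congr_ae (ae_halfLine_of_forall fun r hr => by rw [hopeq c hv r hr])
  have hnorm : ∀ v (c : Fin 4 → ℝ) (E D : ℝ≥0∞), MemAdapted k m v →
      AdaptedBound k m E (fun r => v r - modeSum m c r) → (∀ j, ‖c j‖ₑ ≤ D) →
      adaptedNorm k m v ≤ C₆ * (E + C₄ * D) := by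
    intro v c E D hv hE hD
    exact hC₆ _ _ (hv.regular hk1) ((hE.add (hC₄ c D hD)).congr fun r _ => by simp)
  refine ⟨⟨C₁ * C₅ + C₇ + C₆ * (C₂ + C₄ * C₃), fun v hv => ⟨?_, ?_⟩⟩, fun v => ⟨?_, ?_⟩, ?_⟩
  · have hfin := hv.adaptedNorm_ne_top hk2 hkm
    have h1 := hC₁ _ v (ENNReal.mul_ne_top ENNReal.coe_ne_top hfin) (hC₅ v (hv.regular hk1))
    have h2 := hC₇ v (hv.regular hk1)
    calc _ ≤ C₁ * (C₅ * adaptedNorm k m v) + C₇ * adaptedNorm k m v := add_le_add h1 h2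
      _ = ((C₁ * C₅ + C₇ : NNReal) : ℝ≥0∞) * adaptedNorm k m v := by push_cast; ring
      _ ≤ _ := mul_le_mul' (ENNReal.coe_le_coe.2 le_self_add) le_rfl
  · obtain ⟨c, hc, hB⟩ := hrem v hv
    refine (hnorm v c _ _ hv hB hc).trans ?_
    set a := l2norm (fun r => ‖op v r‖ₑ)
    set b := l2norm (fun r => ENNReal.ofReal (Q m r) * homAbs (k - 1) v r)
    calc _ ≤ C₆ * (C₂ * (a + b) + C₄ * (C₃ * (a + b))) := by
          gcongr
          · exact le_self_add
          · exact le_add_self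
      _ = ((C₆ * (C₂ + C₄ * C₃) : NNReal) : ℝ≥0∞) * (a + b) := by push_cast; ring
      _ ≤ _ := mul_le_mul' (ENNReal.coe_le_coe.2 le_add_self) le_rfl
  · rintro ⟨hv, h0⟩
    obtain ⟨c, -, hB⟩ := hrem v hv
    have hz : l2norm (fun r => ‖op v r‖ₑ) = 0 := by
      rw [l2norm_congr_ae (h := fun _ => 0) (h0.mono fun r hr => by rw [hr]; simp)]
      simp [l2norm]
    rw [hz, mul_zero] at hB
    -- The remainder is bounded by the norm of `op v`, which is zero; so v is the subtracted
    -- combination of modes.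
    exact ⟨c, fun r hr => sub_eq_zero.1 (eq_zero_of_adaptedBound_zero hk hB hr)⟩
  · rintro ⟨c, hc⟩
    have hc' : ∀ r, 0 < r → modeSum m c r = v r := fun r hr => (hc r hr).symm
    refine ⟨(memAdapted_modeSum hk hkm c).congr hk2 hkm hc', ae_halfLine_of_forall fun r hr => ?_⟩
    have h0 : ∀ r, LQ m (fun _ => 0) r = 0 := fun r => by simp [LQ, BQ]
    have h1 : ∀ r, AQ m (LQ m (fun _ => 0)) r = 0 := fun r => by
      rw [funext h0]; simp [AQ]
    rw [hop v (fun _ => 0) (fun r hr => ?_) r hr, hop0]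
    rw [h1, AQ_congr (fun x hx => LQ_congr hc hx) hr]
    exact hAQ c r hr
  · intro ψ hψ hdet
    set A : Matrix (Fin 4) (Fin 4) ℝ := Matrix.of fun i j => ψ i (mode m j) with hA
    have hmode := fun j => memAdapted_mode hk hkm j
    have hψs : ∀ i (c : Fin 4 → ℝ), ψ i (modeSum m c) = ∑ j, A i j * c j := by
      intro i c
      obtain ⟨hadd, hsmul, -⟩ := hψ i
      have h := fun j => (hmode j).const_smul hk2 hkm (c j)
      rw [modeSum_eq, hadd _ _ (((h 0).add hk2 hkm (h 1)).add hk2 hkm (h 2)) (h 3),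
        hadd _ _ ((h 0).add hk2 hkm (h 1)) (h 2), hadd _ _ (h 0) (h 1), Fin.sum_univ_four]
      simp only [hsmul _ _ (hmode _), hA, Matrix.of_apply]
      ring
    choose D hD using fun i => (hψ i).2.2
    -- A bound for the inverse matrix combined with the norms of the functionals.
    set S : NNReal := ∑ j, ∑ i, ‖A⁻¹ j i‖₊ * D i with hS
    refine ⟨C₆ * (C₂ + C₄ * (S * (C₆ * C₂))), fun v hv hv0 => ?_⟩
    obtain ⟨c, -, hB⟩ := hrem v hv
    set a := l2norm (fun r => ‖op v r‖ₑ) with ha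
    set w : ℝ → ℂ := fun r => v r - modeSum m c r with hw
    have hwm : MemAdapted k m w := hsub c hv
    have hwn : adaptedNorm k m w ≤ C₆ * (C₂ * a) := hC₆ _ _ (hwm.regular hk1) hB
    have hψw : ∀ i, ψ i w = -(A.mulVec c) i := by
      intro i
      have h := (hψ i).1 w (modeSum m c) hwm (memAdapted_modeSum hk hkm c)
      have e : (fun r => w r + modeSum m c r) = v := by
        funext r; simp [hw]
      rw [e, hv0 i, hψs] at h
      simp only [Matrix.mulVec, dotProduct]
      linarith
    -- From ψ_i(v) = 0 the coefficients solve Ac = -ψ(w), so invertibility of A bounds them by the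
    -- remainder w, which the operator controls.
    have hcw : c = -(A⁻¹.mulVec fun i => ψ i w) := by
      have e : (fun i => ψ i w) = -(A.mulVec c) := funext hψw
      rw [e, Matrix.mulVec_neg, neg_neg, Matrix.mulVec_mulVec,
        Matrix.nonsing_inv_mul _ (isUnit_iff_ne_zero.2 hdet), Matrix.one_mulVec]
    have hcb : ∀ j, ‖c j‖ₑ ≤ S * (C₆ * (C₂ * a)) := by
      intro j
      have e : c j = -∑ i, A⁻¹ j i * ψ i w := by
        conv_lhs => rw [hcw]
        rfl
      calc ‖c j‖ₑ ≤ ∑ i, ‖A⁻¹ j i * ψ i w‖ₑ := by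
            rw [e, enorm_neg]; exact enorm_sum_le _ _
        _ ≤ ∑ i, ((‖A⁻¹ j i‖₊ * D i : NNReal) : ℝ≥0∞) * (C₆ * (C₂ * a)) := by
            refine Finset.sum_le_sum fun i _ => ?_
            rw [enorm_mul, ENNReal.coe_mul, mul_assoc]
            refine mul_le_mul' le_rfl ((hD i w hwm).trans ?_)
            gcongr
        _ = ((∑ i, ‖A⁻¹ j i‖₊ * D i : NNReal) : ℝ≥0∞) * (C₆ * (C₂ * a)) := by
            rw [← Finset.sum_mul, ENNReal.ofNNReal_finsetSum]
        _ ≤ _ := by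
            gcongr
            exact Finset.single_le_sum (f := fun j => ∑ i, ‖A⁻¹ j i‖₊ * D i)
              (fun _ _ => zero_le) (Finset.mem_univ j)
    refine (hnorm v c _ _ hv hB hcb).trans (le_of_eq ?_)
    push_cast
    ring

/-! ### The operators of order three and five as functions of `A_Q L_Q v`. -/

lemma op3_congr (h : ∀ r, 0 < r → AQ m (LQ m v) r = AQ m (LQ m w) r) {r : ℝ} (hr : 0 < r) :
    op3 m v r = op3 m w r :=
  AQstar_congr h hr

lemma op5_congr (h : ∀ r, 0 < r → AQ m (LQ m v) r = AQ m (LQ m w) r) {r : ℝ} (hr : 0 < r) :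
    op5 m v r = op5 m w r :=
  AQstar_congr (fun _ h1 => AQ_congr (fun _ h2 => AQstar_congr h h2) h1) hr

lemma op3_zero (m : ℕ) (r : ℝ) : op3 m (fun _ => 0) r = 0 := by
  have h0 : LQ m (fun _ => 0) = fun _ => 0 := funext fun r => by simp [LQ, BQ]
  have h1 : AQ m (fun _ => 0) = fun _ => 0 := funext fun r => by simp [AQ]
  simp [op3, h0, h1, AQstar]

lemma op5_zero (m : ℕ) (r : ℝ) : op5 m (fun _ => 0) r = 0 := by
  have h : AQstar m (AQ m (LQ m (fun _ => 0))) = fun _ => 0 := funext (op3_zero m)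
  have h1 : AQ m (fun _ => 0) = fun _ => 0 := funext fun r => by simp [AQ]
  simp [op5, h, h1, AQstar]

end

end ChernSimons

end

theorem lemma2p6 (m : ℕ) (hm : 1 ≤ m) :
    ((∃ C : NNReal, ∀ v : ℝ → ℂ, ChernSimons.MemAdapted 3 m v →
        ChernSimons.l2norm (fun r => ‖ChernSimons.op3 m v r‖ₑ) +
            ChernSimons.l2norm (fun r =>
              ENNReal.ofReal (ChernSimons.Q m r) * ChernSimons.homAbs 2 v r)
          ≤ C * ChernSimons.adaptedNorm 3 m v ∧
        ChernSimons.adaptedNorm 3 m v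
          ≤ C * (ChernSimons.l2norm (fun r => ‖ChernSimons.op3 m v r‖ₑ) +
            ChernSimons.l2norm (fun r =>
              ENNReal.ofReal (ChernSimons.Q m r) * ChernSimons.homAbs 2 v r))) ∧
      (∀ v : ℝ → ℂ,
        (ChernSimons.MemAdapted 3 m v ∧
          ∀ᵐ r ∂(MeasureTheory.volume.restrict (Set.Ioi (0 : ℝ))), ChernSimons.op3 m v r = 0) ↔
        ∃ c : Fin 4 → ℝ, ∀ r : ℝ, 0 < r → v r = ∑ j, c j • ChernSimons.mode m j r) ∧
      (∀ ψ : Fin 4 → (ℝ → ℂ) → ℝ, (∀ i, ChernSimons.IsDualElement 3 m (ψ i)) →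
        (Matrix.of fun i j => ψ i (ChernSimons.mode m j)).det ≠ 0 →
        ∃ C : NNReal, ∀ v : ℝ → ℂ, ChernSimons.MemAdapted 3 m v → (∀ i, ψ i v = 0) →
          ChernSimons.adaptedNorm 3 m v
            ≤ C * ChernSimons.l2norm (fun r => ‖ChernSimons.op3 m v r‖ₑ))) ∧
    (3 ≤ m →
      ((∃ C : NNReal, ∀ v : ℝ → ℂ, ChernSimons.MemAdapted 5 m v →
        ChernSimons.l2norm (fun r => ‖ChernSimons.op5 m v r‖ₑ) +
            ChernSimons.l2norm (fun r =>
              ENNReal.ofReal (ChernSimons.Q m r) * ChernSimons.homAbs 4 v r)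
          ≤ C * ChernSimons.adaptedNorm 5 m v ∧
        ChernSimons.adaptedNorm 5 m v
          ≤ C * (ChernSimons.l2norm (fun r => ‖ChernSimons.op5 m v r‖ₑ) +
            ChernSimons.l2norm (fun r =>
              ENNReal.ofReal (ChernSimons.Q m r) * ChernSimons.homAbs 4 v r))) ∧
      (∀ v : ℝ → ℂ,
        (ChernSimons.MemAdapted 5 m v ∧
          ∀ᵐ r ∂(MeasureTheory.volume.restrict (Set.Ioi (0 : ℝ))), ChernSimons.op5 m v r = 0) ↔
        ∃ c : Fin 4 → ℝ, ∀ r : ℝ, 0 < r → v r = ∑ j, c j • ChernSimons.mode m j r) ∧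
      (∀ ψ : Fin 4 → (ℝ → ℂ) → ℝ, (∀ i, ChernSimons.IsDualElement 5 m (ψ i)) →
        (Matrix.of fun i j => ψ i (ChernSimons.mode m j)).det ≠ 0 →
        ∃ C : NNReal, ∀ v : ℝ → ℂ, ChernSimons.MemAdapted 5 m v → (∀ i, ψ i v = 0) →
          ChernSimons.adaptedNorm 5 m v
            ≤ C * ChernSimons.l2norm (fun r => ‖ChernSimons.op5 m v r‖ₑ)))) := by
  refine ⟨ChernSimons.boundedness_kernel_coercivity hm le_rfl (by omega)
    (fun v w h r hr => ChernSimons.op3_congr h hr) (ChernSimons.op3_zero m)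
    (ChernSimons.exists_op3_bound hm) (ChernSimons.exists_inverse_three hm), fun h3 => ?_⟩
  exact ChernSimons.boundedness_kernel_coercivity hm (by norm_num) (by omega)
    (fun v w h r hr => ChernSimons.op5_congr h hr) (ChernSimons.op5_zero m)
    (ChernSimons.exists_op5_bound h3) (ChernSimons.exists_inverse_five h3)
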